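/- **Setting.** Let $d\ge 0$, $h_0,T\in(0,\infty)$, $H_T=[0,T]\times\mathbb R^d$, and let $\Lambda_1\subset\mathbb R^d\setminus\{0\}$ be finite. Let $q_\lambda\ge0$, $p_\lambda$ ($\lambda\in\Lambda_1$), $c$, $f$ be real Borel functions on $H_T$, $g$ a real Borel function on $\mathbb R^d$, and $\tau_\lambda\ge0$ ($\lambda\in\Lambda_1$), $\tau_0>0$, $\delta\in(0,1]$, $K\ge1$, $c_0>0$ numbers. Put $|\Lambda_1|^2=\sum_\lambda|\lambda|^2$, $\|\Lambda_1\|^2=\sum_\lambda|\tau_\lambda\lambda|^2$. For an integer $m\ge0$, $\mathfrak B^m$ is the set of bounded Borel functions $\psi$ on $H_T$ that are continuous in $x$ for every $t$ and whose generalized derivatives $D^\alpha\psi$ in $x$, $|\alpha|\le m$, are bounded on $H_T$; $\|\psi\|_m^2=\sup_{H_T}\sum_{|\alpha|\le m}|D^\alpha\psi|^2$ (for generalized derivatives the supremum in $x$ is essential), and $|D^k\psi|^2=\sum_{|\alpha|=k}|D^\alpha\psi|^2$. The same notation is used for functions independent of $t$. With $\delta_{h,\lambda}\varphi(x)=h^{-1}(\varphi(x+h\lambda)-\varphi(x))$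 and $\partial_\lambda=\sum_i\lambda_iD_i$ put $$L_h\varphi=\tfrac1h\sum_{\lambda\in\Lambda_1} q_\lambda\delta_{h,\lambda}\varphi+\sum_{\lambda\in\Lambda_1} p_\lambda\delta_{h,\lambda}\varphi-c\varphi,\qquad \mathcal L=\tfrac12\sum_{\lambda\in\Lambda_1}\sum_{i,j} q_\lambda\lambda_i\lambda_jD_iD_j+\sum_{\lambda\in\Lambda_1}\sum_i p_\lambda\lambda_iD_i-c,$$ $$\mathcal L^{(i)}=\tfrac1{(i+1)(i+2)}\sum_{\lambda\in\Lambda_1} q_\lambda\partial_\lambda^{i+2}+\tfrac1{i+1}\sum_{\lambda\in\Lambda_1} p_\lambda\partial_\lambda^{i+1}.$$ Consider, on $H_T$, the equations $$(1)\ u_h=g+\int_0^t(L_hu_h+f)\,ds,\qquad (2)\ u^{(0)}=g+\int_0^t(\mathcal Lu^{(0)}+f)\,ds,$$ $$(3)\ u^{(j)}=\int_0^t\Big(\mathcal Lu^{(j)}+\sum_{i=1}^j\tbinom ji\mathcal L^{(i)}u^{(j-i)}\Big)ds,\quad j=1,\dots,k.$$ A solution of (1) is a bounded Borel function on $H_T$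 satisfying (1) everywhere. A solution of (2) is a bounded continuous function on $H_T$ in $\mathfrak B^2$ satisfying (2) for every $t\in[0,T]$ in the sense of generalized functions of $x$. A solution of (3), given a solution $u^{(0)}$ of (2), is a family of bounded continuous functions $u^{(j)}\in\mathfrak B^{k-j+2}$, $j=1,\dots,k$, satisfying (3) in the same sense. Let $\Lambda=\Lambda_1\cup\{\ell^1,\dots,\ell^d\}$ with $\ell^i$ being $d$ distinct labels not in $\Lambda_1$. For $\lambda\in\Lambda_1$ let $T_{h,\lambda}\varphi(x)=\varphi(x+h\lambda)$, $\bar\delta_{h,\lambda}=\tau_\lambda h^{-1}(T_{h,\lambda}-1)$, and let $T_{h,\ell^i}=1$, $\bar\delta_{h,\ell^i}=\tau_0D_i$. For $\mu=(\mu^1,\mu^2)\in\Lambda^2$ let $T_{h,\mu}=T_{h,\mu^1}T_{h,\mu^2}$, $\bar\delta_{h,\mu}=\bar\delta_{h,\mu^1}\bar\delta_{h,\mu^2}$. Put $\chi_{h,\lambda}=q_\lambda+hp_\lambda$, $$Q_{h,\mu}\varphi=h^{-1}\sum_{\lambda\in\Lambda_1}(\bar\delta_{h,\mu}q_\lambda)\delta_{h,\lambda}\varphi,\quad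 L^0_{h,\mu}\varphi=Q_{h,\mu}\varphi+\sum_{\lambda\in\Lambda_1}(\bar\delta_{h,\mu}p_\lambda)\delta_{h,\lambda}\varphi,$$ $$A_h(\varphi)=2\sum_{\lambda\in\Lambda}(\bar\delta_{h,\lambda}\varphi)L^0_{h,\lambda}T_{h,\lambda}\varphi,\quad \mathcal Q_h(\varphi)=\sum_{\lambda\in\Lambda_1}\chi_{h,\lambda}(\delta_{h,\lambda}\varphi)^2.$$ Let $\mathfrak K$ be the set of families $\mathcal K=\mathcal K(t)$, $t\in[0,T]$, of bounded linear operators on the space of bounded Borel functions on $\mathbb R^d$ that preserve nonnegativity and satisfy $\mathcal K1\le1$. **Assumptions.** Let $m\ge2$ be an integer, $M_0,\dots,M_m$ real constants, and suppose: (A1) $p_\lambda,q_\lambda,c,f,g\in\mathfrak B^m$ and $\sup_{H_T}\big(\sum_{\lambda\in\Lambda_1}(|D^kq_\lambda|^2+|D^kp_\lambda|^2)+|D^kc|^2\big)\le M_k^2$, $k=0,\dots,m$; (A2) $\chi_{h,\lambda}\ge0$ on $H_T$ for all $h\in(0,h_0]$, $\lambda\in\Lambda_1$; (A3) $\sum_{\lambda\in\Lambda_1}\lambda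 q_\lambda=0$ on $H_T$; (A4) $c\ge c_0$ on $H_T$; (A5) for every $h\in(0,h_0]$ there is $\mathcal K_h\in\mathfrak K$ such that on $H_T$, for all smooth $\varphi$ bounded together with all derivatives, $$mA_h(\varphi)\le(1-\delta)\sum_{\lambda\in\Lambda}\mathcal Q_h(\bar\delta_{h,\lambda}\varphi)+K\mathcal Q_h(\varphi)+2(1-\delta)c\,\mathcal K_h\Big(\sum_{\lambda\in\Lambda}|\bar\delta_{h,\lambda}\varphi|^2\Big);$$ (A6) for every $h\in(0,h_0]$ and $n=1,\dots,m$ there is $\mathcal K_h\in\mathfrak K$ such that for all such $\varphi$, all $t\in[0,T]$ and almost all $x$, $$n\sum_{\nu\in\Lambda}A_h(\bar\delta_{h,\nu}\varphi)+n(n-1)\sum_{\lambda\in\Lambda^2}(\bar\delta_{h,\lambda}\varphi)Q_{h,\lambda}T_{h,\lambda}\varphi\le(1-\delta)\sum_{\lambda\in\Lambda^2}\mathcal Q_h(\bar\delta_{h,\lambda}\varphi)+K\sum_{\lambda\in\Lambda}\mathcal Q_h(\bar\delta_{h,\lambda}\varphi)$$ $$+2(1-\delta)c\,\mathcal K_h\Big(\sum_{\lambda\in\Lambda^2}|\bar\delta_{h,\lambda}\varphi|^2\Big)+K\mathcal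 K_h\Big(\sum_{\lambda\in\Lambda}|\bar\delta_{h,\lambda}\varphi|^2\Big).$$ Denote by (S) the condition that $\Lambda_1=-\Lambda_1$ and $q_\lambda=q_{-\lambda}$ for $\lambda\in\Lambda_1$, and by (P) the condition that $p_{-\lambda}=-p_\lambda$ for $\lambda\in\Lambda_1$. **Theorem.** There is a constant $N$ depending only on $m,\delta,c_0,\tau_0,K,M_0,\dots,M_m,|\Lambda_1|$ and $\|\Lambda_1\|$ (in particular, independent of $T$) such that, under (A1)–(A6), the following holds with $F:=\|f\|_m+\|g\|_m$. (a) Equation (2) has a unique solution $u^{(0)}$; moreover $u^{(0)}\in\mathfrak B^m$ and $\|u^{(0)}\|_m\le NF$. (b) Let $k\ge1$. If $m\ge3k+2$, then (3) has a unique solution, and $u^{(j)}\in\mathfrak B^{m-3j}$, $\|u^{(j)}\|_{m-3j}\le NF$ for $j=1,\dots,k$. If $m\ge2k+2$ and (S) holds, then (3) has a unique solution, and $u^{(j)}\in\mathfrak B^{m-2j}$, $\|u^{(j)}\|_{m-2j}\le NF$ for $j=1,\dots,k$; if in addition (P) holds, then $u^{(j)}=0$ for all odd $j\le k$. (c) For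 every $h\in(0,h_0]$ equation (1) has a unique bounded solution $u_h$. Let $m\ge3$ and $k\ge0$, and suppose that one of the following holds: (i) $m\ge3k+3$; (ii) $m\ge2k+3$ and (S); (iii) $k$ is odd, $m\ge2k+2$, (S) and (P). Then for all $h\in(0,h_0]$, on $H_T$, $$u_h=u^{(0)}+\sum_{1\le j\le k}\frac{h^j}{j!}u^{(j)}+h^{k+1}r_h,\qquad |r_h|\le NF,$$ and in case (iii) $u^{(j)}=0$ for all odd $j\le k$. (d) In each of the cases of (c), $|\bar u_h-u^{(0)}|\le NFh^{k+1}$ on $H_T$ for $h\in(0,h_0]$, where $\bar u_h=\sum_{j=0}^kb_ju_{2^{-j}h}$, $(b_0,\dots,b_k)=(1,0,\dots,0)V^{-1}$, $V^{ij}=2^{-(i-1)(j-1)}$, $i,j=1,\dots,k+1$. (e) In case (iii) of (c), $|u^{(0)}-\tilde u_h|\le NFh^{k+1}$ on $H_T$ for $h\in(0,h_0]$, where, with $\tilde k=(k-1)/2$, $\tilde u_h=\sum_{j=0}^{\tilde k}\tilde b_ju_{2^{-j}h}$, $(\tilde b_0,\dots,\tilde b_{\tilde k})=(1,0,\dots,0)\tilde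 V^{-1}$, $\tilde V^{ij}=4^{-(i-1)(j-1)}$, $i,j=1,\dots,\tilde k+1$. -/

import Mathlib

open MeasureTheory Set Finset
open scoped ContDiff ENNReal

noncomputable section

namespace FDScheme

/-- The space `ℝ^d`. -/
abbrev Sp (d : ℕ) : Type := EuclideanSpace ℝ (Fin d)

/-- The `i`-th standard basis vector. -/
def e {d : ℕ} (i : Fin d) : Sp d := EuclideanSpace.single i 1

/-! ### Generalized derivatives -/

/-- Test functions of class `C_0^∞(ℝ^d)`. -/
def IsTest {d : ℕ} (φ : Sp d → ℝ) : Prop := ContDiff ℝ ∞ φ ∧ HasCompactSupport φ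

/-- `v` is the generalized derivative of `ψ` along the list of directions `l`, i.e.
`D_{l₁} ⋯ D_{lₙ} ψ = v` in the sense of distributions. -/
def IsWeakDeriv {d : ℕ} (l : List (Sp d)) (ψ v : Sp d → ℝ) : Prop :=
  LocallyIntegrable ψ volume ∧ LocallyIntegrable v volume ∧
    ∀ φ : Sp d → ℝ, IsTest φ →
      ∫ x, ψ x * iteratedFDeriv ℝ l.length φ x l.get = (-1) ^ l.length * ∫ x, v x * φ x

open Classical in
/-- A representative of the generalized derivative along the list of directions `l` (it is unique
up to null sets; the value is `0` if the generalized derivative is not a function). -/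
def weakDeriv {d : ℕ} (l : List (Sp d)) (ψ : Sp d → ℝ) : Sp d → ℝ :=
  if h : ∃ v, IsWeakDeriv l ψ v then h.choose else 0

/-- The list of directions of the operator `D^α = D_1^{α_1} ⋯ D_d^{α_d}`. -/
def dirs {d : ℕ} (α : Fin d → ℕ) : List (Sp d) :=
  (List.finRange d).flatMap fun i => List.replicate (α i) (e i)

/-- The multi-indices `α` with `|α| = k`. -/
def multi (d k : ℕ) : Finset (Fin d → ℕ) := Finset.piAntidiag Finset.univ k

/-- `|D^k ψ|² = ∑_{|α| = k} |D^α ψ|²`. -/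
def sqD {d : ℕ} (k : ℕ) (ψ : Sp d → ℝ) (x : Sp d) : ℝ :=
  ∑ α ∈ multi d k, weakDeriv (dirs α) ψ x ^ 2

/-- The class `𝔅^m_T`: Borel bounded functions on `H_T = [0,T] × ℝ^d`, continuous in `x` for every
`t`, whose generalized derivatives in `x` up to order `m` are bounded on `H_T`. -/
structure MemB {d : ℕ} (T : ℝ) (m : ℕ) (ψ : ℝ → Sp d → ℝ) : Prop where
  measurable : Measurable fun z : Icc (0 : ℝ) T × Sp d => ψ z.1 z.2
  bounded : ∃ C : ℝ, ∀ t ∈ Icc (0 : ℝ) T, ∀ x, |ψ t x| ≤ C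
  continuous : ∀ t ∈ Icc (0 : ℝ) T, Continuous (ψ t)
  deriv_bounded : ∀ k ≤ m, ∀ α ∈ multi d k, ∃ C : ℝ, ∀ t ∈ Icc (0 : ℝ) T,
    ∃ v : Sp d → ℝ, IsWeakDeriv (dirs α) (ψ t) v ∧ ∀ᵐ x, |v x| ≤ C

/-- The norm `‖ψ‖_m`, where `‖ψ‖_m² = sup_{H_T} ∑_{|α| ≤ m} |D^α ψ|²`; the supremum in `x` of a
generalized function is the essential one. (It is finite for `ψ ∈ 𝔅^m_T`.) -/
def normB {d : ℕ} (T : ℝ) (m : ℕ) (ψ : ℝ → Sp d → ℝ) : ℝ :=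
  Real.sqrt (⨆ t ∈ Icc (0 : ℝ) T,
    essSup (fun x => ENNReal.ofReal (∑ k ∈ Finset.range (m + 1), sqD k (ψ t) x)) volume).toReal

/-! ### Data of the problem -/

/-- The data: the finite set `Λ₁ ⊂ ℝ^d ∖ {0}`, the coefficients `q_λ`, `p_λ`, `c`, the free terms
`f`, `g`, the numbers `h₀, T > 0` and the weights `τ_λ ≥ 0`. Only the values for `λ ∈ Λ₁` and
`t ∈ [0,T]` matter. -/
structure Data (d : ℕ) where
  Λ₁ : Finset (Sp d)
  zero_notMem : (0 : Sp d) ∉ Λ₁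
  q : Sp d → ℝ → Sp d → ℝ
  p : Sp d → ℝ → Sp d → ℝ
  c : ℝ → Sp d → ℝ
  f : ℝ → Sp d → ℝ
  g : Sp d → ℝ
  h₀ : ℝ
  h₀_pos : 0 < h₀
  T : ℝ
  T_pos : 0 < T
  q_nonneg : ∀ l ∈ Λ₁, ∀ t ∈ Icc (0 : ℝ) T, ∀ x, 0 ≤ q l t x
  τ : Sp d → ℝ
  τ_nonneg : ∀ l ∈ Λ₁, 0 ≤ τ l

variable {d : ℕ}

/-- `|Λ₁| = (∑ |λ|²)^{1/2}`. -/
def Data.abs (S : Data d) : ℝ := Real.sqrt (∑ l ∈ S.Λ₁, ‖l‖ ^ 2)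

/-- `‖Λ₁‖ = (∑ |τ_λ λ|²)^{1/2}`. -/
def Data.nrm (S : Data d) : ℝ := Real.sqrt (∑ l ∈ S.Λ₁, ‖S.τ l • l‖ ^ 2)

/-- `‖f‖_m + ‖g‖_m`. -/
def Data.size (S : Data d) (m : ℕ) : ℝ := normB S.T m S.f + normB S.T m (fun _ => S.g)

/-! ### Operators -/

/-- `δ_{h,λ} φ`. -/
def delta (h : ℝ) (l : Sp d) (φ : Sp d → ℝ) (x : Sp d) : ℝ := (φ (x + h • l) - φ x) / h

/-- `L_h^0 φ`. -/
def Data.L0h (S : Data d) (h t : ℝ) (φ : Sp d → ℝ) (x : Sp d) : ℝ :=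
  1 / h * ∑ l ∈ S.Λ₁, S.q l t x * delta h l φ x + ∑ l ∈ S.Λ₁, S.p l t x * delta h l φ x

/-- `L_h φ = L_h^0 φ - c φ`. -/
def Data.Lh (S : Data d) (h t : ℝ) (φ : Sp d → ℝ) (x : Sp d) : ℝ :=
  S.L0h h t φ x - S.c t x * φ x

/-- `𝓛 ψ = ½ ∑_λ ∑_{i,j} q_λ λ_i λ_j D_i D_j ψ + ∑_λ ∑_i p_λ λ_i D_i ψ - c ψ`, with generalized
derivatives. -/
def Data.L (S : Data d) (t : ℝ) (ψ : Sp d → ℝ) (x : Sp d) : ℝ :=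
  1 / 2 * ∑ l ∈ S.Λ₁, ∑ i, ∑ j, S.q l t x * l i * l j * weakDeriv [e i, e j] ψ x
    + ∑ l ∈ S.Λ₁, ∑ i, S.p l t x * l i * weakDeriv [e i] ψ x - S.c t x * ψ x

/-- `𝓛^{(i)} ψ = (1/((i+1)(i+2))) ∑_λ q_λ ∂_λ^{i+2} ψ + (1/(i+1)) ∑_λ p_λ ∂_λ^{i+1} ψ`, with
generalized derivatives. -/
def Data.Li (S : Data d) (i : ℕ) (t : ℝ) (ψ : Sp d → ℝ) (x : Sp d) : ℝ :=
  1 / (((i : ℝ) + 1) * ((i : ℝ) + 2)) *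
      ∑ l ∈ S.Λ₁, S.q l t x * weakDeriv (List.replicate (i + 2) l) ψ x
    + 1 / ((i : ℝ) + 1) * ∑ l ∈ S.Λ₁, S.p l t x * weakDeriv (List.replicate (i + 1) l) ψ x

/-! ### Equations -/

/-- `u(t,x) = init(x) + ∫_0^t rhs(s,x) ds` on `H_T` in the sense of generalized functions. -/
def WeakEq (T : ℝ) (init : Sp d → ℝ) (rhs u : ℝ → Sp d → ℝ) : Prop :=
  ∀ t ∈ Icc (0 : ℝ) T, ∀ φ : Sp d → ℝ, IsTest φ →
    ∫ x, φ x * u t x = (∫ x, φ x * init x) + ∫ s in (0 : ℝ)..t, ∫ x, φ x * rhs s x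

/-- `u` is a solution of `∂u/∂t = 𝓛 u + f`, `u(0,·) = g` on `H_T`. -/
structure Data.IsSolution (S : Data d) (u : ℝ → Sp d → ℝ) : Prop where
  continuousOn : ContinuousOn (Function.uncurry u) (Icc 0 S.T ×ˢ univ)
  memB : MemB S.T 2 u
  eq : WeakEq S.T S.g (fun s x => S.L s (u s) x + S.f s x) u

/-- `u 0` is a solution of `∂u/∂t = 𝓛 u + f`, `u(0,·) = g`, and `u 1, …, u k` solve the system
`u_j(t,x) = ∫_0^t (𝓛 u_j + ∑_{i=1}^j C_j^i 𝓛^{(i)} u_{j-i})(s,x) ds`, `j = 1, …, k`,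
in the sense of generalized functions. The function `u_j` enters the system with
derivatives of order up to `k - j + 2`, which are required to be bounded functions. -/
structure Data.IsSystemSolution (S : Data d) (k : ℕ) (u : ℕ → ℝ → Sp d → ℝ) : Prop where
  zero : S.IsSolution (u 0)
  continuousOn : ∀ j ∈ Finset.Icc 1 k,
    ContinuousOn (Function.uncurry (u j)) (Icc 0 S.T ×ˢ univ)
  memB : ∀ j ∈ Finset.Icc 1 k, MemB S.T (k - j + 2) (u j)
  eq : ∀ j ∈ Finset.Icc 1 k, WeakEq S.T 0
    (fun s x => S.L s (u j s) x +
      ∑ i ∈ Finset.Icc 1 j, (j.choose i : ℝ) * S.Li i s (u (j - i) s) x) (u j)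

/-- `v` is a bounded (Borel) solution on `H_T` of the finite difference equation
`v(t,x) = g(x) + ∫_0^t (L_h v + f)(s,x) ds`. -/
structure Data.IsFDSolution (S : Data d) (h : ℝ) (v : ℝ → Sp d → ℝ) : Prop where
  measurable : Measurable fun z : Icc (0 : ℝ) S.T × Sp d => v z.1 z.2
  bounded : ∃ C : ℝ, ∀ t ∈ Icc (0 : ℝ) S.T, ∀ x, |v t x| ≤ C
  eq : ∀ t ∈ Icc (0 : ℝ) S.T, ∀ x,
    v t x = S.g x + ∫ s in (0 : ℝ)..t, (S.Lh h s (v s) x + S.f s x)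

/-- Equality on `H_T`. -/
def Data.EqH (S : Data d) (u v : ℝ → Sp d → ℝ) : Prop :=
  ∀ t ∈ Icc (0 : ℝ) S.T, ∀ x, u t x = v t x

/-! ### Smoothness, positivity and symmetry assumptions -/

/-- `p_λ, q_λ, c, f, g ∈ 𝔅^m` and
`sup_{H_T} (∑_λ (|D^k q_λ|² + |D^k p_λ|²) + |D^k c|²) ≤ M_k²` for `k = 0, …, m`. -/
structure Data.Smooth (S : Data d) (m : ℕ) (M : Fin (m + 1) → ℝ) : Prop where
  p_mem : ∀ l ∈ S.Λ₁, MemB S.T m (S.p l)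
  q_mem : ∀ l ∈ S.Λ₁, MemB S.T m (S.q l)
  c_mem : MemB S.T m S.c
  f_mem : MemB S.T m S.f
  g_mem : MemB S.T m fun _ => S.g
  bound : ∀ k : Fin (m + 1), ∀ t ∈ Icc (0 : ℝ) S.T, ∀ᵐ x,
    (∑ l ∈ S.Λ₁, (sqD k (S.q l t) x + sqD k (S.p l t) x)) + sqD k (S.c t) x ≤ M k ^ 2

/-- `χ_{h,λ} = q_λ + h p_λ`. -/
def Data.chi (S : Data d) (h : ℝ) (l : Sp d) (t : ℝ) (x : Sp d) : ℝ :=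
  S.q l t x + h * S.p l t x

/-- `χ_{h,λ} ≥ 0` on `H_T`. -/
def Data.ChiNonneg (S : Data d) : Prop :=
  ∀ t ∈ Icc (0 : ℝ) S.T, ∀ x, ∀ h ∈ Ioc 0 S.h₀, ∀ l ∈ S.Λ₁, 0 ≤ S.chi h l t x

/-- `∑_λ λ q_λ = 0` on `H_T`. -/
def Data.Centered (S : Data d) : Prop :=
  ∀ t ∈ Icc (0 : ℝ) S.T, ∀ x, ∑ l ∈ S.Λ₁, S.q l t x • l = 0

/-- `Λ₁ = -Λ₁` and `q_λ = q_{-λ}`. -/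
def Data.Symm (S : Data d) : Prop :=
  (∀ l ∈ S.Λ₁, -l ∈ S.Λ₁) ∧
    ∀ l ∈ S.Λ₁, ∀ t ∈ Icc (0 : ℝ) S.T, ∀ x, S.q l t x = S.q (-l) t x

/-- `p_{-λ} = -p_λ`. -/
def Data.Antisymm (S : Data d) : Prop :=
  ∀ l ∈ S.Λ₁, ∀ t ∈ Icc (0 : ℝ) S.T, ∀ x, S.p (-l) t x = -S.p l t x

/-! ### Structural assumptions

The index set `Λ = Λ₁ ∪ Λ₂` is a subset of `Sp d ⊕ Fin d`: `inl λ` stands for `λ ∈ Λ₁`, and `inr i`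
for the label `ℓ^i ∈ Λ₂`. -/

/-- `Λ = Λ₁ ∪ Λ₂`. -/
def Data.Λ (S : Data d) : Finset (Sp d ⊕ Fin d) := S.Λ₁.disjSum Finset.univ

/-- `δ̄_{h,λ} = τ_λ h⁻¹ (T_{h,λ} - 1)` for `λ ∈ Λ₁` and `δ̄_{h,ℓ^i} = τ₀ D_i`. The derivative is the
classical one; it is applied to smooth functions, and (at most twice) to the coefficients, whose
generalized derivatives of order two are bounded, so that the classical second order derivatives
exist and coincide with the generalized ones almost everywhere. -/
def Data.dbar (S : Data d) (τ₀ h : ℝ) : Sp d ⊕ Fin d → (Sp d → ℝ) → Sp d → ℝ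
  | .inl l, φ, x => S.τ l * h⁻¹ * (φ (x + h • l) - φ x)
  | .inr i, φ, x => τ₀ * lineDeriv ℝ φ x (e i)

/-- `T_{h,λ}` for `λ ∈ Λ₁`, and `T_{h,ℓ^i} = 1`. -/
def shift (h : ℝ) : Sp d ⊕ Fin d → (Sp d → ℝ) → Sp d → ℝ
  | .inl l, φ, x => φ (x + h • l)
  | .inr _, φ, x => φ x

/-- `δ̄_{h,μ} = δ̄_{h,μ¹} δ̄_{h,μ²}` for `μ ∈ Λ²`. -/
def Data.dbar2 (S : Data d) (τ₀ h : ℝ) (μ : (Sp d ⊕ Fin d) × (Sp d ⊕ Fin d)) (φ : Sp d → ℝ) :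
    Sp d → ℝ := S.dbar τ₀ h μ.1 (S.dbar τ₀ h μ.2 φ)

/-- `T_{h,μ} = T_{h,μ¹} T_{h,μ²}` for `μ ∈ Λ²`. -/
def shift2 (h : ℝ) (μ : (Sp d ⊕ Fin d) × (Sp d ⊕ Fin d)) (φ : Sp d → ℝ) : Sp d → ℝ :=
  shift h μ.1 (shift h μ.2 φ)

/-- `h⁻¹ ∑_λ (B q_λ) δ_{h,λ} φ`; this is `Q_{h,μ} φ` for `B = δ̄_{h,μ}`, where `μ ∈ Λ` or
`μ ∈ Λ²`. -/
def Data.Q (S : Data d) (h : ℝ) (B : (Sp d → ℝ) → Sp d → ℝ) (t : ℝ) (φ : Sp d → ℝ) (x : Sp d) : ℝ :=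
  h⁻¹ * ∑ l ∈ S.Λ₁, B (S.q l t) x * delta h l φ x

/-- `L^0_{h,μ} φ = Q_{h,μ} φ + ∑_λ (δ̄_{h,μ} p_λ) δ_{h,λ} φ` for `μ ∈ Λ`. -/
def Data.L0μ (S : Data d) (τ₀ h : ℝ) (μ : Sp d ⊕ Fin d) (t : ℝ) (φ : Sp d → ℝ) (x : Sp d) : ℝ :=
  S.Q h (S.dbar τ₀ h μ) t φ x + ∑ l ∈ S.Λ₁, S.dbar τ₀ h μ (S.p l t) x * delta h l φ x

/-- `A_h(φ) = 2 ∑_{λ ∈ Λ} (δ̄_{h,λ} φ) L^0_{h,λ} T_{h,λ} φ`. -/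
def Data.A (S : Data d) (τ₀ h t : ℝ) (φ : Sp d → ℝ) (x : Sp d) : ℝ :=
  2 * ∑ μ ∈ S.Λ, S.dbar τ₀ h μ φ x * S.L0μ τ₀ h μ t (shift h μ φ) x

/-- `𝒬_h(φ) = ∑_{λ ∈ Λ₁} χ_{h,λ} (δ_{h,λ} φ)²`. -/
def Data.calQ (S : Data d) (h t : ℝ) (φ : Sp d → ℝ) (x : Sp d) : ℝ :=
  ∑ l ∈ S.Λ₁, S.chi h l t x * delta h l φ x ^ 2

/-- The set `B(ℝ^d)` of bounded Borel functions. -/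
def BddBorel (ψ : Sp d → ℝ) : Prop := Measurable ψ ∧ ∃ C : ℝ, ∀ x, |ψ x| ≤ C

/-- `𝒦` is (for functions in `B(ℝ^d)`) a linear operator from `B(ℝ^d)` into itself, preserving the
cone of nonnegative functions, with `𝒦 1 ≤ 1`; it is then automatically bounded. The values of `𝒦`
outside of `B(ℝ^d)` are irrelevant. -/
structure MemK (𝒦 : (Sp d → ℝ) → Sp d → ℝ) : Prop where
  maps : ∀ ψ, BddBorel ψ → BddBorel (𝒦 ψ)
  add : ∀ ψ₁ ψ₂, BddBorel ψ₁ → BddBorel ψ₂ → 𝒦 (ψ₁ + ψ₂) = 𝒦 ψ₁ + 𝒦 ψ₂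
  smul : ∀ (a : ℝ) (ψ), BddBorel ψ → 𝒦 (a • ψ) = a • 𝒦 ψ
  nonneg : ∀ ψ, BddBorel ψ → (∀ x, 0 ≤ ψ x) → ∀ x, 0 ≤ 𝒦 ψ x
  one : ∀ x, 𝒦 1 x ≤ 1

/-- Smooth functions, bounded together with all their derivatives. -/
def BddSmooth (φ : Sp d → ℝ) : Prop :=
  ContDiff ℝ ∞ φ ∧ ∀ n : ℕ, ∃ C : ℝ, ∀ x, ‖iteratedFDeriv ℝ n φ x‖ ≤ C

/-- The first structural assumption: for every `h ∈ (0,h₀]` there is `𝒦_h = 𝒦_h(t)` as above with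
`m A_h(φ) ≤ (1-δ) ∑_{λ∈Λ} 𝒬_h(δ̄_{h,λ} φ) + K 𝒬_h(φ) + 2(1-δ) c 𝒦_h(∑_{λ∈Λ} |δ̄_{h,λ} φ|²)`
on `H_T` for all smooth `φ`. -/
def Data.Structural₁ (S : Data d) (m : ℕ) (δ τ₀ K : ℝ) : Prop :=
  ∀ h ∈ Ioc 0 S.h₀, ∃ 𝒦 : ℝ → (Sp d → ℝ) → Sp d → ℝ, (∀ t ∈ Icc (0 : ℝ) S.T, MemK (𝒦 t)) ∧
    ∀ φ, BddSmooth φ → ∀ t ∈ Icc (0 : ℝ) S.T, ∀ x,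
      m * S.A τ₀ h t φ x ≤
        (1 - δ) * ∑ μ ∈ S.Λ, S.calQ h t (S.dbar τ₀ h μ φ) x
        + K * S.calQ h t φ x
        + 2 * (1 - δ) * S.c t x * 𝒦 t (fun y => ∑ μ ∈ S.Λ, S.dbar τ₀ h μ φ y ^ 2) x

/-- The second structural assumption: for every `h ∈ (0,h₀]` and `n = 1, …, m` there is
`𝒦_h = 𝒦_h(t)` as above with
`n ∑_{ν∈Λ} A_h(δ̄_{h,ν} φ) + n(n-1) ∑_{λ∈Λ²} (δ̄_{h,λ} φ) Q_{h,λ} T_{h,λ} φ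
  ≤ (1-δ) ∑_{λ∈Λ²} 𝒬_h(δ̄_{h,λ} φ) + K ∑_{λ∈Λ} 𝒬_h(δ̄_{h,λ} φ)
    + 2(1-δ) c 𝒦_h(∑_{λ∈Λ²} |δ̄_{h,λ} φ|²) + K 𝒦_h(∑_{λ∈Λ} |δ̄_{h,λ} φ|²)`
on `H_T` for all smooth `φ`. The second order derivatives of `q_λ` are only defined almost
everywhere in `x`, and so the inequality is required for almost every `x`. -/
def Data.Structural₂ (S : Data d) (m : ℕ) (δ τ₀ K : ℝ) : Prop :=
  ∀ h ∈ Ioc 0 S.h₀, ∀ n ∈ Finset.Icc 1 m,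
    ∃ 𝒦 : ℝ → (Sp d → ℝ) → Sp d → ℝ, (∀ t ∈ Icc (0 : ℝ) S.T, MemK (𝒦 t)) ∧
    ∀ φ, BddSmooth φ → ∀ t ∈ Icc (0 : ℝ) S.T, ∀ᵐ x,
      n * ∑ ν ∈ S.Λ, S.A τ₀ h t (S.dbar τ₀ h ν φ) x
        + n * ((n : ℝ) - 1) * ∑ μ ∈ S.Λ ×ˢ S.Λ,
            S.dbar2 τ₀ h μ φ x * S.Q h (S.dbar2 τ₀ h μ) t (shift2 h μ φ) x ≤
        (1 - δ) * ∑ μ ∈ S.Λ ×ˢ S.Λ, S.calQ h t (S.dbar2 τ₀ h μ φ) x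
        + K * ∑ μ ∈ S.Λ, S.calQ h t (S.dbar τ₀ h μ φ) x
        + 2 * (1 - δ) * S.c t x * 𝒦 t (fun y => ∑ μ ∈ S.Λ ×ˢ S.Λ, S.dbar2 τ₀ h μ φ y ^ 2) x
        + K * 𝒦 t (fun y => ∑ μ ∈ S.Λ, S.dbar τ₀ h μ φ y ^ 2) x

/-- All the assumptions of the theorem on the data. -/
structure Data.Assumptions (S : Data d) (m : ℕ) (δ c₀ τ₀ K : ℝ) (M : Fin (m + 1) → ℝ) : Prop where
  smooth : S.Smooth m M
  chi_nonneg : S.ChiNonneg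
  centered : S.Centered
  c_ge : ∀ t ∈ Icc (0 : ℝ) S.T, ∀ x, c₀ ≤ S.c t x
  structural₁ : S.Structural₁ m δ τ₀ K
  structural₂ : S.Structural₂ m δ τ₀ K

/-! ### Extrapolation -/

/-- The Vandermonde matrix `(r^{(i-1)(j-1)})_{i,j=1,…,n+1}` (the indices below start from `0`). -/
def vand (r : ℝ) (n : ℕ) : Matrix (Fin (n + 1)) (Fin (n + 1)) ℝ :=
  Matrix.of fun i j => r ^ ((i : ℕ) * (j : ℕ))

/-- The coefficients `(1,0,…,0) V⁻¹` for the Vandermonde matrix `V = vand r n`. -/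
def coef (r : ℝ) (n : ℕ) : Fin (n + 1) → ℝ :=
  Matrix.vecMul (Pi.single 0 1) (vand r n)⁻¹

/-- `ū_h = ∑_{j=0}^k b_j u_{2^{-j}h}`, `(b_0,…,b_k) = (1,0,…,0) V⁻¹`, `V^{ij} = 2^{-(i-1)(j-1)}`. -/
def ubar (k : ℕ) (uh : ℝ → ℝ → Sp d → ℝ) (h t : ℝ) (x : Sp d) : ℝ :=
  ∑ j : Fin (k + 1), coef (1 / 2) k j * uh ((1 / 2) ^ (j : ℕ) * h) t x

/-- `ũ_h = ∑_{j=0}^{k̃} b̃_j u_{2^{-j}h}` with `k̃ = (k-1)/2` for odd `k`,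
`(b̃_0,…,b̃_{k̃}) = (1,0,…,0) Ṽ⁻¹`, `Ṽ^{ij} = 4^{-(i-1)(j-1)}`. -/
def utilde (k : ℕ) (uh : ℝ → ℝ → Sp d → ℝ) (h t : ℝ) (x : Sp d) : ℝ :=
  ∑ j : Fin ((k - 1) / 2 + 1), coef (1 / 4) ((k - 1) / 2) j * uh ((1 / 2) ^ (j : ℕ) * h) t x

/-! ### Assertions with a given constant `N` -/

/-- Unique solvability of `∂u/∂t = 𝓛 u + f`, `u(0,·) = g`; the solution belongs to `𝔅^m_T` and
`‖u‖_m ≤ N (‖f‖_m + ‖g‖_m)`. -/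
def Data.ParabolicClaim (S : Data d) (m : ℕ) (N : ℝ) : Prop :=
  ∃ u, S.IsSolution u ∧ (∀ v, S.IsSolution v → S.EqH v u) ∧
    MemB S.T m u ∧ normB S.T m u ≤ N * S.size m

/-- Unique solvability of the system for `u_1, …, u_k` with `u_j ∈ 𝔅^{m-rj}` and
`‖u_j‖_{m-rj} ≤ N (‖f‖_m + ‖g‖_m)`. -/
def Data.SystemClaim (S : Data d) (m k r : ℕ) (N : ℝ) : Prop :=
  ∃ u, S.IsSystemSolution k u ∧
    (∀ v, S.IsSystemSolution k v → ∀ j ∈ Finset.Icc 1 k, S.EqH (v j) (u j)) ∧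
    ∀ j ∈ Finset.Icc 1 k, MemB S.T (m - r * j) (u j) ∧
      normB S.T (m - r * j) (u j) ≤ N * S.size m

/-- The expansion `u_h = u_0 + ∑_{1≤j≤k} (h^j/j!) u_j + h^{k+1} r_h` on `H_T` with
`|r_h| ≤ N (‖f‖_m + ‖g‖_m)` for all `h ∈ (0,h₀]`. -/
def Data.ExpansionClaim (S : Data d) (m k : ℕ) (N : ℝ) (u : ℕ → ℝ → Sp d → ℝ)
    (uh : ℝ → ℝ → Sp d → ℝ) : Prop :=
  ∃ r : ℝ → ℝ → Sp d → ℝ, ∀ h ∈ Ioc 0 S.h₀, ∀ t ∈ Icc (0 : ℝ) S.T, ∀ x,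
    uh h t x = u 0 t x + ∑ j ∈ Finset.Icc 1 k, h ^ j / (j.factorial : ℝ) * u j t x
      + h ^ (k + 1) * r h t x ∧
    |r h t x| ≤ N * S.size m

/-- `k` is odd, `m ≥ 2k+2`, the symmetry condition holds and `p_{-λ} = -p_λ`. -/
def Data.CaseIII (S : Data d) (m k : ℕ) : Prop :=
  Odd k ∧ 2 * k + 2 ≤ m ∧ S.Symm ∧ S.Antisymm

end FDScheme

end

open Filter (Tendsto atTop)

noncomputable section

namespace FDScheme

open Function (uncurry)

variable {d : ℕ}

/-- Real functions on the space. -/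
abbrev Fn (d : ℕ) : Type := Sp d → ℝ

/-- Real functions of time and space. -/
abbrev TFn (d : ℕ) : Type := ℝ → Fn d

/-- The assumptions of the theorem on the data and on the constants. -/
structure Data.Hyp (S : Data d) (m : ℕ) (δ c₀ τ₀ K : ℝ) (M : Fin (m + 1) → ℝ) : Prop
    extends S.Assumptions m δ c₀ τ₀ K M where
  hm : 2 ≤ m
  hδ : δ ∈ Ioc (0 : ℝ) 1
  hc₀ : 0 < c₀
  hτ₀ : 0 < τ₀
  hK : 0 ≤ K

theorem Data.Hyp.hm1 {S : Data d} {m : ℕ} {δ c₀ τ₀ K : ℝ} {M : Fin (m + 1) → ℝ}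
    (hS : S.Hyp m δ c₀ τ₀ K M) : 1 ≤ m := one_le_two.trans hS.hm

/-! ### The algebra of bounded smooth functions -/

theorem BddSmooth.const (a : ℝ) : BddSmooth (d := d) fun _ => a := by
  refine ⟨contDiff_const, fun n => ?_⟩
  rcases n with _ | n
  · exact ⟨|a|, fun x => by simp⟩
  · exact ⟨0, fun x => by rw [iteratedFDeriv_succ_const]; simp⟩

theorem BddSmooth.add {φ ψ : Fn d} (hφ : BddSmooth φ) (hψ : BddSmooth ψ) :
    BddSmooth (φ + ψ) := by
  refine ⟨hφ.1.add hψ.1, fun n => ?_⟩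
  obtain ⟨C, hC⟩ := hφ.2 n
  obtain ⟨C', hC'⟩ := hψ.2 n
  refine ⟨C + C', fun x => ?_⟩
  rw [iteratedFDeriv_add_apply (hφ.1.of_le (by exact_mod_cast le_top)).contDiffAt
    (hψ.1.of_le (by exact_mod_cast le_top)).contDiffAt]
  exact (norm_add_le _ _).trans (add_le_add (hC x) (hC' x))

theorem BddSmooth.mul {φ ψ : Fn d} (hφ : BddSmooth φ) (hψ : BddSmooth ψ) :
    BddSmooth (φ * ψ) := by
  refine ⟨hφ.1.mul hψ.1, fun n => ?_⟩
  choose C hC using hφ.2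
  choose C' hC' using hψ.2
  refine ⟨∑ i ∈ Finset.range (n + 1), (n.choose i : ℝ) * C i * C' (n - i), fun x => ?_⟩
  refine (norm_iteratedFDeriv_mul_le hφ.1 hψ.1 x (n := n) (by exact_mod_cast le_top)).trans ?_
  refine sum_le_sum fun i _ => ?_
  have h0 := (norm_nonneg _).trans (hC i x)
  gcongr
  · exact hC i x
  · exact hC' _ x

/-- The algebra of smooth functions bounded together with all derivatives. -/
def Smo (d : ℕ) : Subalgebra ℝ (Fn d) where
  carrier := {φ | BddSmooth φ}
  mul_mem' := BddSmooth.mul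
  add_mem' := BddSmooth.add
  algebraMap_mem' a := BddSmooth.const a

instance : CoeFun (Smo d) fun _ => Fn d := ⟨Subtype.val⟩

namespace Smo

@[ext] theorem ext {φ ψ : Smo d} (h : ∀ x, φ x = ψ x) : φ = ψ := Subtype.ext (funext h)

@[simp] theorem add_apply (φ ψ : Smo d) (x : Sp d) : (φ + ψ) x = φ x + ψ x := rfl
@[simp] theorem sub_apply (φ ψ : Smo d) (x : Sp d) : (φ - ψ) x = φ x - ψ x := rfl
@[simp] theorem neg_apply (φ : Smo d) (x : Sp d) : (-φ) x = -φ x := rfl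
@[simp] theorem mul_apply (φ ψ : Smo d) (x : Sp d) : (φ * ψ) x = φ x * ψ x := rfl
@[simp] theorem smul_apply (a : ℝ) (φ : Smo d) (x : Sp d) : (a • φ) x = a * φ x := rfl
@[simp] theorem zero_apply (x : Sp d) : (0 : Smo d) x = 0 := rfl
@[simp] theorem one_apply (x : Sp d) : (1 : Smo d) x = 1 := rfl
@[simp] theorem mk_apply (f : Fn d) (hf : f ∈ Smo d) (x : Sp d) :
    Subtype.val (⟨f, hf⟩ : Smo d) x = f x := rfl

/-- Evaluation at a point. -/
def ev (x : Sp d) : Smo d →ₗ[ℝ] ℝ where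
  toFun φ := φ x
  map_add' _ _ := rfl
  map_smul' _ _ := rfl

@[simp] theorem sum_apply {ι : Type*} (s : Finset ι) (φ : ι → Smo d) (x : Sp d) :
    (∑ i ∈ s, φ i) x = ∑ i ∈ s, φ i x := map_sum (ev x) φ s

theorem contDiff (φ : Smo d) : ContDiff ℝ ∞ φ := φ.2.1

theorem differentiable (φ : Smo d) : Differentiable ℝ φ := (Smo.contDiff φ).differentiable (by simp)

theorem continuous (φ : Smo d) : Continuous φ := (Smo.contDiff φ).continuous

theorem bounded (φ : Smo d) : ∃ C, ∀ x, |φ x| ≤ C := by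
  obtain ⟨C, hC⟩ := φ.2.2 0
  exact ⟨C, fun x => by simpa using hC x⟩

end Smo

/-- The directional derivative. -/
def D (v : Sp d) : Smo d →ₗ[ℝ] Smo d where
  toFun φ := ⟨fun x => fderiv ℝ φ x v, by
    refine ⟨?_, fun n => ?_⟩
    · exact ((Smo.contDiff φ).fderiv_right (m := ∞) (by simp)).clm_apply contDiff_const
    · obtain ⟨C, hC⟩ := φ.2.2 (n + 1)
      refine ⟨‖ContinuousLinearMap.apply ℝ ℝ v‖ * C, fun x => ?_⟩
      have := (ContinuousLinearMap.apply ℝ ℝ v).norm_iteratedFDeriv_comp_left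
        (f := fderiv ℝ φ) (x := x) (N := (∞ : WithTop ℕ∞)) (n := n)
        ((Smo.contDiff φ).fderiv_right (m := ∞) (by simp)).contDiffAt (by exact_mod_cast le_top)
      refine this.trans ?_
      rw [norm_iteratedFDeriv_fderiv]
      gcongr
      exact hC x⟩
  map_add' φ ψ := by
    ext x
    change fderiv ℝ (⇑φ + ⇑ψ) x v = _
    rw [fderiv_add ((Smo.differentiable φ) x) ((Smo.differentiable ψ) x)]; rfl
  map_smul' a φ := by
    ext x
    change fderiv ℝ (a • ⇑φ) x v = _
    rw [fderiv_const_smul ((Smo.differentiable φ) x)]; rfl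

theorem D_apply (v : Sp d) (φ : Smo d) (x : Sp d) : D v φ x = fderiv ℝ φ x v := rfl

/-- Translation. -/
def Tr (y : Sp d) : Smo d →ₗ[ℝ] Smo d where
  toFun φ := ⟨fun x => φ (x + y), by
    refine ⟨(Smo.contDiff φ).comp (contDiff_id.add contDiff_const), fun n => ?_⟩
    obtain ⟨C, hC⟩ := φ.2.2 n
    exact ⟨C, fun x => by rw [iteratedFDeriv_comp_add_right]; exact hC _⟩⟩
  map_add' _ _ := rfl
  map_smul' _ _ := rfl

@[simp] theorem Tr_apply (y : Sp d) (φ : Smo d) (x : Sp d) : Tr y φ x = φ (x + y) := rfl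

theorem Tr_mul (y : Sp d) (φ ψ : Smo d) : Tr y (φ * ψ) = Tr y φ * Tr y ψ := rfl

theorem Tr_Tr (y z : Sp d) (φ : Smo d) : Tr y (Tr z φ) = Tr (y + z) φ := by
  ext x; simp [add_assoc]

theorem Tr_comm (y z : Sp d) (φ : Smo d) : Tr y (Tr z φ) = Tr z (Tr y φ) := by
  rw [Tr_Tr, Tr_Tr, add_comm]

theorem D_Tr (v y : Sp d) (φ : Smo d) : D v (Tr y φ) = Tr y (D v φ) := by
  ext x
  change fderiv ℝ (fun x => φ (x + y)) x v = _
  rw [fderiv_comp_add_right]; rfl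

theorem D_mul (v : Sp d) (φ ψ : Smo d) : D v (φ * ψ) = φ * D v ψ + D v φ * ψ := by
  ext x
  change fderiv ℝ (⇑φ * ⇑ψ) x v = _
  rw [fderiv_mul ((Smo.differentiable φ) x) ((Smo.differentiable ψ) x)]
  simp [D_apply, mul_comm]

theorem D_comm (v w : Sp d) (φ : Smo d) : D v (D w φ) = D w (D v φ) := by
  ext x
  have h2 : DifferentiableAt ℝ (fderiv ℝ φ) x :=
    ((Smo.contDiff φ).fderiv_right (m := ∞) (by simp)).differentiable (by simp) x
  have key : ∀ v w : Sp d, D v (D w φ) x = fderiv ℝ (fderiv ℝ φ) x v w := by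
    intro v w
    change fderiv ℝ (fun x => fderiv ℝ φ x w) x v = _
    rw [fderiv_clm_apply h2 (differentiableAt_const w)]
    simp
  rw [key, key]
  exact (((Smo.contDiff φ).contDiffAt (x := x)).isSymmSndFDerivAt (by simpa using ENat.LEInfty.out)).eq v w

theorem D_smul_dir (a : ℝ) (v : Sp d) (φ : Smo d) : D (a • v) φ = a • D v φ := by
  ext x; simp [D_apply]

theorem sum_smul_e (v : Sp d) : ∑ i, v i • e i = v := by
  have := (EuclideanSpace.basisFun (Fin d) ℝ).sum_repr v
  simpa [e] using this

theorem D_eq_sum (v : Sp d) (φ : Smo d) : D v φ = ∑ i, v i • D (e i) φ := by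
  ext x
  conv_lhs => rw [← sum_smul_e v]
  simp only [D_apply, map_sum, map_smul, smul_eq_mul, Smo.sum_apply, Smo.smul_apply]

/-- A coinductive criterion for being bounded with all derivatives. -/
theorem bddSmooth_of_coind (R : Fn d → Prop)
    (hb : ∀ φ, R φ → ∃ C, ∀ x, |φ x| ≤ C) (hd : ∀ φ, R φ → Differentiable ℝ φ)
    (hs : ∀ φ, R φ → ∀ v, R fun x => fderiv ℝ φ x v) {φ : Fn d} (h : R φ) :
    BddSmooth φ := by
  have hc : ∀ n : ℕ, ∀ φ, R φ → ContDiff ℝ n φ := by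
    intro n
    induction n with
    | zero => intro φ h; exact contDiff_zero.2 (hd φ h).continuous
    | succ n ih =>
      intro φ h
      rw [Nat.cast_add, Nat.cast_one, contDiff_succ_iff_fderiv_apply]
      exact ⟨hd φ h, by simp, fun v => ih _ (hs φ h v)⟩
  refine ⟨contDiff_infty.2 fun n => hc n φ h, fun n => ?_⟩
  induction n generalizing φ with
  | zero =>
    obtain ⟨C, hC⟩ := hb φ h
    exact ⟨C, fun x => by simpa using hC x⟩
  | succ n ih =>
    choose C hC using fun i : Fin d => ih (hs φ h (e i))
    refine ⟨∑ i, C i * ‖(EuclideanSpace.proj i : Sp d →L[ℝ] ℝ)‖, fun x => ?_⟩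
    rw [← norm_iteratedFDeriv_fderiv]
    have hf : fderiv ℝ φ = fun x => ∑ i, (ContinuousLinearMap.toSpanSingleton ℝ
        (EuclideanSpace.proj i : Sp d →L[ℝ] ℝ)) (fderiv ℝ φ x (e i)) := by
      funext x
      ext v
      conv_lhs => rw [← sum_smul_e v]
      simp [mul_comm]
    rw [hf]
    have hcd : ∀ i, ContDiff ℝ ∞ (fun x => (ContinuousLinearMap.toSpanSingleton ℝ
        (EuclideanSpace.proj i : Sp d →L[ℝ] ℝ)) (fderiv ℝ φ x (e i))) := by
      intro i
      exact (ContinuousLinearMap.contDiff _).comp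
        (contDiff_infty.2 fun n => hc n _ (hs φ h (e i)))
    rw [iteratedFDeriv_fun_sum_apply
      (fun i _ => ((hcd i).of_le (by exact_mod_cast le_top)).contDiffAt)]
    refine (norm_sum_le _ _).trans (sum_le_sum fun i _ => ?_)
    refine ((ContinuousLinearMap.toSpanSingleton ℝ _).norm_iteratedFDeriv_comp_left
      (f := fun x => fderiv ℝ φ x (e i)) (N := (∞ : WithTop ℕ∞)) (n := n)
      (contDiff_infty.2 fun n => hc n _ (hs φ h (e i))).contDiffAt
      (by exact_mod_cast le_top)).trans ?_
    rw [mul_comm, ContinuousLinearMap.norm_toSpanSingleton]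
    gcongr
    exact hC i x

/-! ### The operators `δ_{h,λ}`, `δ̄_{h,μ}` and `T_{h,μ}` on smooth functions -/

/-- `δ_{h,λ}`. -/
def dl (h : ℝ) (l : Sp d) : Smo d →ₗ[ℝ] Smo d := h⁻¹ • (Tr (h • l) - LinearMap.id)

theorem dl_apply (h : ℝ) (l : Sp d) (φ : Smo d) (x : Sp d) :
    dl h l φ x = h⁻¹ * (φ (x + h • l) - φ x) := rfl

/-- `δ̄_{h,μ}`. -/
def dB (τ : Fn d) (τ₀ h : ℝ) : Sp d ⊕ Fin d → Smo d →ₗ[ℝ] Smo d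
  | .inl l => τ l • dl h l
  | .inr i => τ₀ • D (e i)

/-- `T_{h,μ}`. -/
def sh (h : ℝ) : Sp d ⊕ Fin d → Smo d →ₗ[ℝ] Smo d
  | .inl l => Tr (h • l)
  | .inr _ => LinearMap.id

@[simp] theorem dB_inl (τ : Fn d) (τ₀ h : ℝ) (l : Sp d) (φ : Smo d) :
    dB τ τ₀ h (.inl l) φ = τ l • dl h l φ := rfl

@[simp] theorem dB_inr (τ : Fn d) (τ₀ h : ℝ) (i : Fin d) (φ : Smo d) :
    dB τ τ₀ h (.inr i) φ = τ₀ • D (e i) φ := rfl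

@[simp] theorem sh_inl (h : ℝ) (l : Sp d) (φ : Smo d) : sh h (.inl l) φ = Tr (h • l) φ := rfl

@[simp] theorem sh_inr (h : ℝ) (i : Fin d) (φ : Smo d) : sh h (.inr i) φ = φ := rfl

theorem dl_Tr (h : ℝ) (l y : Sp d) (φ : Smo d) : dl h l (Tr y φ) = Tr y (dl h l φ) := by
  ext x; simp [dl_apply, add_right_comm]

theorem dl_D (h : ℝ) (l v : Sp d) (φ : Smo d) : dl h l (D v φ) = D v (dl h l φ) := by
  simp [dl, D_Tr]

theorem dl_comm (h : ℝ) (l l' : Sp d) (φ : Smo d) : dl h l (dl h l' φ) = dl h l' (dl h l φ) := by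
  conv_lhs => rw [dl]
  conv_rhs => rw [dl]
  simp only [dl, LinearMap.smul_apply, LinearMap.sub_apply, LinearMap.id_apply, map_smul, map_sub,
    Tr_comm (h • l) (h • l')]
  ext x
  simp only [Smo.smul_apply, Smo.sub_apply]; ring

theorem dl_mul (h : ℝ) (l : Sp d) (φ ψ : Smo d) :
    dl h l (φ * ψ) = φ * dl h l ψ + dl h l φ * Tr (h • l) ψ := by
  ext x; simp only [dl_apply, Smo.mul_apply, Smo.add_apply, Tr_apply]; ring

theorem dB_mul (τ : Fn d) (τ₀ h : ℝ) (μ : Sp d ⊕ Fin d) (φ ψ : Smo d) :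
    dB τ τ₀ h μ (φ * ψ) = φ * dB τ τ₀ h μ ψ + dB τ τ₀ h μ φ * sh h μ ψ := by
  rcases μ with l | i
  · simp [dl_mul]
  · simp [D_mul]

theorem dB_Tr (τ : Fn d) (τ₀ h : ℝ) (μ : Sp d ⊕ Fin d) (y : Sp d) (φ : Smo d) :
    dB τ τ₀ h μ (Tr y φ) = Tr y (dB τ τ₀ h μ φ) := by
  rcases μ with l | i <;> simp [dl_Tr, D_Tr]

theorem dB_dl (τ : Fn d) (τ₀ h : ℝ) (μ : Sp d ⊕ Fin d) (l : Sp d) (φ : Smo d) :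
    dB τ τ₀ h μ (dl h l φ) = dl h l (dB τ τ₀ h μ φ) := by
  rcases μ with l' | i
  · simp [dl_comm h l' l]
  · simp [dl_D]

theorem dB_D (τ : Fn d) (τ₀ h : ℝ) (μ : Sp d ⊕ Fin d) (v : Sp d) (φ : Smo d) :
    dB τ τ₀ h μ (D v φ) = D v (dB τ τ₀ h μ φ) := by
  rcases μ with l | i
  · simp [dl_D]
  · simp [D_comm v]

theorem dB_comm (τ : Fn d) (τ₀ h : ℝ) (μ ν : Sp d ⊕ Fin d) (φ : Smo d) :
    dB τ τ₀ h μ (dB τ τ₀ h ν φ) = dB τ τ₀ h ν (dB τ τ₀ h μ φ) := by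
  rcases ν with l | i
  · simp [dB_dl]
  · simp [dB_D]

theorem dB_sh (τ : Fn d) (τ₀ h : ℝ) (μ ν : Sp d ⊕ Fin d) (φ : Smo d) :
    dB τ τ₀ h μ (sh h ν φ) = sh h ν (dB τ τ₀ h μ φ) := by
  rcases ν with l | i
  · simp [dB_Tr]
  · simp

theorem sh_eq_Tr (h : ℝ) (μ : Sp d ⊕ Fin d) : ∃ y, sh h μ = Tr y := by
  rcases μ with l | i
  · exact ⟨_, rfl⟩
  · exact ⟨0, by ext φ x; simp [sh]⟩

/-! ### Iterated sums over families of commuting operators -/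

section Abstract

variable {I : Type} {X : Type*}

/-- Summation of a functional over the images under a family of maps. -/
def XX (Λ : Finset I) (δ : I → X → X) (Φ : X → ℝ) (φ : X) : ℝ := ∑ μ ∈ Λ, Φ (δ μ φ)

/-- Words of length `k` in the alphabet `Λ`. -/
def Wd (Λ : Finset I) : ℕ → Type
  | 0 => Unit
  | k + 1 => Λ × Wd Λ k

instance Wd.fintype (Λ : Finset I) : ∀ k, Fintype (Wd Λ k)
  | 0 => inferInstanceAs (Fintype Unit)
  | k + 1 => @instFintypeProd _ _ _ (Wd.fintype Λ k)

/-- The composition of the maps indexed by the letters of a word. -/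
def wop {Λ : Finset I} (δ : I → X → X) : (k : ℕ) → Wd Λ k → X → X
  | 0, _, φ => φ
  | k + 1, w, φ => wop δ k w.2 (δ w.1 φ)

theorem sum_wd_zero (Λ : Finset I) (f : Wd Λ 0 → ℝ) : ∑ w, f w = f () :=
  Fintype.sum_unique (ι := Unit) f

theorem sum_wd_succ (Λ : Finset I) (k : ℕ) (f : Wd Λ (k + 1) → ℝ) :
    ∑ w, f w = ∑ μ : Λ, ∑ w : Wd Λ k, f (μ, w) :=
  Fintype.sum_prod_type (f := fun p : Λ × Wd Λ k => f p)

theorem XX_iterate (Λ : Finset I) (δ : I → X → X) (k : ℕ) (Φ : X → ℝ) (φ : X) :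
    (XX Λ δ)^[k] Φ φ = ∑ w : Wd Λ k, Φ (wop δ k w φ) := by
  induction k generalizing φ with
  | zero => rw [sum_wd_zero]; rfl
  | succ k ih =>
    rw [Function.iterate_succ_apply', sum_wd_succ, XX, ← sum_coe_sort Λ]
    exact sum_congr rfl fun μ _ => ih _

theorem wop_comm {Λ : Finset I} (δ : I → X → X) (g : X → X) (hg : ∀ μ φ, g (δ μ φ) = δ μ (g φ))
    (k : ℕ) (w : Wd Λ k) (φ : X) : wop δ k w (g φ) = g (wop δ k w φ) := by
  induction k generalizing φ with
  | zero => rfl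
  | succ k ih =>
    change wop δ k w.2 (δ w.1 (g φ)) = g (wop δ k w.2 (δ w.1 φ))
    rw [← hg, ih]

end Abstract

section Expansion

variable {I : Type} {A M : Type*} (Λ : Finset I) (δ σ : I → A → A) (δM : I → M → M)
  (E : A → A → ℝ) (B : M → A → A)

/-- The polar form of the energy. -/
def P (E : A → A → ℝ) : ℕ → A → A → ℝ
  | 0, ζ, ψ => E ζ ψ
  | n + 1, ζ, ψ => ∑ μ ∈ Λ, P E n (δ μ ζ) (δ μ ψ)

/-- The sum of the terms of the Leibniz expansion in which `k` operators fall on the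
coefficients. -/
def G : ℕ → A → M → A → ℝ
  | 0, ζ, a, φ => E ζ (B a φ)
  | k + 1, ζ, a, φ => ∑ μ ∈ Λ, G k (δ μ ζ) (δM μ a) (σ μ φ)

theorem P_diag (n : ℕ) (φ : A) :
    P Λ δ E n φ φ = (XX Λ δ)^[n] (fun φ => E φ φ) φ := by
  induction n generalizing φ with
  | zero => rfl
  | succ n ih =>
    rw [Function.iterate_succ_apply']
    exact sum_congr rfl fun μ _ => ih _

theorem G_words (k : ℕ) (ζ : A) (a : M) (φ : A) :
    G Λ δ σ δM E B k ζ a φ =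
      ∑ w : Wd Λ k, E (wop δ k w ζ) (B (wop δM k w a) (wop σ k w φ)) := by
  induction k generalizing ζ a φ with
  | zero => rw [sum_wd_zero]; rfl
  | succ k ih =>
    rw [sum_wd_succ, G, ← sum_coe_sort Λ]
    exact sum_congr rfl fun μ _ => ih _ _ _

theorem P_add [AddCommGroup A] (hE : ∀ ζ ψ ψ', E ζ (ψ + ψ') = E ζ ψ + E ζ ψ')
    (hδ : ∀ μ φ ψ, δ μ (φ + ψ) = δ μ φ + δ μ ψ) (n : ℕ) (ζ ψ ψ' : A) :
    P Λ δ E n ζ (ψ + ψ') = P Λ δ E n ζ ψ + P Λ δ E n ζ ψ' := by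
  induction n generalizing ζ ψ ψ' with
  | zero => exact hE _ _ _
  | succ n ih => simp only [P, hδ, ih, sum_add_distrib]

theorem P_expand [AddCommGroup A] (hE : ∀ ζ ψ ψ', E ζ (ψ + ψ') = E ζ ψ + E ζ ψ')
    (hδ : ∀ μ φ ψ, δ μ (φ + ψ) = δ μ φ + δ μ ψ)
    (hB : ∀ μ a φ, δ μ (B a φ) = B a (δ μ φ) + B (δM μ a) (σ μ φ))
    (hδδ : ∀ μ ν φ, δ μ (δ ν φ) = δ ν (δ μ φ)) (hδσ : ∀ μ ν φ, δ μ (σ ν φ) = σ ν (δ μ φ))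
    (n : ℕ) (φ : A) (a : M) :
    P Λ δ E n φ (B a φ) = ∑ k ∈ Finset.range (n + 1),
      (n.choose k : ℝ) * (XX Λ δ)^[n - k] (fun φ => G Λ δ σ δM E B k φ a φ) φ := by
  have hadd := P_add Λ δ E hE hδ
  let Z := A × M × A
  let x : Module.End ℝ (Z → ℝ) :=
    ∑ μ ∈ Λ, LinearMap.funLeft ℝ ℝ fun z : Z => (δ μ z.1, z.2.1, δ μ z.2.2)
  let y : Module.End ℝ (Z → ℝ) :=
    ∑ μ ∈ Λ, LinearMap.funLeft ℝ ℝ fun z : Z => (δ μ z.1, δM μ z.2.1, σ μ z.2.2)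
  have hx : ∀ F z, x F z = ∑ μ ∈ Λ, F (δ μ z.1, z.2.1, δ μ z.2.2) := by
    intro F z; simp [x, LinearMap.funLeft]
  have hy : ∀ F z, y F z = ∑ μ ∈ Λ, F (δ μ z.1, δM μ z.2.1, σ μ z.2.2) := by
    intro F z; simp [y, LinearMap.funLeft]
  have hcomm : Commute y x := by
    refine LinearMap.ext fun F => funext fun z => ?_
    rw [Module.End.mul_apply, Module.End.mul_apply, hx, hy]
    simp only [hx, hy]
    rw [sum_comm]
    simp only [hδδ, hδσ]
  let F₀ : Z → ℝ := fun z => E z.1 (B z.2.1 z.2.2)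
  have h1 : ∀ n ζ a φ, P Λ δ E n ζ (B a φ) = ((y + x) ^ n) F₀ (ζ, a, φ) := by
    intro n
    induction n with
    | zero => intro ζ a φ; rfl
    | succ n ih =>
      intro ζ a φ
      rw [pow_succ', Module.End.mul_apply, LinearMap.add_apply, Pi.add_apply, hx, hy,
        ← sum_add_distrib]
      refine sum_congr rfl fun μ _ => ?_
      rw [hB, hadd, ih, ih, add_comm]
  have h2 : ∀ k ζ a φ, (y ^ k) F₀ (ζ, a, φ) = G Λ δ σ δM E B k ζ a φ := by
    intro k
    induction k with
    | zero => intro ζ a φ; rfl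
    | succ k ih =>
      intro ζ a φ
      rw [pow_succ', Module.End.mul_apply, hy]
      exact sum_congr rfl fun μ _ => ih _ _ _
  have h3 : ∀ j (F : Z → ℝ) φ, (x ^ j) F (φ, a, φ) = (XX Λ δ)^[j] (fun φ => F (φ, a, φ)) φ := by
    intro j F
    induction j with
    | zero => intro φ; rfl
    | succ j ih =>
      intro φ
      rw [pow_succ', Module.End.mul_apply, hx, Function.iterate_succ_apply']
      exact sum_congr rfl fun μ _ => ih _
  rw [h1, hcomm.add_pow]
  simp only [LinearMap.sum_apply, Finset.sum_apply]
  refine sum_congr rfl fun k _ => ?_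
  rw [(hcomm.pow_pow k (n - k)).eq, ← nsmul_eq_mul', LinearMap.smul_apply, Pi.smul_apply,
    nsmul_eq_mul, Module.End.mul_apply, h3]
  simp only [h2]

theorem two_mul_P_le (hE : ∀ ζ ψ, ∀ ε > 0, 2 * E ζ ψ ≤ ε * E ζ ζ + ε⁻¹ * E ψ ψ)
    {ε : ℝ} (hε : 0 < ε) (n : ℕ) (ζ ψ : A) :
    2 * P Λ δ E n ζ ψ ≤ ε * P Λ δ E n ζ ζ + ε⁻¹ * P Λ δ E n ψ ψ := by
  induction n generalizing ζ ψ with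
  | zero => exact hE ζ ψ ε hε
  | succ n ih =>
    simp only [P, mul_sum, ← sum_add_distrib]
    exact sum_le_sum fun μ _ => ih _ _

end Expansion


/-- `Σ_{i₁,…,i_n} |D_{i₁} ⋯ D_{i_n} φ|²`. -/
def H (n : ℕ) (φ : Smo d) (x : Sp d) : ℝ :=
  (XX Finset.univ fun (i : Fin d) => D (e i))^[n] (fun φ => φ x ^ 2) φ

theorem H_succ (n : ℕ) (φ : Smo d) (x : Sp d) : H (n + 1) φ x = ∑ i, H n (D (e i) φ) x := by
  rw [H, Function.iterate_succ_apply']; rfl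

theorem H_zero (φ : Smo d) (x : Sp d) : H 0 φ x = φ x ^ 2 := rfl

theorem H_one (φ : Smo d) (x : Sp d) : H 1 φ x = ∑ i, D (e i) φ x ^ 2 := by
  simp [H_succ, H_zero]

theorem H_words (n : ℕ) (φ : Smo d) (x : Sp d) :
    H n φ x = ∑ w : Wd (Finset.univ : Finset (Fin d)) n, wop (fun i => D (e i)) n w φ x ^ 2 :=
  XX_iterate _ _ _ _ _

theorem H_nonneg (n : ℕ) (φ : Smo d) (x : Sp d) : 0 ≤ H n φ x := by
  rw [H_words]; positivity

/-! ### Estimates for finite families of smooth functions -/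

theorem iterate_D_smul (r : ℕ) (h : ℝ) (v : Sp d) (φ : Smo d) :
    (D (h • v))^[r] φ = h ^ r • (D v)^[r] φ := by
  induction r generalizing φ with
  | zero => simp
  | succ r ih =>
    rw [Function.iterate_succ_apply', Function.iterate_succ_apply', ih, D_smul_dir, map_smul,
      smul_smul, pow_succ']

theorem taylor_lagrange (φ : Smo d) (x v : Sp d) (n : ℕ) :
    ∃ y, φ (x + v) = ∑ r ∈ Finset.range (n + 1), ((D v)^[r] φ) x / (r.factorial : ℝ)
      + ((D v)^[n + 1] φ) y / ((n + 1).factorial : ℝ) := by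
  have hder : ∀ (ψ : Smo d) (t : ℝ), HasDerivAt (fun t : ℝ => ψ (x + t • v)) (D v ψ (x + t • v)) t := by
    intro ψ t
    have h1 := (Smo.differentiable ψ (x + t • v)).hasFDerivAt
    have h2 : HasDerivAt (fun t : ℝ => x + t • v) v t := by
      simpa using ((hasDerivAt_id t).smul_const v).const_add x
    exact h1.comp_hasDerivAt t h2
  have hit : ∀ r, iteratedDeriv r (fun t : ℝ => φ (x + t • v)) =
      fun t => ((D v)^[r] φ) (x + t • v) := by
    intro r
    induction r with
    | zero => simp
    | succ r ih =>
      rw [iteratedDeriv_succ, ih]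
      funext t
      rw [(hder _ t).deriv, Function.iterate_succ_apply']
  have hcd : ContDiff ℝ ∞ fun t : ℝ => φ (x + t • v) :=
    (Smo.contDiff φ).comp (contDiff_const.add (contDiff_id.smul contDiff_const))
  obtain ⟨s, -, hs⟩ := taylor_mean_remainder_lagrange_iteratedDeriv (n := n) (x₀ := 0) (x := 1)
    (f := fun t : ℝ => φ (x + t • v)) one_ne_zero.symm
    (hcd.of_le (by exact_mod_cast le_top)).contDiffOn
  refine ⟨x + s • v, ?_⟩
  rw [hit, sub_eq_iff_eq_add] at hs
  simp only [one_smul, sub_zero, one_pow, mul_one] at hs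
  rw [hs, add_comm, taylor_within_apply]
  congr 1
  refine sum_congr rfl fun r _ => ?_
  rw [iteratedDerivWithin_eq_iteratedDeriv (uniqueDiffOn_uIcc zero_ne_one)
    (hcd.of_le (by exact_mod_cast le_top)).contDiffAt left_mem_uIcc, hit]
  simp [div_eq_inv_mul]

/-- To bound a sum of squares it suffices to bound all the linear combinations. -/
theorem sum_sq_le_of_dual {ι : Type*} [Fintype ι] (r : ι → ℝ) {C : ℝ}
    (h : (∑ i, r i * r i) ^ 2 ≤ (∑ i, r i ^ 2) * C) (hC : 0 ≤ C) : ∑ i, r i ^ 2 ≤ C := by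
  have h0 : 0 ≤ ∑ i, r i ^ 2 := by positivity
  rcases h0.eq_or_lt with h1 | h1
  · rw [← h1]; exact hC
  · have h2 : ∑ i, r i * r i = ∑ i, r i ^ 2 := by simp [sq]
    rw [h2, sq] at h
    exact le_of_mul_le_mul_left h h1

theorem H_sum_smul_le {ι : Type*} [Fintype ι] (n : ℕ) (w : ι → ℝ) (φ : ι → Smo d) (x : Sp d) :
    H n (∑ i, w i • φ i) x ≤ (∑ i, w i ^ 2) * ∑ i, H n (φ i) x := by
  induction n generalizing φ with
  | zero =>
    simp only [H_zero, Smo.sum_apply, Smo.smul_apply]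
    exact sum_mul_sq_le_sq_mul_sq _ _ _
  | succ n ih =>
    simp only [H_succ, map_sum, map_smul]
    rw [sum_comm, mul_sum]
    exact sum_le_sum fun j _ => ih _

theorem H_D_le (n : ℕ) (v : Sp d) (φ : Smo d) (x : Sp d) :
    H n (D v φ) x ≤ ‖v‖ ^ 2 * H (n + 1) φ x := by
  rw [D_eq_sum, H_succ, EuclideanSpace.norm_sq_eq]
  simpa using H_sum_smul_le n (fun i => v i) (fun i => D (e i) φ) x

theorem H_iterate_D_le (n r : ℕ) (v : Sp d) (φ : Smo d) (x : Sp d) :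
    H n ((D v)^[r] φ) x ≤ (‖v‖ ^ 2) ^ r * H (n + r) φ x := by
  induction r generalizing n with
  | zero => simp
  | succ r ih =>
    rw [Function.iterate_succ_apply']
    have := ih (n + 1)
    rw [show n + 1 + r = n + (r + 1) by ring] at this
    calc _ ≤ ‖v‖ ^ 2 * H (n + 1) ((D v)^[r] φ) x := H_D_le n v _ x
      _ ≤ ‖v‖ ^ 2 * ((‖v‖ ^ 2) ^ r * H (n + (r + 1)) φ x) := by gcongr
      _ = _ := by ring

/-- An estimate of a linear functional extends to finite families. -/
theorem sum_functional_sq_le {ι : Type*} [Fintype ι] (n : ℕ) (R : Smo d →ₗ[ℝ] ℝ) {κ : ℝ}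
    (hκ : 0 ≤ κ) (hR : ∀ ψ C, (∀ y, H n ψ y ≤ C) → R ψ ^ 2 ≤ κ * C) (φ : ι → Smo d) {C : ℝ}
    (hC : ∀ y, ∑ i, H n (φ i) y ≤ C) : ∑ i, R (φ i) ^ 2 ≤ κ * C := by
  have hC0 : 0 ≤ C := (sum_nonneg fun i _ => H_nonneg n (φ i) 0).trans (hC 0)
  refine sum_sq_le_of_dual _ ?_ (by positivity)
  have h1 : ∑ i, R (φ i) * R (φ i) = R (∑ i, R (φ i) • φ i) := by simp
  rw [h1]
  refine (hR _ ((∑ i, R (φ i) ^ 2) * C) fun y => ?_).trans (by linarith)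
  refine (H_sum_smul_le _ _ _ _).trans ?_
  gcongr
  exact hC y

theorem dl_sq_le (ψ : Smo d) {C : ℝ} (hC : ∀ y, H 1 ψ y ≤ C) (h : ℝ) (l x : Sp d) :
    dl h l ψ x ^ 2 ≤ ‖l‖ ^ 2 * C := by
  have hC0 : 0 ≤ C := (H_nonneg 1 ψ x).trans (hC x)
  rcases eq_or_ne h 0 with rfl | hh
  · simp only [dl_apply, inv_zero, zero_mul, zero_pow two_ne_zero]; positivity
  obtain ⟨y, hy⟩ := taylor_lagrange ψ x (h • l) 0
  have h2 : dl h l ψ x = D l ψ y := by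
    rw [dl_apply, hy]
    simp [D_smul_dir]
    field_simp
  rw [h2]
  calc D l ψ y ^ 2 ≤ ‖l‖ ^ 2 * H 1 ψ y := H_D_le 0 l ψ y
    _ ≤ _ := by gcongr; exact hC y

theorem centered_eq (ψ : Smo d) (h : ℝ) (Λ₁ : Finset (Sp d)) (b : Fn d)
    (hb : ∑ l ∈ Λ₁, b l • l = 0) (hh : h ≠ 0) (x : Sp d) : ∃ y : Sp d → Sp d,
    h⁻¹ * ∑ l ∈ Λ₁, b l * dl h l ψ x = ∑ l ∈ Λ₁, b l * (D l (D l ψ) (y l) / 2) := by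
  choose y hy using fun l => taylor_lagrange ψ x (h • l) 1
  refine ⟨y, ?_⟩
  have h3 : ∑ l ∈ Λ₁, b l * D l ψ x = 0 := by
    have : ∑ l ∈ Λ₁, b l * D l ψ x = D (∑ l ∈ Λ₁, b l • l) ψ x := by
      simp only [D_apply, map_sum, map_smul, smul_eq_mul]
    rw [this, hb]; simp [D_apply]
  have h4 : ∀ l, dl h l ψ x = D l ψ x + h * (D l (D l ψ) (y l) / 2) := by
    intro l
    rw [dl_apply, hy]
    simp [D_smul_dir, sum_range_succ]
    field_simp
    ring
  simp_rw [h4, mul_add, sum_add_distrib]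
  rw [h3, zero_add, mul_sum]
  refine sum_congr rfl fun l _ => ?_
  field_simp

/-- The second order difference operator is controlled by the second order derivatives. -/
theorem centered_sq_le (ψ : Smo d) {C : ℝ} (hC : ∀ y, H 2 ψ y ≤ C) (h : ℝ)
    (Λ₁ : Finset (Sp d)) (b : Fn d) (hb : ∑ l ∈ Λ₁, b l • l = 0) (x : Sp d) :
    (h⁻¹ * ∑ l ∈ Λ₁, b l * dl h l ψ x) ^ 2 ≤
      ((∑ l ∈ Λ₁, b l ^ 2) * (∑ l ∈ Λ₁, ‖l‖ ^ 2) ^ 2) * C := by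
  have hC0 : 0 ≤ C := (H_nonneg 2 ψ x).trans (hC x)
  rcases eq_or_ne h 0 with rfl | hh
  · simp only [inv_zero, zero_mul, ne_eq, OfNat.ofNat_ne_zero, not_false_eq_true, zero_pow]
    positivity
  obtain ⟨y, hy⟩ := centered_eq ψ h Λ₁ b hb hh x
  rw [hy]
  have h5 : ∀ l, (D l (D l ψ) (y l) / 2) ^ 2 ≤ (‖l‖ ^ 2) ^ 2 * C := by
    intro l
    have h6 := H_iterate_D_le 0 2 l ψ (y l)
    calc (D l (D l ψ) (y l) / 2) ^ 2 ≤ (D l (D l ψ) (y l)) ^ 2 := by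
          nlinarith [sq_nonneg (D l (D l ψ) (y l))]
      _ ≤ (‖l‖ ^ 2) ^ 2 * H 2 ψ (y l) := h6
      _ ≤ _ := by gcongr; exact hC _
  calc (∑ l ∈ Λ₁, b l * (D l (D l ψ) (y l) / 2)) ^ 2
      ≤ (∑ l ∈ Λ₁, b l ^ 2) * ∑ l ∈ Λ₁, (D l (D l ψ) (y l) / 2) ^ 2 :=
        sum_mul_sq_le_sq_mul_sq _ _ _
    _ ≤ (∑ l ∈ Λ₁, b l ^ 2) * ∑ l ∈ Λ₁, (‖l‖ ^ 2) ^ 2 * C := by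
        gcongr with l _
        exact h5 l
    _ ≤ (∑ l ∈ Λ₁, b l ^ 2) * ((∑ l ∈ Λ₁, ‖l‖ ^ 2) ^ 2 * C) := by
        rw [← sum_mul]
        gcongr
        exact Finset.sum_sq_le_sq_sum_of_nonneg fun l _ => by positivity
    _ = _ := by ring

theorem sum_dl_sq_le {ι : Type*} [Fintype ι] (φ : ι → Smo d) {C : ℝ}
    (hC : ∀ y, ∑ i, H 1 (φ i) y ≤ C) (h : ℝ) (l x : Sp d) :
    ∑ i, dl h l (φ i) x ^ 2 ≤ ‖l‖ ^ 2 * C :=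
  sum_functional_sq_le 1 (Smo.ev x ∘ₗ dl h l) (by positivity)
    (fun ψ _ hC => dl_sq_le ψ hC h l x) φ hC

theorem sum_centered_sq_le {ι : Type*} [Fintype ι] (φ : ι → Smo d) {C : ℝ}
    (hC : ∀ y, ∑ i, H 2 (φ i) y ≤ C) (h : ℝ) (Λ₁ : Finset (Sp d)) (b : Fn d)
    (hb : ∑ l ∈ Λ₁, b l • l = 0) (x : Sp d) :
    ∑ i, (h⁻¹ * ∑ l ∈ Λ₁, b l * dl h l (φ i) x) ^ 2 ≤
      ((∑ l ∈ Λ₁, b l ^ 2) * (∑ l ∈ Λ₁, ‖l‖ ^ 2) ^ 2) * C := by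
  have hR : ∀ ψ, (h⁻¹ • ∑ l ∈ Λ₁, b l • (Smo.ev x ∘ₗ dl h l)) ψ =
      h⁻¹ * ∑ l ∈ Λ₁, b l * dl h l ψ x := by
    intro ψ; simp [Smo.ev]
  have := sum_functional_sq_le 2 (h⁻¹ • ∑ l ∈ Λ₁, b l • (Smo.ev x ∘ₗ dl h l))
    (κ := (∑ l ∈ Λ₁, b l ^ 2) * (∑ l ∈ Λ₁, ‖l‖ ^ 2) ^ 2) (by positivity)
    (fun ψ C hC => by rw [hR]; exact centered_sq_le ψ hC h Λ₁ b hb x) φ hC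
  simpa only [hR] using this

/-! ### The differential inequality for the energies at a fixed time -/

/-- The finite set `Λ₁`, the weights and the mesh size. -/
structure Geo (d : ℕ) where
  Λ₁ : Finset (Sp d)
  τ : Fn d
  τ₀ : ℝ
  h : ℝ

/-- Smooth coefficients at a fixed time. -/
structure Coef (d : ℕ) where
  q : Sp d → Smo d
  p : Sp d → Smo d
  c : Smo d

namespace Geo

variable (g : Geo d)

/-- The index set `Λ`. -/
def Λ : Finset (Sp d ⊕ Fin d) := g.Λ₁.disjSum Finset.univ

/-- The operators `δ̄_{h,μ}`. -/
def δ (μ : Sp d ⊕ Fin d) : Smo d → Smo d := dB g.τ g.τ₀ g.h μ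

/-- The energy `Σ_{μ ∈ Λⁿ} |δ̄_{h,μ} φ|²`. -/
def W (n : ℕ) (φ : Smo d) (x : Sp d) : ℝ := (XX g.Λ g.δ)^[n] (fun φ => φ x ^ 2) φ

/-- The polar form of the energy. -/
def Pol (n : ℕ) (ζ ψ : Smo d) (x : Sp d) : ℝ := P g.Λ g.δ (fun ζ ψ => ζ x * ψ x) n ζ ψ

/-- The second order part of the difference operator. -/
def Bq (q : Sp d → Smo d) (φ : Smo d) : Smo d := g.h⁻¹ • ∑ l ∈ g.Λ₁, q l * dl g.h l φ

/-- The first order part of the difference operator. -/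
def Bp (p : Sp d → Smo d) (φ : Smo d) : Smo d := ∑ l ∈ g.Λ₁, p l * dl g.h l φ

/-- The zeroth order part of the difference operator. -/
def Bc (c φ : Smo d) : Smo d := -(c * φ)

/-- The operators `δ̄_{h,μ}` on families of coefficients. -/
def δF (μ : Sp d ⊕ Fin d) (q : Sp d → Smo d) : Sp d → Smo d := fun l => g.δ μ (q l)

/-- The `k`-th term of the Leibniz expansion for an operator `B`. -/
def Gt {M : Type} (δM : Sp d ⊕ Fin d → M → M) (B : M → Smo d → Smo d) (x : Sp d) (k : ℕ) (a : M)
    (φ : Smo d) : ℝ :=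
  G g.Λ g.δ (fun μ => sh g.h μ) δM (fun ζ ψ => ζ x * ψ x) B k φ a φ

/-- The difference operator `L_h`. -/
def Lop (co : Coef d) (φ : Smo d) : Smo d := g.Bq co.q φ + g.Bp co.p φ + Bc co.c φ

/-- `A_h`. -/
def Af (co : Coef d) (φ : Smo d) (x : Sp d) : ℝ :=
  2 * (g.Gt g.δF g.Bq x 1 co.q φ + g.Gt g.δF g.Bp x 1 co.p φ)

/-- `𝒬_h`. -/
def Qf (co : Coef d) (φ : Smo d) (x : Sp d) : ℝ :=
  ∑ l ∈ g.Λ₁, (co.q l x + g.h * co.p l x) * dl g.h l φ x ^ 2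

/-- `Σ_{μ ∈ Λⁿ} 𝒬_h(δ̄_{h,μ} φ)`. -/
def Qn (co : Coef d) (n : ℕ) (φ : Smo d) (x : Sp d) : ℝ :=
  (XX g.Λ g.δ)^[n] (fun φ => g.Qf co φ x) φ

/-- The operator `L_h^0` on arbitrary functions. -/
def L0 (co : Coef d) (v : Fn d) (x : Sp d) : ℝ :=
  ∑ l ∈ g.Λ₁, (co.q l x + g.h * co.p l x) / g.h ^ 2 * (v (x + g.h • l) - v x)

theorem W_succ (n : ℕ) (φ : Smo d) (x : Sp d) :
    g.W (n + 1) φ x = ∑ μ ∈ g.Λ, g.W n (g.δ μ φ) x := by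
  rw [W, Function.iterate_succ_apply']; rfl

theorem W_zero (φ : Smo d) (x : Sp d) : g.W 0 φ x = φ x ^ 2 := rfl

theorem W_words (n : ℕ) (φ : Smo d) (x : Sp d) :
    g.W n φ x = ∑ w : Wd g.Λ n, wop g.δ n w φ x ^ 2 := XX_iterate _ _ _ _ _

theorem W_add (j k : ℕ) (φ : Smo d) (x : Sp d) :
    g.W (j + k) φ x = ∑ w : Wd g.Λ j, g.W k (wop g.δ j w φ) x := by
  rw [W, Function.iterate_add_apply, XX_iterate]; rfl

theorem W_nonneg (n : ℕ) (φ : Smo d) (x : Sp d) : 0 ≤ g.W n φ x := by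
  rw [W_words]; positivity

theorem Pol_diag (n : ℕ) (φ : Smo d) (x : Sp d) : g.Pol n φ φ x = g.W n φ x := by
  rw [Pol, P_diag, W]; simp only [← sq]

theorem two_mul_Pol_le {ε : ℝ} (hε : 0 < ε) (n : ℕ) (ζ ψ : Smo d) (x : Sp d) :
    2 * g.Pol n ζ ψ x ≤ ε * g.W n ζ x + ε⁻¹ * g.W n ψ x := by
  rw [← Pol_diag, ← Pol_diag]
  refine two_mul_P_le _ _ _ (fun ζ ψ ε hε => ?_) hε n ζ ψ
  have h1 : 0 ≤ (ε * ζ x - ψ x) ^ 2 * ε⁻¹ := by positivity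
  have h2 : (ε * ζ x - ψ x) ^ 2 * ε⁻¹ =
      ε * (ζ x * ζ x) + ε⁻¹ * (ψ x * ψ x) - 2 * (ζ x * ψ x) := by
    field_simp; ring
  linarith

theorem δ_add (μ : Sp d ⊕ Fin d) (φ ψ : Smo d) : g.δ μ (φ + ψ) = g.δ μ φ + g.δ μ ψ :=
  map_add _ _ _

theorem Pol_add (n : ℕ) (ζ ψ ψ' : Smo d) (x : Sp d) :
    g.Pol n ζ (ψ + ψ') x = g.Pol n ζ ψ x + g.Pol n ζ ψ' x :=
  P_add _ _ _ (fun _ _ _ => by simp [mul_add]) g.δ_add _ _ _ _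

theorem δ_Bq (μ : Sp d ⊕ Fin d) (q : Sp d → Smo d) (φ : Smo d) :
    g.δ μ (g.Bq q φ) = g.Bq q (g.δ μ φ) + g.Bq (g.δF μ q) (sh g.h μ φ) := by
  have h1 : ∀ l φ, dl g.h l (sh g.h μ φ) = sh g.h μ (dl g.h l φ) := by
    intro l φ; obtain ⟨y, hy⟩ := sh_eq_Tr g.h μ; rw [hy, dl_Tr]
  simp only [δ, Bq, δF, map_smul, map_sum, dB_mul, sum_add_distrib, smul_add, dB_dl, h1]

theorem δ_Bp (μ : Sp d ⊕ Fin d) (q : Sp d → Smo d) (φ : Smo d) :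
    g.δ μ (g.Bp q φ) = g.Bp q (g.δ μ φ) + g.Bp (g.δF μ q) (sh g.h μ φ) := by
  have h1 : ∀ l φ, dl g.h l (sh g.h μ φ) = sh g.h μ (dl g.h l φ) := by
    intro l φ; obtain ⟨y, hy⟩ := sh_eq_Tr g.h μ; rw [hy, dl_Tr]
  simp only [δ, Bp, δF, map_sum, dB_mul, sum_add_distrib, dB_dl, h1]

theorem δ_Bc (μ : Sp d ⊕ Fin d) (c φ : Smo d) :
    g.δ μ (Bc c φ) = Bc c (g.δ μ φ) + Bc (g.δ μ c) (sh g.h μ φ) := by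
  simp only [δ, Bc, map_neg, dB_mul, neg_add]

theorem Pol_expand {M : Type} (δM : Sp d ⊕ Fin d → M → M) (B : M → Smo d → Smo d)
    (hB : ∀ μ a φ, g.δ μ (B a φ) = B a (g.δ μ φ) + B (δM μ a) (sh g.h μ φ))
    (n : ℕ) (a : M) (φ : Smo d) (x : Sp d) :
    g.Pol n φ (B a φ) x = ∑ k ∈ Finset.range (n + 1),
      (n.choose k : ℝ) * (XX g.Λ g.δ)^[n - k] (g.Gt δM B x k a) φ :=
  P_expand _ _ _ _ _ _ (fun _ _ _ => by simp [mul_add]) g.δ_add hB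
    (fun _ _ _ => dB_comm _ _ _ _ _ _) (fun _ _ _ => dB_sh _ _ _ _ _ _) n φ a

/-- Splitting off the first terms of a binomial sum. -/
theorem sum_choose_split (n j : ℕ) (f : ℕ → ℝ) :
    ∑ k ∈ Finset.range (n + 1), (n.choose k : ℝ) * f k =
      ∑ k ∈ Finset.range j, (n.choose k : ℝ) * f k +
      ∑ k ∈ Finset.range (n + 1), (n.choose k : ℝ) * (if k < j then 0 else f k) := by
  have h1 : ∑ k ∈ Finset.range j, (n.choose k : ℝ) * f k =
      ∑ k ∈ Finset.range (n + 1), (n.choose k : ℝ) * (if k < j then f k else 0) := by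
    trans ∑ k ∈ Finset.range (n + 1 + j), (n.choose k : ℝ) * (if k < j then f k else 0)
    · rw [← Finset.sum_subset (Finset.range_subset_range.2 (by omega : j ≤ n + 1 + j))]
      · refine sum_congr rfl fun k hk => ?_
        rw [if_pos (Finset.mem_range.1 hk)]
      · intro k _ hk
        rw [if_neg (by simpa using hk), mul_zero]
    · rw [← Finset.sum_subset (Finset.range_subset_range.2 (by omega : n + 1 ≤ n + 1 + j))]
      intro k _ hk
      rw [Nat.choose_eq_zero_of_lt (by simpa using hk)]; simp
  rw [h1, ← sum_add_distrib]
  refine sum_congr rfl fun k _ => ?_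
  split_ifs <;> ring

/-! #### Remainder estimates -/

theorem H_comm (g : Geo d) (n : ℕ) (μ : Sp d ⊕ Fin d) (φ : Smo d) (x : Sp d) :
    H n (g.δ μ φ) x =
      ∑ w : Wd (Finset.univ : Finset (Fin d)) n, g.δ μ (wop (fun i => D (e i)) n w φ) x ^ 2 := by
  rw [H_words]
  refine sum_congr rfl fun w _ => ?_
  rw [wop_comm (fun i => ⇑(D (e i))) (g.δ μ) fun i φ => dB_D _ _ _ _ _ _]

theorem sum_δ_sq_le {ι : Type*} [Fintype ι] (φ : ι → Smo d) {C A : ℝ}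
    (hA : ∑ l ∈ g.Λ₁, ‖g.τ l • l‖ ^ 2 + g.τ₀ ^ 2 ≤ A)
    (hC : ∀ y, ∑ i, H 1 (φ i) y ≤ C) (x : Sp d) :
    ∑ i, ∑ μ ∈ g.Λ, g.δ μ (φ i) x ^ 2 ≤ A * C := by
  have hC0 : 0 ≤ C := (sum_nonneg fun i _ => H_nonneg 1 (φ i) x).trans (hC x)
  refine le_trans ?_ (mul_le_mul_of_nonneg_right hA hC0)
  rw [sum_comm, Λ, Finset.sum_disjSum, add_mul]
  refine add_le_add ?_ ?_
  · rw [sum_mul]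
    refine sum_le_sum fun l _ => ?_
    simp only [δ, dB_inl, Smo.smul_apply, mul_pow, ← mul_sum, norm_smul, Real.norm_eq_abs,
      sq_abs]
    rw [mul_assoc]
    gcongr
    exact sum_dl_sq_le φ hC g.h l x
  · simp only [δ, dB_inr, Smo.smul_apply, mul_pow, ← mul_sum]
    gcongr
    refine le_trans (le_of_eq ?_) (hC x)
    rw [sum_comm]
    simp only [H_one]

theorem sum_W_le {A : ℝ} (hA : ∑ l ∈ g.Λ₁, ‖g.τ l • l‖ ^ 2 + g.τ₀ ^ 2 ≤ A) (k : ℕ) :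
    ∀ {ι : Type} [Fintype ι] (φ : ι → Smo d) {C : ℝ} (_ : ∀ y, ∑ i, H k (φ i) y ≤ C) (x : Sp d),
    ∑ i, g.W k (φ i) x ≤ A ^ k * C := by
  induction k with
  | zero => intro ι _ φ C hC x; simpa [W_zero, H_zero] using hC x
  | succ k ih =>
    intro ι _ φ C hC x
    have h1 := @ih (ι × g.Λ) _ (fun p => g.δ p.2 (φ p.1)) (A * C) (fun y => ?_) x
    · simp only [W_succ, ← sum_coe_sort g.Λ]
      rw [Fintype.sum_prod_type] at h1
      exact h1.trans (le_of_eq (by ring))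
    · rw [Fintype.sum_prod_type]
      simp only [H_comm]
      have h2 := g.sum_δ_sq_le
        (fun p : ι × Wd (Finset.univ : Finset (Fin d)) k => wop (fun i => D (e i)) k p.2 (φ p.1))
        hA (C := C) (fun y => ?_) y
      · rw [Fintype.sum_prod_type] at h2
        simp only [← sum_coe_sort g.Λ] at h2
        refine le_trans (le_of_eq ?_) h2
        refine sum_congr rfl fun i _ => sum_comm
      · rw [Fintype.sum_prod_type]
        refine le_trans (le_of_eq ?_) (hC y)
        refine sum_congr rfl fun i _ => ?_
        rw [H, Function.iterate_succ_apply, XX_iterate]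
        simp only [H_one]; rfl

theorem H_le_W (hτ : 0 < g.τ₀) (k : ℕ) (φ : Smo d) (x : Sp d) :
    H k φ x ≤ (g.τ₀ ^ 2)⁻¹ ^ k * g.W k φ x := by
  induction k generalizing φ with
  | zero => simp [H_zero, W_zero]
  | succ k ih =>
    have h2 : ∑ i, g.W k (g.τ₀ • D (e i) φ) x ≤ g.W (k + 1) φ x := by
      rw [W_succ, Λ, Finset.sum_disjSum]
      have : 0 ≤ ∑ l ∈ g.Λ₁, g.W k (g.δ (.inl l) φ) x :=
        sum_nonneg fun l _ => g.W_nonneg _ _ _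
      exact le_add_of_nonneg_left this
    have h3 : ∀ ψ : Smo d, H k ψ x ≤ (g.τ₀ ^ 2)⁻¹ * ((g.τ₀ ^ 2)⁻¹ ^ k * g.W k (g.τ₀ • ψ) x) := by
      intro ψ
      have := H_sum_smul_le (ι := Unit) k (fun _ => g.τ₀⁻¹) (fun _ => g.τ₀ • ψ) x
      simp only [Finset.univ_unique, PUnit.default_eq_unit, sum_singleton, smul_smul,
        inv_mul_cancel₀ hτ.ne', one_smul, inv_pow] at this
      refine this.trans ?_
      have := ih (g.τ₀ • ψ)
      gcongr
    rw [H_succ]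
    calc _ ≤ ∑ i, (g.τ₀ ^ 2)⁻¹ * ((g.τ₀ ^ 2)⁻¹ ^ k * g.W k (g.τ₀ • D (e i) φ) x) :=
          sum_le_sum fun i _ => h3 _
      _ = (g.τ₀ ^ 2)⁻¹ ^ (k + 1) * ∑ i, g.W k (g.τ₀ • D (e i) φ) x := by
          rw [← mul_sum, ← mul_sum]; ring
      _ ≤ _ := by gcongr

/-- A word in the translations is a translation. -/
theorem wop_sh (k : ℕ) (w : Wd g.Λ k) : ∃ y, ∀ φ, wop (fun μ => ⇑(sh g.h μ)) k w φ = Tr y φ := by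
  induction k with
  | zero => exact ⟨0, fun φ => by ext x; simp [wop]⟩
  | succ k ih =>
    obtain ⟨y, hy⟩ := ih w.2
    obtain ⟨z, hz⟩ := sh_eq_Tr g.h (w.1 : Sp d ⊕ Fin d)
    refine ⟨y + z, fun φ => ?_⟩
    change wop (fun μ => ⇑(sh g.h μ)) k w.2 (sh g.h (w.1 : Sp d ⊕ Fin d) φ) = _
    rw [hy, hz, Tr_Tr]

/-- Estimate of a term of the Leibniz expansion through an estimate of the operator `B`. -/
theorem abs_term_le {M : Type} (δM : Sp d ⊕ Fin d → M → M) (B : M → Smo d → Smo d) (x : Sp d)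
    {n k : ℕ} (hk : k ≤ n) (a : M) (u : Smo d) {S κ : ℝ} (hS : g.W n u x ≤ S)
    (N : M → ℝ)
    (hB : ∀ v : Wd g.Λ k, ∀ y, ∑ w : Wd g.Λ (n - k),
      (B (wop δM k v a) (Tr y (wop g.δ (n - k) w u)) x) ^ 2 ≤ N (wop δM k v a))
    (hN : (XX g.Λ δM)^[k] N a ≤ κ) :
    |(XX g.Λ g.δ)^[n - k] (g.Gt δM B x k a) u| ≤ √(S * κ) := by
  refine Real.abs_le_sqrt ?_
  rw [XX_iterate]
  simp only [Gt, G_words]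
  rw [← Fintype.sum_prod_type']
  refine (sum_mul_sq_le_sq_mul_sq _ _ _).trans ?_
  have h0 := (g.W_nonneg n u x).trans hS
  refine mul_le_mul ?_ ?_ (by positivity) h0
  · rw [Fintype.sum_prod_type]
    refine le_trans (le_of_eq ?_) hS
    conv_rhs => rw [← Nat.sub_add_cancel hk, W_add]
    simp only [W_words]
  · rw [Fintype.sum_prod_type_right]
    refine le_trans (sum_le_sum fun v _ => ?_) ((XX_iterate _ _ _ _ _).symm.le.trans hN)
    obtain ⟨y, hy⟩ := g.wop_sh k v
    simp only [hy]
    exact hB v y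

end Geo

/-- The assumptions on smooth coefficients at a fixed time that enter the energy estimates. -/
structure Snap (g : Geo d) (co : Coef d) (m : ℕ) (δ K c₀ A L : ℝ) (M : ℕ → ℝ) : Prop where
  τ₀_pos : 0 < g.τ₀
  h_pos : 0 < g.h
  chi : ∀ l ∈ g.Λ₁, ∀ x, 0 ≤ co.q l x + g.h * co.p l x
  cent : ∀ j, ∑ l ∈ g.Λ₁, l j • co.q l = 0
  c_ge : ∀ x, c₀ ≤ co.c x
  nrm : ∑ l ∈ g.Λ₁, ‖g.τ l • l‖ ^ 2 + g.τ₀ ^ 2 ≤ A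
  abs : ∑ l ∈ g.Λ₁, ‖l‖ ^ 2 ≤ L
  coef : ∀ k ≤ m, ∀ x, ∑ l ∈ g.Λ₁, (H k (co.q l) x + H k (co.p l) x) + H k co.c x ≤ M k
  str₁ : ∀ φ C, (∀ y, g.W 1 φ y ≤ C) → ∀ x,
    g.Af co φ x ≤ (1 - δ) * g.Qn co 1 φ x + K * g.Qf co φ x + 2 * (1 - δ) * co.c x * C
  str₂ : ∀ n : ℕ, 2 ≤ n → n ≤ m → ∀ (ι : Type) [Fintype ι] (φ : ι → Smo d) (C₂ C₁ : ℝ),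
    (∀ y, ∑ i, g.W 2 (φ i) y ≤ C₂) → (∀ y, ∑ i, g.W 1 (φ i) y ≤ C₁) → ∀ x,
    n * ∑ i, XX g.Λ g.δ (fun φ => g.Af co φ x) (φ i)
      + n * ((n : ℝ) - 1) * ∑ i, g.Gt g.δF g.Bq x 2 co.q (φ i) ≤
    (1 - δ) * ∑ i, g.Qn co 2 (φ i) x + K * ∑ i, g.Qn co 1 (φ i) x
      + 2 * (1 - δ) * co.c x * C₂ + K * C₁

/-- The constant in the estimates of the terms of the Leibniz expansion. -/
def kap (A L τ₀ : ℝ) (M : ℕ → ℝ) (k : ℕ) : ℝ :=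
  A ^ k * M k * (L ^ 2 * (τ₀ ^ 2)⁻¹ ^ 2 + L * (τ₀ ^ 2)⁻¹ + 1)

/-- The constant in the remainder of the energy inequality. -/
def remC (A L τ₀ : ℝ) (M : ℕ → ℝ) (n : ℕ) : ℝ :=
  2 * ∑ k ∈ Finset.range (n + 1), (n.choose k : ℝ) * (3 * √(kap A L τ₀ M k))

theorem remC_nonneg (A L τ₀ : ℝ) (M : ℕ → ℝ) (n : ℕ) : 0 ≤ remC A L τ₀ M n := by
  unfold remC; positivity

namespace Geo

variable (g : Geo d)

theorem wop_δF (k : ℕ) (v : Wd g.Λ k) (q : Sp d → Smo d) (l : Sp d) :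
    wop g.δF k v q l = wop g.δ k v (q l) := by
  induction k generalizing q with
  | zero => rfl
  | succ k ih => exact ih v.2 _

theorem sum_W_coef (k : ℕ) (q : Sp d → Smo d) (x : Sp d) (κ : ℝ) :
    (XX g.Λ g.δF)^[k] (fun q => (∑ l ∈ g.Λ₁, q l x ^ 2) * κ) q =
      (∑ l ∈ g.Λ₁, g.W k (q l) x) * κ := by
  rw [XX_iterate, ← sum_mul, sum_comm]
  simp only [W_words, wop_δF]

end Geo

namespace Snap

variable {g : Geo d} {co : Coef d} {m : ℕ} {δ K c₀ A L : ℝ} {M : ℕ → ℝ}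

theorem L_nonneg (s : Snap g co m δ K c₀ A L M) : 0 ≤ L :=
  (sum_nonneg fun _ _ => by positivity).trans s.abs

theorem A_nonneg (s : Snap g co m δ K c₀ A L M) : 0 ≤ A :=
  (by positivity : 0 ≤ ∑ l ∈ g.Λ₁, ‖g.τ l • l‖ ^ 2 + g.τ₀ ^ 2).trans s.nrm

theorem coef_q (s : Snap g co m δ K c₀ A L M) {k : ℕ} (hk : k ≤ m) (x : Sp d) :
    ∑ l ∈ g.Λ₁, H k (co.q l) x ≤ M k := by
  refine le_trans ?_ (s.coef k hk x)
  refine le_add_of_le_of_nonneg ?_ (H_nonneg _ _ _)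
  exact sum_le_sum fun l _ => le_add_of_nonneg_right (H_nonneg _ _ _)

theorem coef_p (s : Snap g co m δ K c₀ A L M) {k : ℕ} (hk : k ≤ m) (x : Sp d) :
    ∑ l ∈ g.Λ₁, H k (co.p l) x ≤ M k := by
  refine le_trans ?_ (s.coef k hk x)
  refine le_add_of_le_of_nonneg ?_ (H_nonneg _ _ _)
  exact sum_le_sum fun l _ => le_add_of_nonneg_left (H_nonneg _ _ _)

theorem coef_c (s : Snap g co m δ K c₀ A L M) {k : ℕ} (hk : k ≤ m) (x : Sp d) :
    H k co.c x ≤ M k := by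
  refine le_trans ?_ (s.coef k hk x)
  exact le_add_of_nonneg_left
    (sum_nonneg fun l _ => add_nonneg (H_nonneg _ _ _) (H_nonneg _ _ _))

theorem M_nonneg (s : Snap g co m δ K c₀ A L M) {k : ℕ} (hk : k ≤ m) : 0 ≤ M k :=
  (H_nonneg _ _ 0).trans (s.coef_c hk 0)

theorem W_coef_q_le (s : Snap g co m δ K c₀ A L M) {k : ℕ} (hk : k ≤ m) (x : Sp d) :
    ∑ l ∈ g.Λ₁, g.W k (co.q l) x ≤ A ^ k * M k := by
  rw [← sum_coe_sort g.Λ₁]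
  refine g.sum_W_le s.nrm k (fun l : g.Λ₁ => co.q l) (fun y => ?_) x
  rw [sum_coe_sort g.Λ₁ fun l => H k (co.q l) y]
  exact s.coef_q hk y

theorem W_coef_p_le (s : Snap g co m δ K c₀ A L M) {k : ℕ} (hk : k ≤ m) (x : Sp d) :
    ∑ l ∈ g.Λ₁, g.W k (co.p l) x ≤ A ^ k * M k := by
  rw [← sum_coe_sort g.Λ₁]
  refine g.sum_W_le s.nrm k (fun l : g.Λ₁ => co.p l) (fun y => ?_) x
  rw [sum_coe_sort g.Λ₁ fun l => H k (co.p l) y]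
  exact s.coef_p hk y

theorem W_coef_c_le (s : Snap g co m δ K c₀ A L M) {k : ℕ} (hk : k ≤ m) (x : Sp d) :
    g.W k co.c x ≤ A ^ k * M k := by
  simpa using g.sum_W_le s.nrm k (fun _ : Unit => co.c) (fun y => by simpa using s.coef_c hk y) x

theorem cent_word (s : Snap g co m δ K c₀ A L M) (k : ℕ) (v : Wd g.Λ k) (x : Sp d) :
    ∑ l ∈ g.Λ₁, wop g.δF k v co.q l x • l = 0 := by
  have key : ∀ (k : ℕ) (v : Wd g.Λ k) (q : Sp d → Smo d),
      (∀ j, ∑ l ∈ g.Λ₁, l j • q l = 0) → ∀ j, ∑ l ∈ g.Λ₁, l j • wop g.δF k v q l = 0 := by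
    intro k
    induction k with
    | zero => intro v q hq; exact hq
    | succ k ih =>
      intro v q hq
      refine ih v.2 _ fun j => ?_
      have := congrArg (dB g.τ g.τ₀ g.h (v.1 : Sp d ⊕ Fin d)) (hq j)
      simpa only [map_sum, map_smul, map_zero, Geo.δF, Geo.δ] using this
  ext j
  have := congrArg (fun φ : Smo d => φ x) (key k v co.q s.cent j)
  simpa [mul_comm] using this

theorem kap_nonneg (s : Snap g co m δ K c₀ A L M) {k : ℕ} (hk : k ≤ m) :
    0 ≤ kap A L g.τ₀ M k := by
  have := s.L_nonneg; have := s.A_nonneg; have := s.M_nonneg hk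
  unfold kap; positivity

theorem sum_H_words_le (s : Snap g co m δ K c₀ A L M) {n k j : ℕ} (hk : k ≤ n) (hj : j < k)
    (u : Smo d) {S' : ℝ} (hS' : ∀ i < n, ∀ y, g.W i u y ≤ S') (y : Sp d) :
    ∑ w : Wd g.Λ (n - k), H j (wop g.δ (n - k) w u) y ≤ (g.τ₀ ^ 2)⁻¹ ^ j * S' := by
  calc _ ≤ ∑ w : Wd g.Λ (n - k), (g.τ₀ ^ 2)⁻¹ ^ j * g.W j (wop g.δ (n - k) w u) y :=
        sum_le_sum fun w _ => g.H_le_W s.τ₀_pos _ _ _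
    _ = (g.τ₀ ^ 2)⁻¹ ^ j * g.W (n - k + j) u y := by rw [← mul_sum, Geo.W_add]
    _ ≤ _ := by gcongr; exact hS' _ (by omega) y

theorem abs_Gq_le (s : Snap g co m δ K c₀ A L M) {n k : ℕ} (hn : n ≤ m) (hk : k ≤ n) (hk2 : 2 < k)
    (u : Smo d) {S S' : ℝ} (x : Sp d) (hS : g.W n u x ≤ S) (hS' : ∀ i < n, ∀ y, g.W i u y ≤ S') :
    |(XX g.Λ g.δ)^[n - k] (g.Gt g.δF g.Bq x k co.q) u| ≤
      √(S * (kap A L g.τ₀ M k * S')) := by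
  have hS0 : 0 ≤ S' := (g.W_nonneg 0 u 0).trans (hS' 0 (by omega) 0)
  have hL := s.L_nonneg; have hA := s.A_nonneg; have hM := s.M_nonneg (hk.trans hn)
  refine g.abs_term_le g.δF g.Bq x hk co.q u hS
    (fun q => (∑ l ∈ g.Λ₁, q l x ^ 2) * (L ^ 2 * ((g.τ₀ ^ 2)⁻¹ ^ 2 * S'))) (fun v y => ?_) ?_
  · have h1 := sum_centered_sq_le (fun w : Wd g.Λ (n - k) => wop g.δ (n - k) w u)
      (fun y => s.sum_H_words_le hk hk2 u hS' y) g.h g.Λ₁ (fun l => wop g.δF k v co.q l x)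
      (s.cent_word k v x) (x + y)
    have h2 : ∀ w : Wd g.Λ (n - k),
        g.Bq (wop g.δF k v co.q) (Tr y (wop g.δ (n - k) w u)) x =
        g.h⁻¹ * ∑ l ∈ g.Λ₁, wop g.δF k v co.q l x * dl g.h l (wop g.δ (n - k) w u) (x + y) := by
      intro w; simp [Geo.Bq, dl_Tr]
    simp only [h2]
    refine h1.trans ?_
    rw [mul_assoc]
    have := s.abs
    gcongr
  · rw [Geo.sum_W_coef]
    calc _ ≤ (A ^ k * M k) * (L ^ 2 * ((g.τ₀ ^ 2)⁻¹ ^ 2 * S')) := by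
          gcongr; exact s.W_coef_q_le (hk.trans hn) x
      _ = A ^ k * M k * (L ^ 2 * (g.τ₀ ^ 2)⁻¹ ^ 2) * S' := by ring
      _ ≤ _ := by
          unfold kap; gcongr
          linarith [(by positivity : 0 ≤ L * (g.τ₀ ^ 2)⁻¹)]

theorem abs_Gp_le (s : Snap g co m δ K c₀ A L M) {n k : ℕ} (hn : n ≤ m) (hk : k ≤ n) (hk2 : 1 < k)
    (u : Smo d) {S S' : ℝ} (x : Sp d) (hS : g.W n u x ≤ S) (hS' : ∀ i < n, ∀ y, g.W i u y ≤ S') :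
    |(XX g.Λ g.δ)^[n - k] (g.Gt g.δF g.Bp x k co.p) u| ≤
      √(S * (kap A L g.τ₀ M k * S')) := by
  have hS0 : 0 ≤ S' := (g.W_nonneg 0 u 0).trans (hS' 0 (by omega) 0)
  have hL := s.L_nonneg; have hA := s.A_nonneg; have hM := s.M_nonneg (hk.trans hn)
  refine g.abs_term_le g.δF g.Bp x hk co.p u hS
    (fun q => (∑ l ∈ g.Λ₁, q l x ^ 2) * (L * ((g.τ₀ ^ 2)⁻¹ ^ 1 * S'))) (fun v y => ?_) ?_
  · have h2 : ∀ w : Wd g.Λ (n - k),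
        g.Bp (wop g.δF k v co.p) (Tr y (wop g.δ (n - k) w u)) x =
        ∑ l ∈ g.Λ₁, wop g.δF k v co.p l x * dl g.h l (wop g.δ (n - k) w u) (x + y) := by
      intro w; simp [Geo.Bp, dl_Tr]
    simp only [h2]
    calc _ ≤ ∑ w : Wd g.Λ (n - k), (∑ l ∈ g.Λ₁, wop g.δF k v co.p l x ^ 2) *
          ∑ l ∈ g.Λ₁, dl g.h l (wop g.δ (n - k) w u) (x + y) ^ 2 :=
          sum_le_sum fun w _ => sum_mul_sq_le_sq_mul_sq _ _ _
      _ ≤ _ := by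
          rw [← mul_sum, sum_comm]
          gcongr
          calc _ ≤ ∑ l ∈ g.Λ₁, ‖l‖ ^ 2 * ((g.τ₀ ^ 2)⁻¹ ^ 1 * S') :=
                sum_le_sum fun l _ => sum_dl_sq_le
                  (fun w : Wd g.Λ (n - k) => wop g.δ (n - k) w u)
                  (fun y => s.sum_H_words_le hk hk2 u hS' y) g.h l (x + y)
            _ ≤ _ := by rw [← sum_mul]; have := s.abs; gcongr
  · rw [Geo.sum_W_coef]
    calc _ ≤ (A ^ k * M k) * (L * ((g.τ₀ ^ 2)⁻¹ ^ 1 * S')) := by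
          gcongr; exact s.W_coef_p_le (hk.trans hn) x
      _ = A ^ k * M k * (L * (g.τ₀ ^ 2)⁻¹) * S' := by ring
      _ ≤ _ := by
          unfold kap; gcongr
          linarith [(by positivity : 0 ≤ L ^ 2 * (g.τ₀ ^ 2)⁻¹ ^ 2)]

theorem abs_Gc_le (s : Snap g co m δ K c₀ A L M) {n k : ℕ} (hn : n ≤ m) (hk : k ≤ n) (hk2 : 0 < k)
    (u : Smo d) {S S' : ℝ} (x : Sp d) (hS : g.W n u x ≤ S) (hS' : ∀ i < n, ∀ y, g.W i u y ≤ S') :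
    |(XX g.Λ g.δ)^[n - k] (g.Gt g.δ Geo.Bc x k co.c) u| ≤
      √(S * (kap A L g.τ₀ M k * S')) := by
  have hS0 : 0 ≤ S' := (g.W_nonneg 0 u 0).trans (hS' 0 (by omega) 0)
  have hL := s.L_nonneg; have hA := s.A_nonneg; have hM := s.M_nonneg (hk.trans hn)
  refine g.abs_term_le g.δ Geo.Bc x hk co.c u hS
    (fun c => c x ^ 2 * S') (fun v y => ?_) ?_
  · simp only [Geo.Bc, Smo.neg_apply, Smo.mul_apply, neg_sq, mul_pow, ← mul_sum, Tr_apply]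
    gcongr
    simpa [H_zero] using s.sum_H_words_le hk hk2 u hS' (x + y)
  · rw [XX_iterate, ← sum_mul, ← Geo.W_words]
    calc _ ≤ (A ^ k * M k) * S' := by gcongr; exact s.W_coef_c_le (hk.trans hn) x
      _ = A ^ k * M k * 1 * S' := by ring
      _ ≤ _ := by
          unfold kap; gcongr
          linarith [(by positivity : 0 ≤ L ^ 2 * (g.τ₀ ^ 2)⁻¹ ^ 2 + L * (g.τ₀ ^ 2)⁻¹)]

end Snap

namespace Geo

variable (g : Geo d)

theorem two_mul_Lop (hh : g.h ≠ 0) (co : Coef d) (φ : Smo d) (x : Sp d) :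
    2 * (g.Gt g.δF g.Bq x 0 co.q φ + g.Gt g.δF g.Bp x 0 co.p φ + g.Gt g.δ Bc x 0 co.c φ) =
      g.L0 co (fun y => φ y ^ 2) x - 2 * co.c x * φ x ^ 2 - g.Qf co φ x := by
  simp only [Gt, G, Bq, Bp, Bc, L0, Qf, Smo.smul_apply, Smo.sum_apply, Smo.mul_apply, Smo.neg_apply,
    dl_apply]
  have h1 : ∑ l ∈ g.Λ₁, (co.q l x + g.h * co.p l x) / g.h ^ 2 * (φ (x + g.h • l) ^ 2 - φ x ^ 2) -
      ∑ l ∈ g.Λ₁, (co.q l x + g.h * co.p l x) * (g.h⁻¹ * (φ (x + g.h • l) - φ x)) ^ 2 =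
      2 * (φ x * (g.h⁻¹ * ∑ l ∈ g.Λ₁, co.q l x * (g.h⁻¹ * (φ (x + g.h • l) - φ x))) +
        φ x * ∑ l ∈ g.Λ₁, co.p l x * (g.h⁻¹ * (φ (x + g.h • l) - φ x))) := by
    simp only [mul_sum, ← sum_sub_distrib, ← sum_add_distrib]
    refine sum_congr rfl fun l _ => ?_
    field_simp
    ring
  linarith

theorem L0_sum (co : Coef d) {ι : Type*} (s : Finset ι) (v : ι → Fn d) (x : Sp d) :
    g.L0 co (fun y => ∑ i ∈ s, v i y) x = ∑ i ∈ s, g.L0 co (v i) x := by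
  simp only [L0, ← sum_sub_distrib, mul_sum]
  exact sum_comm

theorem XX_main (hh : g.h ≠ 0) (co : Coef d) (n : ℕ) (u : Smo d) (x : Sp d) :
    2 * ((XX g.Λ g.δ)^[n] (g.Gt g.δF g.Bq x 0 co.q) u + (XX g.Λ g.δ)^[n] (g.Gt g.δF g.Bp x 0 co.p) u
      + (XX g.Λ g.δ)^[n] (g.Gt g.δ Bc x 0 co.c) u) =
    g.L0 co (g.W n u) x - 2 * co.c x * g.W n u x - g.Qn co n u x := by
  have h1 : g.W n u = fun y => ∑ w : Wd g.Λ n, wop g.δ n w u y ^ 2 := funext fun y => W_words _ _ _ _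
  rw [h1, L0_sum, Qn]
  simp only [XX_iterate]
  rw [mul_sum, ← sum_add_distrib, ← sum_add_distrib, mul_sum,
    ← sum_sub_distrib, ← sum_sub_distrib]
  exact sum_congr rfl fun w _ => g.two_mul_Lop hh co _ x

theorem Qn_nonneg (co : Coef d) (hχ : ∀ l ∈ g.Λ₁, ∀ x, 0 ≤ co.q l x + g.h * co.p l x)
    (n : ℕ) (u : Smo d) (x : Sp d) : 0 ≤ g.Qn co n u x := by
  rw [Qn, XX_iterate]
  refine sum_nonneg fun w _ => sum_nonneg fun l hl => ?_
  have := hχ l hl x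
  positivity

end Geo

namespace Snap

variable {g : Geo d} {co : Coef d} {m : ℕ} {δ K c₀ A L : ℝ} {M : ℕ → ℝ}

theorem energy_zero (s : Snap g co m δ K c₀ A L M) (u : Smo d) (x : Sp d) :
    2 * g.Pol 0 u (g.Lop co u) x =
      g.L0 co (g.W 0 u) x - 2 * co.c x * g.W 0 u x - g.Qn co 0 u x := by
  have h1 := g.XX_main s.h_pos.ne' co 0 u x
  rw [← h1]
  simp only [Geo.Pol, P, Geo.Lop, Smo.add_apply, Function.iterate_zero, id, Geo.Gt, G]
  ring

/-- The differential inequality for the energy of order `n ≥ 1`. -/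
theorem energy_le (s : Snap g co m δ K c₀ A L M) {n : ℕ} (hn1 : 1 ≤ n) (hn : n ≤ m)
    (u : Smo d) {S S' : ℝ} (hS : ∀ y, g.W n u y ≤ S)
    (hS' : ∀ i < n, ∀ y, g.W i u y ≤ S') (hK : 0 ≤ K) (x : Sp d) :
    2 * g.Pol n u (g.Lop co u) x ≤
      g.L0 co (g.W n u) x - 2 * co.c x * g.W n u x - δ * g.Qn co n u x
        + K * g.Qn co (n - 1) u x + 2 * (1 - δ) * co.c x * S + K * S'
        + remC A L g.τ₀ M n * √(S * S') := by
  have hS0 : 0 ≤ S' := (g.W_nonneg 0 u 0).trans (hS' 0 (by omega) 0)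
  have hS1 : 0 ≤ S := (g.W_nonneg n u 0).trans (hS 0)
  let fq : ℕ → ℝ := fun k => (XX g.Λ g.δ)^[n - k] (g.Gt g.δF g.Bq x k co.q) u
  let fp : ℕ → ℝ := fun k => (XX g.Λ g.δ)^[n - k] (g.Gt g.δF g.Bp x k co.p) u
  let fc : ℕ → ℝ := fun k => (XX g.Λ g.δ)^[n - k] (g.Gt g.δ Geo.Bc x k co.c) u
  have e1 : g.Pol n u (g.Lop co u) x = ∑ k ∈ Finset.range (n + 1), (n.choose k : ℝ) * fq k
      + ∑ k ∈ Finset.range (n + 1), (n.choose k : ℝ) * fp k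
      + ∑ k ∈ Finset.range (n + 1), (n.choose k : ℝ) * fc k := by
    rw [Geo.Lop, Geo.Pol_add, Geo.Pol_add, g.Pol_expand g.δF g.Bq g.δ_Bq,
      g.Pol_expand g.δF g.Bp g.δ_Bp, g.Pol_expand g.δ Geo.Bc g.δ_Bc]
  have hrem : ∀ (j : ℕ) (f : ℕ → ℝ), (∀ k ≤ n, j ≤ k → |f k| ≤
      √(S * (kap A L g.τ₀ M k * S'))) →
      ∑ k ∈ Finset.range (n + 1), (n.choose k : ℝ) * (if k < j then 0 else f k) ≤
      (∑ k ∈ Finset.range (n + 1), (n.choose k : ℝ) * √(kap A L g.τ₀ M k)) *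
        √(S * S') := by
    intro j f hf
    rw [sum_mul]
    refine sum_le_sum fun k hk => ?_
    have hk' : k ≤ n := by simpa [Nat.lt_succ_iff] using hk
    rw [mul_assoc]
    refine mul_le_mul_of_nonneg_left ?_ (by positivity)
    split_ifs with hkj
    · positivity
    · refine (le_abs_self _).trans ((hf k hk' (not_lt.1 hkj)).trans (le_of_eq ?_))
      rw [← Real.sqrt_mul (s.kap_nonneg (hk'.trans hn))]
      congr 1; ring
  have rq := hrem 3 fq fun k hk hk2 => s.abs_Gq_le hn hk (by omega) u x (hS x) hS'
  have rp := hrem 2 fp fun k hk hk2 => s.abs_Gp_le hn hk (by omega) u x (hS x) hS'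
  have rc := hrem 1 fc fun k hk hk2 => s.abs_Gc_le hn hk (by omega) u x (hS x) hS'
  have hR : remC A L g.τ₀ M n = 6 * ∑ k ∈ Finset.range (n + 1),
      (n.choose k : ℝ) * √(kap A L g.τ₀ M k) := by
    rw [remC, mul_sum, mul_sum]
    exact sum_congr rfl fun k _ => by ring
  have hm := g.XX_main s.h_pos.ne' co n u x
  have hstr : 2 * (n * (fq 1 + fp 1)) + 2 * ((n.choose 2 : ℝ) * fq 2) ≤
      (1 - δ) * g.Qn co n u x + K * g.Qn co (n - 1) u x + 2 * (1 - δ) * co.c x * S + K * S' := by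
    obtain ⟨j, rfl⟩ : ∃ j, n = j + 1 := ⟨n - 1, by omega⟩
    rcases Nat.eq_zero_or_pos j with rfl | hj
    · have h1 := s.str₁ u S hS x
      have h2 : fq 1 + fp 1 = 2⁻¹ * g.Af co u x := by
        simp only [Geo.Af, fq, fp]; simp
      have h3 : ((0 + 1).choose 2 : ℝ) = 0 := by simp
      have h4 : g.Qn co (0 + 1 - 1) u x = g.Qf co u x := rfl
      rw [h2, h3, h4]
      push_cast
      have : 0 ≤ K * S' := by positivity
      simp only [zero_add] at *
      linarith
    · obtain ⟨i, rfl⟩ : ∃ i, j = i + 1 := ⟨j - 1, by omega⟩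
      have h1 := s.str₂ (i + 1 + 1) (by omega) hn (Wd g.Λ i) (fun w => wop g.δ i w u) S S'
        (fun y => by rw [← Geo.W_add]; exact hS y)
        (fun y => by rw [← Geo.W_add]; exact hS' _ (by omega) y) x
      have h2 : ∑ w : Wd g.Λ i, XX g.Λ g.δ (fun φ => g.Af co φ x) (wop g.δ i w u) =
          2 * (fq 1 + fp 1) := by
        have : ∀ Φ : Smo d → ℝ, (XX g.Λ g.δ)^[i + 1 + 1 - 1] Φ u =
            ∑ w : Wd g.Λ i, XX g.Λ g.δ Φ (wop g.δ i w u) := by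
          intro Φ; rw [← XX_iterate, ← Function.iterate_succ_apply]; rfl
        simp only [fq, fp, this, Geo.Af, XX, ← mul_sum, sum_add_distrib]
      have h3 : ∑ w : Wd g.Λ i, g.Gt g.δF g.Bq x 2 co.q (wop g.δ i w u) = fq 2 := by
        rw [← XX_iterate]; rfl
      have h4 : ∑ w : Wd g.Λ i, g.Qn co 2 (wop g.δ i w u) x = g.Qn co (i + 1 + 1) u x := by
        rw [← XX_iterate (Φ := fun φ => g.Qn co 2 φ x)]
        simp only [Geo.Qn, ← Function.iterate_add_apply]
      have h5 : ∑ w : Wd g.Λ i, g.Qn co 1 (wop g.δ i w u) x = g.Qn co (i + 1 + 1 - 1) u x := by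
        rw [← XX_iterate (Φ := fun φ => g.Qn co 1 φ x)]
        simp only [Geo.Qn]
        rw [show i + 1 + 1 - 1 = i + 1 by omega, Function.iterate_add_apply]
      rw [h2, h3, h4, h5] at h1
      have h6 : ((i + 1 + 1).choose 2 : ℝ) = ((i + 1 + 1 : ℕ) : ℝ) * (((i + 1 + 1 : ℕ) : ℝ) - 1) / 2 :=
        Nat.cast_choose_two ℝ _
      rw [h6]
      linarith
  have hq := Geo.sum_choose_split n 3 fq
  have hp := Geo.sum_choose_split n 2 fp
  have hc := Geo.sum_choose_split n 1 fc
  simp only [sum_range_succ _ 2, sum_range_succ _ 1, Finset.sum_range_one,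
    Nat.choose_zero_right, Nat.choose_one_right, Nat.cast_one, one_mul] at hq hp hc
  have hm' : 2 * (fq 0 + fp 0 + fc 0) =
    g.L0 co (g.W n u) x - 2 * co.c x * g.W n u x - g.Qn co n u x := hm
  rw [e1, hq, hp, hc, hR]
  linarith

end Snap

/-! ### Maximum principle for finite difference equations -/

theorem ode_comparison {T κ : ℝ} {w G : ℝ → ℝ} {w₀ : ℝ}
    (hG : IntervalIntegrable G volume 0 T) (hw : ∀ t ∈ Icc 0 T, w t = w₀ + ∫ s in 0..t, G s)
    (h0 : w₀ ≤ 0) (hκ : 0 ≤ κ) (hle : ∀ s ∈ Icc 0 T, G s ≤ -κ * w s) {t : ℝ} (ht : t ∈ Icc 0 T) :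
    w t ≤ 0 := by
  by_contra! hpos
  have hT : 0 ≤ T := ht.1.trans ht.2
  have hsub : ∀ {a b : ℝ}, a ∈ Icc 0 T → b ∈ Icc 0 T → IntervalIntegrable G volume a b := by
    intro a b ha hb
    refine hG.mono_set ?_
    rw [uIcc_of_le hT]
    exact ordConnected_Icc.uIcc_subset ha hb
  have hcont : ContinuousOn w (Icc 0 t) := by
    have h1 : ContinuousOn (fun t => w₀ + ∫ s in 0..t, G s) (Icc 0 t) := by
      refine continuousOn_const.add ?_
      have := intervalIntegral.continuousOn_primitive_interval' (hsub ⟨le_rfl, hT⟩ ht)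
        (left_mem_uIcc)
      rwa [uIcc_of_le ht.1] at this
    exact h1.congr fun s hs => hw s ⟨hs.1, hs.2.trans ht.2⟩
  have hne : (Icc 0 t ∩ w ⁻¹' Iic 0).Nonempty := by
    refine ⟨0, ⟨le_rfl, ht.1⟩, ?_⟩
    change w 0 ≤ 0
    rw [hw 0 ⟨le_rfl, hT⟩]
    simpa using h0
  have hcomp : IsCompact (Icc 0 t ∩ w ⁻¹' Iic 0) :=
    isCompact_Icc.of_isClosed_subset (hcont.preimage_isClosed_of_isClosed isClosed_Icc isClosed_Iic)
      inter_subset_left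
  obtain ⟨r, ⟨hr, hwr⟩, hmax⟩ := hcomp.exists_isGreatest hne
  have hr' : r ∈ Icc 0 T := ⟨hr.1, hr.2.trans ht.2⟩
  have h1 : w t = w r + ∫ s in r..t, G s := by
    rw [hw t ht, hw r hr', add_assoc, intervalIntegral.integral_add_adjacent_intervals
      (hsub ⟨le_rfl, hT⟩ hr') (hsub hr' ht)]
  have h2 : ∫ s in r..t, G s ≤ ∫ s in r..t, (0 : ℝ) := by
    refine intervalIntegral.integral_mono_on_of_le_Ioo hr.2 (hsub hr' ht) (by simp) ?_
    intro s hs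
    have hs' : s ∈ Icc 0 T := ⟨hr.1.trans hs.1.le, hs.2.le.trans ht.2⟩
    have : 0 < w s := by
      by_contra! hle
      have := hmax ⟨⟨hs'.1, hs.2.le⟩, hle⟩
      linarith [hs.1]
    nlinarith [hle s hs']
  have h3 : w r ≤ 0 := hwr
  simp only [intervalIntegral.integral_zero] at h2
  linarith

/-- The finite difference operator with coefficients `a`, `c`. -/
def fdo (Λ₁ : Finset (Sp d)) (h : ℝ) (a : Sp d → TFn d) (c : TFn d) (t : ℝ)
    (v : Fn d) (x : Sp d) : ℝ :=
  ∑ l ∈ Λ₁, a l t x * (v (x + h • l) - v x) - c t x * v x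

section MaxPrinciple

variable {Λ₁ : Finset (Sp d)} {h T : ℝ} {a : Sp d → TFn d} {c : TFn d}

theorem fd_le_zero {κ : ℝ} {v G : TFn d} {v₀ : Fn d} (hT : 0 ≤ T)
    (ha : ∀ l ∈ Λ₁, ∀ t ∈ Icc 0 T, ∀ x, 0 ≤ a l t x) (hc : ∀ t ∈ Icc 0 T, ∀ x, 0 ≤ c t x)
    (hκ : ∀ t ∈ Icc 0 T, ∀ x, ∑ l ∈ Λ₁, a l t x + c t x ≤ κ)
    (hG : ∀ x, IntervalIntegrable (fun s => G s x) volume 0 T)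
    (hv : ∀ t ∈ Icc 0 T, ∀ x, v t x = v₀ x + ∫ s in 0..t, G s x)
    (hb : ∃ C, ∀ t ∈ Icc 0 T, ∀ x, v t x ≤ C) (h0 : ∀ x, v₀ x ≤ 0)
    (hle : ∀ t ∈ Icc 0 T, ∀ x, G t x ≤ fdo Λ₁ h a c t (v t) x) :
    ∀ t ∈ Icc 0 T, ∀ x, v t x ≤ 0 := by
  have hκ0 : 0 ≤ κ := by
    refine le_trans (add_nonneg (sum_nonneg fun l hl => ?_) ?_) (hκ 0 ⟨le_rfl, hT⟩ 0)
    exacts [ha l hl 0 ⟨le_rfl, hT⟩ 0, hc 0 ⟨le_rfl, hT⟩ 0]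
  set θ := 1 - Real.exp (-(κ * T)) with hθ
  have hθ0 : 0 ≤ θ := by
    rw [hθ, sub_nonneg]; exact Real.exp_le_one_iff.2 (by simpa using by positivity)
  have hθ1 : θ < 1 := by rw [hθ]; linarith [Real.exp_pos (-(κ * T))]
  have step : ∀ C, 0 ≤ C → (∀ t ∈ Icc 0 T, ∀ x, v t x ≤ C) → ∀ t ∈ Icc 0 T, ∀ x, v t x ≤ θ * C := by
    intro C hC hvC t ht x
    have hexp : ∀ t, ∫ s in 0..t, C * (κ * Real.exp (-(κ * s))) =
        C * (1 - Real.exp (-(κ * t))) := by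
      intro t
      rw [intervalIntegral.integral_eq_sub_of_hasDerivAt
        (f := fun s => -(C * Real.exp (-(κ * s))))]
      · simp; ring
      · intro s _
        have := ((((hasDerivAt_id s).const_mul κ).neg).exp.const_mul C).neg
        refine this.congr_deriv ?_
        simp only [Pi.neg_apply, id]; ring
      · exact Continuous.intervalIntegrable (by fun_prop) _ _
    have hint : IntervalIntegrable (fun s => C * (κ * Real.exp (-(κ * s)))) volume 0 T :=
      Continuous.intervalIntegrable (by fun_prop) _ _
    have := ode_comparison (T := T) (κ := κ)
      (w := fun t => v t x - C * (1 - Real.exp (-(κ * t))))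
      (G := fun s => G s x - C * (κ * Real.exp (-(κ * s)))) (w₀ := v₀ x)
      ((hG x).sub hint) (fun t ht => ?_) (h0 x) hκ0 (fun s hs => ?_) ht
    · have h1 : C * (1 - Real.exp (-(κ * t))) ≤ θ * C := by
        rw [mul_comm, hθ]
        gcongr
        exact ht.2
      linarith
    · have hsub : IntervalIntegrable (fun s => G s x) volume 0 t := by
        refine (hG x).mono_set ?_
        rw [uIcc_of_le hT, uIcc_of_le ht.1]
        exact Icc_subset_Icc_right ht.2
      rw [intervalIntegral.integral_sub hsub (Continuous.intervalIntegrable (by fun_prop) _ _),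
        hexp, hv t ht]
      ring
    · have h1 := hle s hs x
      have h2 : fdo Λ₁ h a c s (v s) x ≤ ∑ l ∈ Λ₁, a l s x * (C - v s x) + c s x * (C - v s x) := by
        unfold fdo
        have : ∑ l ∈ Λ₁, a l s x * (v s (x + h • l) - v s x) ≤ ∑ l ∈ Λ₁, a l s x * (C - v s x) :=
          sum_le_sum fun l hl => mul_le_mul_of_nonneg_left
            (by linarith [hvC s hs (x + h • l)]) (ha l hl s hs x)
        nlinarith [hc s hs x]
      rw [← sum_mul, ← add_mul] at h2
      have h3 : (∑ l ∈ Λ₁, a l s x + c s x) * (C - v s x) ≤ κ * (C - v s x) :=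
        mul_le_mul_of_nonneg_right (hκ s hs x) (by linarith [hvC s hs x])
      have h4 : -κ * (v s x - C * (1 - Real.exp (-(κ * s)))) =
        κ * (C - v s x) - C * (κ * Real.exp (-(κ * s))) := by ring
      rw [h4]
      linarith
  obtain ⟨C, hC⟩ := hb
  have hit : ∀ n : ℕ, ∀ t ∈ Icc 0 T, ∀ x, v t x ≤ θ ^ n * max C 0 := by
    intro n
    induction n with
    | zero => intro t ht x; simpa using Or.inl (hC t ht x)
    | succ n ih =>
      have := step _ (by positivity) ih
      intro t ht x
      rw [pow_succ', mul_assoc]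
      exact this t ht x
  intro t ht x
  have hlim : Tendsto (fun n : ℕ => θ ^ n * max C 0) atTop (nhds (0 * max C 0)) :=
    (tendsto_pow_atTop_nhds_zero_of_lt_one hθ0 hθ1).mul_const _
  rw [zero_mul] at hlim
  exact ge_of_tendsto' hlim fun n => hit n t ht x

theorem fd_le {κ B : ℝ} {v G : TFn d} {v₀ : Fn d} (hT : 0 ≤ T)
    (ha : ∀ l ∈ Λ₁, ∀ t ∈ Icc 0 T, ∀ x, 0 ≤ a l t x) (hc : ∀ t ∈ Icc 0 T, ∀ x, 0 ≤ c t x)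
    (hκ : ∀ t ∈ Icc 0 T, ∀ x, ∑ l ∈ Λ₁, a l t x + c t x ≤ κ)
    (hG : ∀ x, IntervalIntegrable (fun s => G s x) volume 0 T)
    (hv : ∀ t ∈ Icc 0 T, ∀ x, v t x = v₀ x + ∫ s in 0..t, G s x)
    (hb : ∃ C, ∀ t ∈ Icc 0 T, ∀ x, v t x ≤ C) (h0 : ∀ x, v₀ x ≤ B)
    (hle : ∀ t ∈ Icc 0 T, ∀ x, G t x ≤ fdo Λ₁ h a c t (v t) x + c t x * B) :
    ∀ t ∈ Icc 0 T, ∀ x, v t x ≤ B := by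
  obtain ⟨C, hC⟩ := hb
  have := fd_le_zero (v := fun t x => v t x - B) (v₀ := fun x => v₀ x - B) (h := h) hT ha hc hκ hG
    (fun t ht x => by rw [hv t ht x]; ring) ⟨C - B, fun t ht x => by linarith [hC t ht x]⟩
    (fun x => by linarith [h0 x]) (fun t ht x => by
      refine (hle t ht x).trans (le_of_eq ?_)
      simp only [fdo, sub_sub_sub_cancel_right]
      ring)
  intro t ht x
  linarith [this t ht x]

theorem fdo_neg (t : ℝ) (v : Fn d) (x : Sp d) :
    fdo Λ₁ h a c t (fun y => -v y) x = -fdo Λ₁ h a c t v x := by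
  have : ∑ l ∈ Λ₁, a l t x * (-v (x + h • l) - -v x) =
      -∑ l ∈ Λ₁, a l t x * (v (x + h • l) - v x) := by
    rw [← sum_neg_distrib]
    exact sum_congr rfl fun l _ => by ring
  rw [fdo, fdo, this]; ring

end MaxPrinciple

/-! ### Existence for finite difference equations -/

/-- Jointly measurable bounded functions. -/
def BM (ψ : TFn d) : Prop :=
  Measurable (uncurry ψ) ∧ ∃ C, ∀ t x, |ψ t x| ≤ C

namespace BM

variable {φ ψ : TFn d}

theorem add (hφ : BM φ) (hψ : BM ψ) : BM fun t x => φ t x + ψ t x := by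
  obtain ⟨C, hC⟩ := hφ.2
  obtain ⟨C', hC'⟩ := hψ.2
  exact ⟨hφ.1.add hψ.1, C + C', fun t x =>
    (abs_add_le _ _).trans (add_le_add (hC t x) (hC' t x))⟩

theorem mul (hφ : BM φ) (hψ : BM ψ) : BM fun t x => φ t x * ψ t x := by
  obtain ⟨C, hC⟩ := hφ.2
  obtain ⟨C', hC'⟩ := hψ.2
  exact ⟨hφ.1.mul hψ.1, C * C', fun t x => by
    rw [abs_mul]
    exact mul_le_mul (hC t x) (hC' t x) (abs_nonneg _) ((abs_nonneg _).trans (hC t x))⟩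

theorem const (a : ℝ) : BM (d := d) fun _ _ => a := ⟨measurable_const, |a|, fun _ _ => le_rfl⟩

theorem neg (hφ : BM φ) : BM fun t x => -φ t x := by
  simpa using (const (-1)).mul hφ

theorem sub (hφ : BM φ) (hψ : BM ψ) : BM fun t x => φ t x - ψ t x := by
  simpa [sub_eq_add_neg] using hφ.add hψ.neg

theorem shift (hφ : BM φ) (y : Sp d) : BM fun t x => φ t (x + y) := by
  refine ⟨hφ.1.comp (measurable_fst.prodMk (measurable_snd.add_const y)), ?_⟩
  obtain ⟨C, hC⟩ := hφ.2
  exact ⟨C, fun t x => hC _ _⟩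

theorem sum {ι : Type*} (s : Finset ι) {f : ι → TFn d} (h : ∀ i ∈ s, BM (f i)) :
    BM fun t x => ∑ i ∈ s, f i t x := by
  classical
  induction s using Finset.induction_on with
  | empty => simpa using const 0
  | insert i s hi ih =>
    simp only [sum_insert hi]
    exact (h i (by simp)).add (ih fun j hj => h j (by simp [hj]))

theorem fdo {Λ₁ : Finset (Sp d)} {h : ℝ} {a : Sp d → TFn d} {c : TFn d}
    (ha : ∀ l ∈ Λ₁, BM (a l)) (hc : BM c) (hφ : BM φ) : BM fun t x => fdo Λ₁ h a c t (φ t) x :=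
  (BM.sum _ fun l hl => (ha l hl).mul ((hφ.shift _).sub hφ)).sub (hc.mul hφ)

theorem measurable_time (hφ : BM φ) (x : Sp d) : Measurable fun t => φ t x :=
  hφ.1.comp (measurable_id.prodMk measurable_const)

theorem measurable_space (hφ : BM φ) (t : ℝ) : Measurable (φ t) :=
  hφ.1.comp (measurable_const.prodMk measurable_id)

theorem intervalIntegrable (hφ : BM φ) (x : Sp d) (a b : ℝ) :
    IntervalIntegrable (fun t => φ t x) volume a b := by
  obtain ⟨C, hC⟩ := hφ.2
  refine (intervalIntegrable_const (c := C) (μ := volume)).mono_fun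
    (hφ.measurable_time x).aestronglyMeasurable (ae_of_all _ fun t => ?_)
  exact (hC t x).trans (le_abs_self C)

/-- The primitive in time, stopped at the ends of `[0,T]`. -/
theorem primitive (hφ : BM φ) {T : ℝ} (hT : 0 ≤ T) :
    BM fun t x => ∫ s in 0..(max 0 (min T t)), φ s x := by
  obtain ⟨C, hC⟩ := hφ.2
  constructor
  · have h1 : ∀ t x, ∫ s in 0..(max 0 (min T t)), φ s x =
        ∫ s, (Ioc 0 (max 0 (min T t))).indicator (fun s => φ s x) s := by
      intro t x
      rw [intervalIntegral.integral_of_le (le_max_left _ _), integral_indicator measurableSet_Ioc]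
    simp only [Function.uncurry_def, h1]
    have h2 : Measurable fun z : (ℝ × Sp d) × ℝ =>
        (Ioc 0 (max 0 (min T z.1.1))).indicator (fun s => φ s z.1.2) z.2 := by
      have h3 : Measurable fun z : (ℝ × Sp d) × ℝ => φ z.2 z.1.2 :=
        hφ.1.comp (measurable_snd.prodMk (measurable_snd.comp measurable_fst))
      have h4 : MeasurableSet {z : (ℝ × Sp d) × ℝ | z.2 ∈ Ioc 0 (max 0 (min T z.1.1))} := by
        refine (measurableSet_lt measurable_const measurable_snd).inter
          (measurableSet_le measurable_snd ?_)
        fun_prop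
      exact h3.indicator h4
    exact (h2.stronglyMeasurable.integral_prod_right (ν := volume)).measurable
  · refine ⟨C * T, fun t x => ?_⟩
    have h0 : 0 ≤ C := (abs_nonneg _).trans (hC 0 0)
    have := intervalIntegral.norm_integral_le_of_norm_le_const (a := (0 : ℝ))
      (b := max 0 (min T t)) (f := fun s => φ s x) (C := C) fun s _ => hC s x
    refine this.trans ?_
    rw [sub_zero, abs_of_nonneg (le_max_left _ _)]
    gcongr
    exact max_le hT (min_le_left _ _)

end BM

/-- The clamping of time to `[0,T]`. -/
def clamp (T t : ℝ) : ℝ := max 0 (min T t)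

theorem clamp_mem {T : ℝ} (hT : 0 ≤ T) (t : ℝ) : clamp T t ∈ Icc 0 T :=
  ⟨le_max_left _ _, max_le hT (min_le_left _ _)⟩

theorem clamp_of_mem {T t : ℝ} (ht : t ∈ Icc 0 T) : clamp T t = t := by
  rw [clamp, min_eq_right ht.2, max_eq_right ht.1]

theorem measurable_clamp (T : ℝ) : Measurable (clamp T) := by unfold clamp; fun_prop

/-- Existence of a bounded solution of the finite difference equation. -/
theorem exists_fd_solution {Λ₁ : Finset (Sp d)} {h T : ℝ} {a : Sp d → TFn d}
    {c f : TFn d} {g : Fn d} (hT : 0 ≤ T) (ha : ∀ l ∈ Λ₁, BM (a l)) (hc : BM c)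
    (hf : BM f) (hg : BM fun _ => g) :
    ∃ u, BM u ∧ ∀ t x, u t x = g x + ∫ s in 0..clamp T t,
      (fdo Λ₁ h a c s (u s) x + f s x) := by
  let Φ : TFn d → TFn d := fun u t x =>
    g x + ∫ s in 0..clamp T t, (fdo Λ₁ h a c s (u s) x + f s x)
  have hΦ : ∀ u, BM u → BM (Φ u) := fun u hu =>
    hg.add (((BM.fdo ha hc hu).add hf).primitive hT)
  obtain ⟨κ, hκ0, hκ⟩ : ∃ κ > 0, ∀ t x, ∑ l ∈ Λ₁, |a l t x| * 2 + |c t x| ≤ κ := by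
    have h1 : ∀ l, ∃ C, l ∈ Λ₁ → ∀ t x, |a l t x| ≤ C := by
      intro l
      by_cases hl : l ∈ Λ₁
      · obtain ⟨C, hC⟩ := (ha l hl).2; exact ⟨C, fun _ => hC⟩
      · exact ⟨0, fun h => absurd h hl⟩
    choose C hC using h1
    obtain ⟨C', hC'⟩ := hc.2
    refine ⟨max 1 (∑ l ∈ Λ₁, C l * 2 + C'), by positivity, fun t x => le_max_of_le_right ?_⟩
    gcongr with l hl
    · exact hC l hl t x
    · exact hC' t x
  have hlip : ∀ (v w : Fn d) (B : ℝ) (t : ℝ) (x : Sp d), (∀ y, |v y - w y| ≤ B) →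
      |fdo Λ₁ h a c t v x - fdo Λ₁ h a c t w x| ≤ κ * B := by
    intro v w B t x hB
    have hB0 : 0 ≤ B := (abs_nonneg _).trans (hB 0)
    have e1 : fdo Λ₁ h a c t v x - fdo Λ₁ h a c t w x =
        ∑ l ∈ Λ₁, a l t x * ((v (x + h • l) - w (x + h • l)) - (v x - w x))
          - c t x * (v x - w x) := by
      simp only [fdo]
      rw [sub_sub_sub_comm, ← sum_sub_distrib, ← mul_sub]
      congr 1
      exact sum_congr rfl fun l _ => by ring
    rw [e1]
    calc _ ≤ |∑ l ∈ Λ₁, a l t x * ((v (x + h • l) - w (x + h • l)) - (v x - w x))|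
          + |c t x * (v x - w x)| := abs_sub _ _
      _ ≤ ∑ l ∈ Λ₁, |a l t x| * (2 * B) + |c t x| * B := by
          refine add_le_add ((abs_sum_le_sum_abs _ _).trans
            (sum_le_sum fun l _ => ?_)) ?_
          · rw [abs_mul]
            gcongr
            refine (abs_sub _ _).trans ?_
            linarith [hB (x + h • l), hB x]
          · rw [abs_mul]; gcongr; exact hB x
      _ = (∑ l ∈ Λ₁, |a l t x| * 2 + |c t x|) * B := by
          rw [add_mul, sum_mul]; congr 1; exact sum_congr rfl fun l _ => by ring
      _ ≤ κ * B := by gcongr; exact hκ t x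
  let U : ℕ → TFn d := fun n => Φ^[n] fun _ _ => 0
  have hU : ∀ n, BM (U n) := by
    intro n
    induction n with
    | zero => exact BM.const 0
    | succ n ih =>
      change BM (Φ^[n + 1] fun _ _ => 0)
      rw [Function.iterate_succ_apply']; exact hΦ _ ih
  have hUs : ∀ n, U (n + 1) = Φ (U n) := fun n => Function.iterate_succ_apply' _ _ _
  obtain ⟨B, hB⟩ := (hU 1).2
  have hB0 : 0 ≤ B := (abs_nonneg _).trans (hB 0 0)
  have hdiff : ∀ n t x, |U (n + 1) t x - U n t x| ≤
      B * (1 / 2) ^ n * Real.exp (2 * κ * clamp T t) := by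
    intro n
    induction n with
    | zero =>
      intro t x
      have : U 0 t x = 0 := rfl
      rw [this, sub_zero, pow_zero, mul_one]
      refine (hB t x).trans (le_mul_of_one_le_right hB0 (Real.one_le_exp ?_))
      have := (clamp_mem hT t).1
      positivity
    | succ n ih =>
      intro t x
      have hct := clamp_mem hT t
      rw [hUs (n + 1)]
      have e1 : Φ (U (n + 1)) t x - Φ (U n) t x = ∫ s in 0..clamp T t,
          (fdo Λ₁ h a c s (U (n + 1) s) x - fdo Λ₁ h a c s (U n s) x) := by
        simp only [Φ]
        rw [add_sub_add_left_eq_sub, ← intervalIntegral.integral_sub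
          (((BM.fdo ha hc (hU _)).add hf).intervalIntegrable x _ _)
          (((BM.fdo ha hc (hU _)).add hf).intervalIntegrable x _ _)]
        congr 1; funext s; ring
      rw [← hUs n] at e1
      rw [e1]
      have h2 : ∀ s ∈ Ioc 0 (clamp T t), ‖fdo Λ₁ h a c s (U (n + 1) s) x -
          fdo Λ₁ h a c s (U n s) x‖ ≤ κ * (B * (1 / 2) ^ n * Real.exp (2 * κ * s)) := by
        intro s hs
        refine hlip _ _ _ _ _ fun y => ?_
        have := ih s y
        rwa [clamp_of_mem ⟨hs.1.le, hs.2.trans hct.2⟩] at this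
      refine (intervalIntegral.norm_integral_le_of_norm_le hct.1 (ae_of_all _ h2)
        (Continuous.intervalIntegrable (by fun_prop) _ _)).trans ?_
      have h3 : ∫ s in 0..clamp T t, κ * (B * (1 / 2) ^ n * Real.exp (2 * κ * s)) =
          B * (1 / 2) ^ (n + 1) * (Real.exp (2 * κ * clamp T t) - 1) := by
        rw [intervalIntegral.integral_eq_sub_of_hasDerivAt
          (f := fun s => B * (1 / 2) ^ (n + 1) * Real.exp (2 * κ * s))]
        · simp; ring
        · intro s _
          have := (((hasDerivAt_id s).const_mul (2 * κ)).exp).const_mul (B * (1 / 2) ^ (n + 1))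
          refine this.congr_deriv ?_
          simp only [id, mul_one, pow_succ]; ring
        · exact Continuous.intervalIntegrable (by fun_prop) _ _
      rw [h3]
      gcongr
      linarith
  set E := Real.exp (2 * κ * T)
  have hdiff' : ∀ t x n, dist (U n t x) (U (n + 1) t x) ≤ B * E * (1 / 2) ^ n := by
    intro t x n
    rw [dist_comm, Real.dist_eq]
    refine (hdiff n t x).trans ?_
    rw [mul_right_comm]
    gcongr
    exact Real.exp_le_exp.2 (by have := (clamp_mem hT t).2; gcongr)
  have hcau : ∀ t x, ∃ y, Tendsto (fun n => U n t x) atTop (nhds y) := fun t x =>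
    cauchySeq_tendsto_of_complete (cauchySeq_of_le_geometric _ _ (by norm_num) (hdiff' t x))
  choose u hu using hcau
  have hub : ∀ n t x, |U n t x| ≤ B * E / (1 - 1 / 2) := by
    intro n t x
    have h1 := dist_le_of_le_geometric_of_tendsto₀ (1 / 2) (B * E) (by norm_num) (hdiff' t x) (hu t x)
    have h2 : ∀ n, dist (U 0 t x) (U n t x) ≤ B * E / (1 - 1 / 2) := by
      intro n
      refine (dist_le_range_sum_of_dist_le n fun {k} _ => hdiff' t x k).trans ?_
      rw [← mul_sum]
      have h3 := (summable_geometric_of_lt_one (r := (1 / 2 : ℝ)) (by norm_num)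
        (by norm_num)).sum_le_tsum (Finset.range n) (fun i _ => by positivity)
      rw [tsum_geometric_of_lt_one (by norm_num) (by norm_num)] at h3
      exact (mul_le_mul_of_nonneg_left h3 (by positivity)).trans_eq (div_eq_mul_inv _ _).symm
    have := h2 n
    rwa [dist_comm, Real.dist_eq, show U 0 t x = 0 from rfl, sub_zero] at this
  have huM : BM u := by
    refine ⟨measurable_of_tendsto_metrizable (fun n => (hU n).1)
      (tendsto_pi_nhds.2 fun z => hu z.1 z.2), _, fun t x =>
      le_of_tendsto (hu t x).abs (.of_forall fun n => hub n t x)⟩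
  refine ⟨u, huM, fun t x => ?_⟩
  have h1 : Tendsto (fun n => U (n + 1) t x) atTop (nhds (u t x)) :=
    (hu t x).comp (Filter.tendsto_add_atTop_nat 1)
  refine tendsto_nhds_unique h1 ?_
  simp only [hUs]
  refine Tendsto.const_add _ ?_
  obtain ⟨Cf, hCf⟩ := hf.2
  refine intervalIntegral.tendsto_integral_filter_of_dominated_convergence
    (fun _ => κ * (B * E / (1 - 1 / 2)) + Cf) ?_ ?_ (by simp) ?_
  · exact Filter.Eventually.of_forall fun n =>
      (((BM.fdo ha hc (hU n)).add hf).measurable_time x).aestronglyMeasurable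
  · refine Filter.Eventually.of_forall fun n => ae_of_all _ fun s _ => ?_
    refine (norm_add_le _ _).trans (add_le_add ?_ (hCf s x))
    have := hlip (U n s) (fun _ => 0) (B * E / (1 - 1 / 2)) s x fun y => by
      rw [sub_zero]; exact hub n s y
    have h0 : fdo Λ₁ h a c s (fun _ => 0) x = 0 := by simp [fdo]
    rwa [h0, sub_zero] at this
  · refine ae_of_all _ fun s _ => ?_
    refine Tendsto.add_const _ ?_
    unfold fdo
    exact (tendsto_finsetSum _ fun l _ => ((hu s _).sub (hu s _)).const_mul _).sub
      ((hu s _).const_mul _)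

/-! ### Regularity of solutions of finite difference equations -/

/-- Jointly measurable bounded functions, Lipschitz in `x`. -/
def LipT (ψ : TFn d) : Prop :=
  BM ψ ∧ ∃ C, ∀ t x y, |ψ t (x + y) - ψ t x| ≤ C * ‖y‖

/-- Functions whose derivatives in `x` up to order `n` are bounded, jointly measurable and Lipschitz
in `x`. -/
def SmT : ℕ → TFn d → Prop
  | 0, ψ => LipT ψ
  | n + 1, ψ => LipT ψ ∧ (∀ t, Differentiable ℝ (ψ t)) ∧ ∀ v, SmT n fun t x => fderiv ℝ (ψ t) x v

theorem LipT.exists_nonneg {ψ : TFn d} (h : LipT ψ) :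
    ∃ C, 0 ≤ C ∧ (∀ t x, |ψ t x| ≤ C) ∧ ∀ t x y, |ψ t (x + y) - ψ t x| ≤ C * ‖y‖ := by
  obtain ⟨⟨-, C, hC⟩, C', hC'⟩ := h
  refine ⟨max C C', ((abs_nonneg _).trans (hC 0 0)).trans (le_max_left _ _),
    fun t x => (hC t x).trans (le_max_left _ _), fun t x y => (hC' t x y).trans ?_⟩
  gcongr
  exact le_max_right _ _

namespace LipT

variable {φ ψ : TFn d}

theorem const (a : ℝ) : LipT (d := d) fun _ _ => a := ⟨BM.const a, 0, fun t x y => by simp⟩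

theorem add (hφ : LipT φ) (hψ : LipT ψ) : LipT fun t x => φ t x + ψ t x := by
  refine ⟨hφ.1.add hψ.1, ?_⟩
  obtain ⟨C, hC⟩ := hφ.2
  obtain ⟨C', hC'⟩ := hψ.2
  refine ⟨C + C', fun t x y => ?_⟩
  rw [add_sub_add_comm, add_mul]
  exact (abs_add_le _ _).trans (add_le_add (hC t x y) (hC' t x y))

theorem mul (hφ : LipT φ) (hψ : LipT ψ) : LipT fun t x => φ t x * ψ t x := by
  refine ⟨hφ.1.mul hψ.1, ?_⟩
  obtain ⟨C, hC0, hC, hC1⟩ := hφ.exists_nonneg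
  obtain ⟨C', hC0', hC', hC1'⟩ := hψ.exists_nonneg
  refine ⟨C * C' + C * C', fun t x y => ?_⟩
  have e : φ t (x + y) * ψ t (x + y) - φ t x * ψ t x =
      φ t (x + y) * (ψ t (x + y) - ψ t x) + (φ t (x + y) - φ t x) * ψ t x := by ring
  rw [e]
  refine (abs_add_le _ _).trans ?_
  rw [abs_mul, abs_mul, add_mul]
  refine add_le_add ?_ ?_
  · rw [mul_assoc]
    exact mul_le_mul (hC _ _) (hC1' t x y) (abs_nonneg _) hC0
  · rw [mul_right_comm]
    exact mul_le_mul (hC1 t x y) (hC' _ _) (abs_nonneg _) (by positivity)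

theorem shift (hφ : LipT φ) (y : Sp d) : LipT fun t x => φ t (x + y) := by
  refine ⟨hφ.1.shift y, ?_⟩
  obtain ⟨C, hC⟩ := hφ.2
  exact ⟨C, fun t x z => by
    simpa only [add_right_comm x z y] using hC t (x + y) z⟩

theorem continuous (hφ : LipT φ) (t : ℝ) : Continuous (φ t) := by
  obtain ⟨C, hC0, -, hC⟩ := hφ.exists_nonneg
  refine (LipschitzWith.of_dist_le_mul (K := ⟨C, hC0⟩) fun x y => ?_).continuous
  have := hC t y (x - y)
  rwa [add_sub_cancel, ← dist_eq_norm] at this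

end LipT

namespace SmT

variable {φ ψ : TFn d} {n : ℕ}

theorem lip (h : SmT n ψ) : LipT ψ := by
  cases n with
  | zero => exact h
  | succ n => exact h.1

theorem of_succ (h : SmT (n + 1) ψ) : SmT n ψ := by
  induction n generalizing ψ with
  | zero => exact h.1
  | succ n ih => exact ⟨h.1, h.2.1, fun v => ih (h.2.2 v)⟩

theorem const (a : ℝ) : SmT n fun (_ : ℝ) (_ : Sp d) => a := by
  induction n generalizing a with
  | zero => exact LipT.const a
  | succ n ih =>
    refine ⟨LipT.const a, fun t => differentiable_const _, fun v => ?_⟩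
    simpa using ih 0

theorem add (hφ : SmT n φ) (hψ : SmT n ψ) : SmT n fun t x => φ t x + ψ t x := by
  induction n generalizing φ ψ with
  | zero => exact LipT.add hφ hψ
  | succ n ih =>
    refine ⟨LipT.add hφ.1 hψ.1, fun t => (hφ.2.1 t).add (hψ.2.1 t), fun v => ?_⟩
    convert ih (hφ.2.2 v) (hψ.2.2 v) using 3 with t x
    rw [fderiv_fun_add (hφ.2.1 t x) (hψ.2.1 t x)]; rfl

theorem mul (hφ : SmT n φ) (hψ : SmT n ψ) : SmT n fun t x => φ t x * ψ t x := by
  induction n generalizing φ ψ with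
  | zero => exact LipT.mul hφ hψ
  | succ n ih =>
    refine ⟨LipT.mul hφ.1 hψ.1, fun t => (hφ.2.1 t).mul (hψ.2.1 t), fun v => ?_⟩
    convert (ih hφ.of_succ (hψ.2.2 v)).add (ih hψ.of_succ (hφ.2.2 v)) using 3 with t x
    rw [fderiv_fun_mul (hφ.2.1 t x) (hψ.2.1 t x)]; rfl

theorem neg (hφ : SmT n φ) : SmT n fun t x => -φ t x := by
  simpa using (const (-1)).mul hφ

theorem sub (hφ : SmT n φ) (hψ : SmT n ψ) : SmT n fun t x => φ t x - ψ t x := by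
  simpa [sub_eq_add_neg] using hφ.add hψ.neg

theorem shift (hφ : SmT n φ) (y : Sp d) : SmT n fun t x => φ t (x + y) := by
  induction n generalizing φ with
  | zero => exact LipT.shift hφ y
  | succ n ih =>
    refine ⟨LipT.shift hφ.1 y, fun t => (hφ.2.1 t).comp (differentiable_id.add_const y),
      fun v => ?_⟩
    convert ih (hφ.2.2 v) using 3 with t x
    rw [fderiv_comp_add_right]

theorem sum {ι : Type*} (s : Finset ι) {f : ι → TFn d} (h : ∀ i ∈ s, SmT n (f i)) :
    SmT n fun t x => ∑ i ∈ s, f i t x := by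
  classical
  induction s using Finset.induction_on with
  | empty => simpa using const 0
  | insert i s hi ih =>
    simp only [sum_insert hi]
    exact (h i (by simp)).add (ih fun j hj => h j (by simp [hj]))

/-- First order Taylor estimate. -/
theorem taylor (h : SmT 1 ψ) :
    ∃ C, 0 ≤ C ∧ ∀ t x y, |ψ t (x + y) - ψ t x - fderiv ℝ (ψ t) x y| ≤ C * ‖y‖ ^ 2 := by
  choose C hC0 _ hC using fun i : Fin d => LipT.exists_nonneg (h.2.2 (e i))
  refine ⟨∑ i, C i, sum_nonneg fun i _ => hC0 i, fun t x y => ?_⟩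
  have hD : ∀ s : ℝ, HasDerivAt (fun s : ℝ => ψ t (x + s • y)) (fderiv ℝ (ψ t) (x + s • y) y) s := by
    intro s
    have h2 : HasDerivAt (fun s : ℝ => x + s • y) y s := by
      simpa using ((hasDerivAt_id s).smul_const y).const_add x
    exact (h.2.1 t (x + s • y)).hasFDerivAt.comp_hasDerivAt s h2
  obtain ⟨s, hs, hs'⟩ := exists_hasDerivAt_eq_slope (fun s : ℝ => ψ t (x + s • y))
    (fun s => fderiv ℝ (ψ t) (x + s • y) y) zero_lt_one
    (fun s _ => (hD s).continuousAt.continuousWithinAt) (fun s _ => hD s)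
  simp only [one_smul, zero_smul, add_zero, sub_zero, div_one] at hs'
  rw [← hs']
  have e1 : ∀ z, fderiv ℝ (ψ t) z y = ∑ i, y i * fderiv ℝ (ψ t) z (e i) := by
    intro z
    conv_lhs => rw [← sum_smul_e y]
    simp only [map_sum, map_smul, smul_eq_mul]
  rw [e1, e1, ← sum_sub_distrib, sum_mul]
  refine (abs_sum_le_sum_abs _ _).trans (sum_le_sum fun i _ => ?_)
  rw [← mul_sub, abs_mul]
  have h3 : |y i| ≤ ‖y‖ := PiLp.norm_apply_le y i
  have h4 := hC i t x (s • y)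
  have h5 : ‖s • y‖ ≤ ‖y‖ := by
    rw [norm_smul, Real.norm_eq_abs, abs_of_pos hs.1]
    exact mul_le_of_le_one_left (norm_nonneg _) hs.2.le
  calc _ ≤ ‖y‖ * (C i * ‖y‖) := by
        gcongr
        refine h4.trans ?_
        have := hC0 i
        gcongr
    _ = _ := by ring

end SmT

section Regularity

variable {Λ₁ : Finset (Sp d)} {h T c₀ : ℝ} {a : Sp d → TFn d} {c : TFn d}

theorem BM.exists_bound_coef (ha : ∀ l ∈ Λ₁, BM (a l)) (hc : BM c) :
    ∃ κ, ∀ t x, ∑ l ∈ Λ₁, a l t x + c t x ≤ κ := by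
  obtain ⟨κ, hκ⟩ := ((BM.sum Λ₁ ha).add hc).2
  exact ⟨κ, fun t x => (le_abs_self _).trans (hκ t x)⟩

/-- Stability for solutions of finite difference equations with bounded measurable data. -/
theorem fd_stable {v G : TFn d} {v₀ : Fn d} {b ε : ℝ} (hT : 0 ≤ T) (hc₀ : 0 < c₀)
    (ha : ∀ l ∈ Λ₁, BM (a l)) (hc : BM c)
    (ha0 : ∀ l ∈ Λ₁, ∀ t x, 0 ≤ a l t x) (hc0 : ∀ t x, c₀ ≤ c t x)
    (hG : ∀ x, IntervalIntegrable (fun s => G s x) volume 0 T)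
    (hv : ∀ t ∈ Icc 0 T, ∀ x, v t x = v₀ x + ∫ s in 0..t, G s x)
    (hb : ∃ C, ∀ t ∈ Icc 0 T, ∀ x, |v t x| ≤ C) (h0 : ∀ x, |v₀ x| ≤ b) (hε : 0 ≤ ε)
    (hle : ∀ t ∈ Icc 0 T, ∀ x, |G t x - fdo Λ₁ h a c t (v t) x| ≤ ε) :
    ∀ t ∈ Icc 0 T, ∀ x, |v t x| ≤ b + ε / c₀ := by
  obtain ⟨κ, hκ⟩ := BM.exists_bound_coef ha hc
  have ha' : ∀ l ∈ Λ₁, ∀ t ∈ Icc 0 T, ∀ x, 0 ≤ a l t x := fun l hl t _ x => ha0 l hl t x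
  obtain ⟨C, hC⟩ := hb
  have hb0 : 0 ≤ b := (abs_nonneg _).trans (h0 0)
  have hB : ∀ t ∈ Icc 0 T, ∀ x, ε ≤ c t x * (b + ε / c₀) := by
    intro t _ x
    have : 0 < c t x := hc₀.trans_le (hc0 t x)
    calc ε = c₀ * (ε / c₀) := by field_simp
      _ ≤ c t x * (b + ε / c₀) :=
        mul_le_mul (hc0 t x) (by linarith) (by positivity) this.le
  have hb' : b ≤ b + ε / c₀ := by have : 0 ≤ ε / c₀ := by positivity
                                  linarith
  have h1 := fd_le (h := h) (B := b + ε / c₀) hT ha' (fun t _ x => hc₀.le.trans (hc0 t x)) (fun t _ x => hκ t x) hG hv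
    ⟨C, fun t ht x => (le_abs_self _).trans (hC t ht x)⟩
    (fun x => ((le_abs_self _).trans (h0 x)).trans hb')
    (fun t ht x => by linarith [(abs_le.1 (hle t ht x)).2, hB t ht x])
  have h2 := fd_le (h := h) (B := b + ε / c₀) (v := fun t x => -v t x) (G := fun t x => -G t x)
    (v₀ := fun x => -v₀ x) hT ha' (fun t _ x => hc₀.le.trans (hc0 t x)) (fun t _ x => hκ t x)
    (fun x => (hG x).neg)
    (fun t ht x => by rw [hv t ht x, intervalIntegral.integral_neg]; ring)
    ⟨C, fun t ht x => (neg_le_abs _).trans (hC t ht x)⟩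
    (fun x => ((neg_le_abs _).trans (h0 x)).trans hb')
    (fun t ht x => by rw [fdo_neg]; linarith [(abs_le.1 (hle t ht x)).1, hB t ht x])
  intro t ht x
  exact abs_le.2 ⟨by linarith [h2 t ht x], h1 t ht x⟩

/-- The equation satisfied on `[0,T]`. -/
def FDSol (Λ₁ : Finset (Sp d)) (h T : ℝ) (a : Sp d → TFn d) (c f : TFn d)
    (g : Fn d) (u : TFn d) : Prop :=
  BM u ∧ ∀ t x, u t x = g x + ∫ s in 0..clamp T t, (fdo Λ₁ h a c s (u s) x + f s x)

theorem FDSol.clamp_eq {f : TFn d} {g : Fn d} {u : TFn d}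
    (hu : FDSol Λ₁ h T a c f g u) (hT : 0 ≤ T) (t : ℝ) (x : Sp d) : u t x = u (clamp T t) x := by
  rw [hu.2 t, hu.2 (clamp T t), clamp_of_mem (clamp_mem hT t)]

theorem FDSol.integrable {f : TFn d} {g : Fn d} {u : TFn d}
    (hu : FDSol Λ₁ h T a c f g u) (ha : ∀ l ∈ Λ₁, BM (a l)) (hc : BM c) (hf : BM f) (x : Sp d)
    (t t' : ℝ) : IntervalIntegrable (fun s => fdo Λ₁ h a c s (u s) x + f s x) volume t t' :=
  ((BM.fdo ha hc hu.1).add hf).intervalIntegrable x t t'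

/-- Comparison of a bounded measurable function with a solution. -/
theorem FDSol.lip {f : TFn d} {g : Fn d} {u : TFn d} (hT : 0 ≤ T) (hc₀ : 0 < c₀)
    (ha : ∀ l ∈ Λ₁, LipT (a l)) (hc : LipT c) (hf : LipT f) (hg : LipT fun _ => g)
    (ha0 : ∀ l ∈ Λ₁, ∀ t x, 0 ≤ a l t x) (hc0 : ∀ t x, c₀ ≤ c t x)
    (hu : FDSol Λ₁ h T a c f g u) : LipT u := by
  refine ⟨hu.1, ?_⟩
  obtain ⟨U, hU⟩ := hu.1.2
  have hU0 : 0 ≤ U := (abs_nonneg _).trans (hU 0 0)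
  have h1 : ∀ l, ∃ C, 0 ≤ C ∧ (l ∈ Λ₁ → ∀ t x y, |a l t (x + y) - a l t x| ≤ C * ‖y‖) := by
    intro l
    by_cases hl : l ∈ Λ₁
    · obtain ⟨C, hC0, -, hC⟩ := (ha l hl).exists_nonneg; exact ⟨C, hC0, fun _ => hC⟩
    · exact ⟨0, le_rfl, fun h => absurd h hl⟩
  choose Ca hCa0 hCa using h1
  obtain ⟨Cc, hCc0, -, hCc⟩ := hc.exists_nonneg
  obtain ⟨Cf, hCf0, -, hCf⟩ := hf.exists_nonneg
  obtain ⟨Cg, hCg0, -, hCg⟩ := hg.exists_nonneg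
  refine ⟨Cg + (∑ l ∈ Λ₁, Ca l * (2 * U) + Cc * U + Cf) / c₀, fun t x y => ?_⟩
  have hint := hu.integrable (fun l hl => (ha l hl).1) hc.1 hf.1
  have key := fd_stable (h := h) (v := fun t x => u t (x + y) - u t x)
    (G := fun s x => (fdo Λ₁ h a c s (u s) (x + y) + f s (x + y)) -
      (fdo Λ₁ h a c s (u s) x + f s x))
    (v₀ := fun x => g (x + y) - g x) (b := Cg * ‖y‖)
    (ε := (∑ l ∈ Λ₁, Ca l * (2 * U) + Cc * U + Cf) * ‖y‖)
    hT hc₀ (fun l hl => (ha l hl).1) hc.1 ha0 hc0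
    (fun x => (hint _ _ _).sub (hint _ _ _))
    (fun t ht x => by
      rw [hu.2 t (x + y), hu.2 t x, clamp_of_mem ht,
        intervalIntegral.integral_sub (hint _ _ _) (hint _ _ _)]
      ring)
    ⟨U + U, fun t _ x => (abs_sub _ _).trans (add_le_add (hU _ _) (hU _ _))⟩
    (fun x => hCg 0 x y)
    (mul_nonneg (add_nonneg (add_nonneg (sum_nonneg fun l _ =>
      mul_nonneg (hCa0 l) (by positivity)) (by positivity)) hCf0) (norm_nonneg _))
    (fun t ht x => by
      have e1 : (fdo Λ₁ h a c t (u t) (x + y) + f t (x + y)) - (fdo Λ₁ h a c t (u t) x + f t x) -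
          fdo Λ₁ h a c t (fun x => u t (x + y) - u t x) x =
          ∑ l ∈ Λ₁, (a l t (x + y) - a l t x) * (u t (x + y + h • l) - u t (x + y))
            - (c t (x + y) - c t x) * u t (x + y) + (f t (x + y) - f t x) := by
        have e2 : ∑ l ∈ Λ₁, (a l t (x + y) - a l t x) * (u t (x + y + h • l) - u t (x + y)) =
            ∑ l ∈ Λ₁, a l t (x + y) * (u t (x + y + h • l) - u t (x + y))
            - ∑ l ∈ Λ₁, a l t x * (u t (x + h • l) - u t x)
            - ∑ l ∈ Λ₁, a l t x * (u t (x + h • l + y) - u t (x + h • l) - (u t (x + y) - u t x))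
            := by
          rw [← sum_sub_distrib, ← sum_sub_distrib]
          refine sum_congr rfl fun l _ => ?_
          rw [add_right_comm x y (h • l)]; ring
        rw [e2]
        simp only [fdo]
        ring
      rw [e1]
      refine (abs_add_le _ _).trans ?_
      rw [add_mul, add_mul]
      refine add_le_add ((abs_sub _ _).trans (add_le_add ?_ ?_)) (hCf t x y)
      · rw [sum_mul]
        refine (abs_sum_le_sum_abs _ _).trans (sum_le_sum fun l hl => ?_)
        rw [abs_mul, mul_right_comm]
        refine mul_le_mul (hCa l hl t x y) ?_ (abs_nonneg _)
          (mul_nonneg (hCa0 l) (norm_nonneg _))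
        refine (abs_sub _ _).trans ?_
        linarith [hU t (x + y + h • l), hU t (x + y)]
      · rw [abs_mul, mul_right_comm]
        exact mul_le_mul (hCc t x y) (hU _ _) (abs_nonneg _) (by positivity))
    (clamp T t) (clamp_mem hT t) x
  rw [← hu.clamp_eq hT, ← hu.clamp_eq hT] at key
  refine key.trans (le_of_eq ?_)
  ring

theorem FDSol.lin_comb {f f' : TFn d} {g g' : Fn d} {u v : TFn d}
    (ha : ∀ l ∈ Λ₁, BM (a l)) (hc : BM c) (hf : BM f) (hf' : BM f')
    (hu : FDSol Λ₁ h T a c f g u) (hv : FDSol Λ₁ h T a c f' g' v) (r s : ℝ) :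
    FDSol Λ₁ h T a c (fun t x => r * f t x + s * f' t x) (fun x => r * g x + s * g' x)
      (fun t x => r * u t x + s * v t x) := by
  refine ⟨((BM.const r).mul hu.1).add ((BM.const s).mul hv.1), fun t x => ?_⟩
  have hiu := hu.integrable ha hc hf x 0 (clamp T t)
  have hiv := hv.integrable ha hc hf' x 0 (clamp T t)
  have e : ∀ q, fdo Λ₁ h a c q (fun x => r * u q x + s * v q x) x + (r * f q x + s * f' q x) =
      r * (fdo Λ₁ h a c q (u q) x + f q x) + s * (fdo Λ₁ h a c q (v q) x + f' q x) := by
    intro q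
    have e2 : ∑ l ∈ Λ₁, a l q x * (r * u q (x + h • l) + s * v q (x + h • l) -
        (r * u q x + s * v q x)) = r * ∑ l ∈ Λ₁, a l q x * (u q (x + h • l) - u q x)
          + s * ∑ l ∈ Λ₁, a l q x * (v q (x + h • l) - v q x) := by
      rw [mul_sum, mul_sum, ← sum_add_distrib]
      exact sum_congr rfl fun l _ => by ring
    simp only [fdo, e2]
    ring
  simp only [e]
  rw [intervalIntegral.integral_add (hiu.const_mul r) (hiv.const_mul s),
    intervalIntegral.integral_const_mul, intervalIntegral.integral_const_mul]
  rw [hu.2 t x, hv.2 t x]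
  ring

/-- Uniqueness for the stopped equation. -/
theorem FDSol.unique {f : TFn d} {g : Fn d} {u v : TFn d} (hT : 0 ≤ T)
    (hc₀ : 0 < c₀) (ha : ∀ l ∈ Λ₁, BM (a l)) (hc : BM c) (hf : BM f)
    (ha0 : ∀ l ∈ Λ₁, ∀ t x, 0 ≤ a l t x) (hc0 : ∀ t x, c₀ ≤ c t x)
    (hu : FDSol Λ₁ h T a c f g u) (hv : FDSol Λ₁ h T a c f g v) : u = v := by
  funext t x
  have hw := hu.lin_comb ha hc hf hf hv 1 (-1)
  obtain ⟨U, hU⟩ := hw.1.2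
  have key := fd_stable (h := h) (v := fun t x => 1 * u t x + -1 * v t x)
    (v₀ := fun x => 1 * g x + -1 * g x) (b := 0) (ε := 0) hT hc₀ ha hc ha0 hc0 (fun x => hw.integrable ha hc (((BM.const 1).mul hf).add ((BM.const (-1)).mul hf)) x 0 T)
    (fun t ht x => (hw.2 t x).trans (by rw [clamp_of_mem ht])) ⟨U, fun t _ => hU t⟩
    (fun x => by simp) le_rfl (fun t _ x => by simp) (clamp T t) (clamp_mem hT t) x
  have := abs_nonpos_iff.1 (key.trans (by simp))
  linarith [hw.clamp_eq hT t x]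

/-- The free term of the differentiated equation. -/
def dfree (Λ₁ : Finset (Sp d)) (h : ℝ) (a : Sp d → TFn d) (c f u : TFn d) (v : Sp d)
    (t : ℝ) (x : Sp d) : ℝ :=
  fderiv ℝ (f t) x v + (∑ l ∈ Λ₁, fderiv ℝ (a l t) x v * (u t (x + h • l) - u t x)
    - fderiv ℝ (c t) x v * u t x)

theorem SmT.dfree {n : ℕ} {f u : TFn d} (ha : ∀ l ∈ Λ₁, SmT (n + 1) (a l))
    (hc : SmT (n + 1) c) (hf : SmT (n + 1) f) (hu : SmT n u) (v : Sp d) :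
    SmT n (dfree Λ₁ h a c f u v) :=
  (hf.2.2 v).add ((SmT.sum _ fun l hl => ((ha l hl).2.2 v).mul ((hu.shift _).sub hu)).sub
    ((hc.2.2 v).mul hu))

/-- The difference quotients of a solution converge to the solution of the differentiated
equation. -/
theorem FDSol.taylor {f u : TFn d} {g : Fn d} (hT : 0 ≤ T)
    (hc₀ : 0 < c₀) (ha : ∀ l ∈ Λ₁, SmT 1 (a l)) (hc : SmT 1 c) (hf : SmT 1 f)
    (hg : SmT 1 fun _ => g) (ha0 : ∀ l ∈ Λ₁, ∀ t x, 0 ≤ a l t x) (hc0 : ∀ t x, c₀ ≤ c t x)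
    (hu : FDSol Λ₁ h T a c f g u) (w : Sp d → TFn d)
    (hw : ∀ y, FDSol Λ₁ h T a c (dfree Λ₁ h a c f u y) (fun x => fderiv ℝ g x y) (w y)) :
    ∃ C, ∀ t x y, |u t (x + y) - u t x - w y t x| ≤ C * ‖y‖ ^ 2 := by
  have hul : LipT u := hu.lip hT hc₀ (fun l hl => (ha l hl).1) hc.1 hf.1 hg.1 ha0 hc0
  obtain ⟨U, hU0, hU, hUl⟩ := hul.exists_nonneg
  have h1 : ∀ l, ∃ C, 0 ≤ C ∧ (l ∈ Λ₁ → (∀ t x y, |a l t (x + y) - a l t x| ≤ C * ‖y‖) ∧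
      ∀ t x y, |a l t (x + y) - a l t x - fderiv ℝ (a l t) x y| ≤ C * ‖y‖ ^ 2) := by
    intro l
    by_cases hl : l ∈ Λ₁
    · obtain ⟨C, hC0, -, hC⟩ := (ha l hl).1.exists_nonneg
      obtain ⟨C', hC0', hC'⟩ := (ha l hl).taylor
      refine ⟨C + C', by positivity, fun _ => ⟨fun t x y => (hC t x y).trans ?_,
        fun t x y => (hC' t x y).trans ?_⟩⟩
      · gcongr; linarith
      · gcongr; linarith
    · exact ⟨0, le_rfl, fun h => absurd h hl⟩
  choose Ca hCa0 hCa using h1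
  obtain ⟨Cc, hCc0, -, hCc⟩ := hc.1.exists_nonneg
  obtain ⟨Cc', hCc0', hCc'⟩ := hc.taylor
  obtain ⟨Cf, hCf0, hCf⟩ := hf.taylor
  obtain ⟨Cg, hCg0, hCg⟩ := hg.taylor
  have hdf : ∀ y, BM (dfree Λ₁ h a c f u y) := fun y => (SmT.dfree (n := 0) ha hc hf hul y).1
  have haB : ∀ l ∈ Λ₁, BM (a l) := fun l hl => (ha l hl).1.1
  set E := ∑ l ∈ Λ₁, (Ca l * (2 * U) + Ca l * (2 * U)) + (Cc' * U + Cc * U) + Cf with hE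
  have hE0 : 0 ≤ E := add_nonneg (add_nonneg (sum_nonneg fun l _ =>
    (by have := hCa0 l; positivity)) (by positivity)) hCf0
  refine ⟨Cg + E / c₀, fun t x y => ?_⟩
  obtain ⟨V, hV⟩ := (hw y).1.2
  have hiu := hu.integrable haB hc.1.1 hf.1.1
  have hiw := (hw y).integrable haB hc.1.1 (hdf y)
  have key := fd_stable (h := h) (v := fun t x => u t (x + y) - u t x - w y t x)
    (G := fun s x => (fdo Λ₁ h a c s (u s) (x + y) + f s (x + y)) -
      (fdo Λ₁ h a c s (u s) x + f s x) - (fdo Λ₁ h a c s (w y s) x + dfree Λ₁ h a c f u y s x))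
    (v₀ := fun x => g (x + y) - g x - fderiv ℝ g x y) (b := Cg * ‖y‖ ^ 2)
    (ε := E * ‖y‖ ^ 2)
    hT hc₀ haB hc.1.1 ha0 hc0
    (fun x => ((hiu _ _ _).sub (hiu _ _ _)).sub (hiw _ _ _))
    (fun t ht x => by
      rw [hu.2 t (x + y), hu.2 t x, (hw y).2 t x, clamp_of_mem ht,
        intervalIntegral.integral_sub ((hiu _ _ _).sub (hiu _ _ _)) (hiw _ _ _),
        intervalIntegral.integral_sub (hiu _ _ _) (hiu _ _ _)]
      ring)
    ⟨U + U + V, fun t _ x => (abs_sub _ _).trans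
      (add_le_add ((abs_sub _ _).trans (add_le_add (hU _ _) (hU _ _))) (hV _ _))⟩
    (fun x => hCg 0 x y) (by positivity)
    (fun t ht x => by
      have e1 : (fdo Λ₁ h a c t (u t) (x + y) + f t (x + y)) - (fdo Λ₁ h a c t (u t) x + f t x) -
          (fdo Λ₁ h a c t (w y t) x + dfree Λ₁ h a c f u y t x) -
          fdo Λ₁ h a c t (fun x => u t (x + y) - u t x - w y t x) x =
          ∑ l ∈ Λ₁, ((a l t (x + y) - a l t x - fderiv ℝ (a l t) x y) * (u t (x + h • l) - u t x)
            + (a l t (x + y) - a l t x) *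
              ((u t (x + h • l + y) - u t (x + h • l)) - (u t (x + y) - u t x)))
            - ((c t (x + y) - c t x - fderiv ℝ (c t) x y) * u t x +
              (c t (x + y) - c t x) * (u t (x + y) - u t x))
            + (f t (x + y) - f t x - fderiv ℝ (f t) x y) := by
        have e2 : ∑ l ∈ Λ₁, ((a l t (x + y) - a l t x - fderiv ℝ (a l t) x y) *
              (u t (x + h • l) - u t x) + (a l t (x + y) - a l t x) *
              ((u t (x + h • l + y) - u t (x + h • l)) - (u t (x + y) - u t x))) =
            ∑ l ∈ Λ₁, a l t (x + y) * (u t (x + y + h • l) - u t (x + y))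
            - ∑ l ∈ Λ₁, a l t x * (u t (x + h • l) - u t x)
            - ∑ l ∈ Λ₁, a l t x * (w y t (x + h • l) - w y t x)
            - ∑ l ∈ Λ₁, fderiv ℝ (a l t) x y * (u t (x + h • l) - u t x)
            - ∑ l ∈ Λ₁, a l t x * (u t (x + h • l + y) - u t (x + h • l) - w y t (x + h • l)
              - (u t (x + y) - u t x - w y t x)) := by
          rw [← sum_sub_distrib, ← sum_sub_distrib, ← sum_sub_distrib,
            ← sum_sub_distrib]
          refine sum_congr rfl fun l _ => ?_
          rw [add_right_comm x y (h • l)]; ring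
        rw [e2]
        simp only [fdo, dfree]
        ring
      rw [e1]
      refine (abs_add_le _ _).trans ?_
      rw [hE, add_mul, add_mul]
      refine add_le_add ((abs_sub _ _).trans (add_le_add ?_ ?_)) (hCf t x y)
      · rw [sum_mul]
        refine (abs_sum_le_sum_abs _ _).trans (sum_le_sum fun l hl => ?_)
        refine (abs_add_le _ _).trans ?_
        rw [abs_mul, abs_mul, add_mul]
        refine add_le_add ?_ ?_
        · rw [mul_right_comm]
          refine mul_le_mul ((hCa l hl).2 t x y) ?_ (abs_nonneg _)
            (mul_nonneg (hCa0 l) (by positivity))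
          refine (abs_sub _ _).trans ?_
          linarith [hU t (x + h • l), hU t x]
        · calc _ ≤ (Ca l * ‖y‖) * (U * ‖y‖ + U * ‖y‖) := by
                refine mul_le_mul ((hCa l hl).1 t x y) ?_ (abs_nonneg _)
                  (mul_nonneg (hCa0 l) (by positivity))
                exact (abs_sub _ _).trans (add_le_add (hUl _ _ _) (hUl _ _ _))
            _ = _ := by ring
      · refine (abs_add_le _ _).trans ?_
        rw [abs_mul, abs_mul, add_mul]
        refine add_le_add ?_ ?_
        · rw [mul_right_comm]
          exact mul_le_mul (hCc' t x y) (hU _ _) (abs_nonneg _) (by positivity)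
        · calc _ ≤ (Cc * ‖y‖) * (U * ‖y‖) := by
                refine mul_le_mul (hCc t x y) (hUl _ _ _) (abs_nonneg _) (by positivity)
            _ = _ := by ring)
    (clamp T t) (clamp_mem hT t) x
  rw [← hu.clamp_eq hT, ← hu.clamp_eq hT, ← (hw y).clamp_eq hT] at key
  refine key.trans (le_of_eq ?_)
  ring

/-- Solutions of finite difference equations inherit the smoothness of the data. -/
theorem FDSol.smooth (hT : 0 ≤ T) (hc₀ : 0 < c₀) (ha0 : ∀ l ∈ Λ₁, ∀ t x, 0 ≤ a l t x)
    (hc0 : ∀ t x, c₀ ≤ c t x) (n : ℕ) :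
    ∀ {f u : TFn d} {g : Fn d} (_ : ∀ l ∈ Λ₁, SmT n (a l)) (_ : SmT n c)
    (_ : SmT n f) (_ : SmT n fun _ => g) (_ : FDSol Λ₁ h T a c f g u), SmT n u := by
  induction n with
  | zero => intro f u g ha hc hf hg hu; exact hu.lip hT hc₀ ha hc hf hg ha0 hc0
  | succ n ih =>
    intro f u g ha hc hf hg hu
    have hun := ih (fun l hl => (ha l hl).of_succ) hc.of_succ hf.of_succ hg.of_succ hu
    have hdf : ∀ v, SmT n (FDScheme.dfree Λ₁ h a c f u v) := fun v => SmT.dfree ha hc hf hun v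
    have haB : ∀ l ∈ Λ₁, BM (a l) := fun l hl => (ha l hl).1.1
    have h1 : ∀ {m : ℕ} {ψ : TFn d}, SmT (m + 1) ψ → SmT 1 ψ := by
      intro m ψ hψ
      exact ⟨hψ.1, hψ.2.1, fun v => (hψ.2.2 v).lip⟩
    choose w hwB hw using fun v => exists_fd_solution (h := h) hT haB hc.1.1 (hdf v).lip.1
      (g := fun x => fderiv ℝ g x v) (hg.2.2 v).lip.1
    have hws : ∀ v, FDSol Λ₁ h T a c (FDScheme.dfree Λ₁ h a c f u v) (fun x => fderiv ℝ g x v) (w v) :=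
      fun v => ⟨hwB v, hw v⟩
    obtain ⟨C, hC⟩ := hu.taylor hT hc₀ (fun l hl => h1 (ha l hl)) (h1 hc) (h1 hf) (h1 hg)
      ha0 hc0 w hws
    have hlin : ∀ r v s v', w (r • v + s • v') = fun t x => r * w v t x + s * w v' t x := by
      intro r v s v'
      have hA := (hws v).lin_comb haB hc.1.1 (hdf v).lip.1 (hdf v').lip.1 (hws v') r s
      refine (hws _).unique hT hc₀ haB hc.1.1 (hdf _).lip.1 ha0 hc0 ?_
      convert hA using 1
      · funext t x
        have e2 : ∑ l ∈ Λ₁, (r * fderiv ℝ (a l t) x v + s * fderiv ℝ (a l t) x v') *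
            (u t (x + h • l) - u t x) =
            r * ∑ l ∈ Λ₁, fderiv ℝ (a l t) x v * (u t (x + h • l) - u t x)
            + s * ∑ l ∈ Λ₁, fderiv ℝ (a l t) x v' * (u t (x + h • l) - u t x) := by
          rw [mul_sum, mul_sum, ← sum_add_distrib]
          exact sum_congr rfl fun l _ => by ring
        simp only [FDScheme.dfree, map_add, map_smul, smul_eq_mul, e2]
        ring
      · funext x
        simp
    have hder : ∀ t x, ∃ L : Sp d →L[ℝ] ℝ, (∀ v, L v = w v t x) ∧ HasFDerivAt (u t) L x := by
      intro t x
      let L : Sp d →ₗ[ℝ] ℝ :=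
        { toFun := fun v => w v t x
          map_add' := fun v v' => by simpa using congrFun (congrFun (hlin 1 v 1 v') t) x
          map_smul' := fun r v => by simpa using congrFun (congrFun (hlin r v 0 0) t) x }
      refine ⟨LinearMap.toContinuousLinearMap L, fun v => rfl, ?_⟩
      rw [hasFDerivAt_iff_isLittleO_nhds_zero]
      refine Asymptotics.IsBigO.trans_isLittleO (g := fun y : Sp d => ‖y‖ ^ 2) ?_ ?_
      · refine Asymptotics.IsBigO.of_bound C (.of_forall fun y => ?_)
        rw [norm_pow, norm_norm, Real.norm_eq_abs]
        exact hC t x y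
      · exact Asymptotics.isLittleO_norm_pow_id one_lt_two
    refine ⟨hun.lip, fun t x => ?_, fun v => ?_⟩
    · obtain ⟨L, -, hL⟩ := hder t x; exact hL.differentiableAt
    · have e : (fun t x => fderiv ℝ (u t) x v) = w v := by
        funext t x
        obtain ⟨L, hL1, hL⟩ := hder t x
        rw [hL.fderiv, hL1]
      rw [e]
      exact ih (fun l hl => (ha l hl).of_succ) hc.of_succ (hdf v) (hg.2.2 v) (hws v)

end Regularity

/-! ### A priori estimates for smooth data -/

theorem sq_integral {Y y : ℝ → ℝ} {y₀ t : ℝ} (ht : 0 ≤ t) (hY : IntervalIntegrable Y volume 0 t)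
    (hy : ∀ s ∈ Icc 0 t, y s = y₀ + ∫ r in 0..s, Y r) :
    y t ^ 2 = y₀ ^ 2 + ∫ s in 0..t, 2 * (y s * Y s) := by
  set f : ℝ → ℝ := fun s => ∫ r in 0..s, Y r with hf
  have hac : AbsolutelyContinuousOnInterval f 0 t :=
    hY.absolutelyContinuousOnInterval_intervalIntegral (by simp)
  have h1 := hac.integral_deriv_mul_eq_sub hac
  have hf0 : f 0 = 0 := by simp [hf]
  have hYf : IntervalIntegrable (fun s => f s * Y s) volume 0 t :=
    hY.continuousOn_mul hac.continuousOn
  have h2 : ∫ s in 0..t, deriv f s * f s + f s * deriv f s =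
      ∫ s in 0..t, 2 * (f s * Y s) := by
    refine intervalIntegral.integral_congr_ae ?_
    filter_upwards [hY.ae_hasDerivAt_integral] with s hs hs'
    rw [(hs (uIoc_subset_uIcc hs') 0 left_mem_uIcc).deriv]
    ring
  have h3 : ∫ s in 0..t, 2 * (y s * Y s) =
      ∫ s in 0..t, (2 * y₀ * Y s + 2 * (f s * Y s)) := by
    refine intervalIntegral.integral_congr fun s hs => ?_
    rw [uIcc_of_le ht] at hs
    simp only [hy s hs, hf]
    ring
  rw [h3, intervalIntegral.integral_add (hY.const_mul _) (hYf.const_mul _), ← h2, h1,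
    intervalIntegral.integral_const_mul, hy t ⟨ht, le_rfl⟩, hf0]
  simp only [hf]
  ring

/-- Time dependent bounded smooth functions which are jointly measurable with all derivatives. -/
def RegT (ψ : ℝ → Smo d) : Prop := ∀ n, SmT n fun t x => ψ t x

namespace RegT

variable {φ ψ : ℝ → Smo d}

theorem bm (h : RegT ψ) : BM fun t x => ψ t x := (h 0).lip.1

theorem D (h : RegT ψ) (v : Sp d) : RegT fun t => D v (ψ t) := fun n => (h (n + 1)).2.2 v

theorem add (hφ : RegT φ) (hψ : RegT ψ) : RegT fun t => φ t + ψ t := fun n => (hφ n).add (hψ n)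

theorem sub (hφ : RegT φ) (hψ : RegT ψ) : RegT fun t => φ t - ψ t := fun n => (hφ n).sub (hψ n)

theorem mul (hφ : RegT φ) (hψ : RegT ψ) : RegT fun t => φ t * ψ t := fun n => (hφ n).mul (hψ n)

theorem neg (hφ : RegT φ) : RegT fun t => -φ t := fun n => (hφ n).neg

theorem smul (hφ : RegT φ) (a : ℝ) : RegT fun t => a • φ t := fun n => (SmT.const a).mul (hφ n)

theorem Tr (hφ : RegT φ) (y : Sp d) : RegT fun t => Tr y (φ t) := fun n => (hφ n).shift y

theorem dl (hφ : RegT φ) (h : ℝ) (l : Sp d) : RegT fun t => dl h l (φ t) :=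
  ((hφ.Tr (h • l)).sub hφ).smul h⁻¹

theorem dB (hφ : RegT φ) (τ : Fn d) (τ₀ h : ℝ) (μ : Sp d ⊕ Fin d) :
    RegT fun t => dB τ τ₀ h μ (φ t) := by
  cases μ with
  | inl l => exact (hφ.dl h l).smul (τ l)
  | inr i => exact (hφ.D (e i)).smul τ₀

theorem sum {ι : Type*} (s : Finset ι) {f : ι → ℝ → Smo d} (h : ∀ i ∈ s, RegT (f i)) :
    RegT fun t => ∑ i ∈ s, f i t := by
  intro n
  convert SmT.sum s fun i hi => h i hi n using 3 with t x
  exact map_sum (Smo.ev x) _ _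

/-- Functions with bounded measurable derivatives of all orders form time dependent elements of
`Smo d`. -/
theorem lift {u : TFn d} (h : ∀ n, SmT n u) :
    ∃ ψ : ℝ → Smo d, RegT ψ ∧ ∀ t x, ψ t x = u t x := by
  have hs : ∀ t, BddSmooth (u t) := fun t =>
    bddSmooth_of_coind (fun φ => ∃ u : TFn d, (∀ n, SmT n u) ∧ φ = u t)
      (by
        rintro φ ⟨u, hu, rfl⟩
        obtain ⟨C, hC⟩ := (hu 0).lip.1.2
        exact ⟨C, hC t⟩)
      (by rintro φ ⟨u, hu, rfl⟩; exact (hu 1).2.1 t)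
      (by
        rintro φ ⟨u, hu, rfl⟩ v
        exact ⟨fun t x => fderiv ℝ (u t) x v, fun n => (hu (n + 1)).2.2 v, rfl⟩) ⟨u, h, rfl⟩
  exact ⟨fun t => ⟨u t, hs t⟩, h, fun _ _ => rfl⟩

end RegT

/-- `ψ(t) = ψ(0) + ∫_0^t Ψ(s) ds` on `[0,T]`. -/
def IntT (T : ℝ) (ψ Ψ : ℝ → Smo d) : Prop :=
  RegT ψ ∧ RegT Ψ ∧ ∀ t ∈ Icc 0 T, ∀ x, ψ t x = ψ 0 x + ∫ s in 0..t, Ψ s x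

namespace IntT

variable {T : ℝ} {ψ Ψ : ℝ → Smo d}

theorem D (h : IntT T ψ Ψ) (v : Sp d) : IntT T (fun t => D v (ψ t)) (fun t => D v (Ψ t)) := by
  refine ⟨h.1.D v, h.2.1.D v, fun t ht x => ?_⟩
  have hline : ∀ (φ : Smo d) (r : ℝ), HasDerivAt (fun r : ℝ => φ (x + r • v))
      (FDScheme.D v φ (x + r • v)) r := by
    intro φ r
    have h2 : HasDerivAt (fun r : ℝ => x + r • v) v r := by
      simpa using ((hasDerivAt_id r).smul_const v).const_add x
    exact (Smo.differentiable φ (x + r • v)).hasFDerivAt.comp_hasDerivAt r h2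
  obtain ⟨C, hC⟩ := (h.2.1.D v).bm.2
  have h1 := (intervalIntegral.hasDerivAt_integral_of_dominated_loc_of_deriv_le
    (F := fun (r : ℝ) s => Ψ s (x + r • v)) (F' := fun r s => FDScheme.D v (Ψ s) (x + r • v))
    (x₀ := (0 : ℝ)) (a := 0) (b := t) (μ := volume) (bound := fun _ => C) Filter.univ_mem
    (.of_forall fun r => (h.2.1.bm.measurable_time _).aestronglyMeasurable)
    (h.2.1.bm.intervalIntegrable _ _ _)
    ((h.2.1.D v).bm.measurable_time _).aestronglyMeasurable
    (ae_of_all _ fun s _ r _ => hC s _) (by simp)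
    (ae_of_all _ fun s _ r _ => hline (Ψ s) r)).2
  have h2 := (hline (ψ 0) 0).add h1
  have h3 : (fun r : ℝ => ψ t (x + r • v)) =
      (fun r : ℝ => ψ 0 (x + r • v)) + fun r => ∫ s in 0..t, Ψ s (x + r • v) := by
    funext r
    exact h.2.2 t ht _
  rw [← h3] at h2
  simpa using (hline (ψ t) 0).unique h2

theorem Tr (h : IntT T ψ Ψ) (y : Sp d) : IntT T (fun t => Tr y (ψ t)) (fun t => Tr y (Ψ t)) :=
  ⟨h.1.Tr y, h.2.1.Tr y, fun t ht x => h.2.2 t ht (x + y)⟩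

theorem smul (h : IntT T ψ Ψ) (a : ℝ) : IntT T (fun t => a • ψ t) (fun t => a • Ψ t) := by
  refine ⟨h.1.smul a, h.2.1.smul a, fun t ht x => ?_⟩
  simp only [Smo.smul_apply]
  rw [intervalIntegral.integral_const_mul, h.2.2 t ht x, mul_add]

theorem sub {φ Φ : ℝ → Smo d} (h : IntT T ψ Ψ) (h' : IntT T φ Φ) :
    IntT T (fun t => ψ t - φ t) (fun t => Ψ t - Φ t) := by
  refine ⟨h.1.sub h'.1, h.2.1.sub h'.2.1, fun t ht x => ?_⟩
  simp only [Smo.sub_apply]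
  rw [intervalIntegral.integral_sub (h.2.1.bm.intervalIntegrable _ _ _)
    (h'.2.1.bm.intervalIntegrable _ _ _), h.2.2 t ht x, h'.2.2 t ht x]
  ring

theorem dB (h : IntT T ψ Ψ) (τ : Fn d) (τ₀ r : ℝ) (μ : Sp d ⊕ Fin d) :
    IntT T (fun t => dB τ τ₀ r μ (ψ t)) (fun t => dB τ τ₀ r μ (Ψ t)) := by
  cases μ with
  | inl l => exact (((h.Tr (r • l)).sub h).smul r⁻¹).smul (τ l)
  | inr i => exact (h.D (e i)).smul τ₀

end IntT

namespace Geo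

variable (g : Geo d)

theorem Pol_succ (n : ℕ) (ζ ψ : Smo d) (x : Sp d) :
    g.Pol (n + 1) ζ ψ x = ∑ μ ∈ g.Λ, g.Pol n (g.δ μ ζ) (g.δ μ ψ) x := rfl

theorem bm_Pol {ψ Ψ : ℝ → Smo d} (n : ℕ) (h : RegT ψ) (h' : RegT Ψ) :
    BM fun t x => g.Pol n (ψ t) (Ψ t) x := by
  induction n generalizing ψ Ψ with
  | zero => exact h.bm.mul h'.bm
  | succ n ih => exact BM.sum _ fun μ _ => ih (h.dB _ _ _ μ) (h'.dB _ _ _ μ)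

theorem bm_W {ψ : ℝ → Smo d} (n : ℕ) (h : RegT ψ) : BM fun t x => g.W n (ψ t) x := by
  simpa only [Pol_diag] using g.bm_Pol n h h

theorem W_integral {T : ℝ} {ψ Ψ : ℝ → Smo d} (n : ℕ) (h : IntT T ψ Ψ) :
    ∀ t ∈ Icc 0 T, ∀ x,
      g.W n (ψ t) x = g.W n (ψ 0) x + ∫ s in 0..t, 2 * g.Pol n (ψ s) (Ψ s) x := by
  induction n generalizing ψ Ψ with
  | zero =>
    intro t ht x
    exact sq_integral ht.1 (h.2.1.bm.intervalIntegrable _ _ _)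
      fun s hs => h.2.2 s ⟨hs.1, hs.2.trans ht.2⟩ x
  | succ n ih =>
    intro t ht x
    simp only [W_succ, Pol_succ, mul_sum]
    rw [intervalIntegral.integral_finsetSum, ← sum_add_distrib]
    · exact sum_congr rfl fun μ _ => ih (h.dB _ _ _ μ) t ht x
    · intro μ _
      exact ((g.bm_Pol n (h.1.dB _ _ _ μ) (h.2.1.dB _ _ _ μ)).intervalIntegrable _ _ _).const_mul _

theorem Lop_eq (hh : g.h ≠ 0) (co : Coef d) (φ : Smo d) (x : Sp d) :
    g.Lop co φ x = g.L0 co φ x - co.c x * φ x := by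
  have e1 : g.Lop co φ x = g.h⁻¹ * ∑ l ∈ g.Λ₁, co.q l x * dl g.h l φ x
      + ∑ l ∈ g.Λ₁, co.p l x * dl g.h l φ x - co.c x * φ x := by
    have h1 : ∀ f : Sp d → Smo d, (∑ l ∈ g.Λ₁, f l) x = ∑ l ∈ g.Λ₁, f l x :=
      fun f => map_sum (Smo.ev x) _ _
    simp only [Lop, Bq, Bp, Bc, Smo.add_apply, Smo.smul_apply, Smo.neg_apply, h1, Smo.mul_apply]
    ring
  rw [e1, L0, mul_sum, ← sum_add_distrib]
  congr 1
  refine sum_congr rfl fun l _ => ?_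
  rw [dl_apply]
  field_simp

end Geo

/-- The absorption argument for a bounded function satisfying a differential inequality. -/
theorem absorb {T δ c₀ a b v F κ : ℝ} {g : Geo d} {co : ℝ → Coef d} {W V G : TFn d}
    (hT : 0 ≤ T) (hδ : 0 < δ) (hδ1 : δ ≤ 1) (hc₀ : 0 < c₀) (hb : 0 ≤ b) (hF : 0 ≤ F)
    (hv : 0 ≤ v) (ha : 0 ≤ a)
    (hchi : ∀ t ∈ Icc 0 T, ∀ l ∈ g.Λ₁, ∀ x, 0 ≤ (co t).q l x + g.h * (co t).p l x)
    (hc : ∀ t ∈ Icc 0 T, ∀ x, c₀ ≤ (co t).c x)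
    (hκ : ∀ t ∈ Icc 0 T, ∀ x, ∑ l ∈ g.Λ₁, ((co t).q l x + g.h * (co t).p l x) / g.h ^ 2
      + 2 * (co t).c x ≤ κ)
    (hW : ∀ t x, 0 ≤ W t x) (hWV : ∀ t x, W t x ≤ V t x) (hV : BM V) (hG : BM G)
    (hVG : ∀ t ∈ Icc 0 T, ∀ x, V t x = V 0 x + ∫ s in 0..t, G s x)
    (h0 : ∀ x, V 0 x ≤ v * F)
    (hle : ∀ S, 0 ≤ S → (∀ t ∈ Icc 0 T, ∀ x, W t x ≤ S) → ∀ t ∈ Icc 0 T, ∀ x,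
      G t x ≤ g.L0 (co t) (V t) x - 2 * (co t).c x * V t x
        + ((2 * (1 - δ) + δ) * (co t).c x * S + (co t).c x * (a * F) + b * F)) :
    ∀ t ∈ Icc 0 T, ∀ x, V t x ≤ 2 / δ * (a / 2 + b / (2 * c₀) + v) * F := by
  set ee := a / 2 + b / (2 * c₀) + v with hee
  have hee0 : 0 ≤ ee := by positivity
  have key : ∀ S, 0 ≤ S → (∀ t ∈ Icc 0 T, ∀ x, W t x ≤ S) → ∀ t ∈ Icc 0 T, ∀ x,
      V t x ≤ (1 - δ / 2) * S + ee * F := by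
    intro S hS0 hS
    obtain ⟨C, hC⟩ := hV.2
    refine fd_le (h := g.h) (Λ₁ := g.Λ₁) (κ := κ)
      (a := fun l t x => ((co t).q l x + g.h * (co t).p l x) / g.h ^ 2)
      (c := fun t x => 2 * (co t).c x) (v₀ := V 0) hT
      (fun l hl t ht x => div_nonneg (hchi t ht l hl x) (sq_nonneg _))
      (fun t ht x => by linarith [hc t ht x]) hκ (fun x => hG.intervalIntegrable _ _ _) hVG
      ⟨C, fun t _ x => (le_abs_self _).trans (hC t x)⟩ (fun x => ?_) (fun t ht x => ?_)
    · refine (h0 x).trans ?_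
      have h1 : v * F ≤ ee * F := by
        refine mul_le_mul_of_nonneg_right ?_ hF
        rw [hee]
        have : 0 ≤ a / 2 + b / (2 * c₀) := by positivity
        linarith
      have h2 : 0 ≤ (1 - δ / 2) * S := mul_nonneg (by linarith) hS0
      linarith
    · refine (hle S hS0 hS t ht x).trans ?_
      have hcx := hc t ht x
      have h1 : b * F ≤ 2 * (co t).c x * (b / (2 * c₀) * F) := by
        have : b * F = 2 * c₀ * (b / (2 * c₀) * F) := by field_simp
        rw [this]
        gcongr
      have h2 : 0 ≤ 2 * (co t).c x * (v * F) := by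
        have : 0 ≤ (co t).c x := hc₀.le.trans hcx
        positivity
      simp only [fdo, Geo.L0, hee]
      linarith
  rcases isEmpty_or_nonempty (Sp d) with hemp | hne
  · intro t ht x; exact (hemp.false x).elim
  have hbdd : BddAbove (range fun z : Icc (0 : ℝ) T × Sp d => W z.1 z.2) := by
    obtain ⟨C, hC⟩ := hV.2
    refine ⟨C, ?_⟩
    rintro _ ⟨z, rfl⟩
    exact (hWV _ _).trans ((le_abs_self _).trans (hC _ _))
  set S := sSup (range fun z : Icc (0 : ℝ) T × Sp d => W z.1 z.2) with hSdef
  have hS : ∀ t ∈ Icc 0 T, ∀ x, W t x ≤ S := fun t ht x =>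
    le_csSup hbdd ⟨(⟨t, ht⟩, x), rfl⟩
  have hS0 : 0 ≤ S := (hW 0 0).trans (hS 0 ⟨le_rfl, hT⟩ 0)
  have hS1 : S ≤ (1 - δ / 2) * S + ee * F := by
    refine csSup_le ⟨_, ⟨(⟨0, ⟨le_rfl, hT⟩⟩, 0), rfl⟩⟩ ?_
    rintro _ ⟨z, rfl⟩
    exact (hWV _ _).trans (key S hS0 hS z.1 z.1.2 z.2)
  have hS2 : S ≤ 2 / δ * ee * F := by
    have : δ * S ≤ 2 * (ee * F) := by linarith
    rw [div_mul_eq_mul_div, div_mul_eq_mul_div, le_div_iff₀ hδ]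
    linarith
  intro t ht x
  refine (key S hS0 hS t ht x).trans ?_
  have h1 : (1 - δ / 2) * S ≤ (1 - δ / 2) * (2 / δ * ee * F) :=
    mul_le_mul_of_nonneg_left hS2 (by linarith)
  have h2 : (1 - δ / 2) * (2 / δ * ee * F) + ee * F = 2 / δ * ee * F := by
    field_simp; ring
  linarith

set_option maxHeartbeats 1000000 in
/-- The a priori estimate of the energies, uniformly in the mesh size. -/
theorem apriori (m : ℕ) {δ K c₀ A L τ₀ : ℝ} (M : ℕ → ℝ) (hδ : 0 < δ) (hδ1 : δ ≤ 1) (hK : 0 ≤ K)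
    (hc₀ : 0 < c₀) : ∀ n ≤ m, ∃ C, 0 ≤ C ∧ ∀ (d : ℕ) (g : Geo d) (co : ℝ → Coef d) (T κ F : ℝ)
    (u f : ℝ → Smo d), g.τ₀ = τ₀ → 0 ≤ T →
    (∀ t ∈ Icc 0 T, Snap g (co t) m δ K c₀ A L M) →
    (∀ t ∈ Icc 0 T, ∀ x, ∑ l ∈ g.Λ₁, ((co t).q l x + g.h * (co t).p l x) / g.h ^ 2
      + 2 * (co t).c x ≤ κ) → RegT f →
    IntT T u (fun t => g.Lop (co t) (u t) + f t) → 0 ≤ F →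
    (∀ k ≤ n, ∀ t ∈ Icc 0 T, ∀ x, g.W k (f t) x ≤ F) → (∀ k ≤ n, ∀ x, g.W k (u 0) x ≤ F) →
    ∃ V G : TFn d, BM V ∧ BM G ∧ (∀ t x, 0 ≤ V t x) ∧
      (∀ t ∈ Icc 0 T, ∀ x, V t x = V 0 x + ∫ s in 0..t, G s x) ∧
      (∀ x, V 0 x ≤ C * F) ∧
      (∀ t ∈ Icc 0 T, ∀ x, G t x ≤ g.L0 (co t) (V t) x - 2 * (co t).c x * V t x
        - δ * g.Qn (co t) n (u t) x + (co t).c x * (C * F) + C * F) ∧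
      ∀ k ≤ n, ∀ t ∈ Icc 0 T, ∀ x, g.W k (u t) x ≤ C * F := by
  intro n
  set ε := δ * c₀ / 2 with hε
  have hε0 : 0 < ε := by positivity
  induction n with
  | zero =>
    intro _
    set C₁ := 2 / δ * (0 / 2 + ε⁻¹ / (2 * c₀) + 1) with hC₁
    have hC₁0 : 0 ≤ C₁ := by positivity
    refine ⟨1 + ε⁻¹ + δ * C₁ + C₁, by positivity, ?_⟩
    intro d g co T κ F u f hτ hT hs hκ hf hu hF hfF huF
    have hPol : ∀ t ∈ Icc 0 T, ∀ x, 2 * g.Pol 0 (u t) (g.Lop (co t) (u t) + f t) x ≤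
        g.L0 (co t) (g.W 0 (u t)) x - 2 * (co t).c x * g.W 0 (u t) x - δ * g.Qn (co t) 0 (u t) x
          + (ε * g.W 0 (u t) x + ε⁻¹ * F) := by
      intro t ht x
      rw [Geo.Pol_add, mul_add, (hs t ht).energy_zero]
      have h1 := g.two_mul_Pol_le hε0 0 (u t) (f t) x
      have h2 := hfF 0 le_rfl t ht x
      have h3 : ε⁻¹ * g.W 0 (f t) x ≤ ε⁻¹ * F := by gcongr
      have h4 := g.Qn_nonneg (co t) (hs t ht).chi 0 (u t) x
      nlinarith
    have key := absorb (W := fun t x => g.W 0 (u t) x) (V := fun t x => g.W 0 (u t) x)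
      (G := fun t x => 2 * g.Pol 0 (u t) (g.Lop (co t) (u t) + f t) x) (a := 0) (b := ε⁻¹) (v := 1)
      (F := F) hT hδ hδ1 hc₀
      (by positivity) hF zero_le_one le_rfl (fun t ht => (hs t ht).chi) (fun t ht => (hs t ht).c_ge)
      hκ (fun t x => g.W_nonneg _ _ _) (fun _ _ => le_rfl) (g.bm_W 0 hu.1)
      ((BM.const 2).mul (g.bm_Pol 0 hu.1 hu.2.1)) (g.W_integral 0 hu)
      (fun x => by simpa using huF 0 le_rfl x) (fun S hS0 hS t ht x => by
        refine (hPol t ht x).trans ?_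
        have h4 := g.Qn_nonneg (co t) (hs t ht).chi 0 (u t) x
        have h5 := hS t ht x
        have hcx := (hs t ht).c_ge x
        have hcx0 := hc₀.le.trans hcx
        have h6 : ε * g.W 0 (u t) x ≤ δ * (co t).c x * S := by
          refine mul_le_mul ?_ h5 (g.W_nonneg _ _ _) (by positivity)
          rw [hε]
          nlinarith
        have h7 : 0 ≤ (1 - δ) * ((co t).c x * S) := mul_nonneg (by linarith) (by positivity)
        nlinarith)
    rw [← hC₁] at key
    have hCF : C₁ * F ≤ (1 + ε⁻¹ + δ * C₁ + C₁) * F := by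
      refine mul_le_mul_of_nonneg_right ?_ hF
      have : 0 ≤ 1 + ε⁻¹ + δ * C₁ := by positivity
      linarith
    refine ⟨fun t x => g.W 0 (u t) x, _, g.bm_W 0 hu.1,
      (BM.const 2).mul (g.bm_Pol 0 hu.1 hu.2.1), fun t x => g.W_nonneg _ _ _, g.W_integral 0 hu,
      fun x => ?_, fun t ht x => ?_, fun k hk t ht x => ?_⟩
    · exact (key 0 ⟨le_rfl, hT⟩ x).trans hCF
    · refine (hPol t ht x).trans ?_
      have hcx := (hs t ht).c_ge x
      have hcx0 := hc₀.le.trans hcx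
      have h6 : ε * g.W 0 (u t) x ≤ (co t).c x * (δ * (C₁ * F)) := by
        rw [← mul_assoc]
        refine mul_le_mul ?_ (key t ht x) (g.W_nonneg _ _ _) (by positivity)
        rw [hε]
        nlinarith
      have h7 : (co t).c x * (δ * (C₁ * F)) ≤ (co t).c x * ((1 + ε⁻¹ + δ * C₁ + C₁) * F) := by
        refine mul_le_mul_of_nonneg_left ?_ hcx0
        have : 0 ≤ (1 + ε⁻¹ + C₁) * F := by positivity
        linarith
      have h8 : 0 ≤ (1 + δ * C₁ + C₁) * F := by positivity
      linarith
    · obtain rfl : k = 0 := by omega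
      exact (key t ht x).trans hCF
  | succ n ih =>
    intro hn
    obtain ⟨C', hC'0, ih⟩ := ih (by omega)
    set r := K / δ with hr
    have hr0 : 0 ≤ r := by positivity
    set R := remC A L τ₀ M (n + 1) with hR
    have hR0 : 0 ≤ R := remC_nonneg _ _ _ _ _
    set a := r * C' with ha
    set b := K * C' + ε⁻¹ * R ^ 2 * C' + ε⁻¹ + r * C' with hb
    have ha0 : 0 ≤ a := by positivity
    have hb0 : 0 ≤ b := by positivity
    set C₁ := 2 / δ * (a / 2 + b / (2 * c₀) + (1 + r * C')) with hC₁
    have hC₁0 : 0 ≤ C₁ := by positivity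
    refine ⟨C' + C₁ + 2 * C₁ + a + b, by positivity, ?_⟩
    intro d g co T κ F u f hτ hT hs hκ hf hu hF hfF huF
    obtain ⟨V, G, hV, hG, hV0, hVG, hVi, hGle, hWk⟩ := ih d g co T κ F u f hτ hT hs hκ hf hu hF
      (fun k hk => hfF k (by omega)) (fun k hk => huF k (by omega))
    set G₁ : TFn d := fun t x =>
      2 * g.Pol (n + 1) (u t) (g.Lop (co t) (u t) + f t) x + r * G t x with hG₁
    set V₁ : TFn d := fun t x => g.W (n + 1) (u t) x + r * V t x with hV₁
    have hBG₁ : BM G₁ := ((BM.const 2).mul (g.bm_Pol _ hu.1 hu.2.1)).add ((BM.const r).mul hG)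
    have hBV₁ : BM V₁ := (g.bm_W _ hu.1).add ((BM.const r).mul hV)
    have hint : ∀ t ∈ Icc 0 T, ∀ x, V₁ t x = V₁ 0 x + ∫ s in 0..t, G₁ s x := by
      intro t ht x
      simp only [hV₁, hG₁]
      rw [intervalIntegral.integral_add
        (((BM.const 2).mul (g.bm_Pol _ hu.1 hu.2.1)).intervalIntegrable _ _ _)
        ((hG.intervalIntegrable _ _ _).const_mul r), intervalIntegral.integral_const_mul r,
        g.W_integral (n + 1) hu t ht x, hVG t ht x]
      ring
    have hmain : ∀ S, 0 ≤ S → (∀ t ∈ Icc 0 T, ∀ x, g.W (n + 1) (u t) x ≤ S) → ∀ t ∈ Icc 0 T, ∀ x,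
        G₁ t x ≤ g.L0 (co t) (V₁ t) x - 2 * (co t).c x * V₁ t x
          - δ * g.Qn (co t) (n + 1) (u t) x
          + ((2 * (1 - δ) + δ) * (co t).c x * S + (co t).c x * (a * F) + b * F) := by
      intro S hS0 hS t ht x
      have hcx := (hs t ht).c_ge x
      have hcx0 := hc₀.le.trans hcx
      have h1 := (hs t ht).energy_le (n := n + 1) (by omega) hn (u t) (S := S) (S' := C' * F)
        (hS t ht) (fun i hi y => hWk i (by omega) t ht y) hK x
      rw [hτ, ← hR, Nat.add_sub_cancel] at h1
      have h2 := g.two_mul_Pol_le hε0 (n + 1) (u t) (f t) x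
      have h3 : ε⁻¹ * g.W (n + 1) (f t) x ≤ ε⁻¹ * F := by
        have := hfF (n + 1) le_rfl t ht x
        gcongr
      have h4 : ε * g.W (n + 1) (u t) x ≤ ε * S := by
        have := hS t ht x
        gcongr
      have h5 : R * √(S * (C' * F)) ≤ ε * S + ε⁻¹ * R ^ 2 * C' * F := by
        rw [Real.sqrt_mul hS0]
        have e1 : ε * S = (Real.sqrt ε * √S) ^ 2 := by
          rw [mul_pow, Real.sq_sqrt hε0.le, Real.sq_sqrt hS0]
        have e2 : ε⁻¹ * R ^ 2 * C' * F = ((Real.sqrt ε)⁻¹ * R * √(C' * F)) ^ 2 := by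
          rw [mul_pow, mul_pow, inv_pow, Real.sq_sqrt hε0.le, Real.sq_sqrt (by positivity)]
          ring
        have e3 : R * (√S * √(C' * F)) =
            (Real.sqrt ε * √S) * ((Real.sqrt ε)⁻¹ * R * √(C' * F)) := by
          have := (Real.sqrt_pos.2 hε0).ne'
          field_simp
        rw [e1, e2, e3]
        have := two_mul_le_add_sq (Real.sqrt ε * √S)
          ((Real.sqrt ε)⁻¹ * R * √(C' * F))
        have h0 : 0 ≤ (Real.sqrt ε * √S) *
          ((Real.sqrt ε)⁻¹ * R * √(C' * F)) := by positivity
        linarith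
      have h6 : 2 * ε * S ≤ δ * (co t).c x * S := by
        rw [hε]
        have : δ * c₀ ≤ δ * (co t).c x := by gcongr
        have := mul_le_mul_of_nonneg_right this hS0
        linarith
      have h7 := mul_le_mul_of_nonneg_left (hGle t ht x) hr0
      have h8 : r * (δ * g.Qn (co t) n (u t) x) = K * g.Qn (co t) n (u t) x := by
        rw [hr]; field_simp
      have h9 : g.L0 (co t) (V₁ t) x = g.L0 (co t) (g.W (n + 1) (u t)) x
          + r * g.L0 (co t) (V t) x := by
        simp only [Geo.L0, hV₁, mul_sum]
        rw [← sum_add_distrib]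
        exact sum_congr rfl fun l _ => by ring
      simp only [hG₁, Geo.Pol_add, h9]
      simp only [hV₁, ha, hb]
      linarith
    have key := absorb (W := fun t x => g.W (n + 1) (u t) x) (V := V₁) (G := G₁) (a := a) (b := b)
      (v := 1 + r * C') (F := F) hT hδ hδ1 hc₀ hb0 hF (by positivity) ha0
      (fun t ht => (hs t ht).chi) (fun t ht => (hs t ht).c_ge)
      hκ (fun t x => g.W_nonneg _ _ _)
      (fun t x => by have := mul_nonneg hr0 (hV0 t x); simp only [hV₁]; linarith) hBV₁ hBG₁ hint
      (fun x => by
        have h1 := huF (n + 1) le_rfl x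
        have h2 := mul_le_mul_of_nonneg_left (hVi x) hr0
        simp only [hV₁]
        linarith)
      (fun S hS0 hS t ht x => by
        have h4 := g.Qn_nonneg (co t) (hs t ht).chi (n + 1) (u t) x
        have := hmain S hS0 hS t ht x
        nlinarith)
    rw [← hC₁] at key
    have hW1 : ∀ t ∈ Icc 0 T, ∀ x, g.W (n + 1) (u t) x ≤ C₁ * F := by
      intro t ht x
      have h1 := key t ht x
      have h2 := mul_nonneg hr0 (hV0 t x)
      simp only [hV₁] at h1
      linarith
    refine ⟨V₁, G₁, hBV₁, hBG₁, fun t x => add_nonneg (g.W_nonneg _ _ _)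
      (mul_nonneg hr0 (hV0 t x)), hint, fun x => ?_, fun t ht x => ?_, fun k hk t ht x => ?_⟩
    · refine (key 0 ⟨le_rfl, hT⟩ x).trans ?_
      have : 0 ≤ (C' + 2 * C₁ + a + b) * F := by positivity
      linarith
    · refine (hmain _ (mul_nonneg hC₁0 hF) hW1 t ht x).trans ?_
      have hcx0 := hc₀.le.trans ((hs t ht).c_ge x)
      have h1 : 0 ≤ (co t).c x * ((C' + C₁ + δ * C₁ + b) * F) := by positivity
      have h2 : 0 ≤ (C' + C₁ + 2 * C₁ + a) * F := by positivity
      linarith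
    · rcases Nat.lt_or_ge k (n + 1) with h | h
      · refine (hWk k (by omega) t ht x).trans ?_
        have : 0 ≤ (C₁ + 2 * C₁ + a + b) * F := by positivity
        linarith
      · obtain rfl : k = n + 1 := by omega
        refine (hW1 t ht x).trans ?_
        have : 0 ≤ (C' + 2 * C₁ + a + b) * F := by positivity
        linarith

/-! ### Iterated directional derivatives -/

/-- The iterated derivative along a list of directions. -/
def Dl : List (Sp d) → Smo d →ₗ[ℝ] Smo d
  | [] => LinearMap.id
  | v :: l => D v ∘ₗ Dl l

@[simp] theorem Dl_nil (φ : Smo d) : Dl [] φ = φ := rfl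

@[simp] theorem Dl_cons (v : Sp d) (l : List (Sp d)) (φ : Smo d) :
    Dl (v :: l) φ = D v (Dl l φ) := rfl

theorem D_Dl (v : Sp d) (l : List (Sp d)) (φ : Smo d) : D v (Dl l φ) = Dl l (D v φ) := by
  induction l with
  | nil => rfl
  | cons w l ih => rw [Dl_cons, Dl_cons, D_comm, ih]

theorem Dl_perm {l l' : List (Sp d)} (h : l.Perm l') (φ : Smo d) : Dl l φ = Dl l' φ := by
  induction h with
  | nil => rfl
  | cons v _ ih => rw [Dl_cons, Dl_cons, ih]
  | swap v w l => simp only [Dl_cons, D_comm]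
  | trans _ _ ih ih' => rw [ih, ih']

theorem Dl_append (l l' : List (Sp d)) (φ : Smo d) : Dl (l ++ l') φ = Dl l (Dl l' φ) := by
  induction l with
  | nil => rfl
  | cons v l ih => rw [List.cons_append, Dl_cons, Dl_cons, ih]

theorem Dl_replicate (r : ℕ) (v : Sp d) (φ : Smo d) : Dl (List.replicate r v) φ = (D v)^[r] φ := by
  induction r with
  | zero => rfl
  | succ r ih => rw [List.replicate_succ, Dl_cons, ih, Function.iterate_succ_apply']

theorem iteratedFDeriv_eq_Dl (l : List (Sp d)) (φ : Smo d) (x : Sp d) :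
    iteratedFDeriv ℝ l.length φ x l.get = Dl l φ x := by
  induction l generalizing x with
  | nil => simp
  | cons v l ih =>
    have h1 : iteratedFDeriv ℝ (v :: l).length φ x (v :: l).get =
        (fderiv ℝ (iteratedFDeriv ℝ l.length φ) x) v l.get :=
      iteratedFDeriv_succ_apply_left (n := l.length) (v :: l).get
    have h2 : DifferentiableAt ℝ (iteratedFDeriv ℝ l.length φ) x :=
      ((Smo.contDiff φ).differentiable_iteratedFDeriv (by
        exact_mod_cast WithTop.coe_lt_coe.2 (WithTop.coe_lt_top _))) x
    rw [h1, ← fderiv_continuousMultilinear_apply_const_apply h2, Dl_cons, D_apply]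
    simp only [ih]

theorem hasCompactSupport_Dl {φ : Smo d} (h : HasCompactSupport φ) (l : List (Sp d)) :
    HasCompactSupport (Dl l φ) := by
  induction l with
  | nil => exact h
  | cons v l ih => exact ih.fderiv_apply ℝ v

theorem integrable_of_hasCompactSupport {φ : Smo d} (h : HasCompactSupport φ) :
    Integrable φ (volume : Measure (Sp d)) := (Smo.continuous φ).integrable_of_hasCompactSupport h

/-! ### Essentially bounded functions and convolutions -/

/-- `ψ` is measurable and essentially bounded by `C`. -/
def EB (C : ℝ) (ψ : Fn d) : Prop :=
  AEStronglyMeasurable ψ volume ∧ ∀ᵐ x, |ψ x| ≤ C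

theorem EB.locallyIntegrable {C : ℝ} {ψ : Fn d} (h : EB C ψ) :
    LocallyIntegrable ψ (volume : Measure (Sp d)) :=
  (locallyIntegrable_const C).mono h.1 (by
    filter_upwards [h.2] with x hx
    rw [Real.norm_eq_abs, Real.norm_eq_abs]
    exact hx.trans (le_abs_self C))

theorem EB.integrable_mul {C : ℝ} {ψ : Fn d} (h : EB C ψ) {θ : Fn d}
    (hθ : Integrable θ (volume : Measure (Sp d))) : Integrable fun x => θ x * ψ x :=
  hθ.mul_bdd (c := C) h.1 h.2

theorem qmp_sub (x : Sp d) :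
    Measure.QuasiMeasurePreserving (fun y : Sp d => x - y) volume volume :=
  (Measure.measurePreserving_sub_left volume x).quasiMeasurePreserving

theorem EB.comp_sub {C : ℝ} {ψ : Fn d} (h : EB C ψ) (x : Sp d) : EB C fun y => ψ (x - y) := by
  have h1 := qmp_sub x
  exact ⟨h.1.comp_quasiMeasurePreserving h1, h1.ae h.2⟩

theorem EB.of_bound {C : ℝ} {ψ : Fn d} (h : Measurable ψ) (h' : ∀ x, |ψ x| ≤ C) : EB C ψ :=
  ⟨h.aestronglyMeasurable, ae_of_all _ h'⟩

theorem Smo.eb (φ : Smo d) : ∃ C, EB C φ := by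
  obtain ⟨C, hC⟩ := Smo.bounded φ
  exact ⟨C, EB.of_bound (Smo.continuous φ).measurable hC⟩

/-- Convolution. -/
def conv (K ψ : Fn d) (x : Sp d) : ℝ := ∫ y, K y * ψ (x - y)

theorem conv_swap (K ψ : Fn d) (x : Sp d) : conv K ψ x = ∫ y, K (x - y) * ψ y := by
  rw [conv, ← integral_sub_left_eq_self _ volume x]
  simp

theorem abs_conv_le {C : ℝ} {ψ K : Fn d} (h : EB C ψ) (hK : Integrable K volume) (x : Sp d) :
    |conv K ψ x| ≤ (∫ y, |K y|) * C := by
  rw [← Real.norm_eq_abs, conv, ← integral_mul_const]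
  refine norm_integral_le_of_norm_le (hK.abs.mul_const C) ?_
  filter_upwards [(h.comp_sub x).2] with y hy
  rw [norm_mul, Real.norm_eq_abs, Real.norm_eq_abs]
  gcongr

theorem hasFDerivAt_conv {C : ℝ} {ψ : Fn d} (h : EB C ψ) {K : Smo d} (hK : HasCompactSupport K)
    (x : Sp d) : ∃ L : Sp d →L[ℝ] ℝ, HasFDerivAt (conv K ψ) L x ∧
      ∀ v, L v = conv (D v K) ψ x := by
  have h1 := hK.hasFDerivAt_convolution_left (ContinuousLinearMap.mul ℝ ℝ) (μ := volume)
    ((Smo.contDiff K).of_le (by exact_mod_cast le_top)) h.locallyIntegrable x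
  refine ⟨_, h1, fun v => ?_⟩
  have h2 : ConvolutionExistsAt (fderiv ℝ K) ψ x
      ((ContinuousLinearMap.mul ℝ ℝ).precompL (Sp d)) volume :=
    (hK.fderiv ℝ).convolutionExists_left _
      ((Smo.contDiff K).continuous_fderiv (by simp)) h.locallyIntegrable x
  rw [convolution_def, ContinuousLinearMap.integral_apply h2]
  rfl

theorem fderiv_conv {C : ℝ} {ψ : Fn d} (h : EB C ψ) {K : Smo d} (hK : HasCompactSupport K)
    (x v : Sp d) : fderiv ℝ (conv K ψ) x v = conv (D v K) ψ x := by
  obtain ⟨L, hL, hLv⟩ := hasFDerivAt_conv h hK x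
  rw [hL.fderiv, hLv]

theorem differentiable_conv {C : ℝ} {ψ : Fn d} (h : EB C ψ) {K : Smo d}
    (hK : HasCompactSupport K) : Differentiable ℝ (conv K ψ) := fun x => by
  obtain ⟨L, hL, -⟩ := hasFDerivAt_conv h hK x
  exact hL.differentiableAt

theorem bddSmooth_conv {C : ℝ} {ψ : Fn d} (h : EB C ψ) {K : Smo d} (hK : HasCompactSupport K) :
    BddSmooth (conv K ψ) := by
  refine bddSmooth_of_coind (fun φ => ∃ K : Smo d, HasCompactSupport K ∧ φ = conv K ψ) ?_ ?_ ?_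
    ⟨K, hK, rfl⟩
  · rintro φ ⟨K, hK, rfl⟩
    exact ⟨_, abs_conv_le h (integrable_of_hasCompactSupport hK)⟩
  · rintro φ ⟨K, hK, rfl⟩
    exact differentiable_conv h hK
  · rintro φ ⟨K, hK, rfl⟩ v
    exact ⟨D v K, hasCompactSupport_Dl hK [v], funext fun x => fderiv_conv h hK x v⟩

/-- The criterion for regularity of time dependent functions. -/
theorem smT_of_coind (R : TFn d → Prop) (hb : ∀ ψ, R ψ → BM ψ)
    (hd : ∀ ψ, R ψ → ∀ t, Differentiable ℝ (ψ t))
    (hs : ∀ ψ, R ψ → ∀ v, R fun t x => fderiv ℝ (ψ t) x v) {ψ : TFn d} (h : R ψ) (n : ℕ) :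
    SmT n ψ := by
  have hlip : ∀ ψ, R ψ → LipT ψ := by
    intro ψ h
    refine ⟨hb ψ h, ?_⟩
    choose C hC using fun i : Fin d => (hb _ (hs ψ h (e i))).2
    have hC0 : ∀ i, 0 ≤ C i := fun i => (abs_nonneg _).trans (hC i 0 0)
    have h1 : ∀ t x, ‖fderiv ℝ (ψ t) x‖ ≤ ∑ i, C i := by
      intro t x
      refine ContinuousLinearMap.opNorm_le_bound _ (sum_nonneg fun i _ => hC0 i) fun v => ?_
      have h2 : fderiv ℝ (ψ t) x v = ∑ i, v i * fderiv ℝ (ψ t) x (e i) := by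
        conv_lhs => rw [← sum_smul_e v]
        simp only [map_sum, map_smul, smul_eq_mul]
      rw [h2, Real.norm_eq_abs, sum_mul]
      refine (abs_sum_le_sum_abs _ _).trans (sum_le_sum fun i _ => ?_)
      rw [abs_mul, mul_comm]
      exact mul_le_mul (hC i t x) (PiLp.norm_apply_le v i) (abs_nonneg _) (hC0 i)
    refine ⟨∑ i, C i, fun t x y => ?_⟩
    have := Convex.norm_image_sub_le_of_norm_fderiv_le (𝕜 := ℝ) (f := ψ t) (s := univ)
      (fun x _ => hd ψ h t x) (fun x _ => h1 t x) convex_univ (mem_univ x) (mem_univ (x + y))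
    simpa using this
  induction n generalizing ψ with
  | zero => exact hlip ψ h
  | succ n ih => exact ⟨hlip ψ h, hd ψ h, fun v => ih (hs ψ h v)⟩

theorem BM.eb {ψ : TFn d} (h : BM ψ) : ∃ C, ∀ t, EB C (ψ t) := by
  obtain ⟨C, hC⟩ := h.2
  exact ⟨C, fun t => EB.of_bound (h.measurable_space t) (hC t)⟩

theorem BM.conv {ψ : TFn d} (h : BM ψ) {K : Smo d} (hK : HasCompactSupport K) :
    BM fun t x => conv K (ψ t) x := by
  obtain ⟨C, hC⟩ := h.eb
  refine ⟨?_, _, fun t x => abs_conv_le (hC t) (integrable_of_hasCompactSupport hK) x⟩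
  have h1 : Measurable fun z : (ℝ × Sp d) × Sp d => K z.2 * ψ z.1.1 (z.1.2 - z.2) :=
    ((Smo.continuous K).measurable.comp measurable_snd).mul
      (h.1.comp ((measurable_fst.comp measurable_fst).prodMk
        ((measurable_snd.comp measurable_fst).sub measurable_snd)))
  exact (h1.stronglyMeasurable.integral_prod_right' (ν := volume)).measurable

theorem smT_conv {ψ : TFn d} (h : BM ψ) {K : Smo d} (hK : HasCompactSupport K) (n : ℕ) :
    SmT n fun t x => conv K (ψ t) x := by
  obtain ⟨C, hC⟩ := h.eb
  refine smT_of_coind (fun φ => ∃ K : Smo d, HasCompactSupport K ∧ φ = fun t x => conv K (ψ t) x)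
    ?_ ?_ ?_ ⟨K, hK, rfl⟩ n
  · rintro φ ⟨K, hK, rfl⟩; exact h.conv hK
  · rintro φ ⟨K, hK, rfl⟩ t; exact differentiable_conv (hC t) hK
  · rintro φ ⟨K, hK, rfl⟩ v
    exact ⟨D v K, hasCompactSupport_Dl hK [v],
      funext fun t => funext fun x => fderiv_conv (hC t) hK x v⟩

/-! ### Mollifiers -/

/-- Bump functions with support shrinking to the origin. -/
def bump (d n : ℕ) : ContDiffBump (0 : Sp d) :=
  ⟨1 / (2 * ((n : ℝ) + 1)), 1 / ((n : ℝ) + 1), by positivity, by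
    apply one_div_lt_one_div_of_lt <;> linarith [(n.cast_nonneg : (0 : ℝ) ≤ n)]⟩

theorem bddSmooth_of_hasCompactSupport {φ : Fn d} (h : ContDiff ℝ ∞ φ)
    (h' : HasCompactSupport φ) : BddSmooth φ := by
  refine ⟨h, fun n => ?_⟩
  obtain ⟨C, hC⟩ := (h.continuous_iteratedFDeriv (m := n) (by exact_mod_cast le_top)).bounded_above_of_compact_support
    (h'.iteratedFDeriv n)
  exact ⟨C, hC⟩

/-- The mollification kernel. -/
def rho (d n : ℕ) : Smo d :=
  ⟨(bump d n).normed volume, bddSmooth_of_hasCompactSupport (bump d n).contDiff_normed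
    (bump d n).hasCompactSupport_normed⟩

/-- The radius of the support of the mollification kernel. -/
def eps (n : ℕ) : ℝ := 1 / ((n : ℝ) + 1)

theorem eps_pos (n : ℕ) : 0 < eps n := by unfold eps; positivity

theorem tendsto_eps : Tendsto eps atTop (nhds 0) := tendsto_one_div_add_atTop_nhds_zero_nat

theorem rho_nonneg (n : ℕ) (x : Sp d) : 0 ≤ rho d n x := (bump d n).nonneg_normed x

theorem integral_rho (n : ℕ) : ∫ x, rho d n x = 1 := (bump d n).integral_normed

theorem hasCompactSupport_rho (n : ℕ) : HasCompactSupport (rho d n) :=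
  (bump d n).hasCompactSupport_normed

theorem integrable_rho (n : ℕ) : Integrable (rho d n) (volume : Measure (Sp d)) :=
  integrable_of_hasCompactSupport (hasCompactSupport_rho n)

theorem rho_eq_zero {n : ℕ} {x : Sp d} (h : eps n < ‖x‖) : rho d n x = 0 := by
  by_contra h'
  have h1 : x ∈ Function.support ((bump d n).normed volume) := h'
  rw [ContDiffBump.support_normed_eq, mem_ball_zero_iff] at h1
  exact absurd (h1.trans h) (lt_irrefl _)

/-- The function `∫ ρ_n(y) ψ(x - y) dy` as a number. -/
theorem conv_rho_le {n : ℕ} {ψ : Fn d} {C a : ℝ} {x : Sp d} (h : EB C ψ)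
    (h' : ∀ᵐ y, ‖y‖ ≤ eps n → ψ (x - y) ≤ a) : conv (rho d n) ψ x ≤ a := by
  have h1 : ∫ y, rho d n y * a = a := by rw [integral_mul_const, integral_rho, one_mul]
  rw [← h1, conv]
  refine integral_mono_ae ((h.comp_sub x).integrable_mul (integrable_rho n))
    ((integrable_rho n).mul_const a) ?_
  filter_upwards [h'] with y hy
  rcases le_or_gt ‖y‖ (eps n) with h2 | h2
  · exact mul_le_mul_of_nonneg_left (hy h2) (rho_nonneg n y)
  · simp [rho_eq_zero h2]

theorem conv_sub_const {n : ℕ} {ψ : Fn d} {C : ℝ} {x : Sp d} (h : EB C ψ) (b : ℝ) :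
    conv (rho d n) (fun y => ψ y - b) x = conv (rho d n) ψ x - b := by
  have h1 : ∫ y, rho d n y * b = b := by rw [integral_mul_const, integral_rho, one_mul]
  simp only [conv, mul_sub]
  rw [integral_sub ((h.comp_sub x).integrable_mul (integrable_rho n))
    ((integrable_rho n).mul_const b), h1]

theorem EB.neg {ψ : Fn d} {C : ℝ} (h : EB C ψ) : EB C fun x => -ψ x :=
  ⟨h.1.neg, by simpa using h.2⟩

theorem EB.add {ψ φ : Fn d} {C C' : ℝ} (h : EB C ψ) (h' : EB C' φ) :
    EB (C + C') fun x => ψ x + φ x :=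
  ⟨h.1.add h'.1, by
    filter_upwards [h.2, h'.2] with x h1 h2
    exact (abs_add_le _ _).trans (add_le_add h1 h2)⟩

theorem EB.mul {ψ φ : Fn d} {C C' : ℝ} (h : EB C ψ) (h' : EB C' φ) :
    EB (C * C') fun x => ψ x * φ x :=
  ⟨h.1.mul h'.1, by
    filter_upwards [h.2, h'.2] with x h1 h2
    rw [abs_mul]
    exact mul_le_mul h1 h2 (abs_nonneg _) ((abs_nonneg _).trans h1)⟩

theorem EB.const (a : ℝ) : EB (d := d) |a| fun _ => a := EB.of_bound measurable_const fun _ => le_rfl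

theorem conv_neg (K ψ : Fn d) (x : Sp d) : conv K (fun y => -ψ y) x = -conv K ψ x := by
  simp [conv, integral_neg]

theorem conv_add {K ψ φ : Fn d} {C C' : ℝ} (hK : Integrable K volume) (h : EB C ψ)
    (h' : EB C' φ) (x : Sp d) :
    conv K (fun y => ψ y + φ y) x = conv K ψ x + conv K φ x := by
  simp only [conv, mul_add]
  exact integral_add ((h.comp_sub x).integrable_mul hK) ((h'.comp_sub x).integrable_mul hK)

theorem conv_const_mul (K ψ : Fn d) (a : ℝ) (x : Sp d) :
    conv K (fun y => a * ψ y) x = a * conv K ψ x := by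
  simp only [conv]
  rw [← integral_const_mul]
  congr 1; funext y; ring

theorem conv_congr {K ψ φ : Fn d} (h : ψ =ᵐ[volume] φ) (x : Sp d) :
    conv K ψ x = conv K φ x := by
  refine integral_congr_ae ?_
  have h1 := qmp_sub x
  filter_upwards [h1.ae h] with y hy
  rw [hy]

theorem abs_conv_rho_sub_le {n : ℕ} {ψ : Fn d} {C a b : ℝ} {x : Sp d} (h : EB C ψ)
    (h' : ∀ᵐ y, ‖y‖ ≤ eps n → |ψ (x - y) - b| ≤ a) : |conv (rho d n) ψ x - b| ≤ a := by
  rw [← conv_sub_const h, abs_le, neg_le]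
  have h1 : EB (C + |b|) fun y => ψ y - b := by
    simpa [sub_eq_add_neg] using h.add (EB.const (-b))
  constructor
  · rw [← conv_neg]
    refine conv_rho_le h1.neg ?_
    filter_upwards [h'] with y hy h2
    exact (neg_le_abs _).trans (hy h2)
  · refine conv_rho_le h1 ?_
    filter_upwards [h'] with y hy h2
    exact (le_abs_self _).trans (hy h2)

theorem tendsto_conv_rho {ψ : Fn d} {C : ℝ} (h : EB C ψ) {x : Sp d} (hx : ContinuousAt ψ x) :
    Tendsto (fun n => conv (rho d n) ψ x) atTop (nhds (ψ x)) := by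
  rw [Metric.tendsto_atTop]
  intro ε hε
  obtain ⟨r, hr, hr'⟩ := Metric.continuousAt_iff.1 hx (ε / 2) (by linarith)
  obtain ⟨N, hN⟩ := (tendsto_eps.eventually (gt_mem_nhds hr)).exists_forall_of_atTop
  refine ⟨N, fun n hn => ?_⟩
  rw [Real.dist_eq]
  refine (abs_conv_rho_sub_le h (a := ε / 2) (ae_of_all _ fun y hy => ?_)).trans_lt (by linarith)
  have : dist (x - y) x < r := by
    rw [dist_eq_norm]; simpa using hy.trans_lt (hN n hn)
  exact (hr' this).le

theorem ae_tendsto_conv_rho {v : Fn d} (h : LocallyIntegrable v (volume : Measure (Sp d))) :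
    ∀ᵐ x, Tendsto (fun n => conv (rho d n) v x) atTop (nhds (v x)) := by
  have h1 : Tendsto (fun n => (bump d n).rOut) atTop (nhds 0) := tendsto_eps
  refine ContDiffBump.ae_convolution_tendsto_right_of_locallyIntegrable (φ := bump d) (K := 2) h1
    (.of_forall fun n => ?_) h
  have : (0 : ℝ) < n + 1 := by positivity
  simp only [bump]
  rw [← mul_div_assoc, mul_one, div_le_div_iff₀ (by positivity) (by positivity)]
  linarith

/-- Jensen's inequality for a family of functions. -/
theorem sum_sq_conv_rho_le {ι : Type*} [Fintype ι] {v : ι → Fn d} {C : ℝ}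
    (hv : ∀ i, ∃ B, EB B (v i)) (h : ∀ᵐ x, ∑ i, v i x ^ 2 ≤ C) (n : ℕ) (x : Sp d) :
    ∑ i, conv (rho d n) (v i) x ^ 2 ≤ C := by
  choose B hB using hv
  set a : ι → ℝ := fun i => conv (rho d n) (v i) x with ha
  have h1 := qmp_sub x
  have hE : ∀ s : Finset ι, (∃ B', EB B' fun y => ∑ i ∈ s, a i * v i y) ∧
      conv (rho d n) (fun y => ∑ i ∈ s, a i * v i y) x = ∑ i ∈ s, a i * a i := by
    classical
    intro s
    induction s using Finset.induction_on with
    | empty => exact ⟨⟨|0|, by simpa using EB.const 0⟩, by simp [conv]⟩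
    | insert i s hi ih =>
      obtain ⟨⟨B', hB'⟩, ih⟩ := ih
      have h2 : EB (|a i| * B i) fun y => a i * v i y := (EB.const (a i)).mul (hB i)
      simp only [sum_insert hi]
      refine ⟨⟨_, h2.add hB'⟩, ?_⟩
      rw [conv_add (integrable_rho n) h2 hB', conv_const_mul, ih]
  obtain ⟨⟨B', hB'⟩, hE⟩ := hE Finset.univ
  have h2 : ∑ i, a i * a i ≤ (∑ i, a i ^ 2 + C) / 2 := by
    rw [← hE]
    refine conv_rho_le hB' ?_
    filter_upwards [h1.ae h] with y hy _
    have : ∑ i, a i * v i (x - y) ≤ ∑ i, (a i ^ 2 + v i (x - y) ^ 2) / 2 :=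
      sum_le_sum fun i _ => by nlinarith [sq_nonneg (a i - v i (x - y))]
    rw [← Finset.sum_div, sum_add_distrib] at this
    linarith
  simp only [← sq] at h2
  linarith

open Classical in
/-- The mollification of an essentially bounded function. -/
def mo (n : ℕ) (ψ : Fn d) : Smo d :=
  if h : ∃ C, EB C ψ then ⟨conv (rho d n) ψ, bddSmooth_conv h.choose_spec (hasCompactSupport_rho n)⟩
  else 0

theorem mo_apply {ψ : Fn d} {C : ℝ} (h : EB C ψ) (n : ℕ) (x : Sp d) :
    mo n ψ x = conv (rho d n) ψ x := by
  rw [mo, dif_pos ⟨C, h⟩]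

theorem Dl_mo {ψ : Fn d} {C : ℝ} (h : EB C ψ) (n : ℕ) (l : List (Sp d)) (x : Sp d) :
    Dl l (mo n ψ) x = conv (Dl l (rho d n)) ψ x := by
  induction l generalizing x with
  | nil => exact mo_apply h n x
  | cons v l ih =>
    rw [Dl_cons, D_apply, funext ih, fderiv_conv h (hasCompactSupport_Dl (hasCompactSupport_rho n) l)]
    rfl

theorem regT_mo {ψ : TFn d} (h : BM ψ) (n : ℕ) : RegT fun t => mo n (ψ t) := by
  obtain ⟨C, hC⟩ := h.eb
  intro k
  simp only [mo_apply (hC _)]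
  exact smT_conv h (hasCompactSupport_rho n) k

theorem mo_congr {ψ φ : Fn d} {C : ℝ} (h : EB C ψ) (h' : ψ =ᵐ[volume] φ) (n : ℕ) :
    mo n ψ = mo n φ := by
  have h2 : EB C φ := ⟨h.1.congr h', by filter_upwards [h.2, h'] with x h1 h2; rwa [← h2]⟩
  ext x
  rw [mo_apply h, mo_apply h2, conv_congr h']

theorem isTest_of {φ : Smo d} (h : HasCompactSupport φ) : IsTest φ := ⟨Smo.contDiff φ, h⟩

theorem IsTest.lift {φ : Fn d} (h : IsTest φ) :
    ∃ θ : Smo d, HasCompactSupport θ ∧ φ = θ :=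
  ⟨⟨φ, bddSmooth_of_hasCompactSupport h.1 h.2⟩, h.2, rfl⟩

theorem integral_mul_D {φ θ : Smo d} (hθ : HasCompactSupport θ) (v : Sp d) :
    ∫ x, φ x * D v θ x = -∫ x, D v φ x * θ x := by
  have h1 : ∀ (φ θ : Smo d), HasCompactSupport θ → Integrable fun x => φ x * θ x := by
    intro φ θ hθ
    exact ((Smo.continuous φ).mul (Smo.continuous θ)).integrable_of_hasCompactSupport hθ.mul_left
  exact integral_mul_fderiv_eq_neg_fderiv_mul_of_integrable (h1 (D v φ) θ hθ)
    (h1 φ (D v θ) (hasCompactSupport_Dl hθ [v])) (h1 φ θ hθ)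
    (fun x _ => Smo.differentiable φ x) (fun x _ => Smo.differentiable θ x)

theorem integral_mul_Dl {φ θ : Smo d} (hθ : HasCompactSupport θ) (l : List (Sp d)) :
    ∫ x, φ x * Dl l θ x = (-1) ^ l.length * ∫ x, Dl l φ x * θ x := by
  induction l generalizing φ with
  | nil => simp
  | cons v l ih =>
    rw [Dl_cons, integral_mul_D (hasCompactSupport_Dl hθ l), ih, Dl_cons, ← D_Dl,
      List.length_cons, pow_succ]
    ring

theorem isWeakDeriv_iff {l : List (Sp d)} {ψ v : Fn d} :
    IsWeakDeriv l ψ v ↔ LocallyIntegrable ψ volume ∧ LocallyIntegrable v volume ∧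
      ∀ θ : Smo d, HasCompactSupport θ →
        ∫ x, ψ x * Dl l θ x = (-1) ^ l.length * ∫ x, v x * θ x := by
  unfold IsWeakDeriv
  refine and_congr_right fun _ => and_congr_right fun _ => ⟨fun h θ hθ => ?_, fun h φ hφ => ?_⟩
  · have := h θ (isTest_of hθ)
    simpa only [iteratedFDeriv_eq_Dl] using this
  · obtain ⟨θ, hθ, rfl⟩ := hφ.lift
    simpa only [iteratedFDeriv_eq_Dl] using h θ hθ

theorem isWeakDeriv_Dl (l : List (Sp d)) (φ : Smo d) : IsWeakDeriv l φ (Dl l φ) :=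
  isWeakDeriv_iff.2 ⟨(Smo.continuous φ).locallyIntegrable, (Smo.continuous _).locallyIntegrable,
    fun _ hθ => integral_mul_Dl hθ l⟩

/-- The reflected kernel `y ↦ K(x - y)`. -/
def refl (x : Sp d) (K : Smo d) : Smo d :=
  ⟨fun y => K (x - y), by
    refine bddSmooth_of_coind (fun φ => ∃ K : Smo d, φ = fun y => K (x - y)) ?_ ?_ ?_ ⟨K, rfl⟩
    · rintro φ ⟨K, rfl⟩
      obtain ⟨C, hC⟩ := Smo.bounded K
      exact ⟨C, fun y => hC _⟩
    · rintro φ ⟨K, rfl⟩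
      exact (Smo.differentiable K).comp (differentiable_id.const_sub x)
    · rintro φ ⟨K, rfl⟩ v
      refine ⟨-D v K, funext fun y => ?_⟩
      have h1 : HasFDerivAt (fun y => K (x - y)) ((fderiv ℝ K (x - y)).comp
          (-ContinuousLinearMap.id ℝ (Sp d))) y :=
        (Smo.differentiable K (x - y)).hasFDerivAt.comp y ((hasFDerivAt_id y).const_sub x)
      rw [h1.fderiv]
      simp [D_apply]⟩

theorem refl_apply (x : Sp d) (K : Smo d) (y : Sp d) : refl x K y = K (x - y) := rfl

theorem D_refl (x v : Sp d) (K : Smo d) : D v (refl x K) = -refl x (D v K) := by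
  ext y
  have h1 : HasFDerivAt (fun y => K (x - y)) ((fderiv ℝ K (x - y)).comp
      (-ContinuousLinearMap.id ℝ (Sp d))) y :=
    (Smo.differentiable K (x - y)).hasFDerivAt.comp y ((hasFDerivAt_id y).const_sub x)
  have : fderiv ℝ (refl x K) y v = -fderiv ℝ K (x - y) v := by
    have h2 : (refl x K : Fn d) = fun y => K (x - y) := rfl
    rw [h2, h1.fderiv]
    simp
  simpa [D_apply, refl_apply] using this

theorem Dl_refl (x : Sp d) (l : List (Sp d)) (K : Smo d) :
    Dl l (refl x K) = (-1 : ℝ) ^ l.length • refl x (Dl l K) := by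
  induction l with
  | nil => simp
  | cons v l ih =>
    rw [Dl_cons, ih, map_smul, D_refl, Dl_cons, List.length_cons, pow_succ]
    simp

theorem hasCompactSupport_refl (x : Sp d) {K : Smo d} (h : HasCompactSupport K) :
    HasCompactSupport (refl x K) :=
  h.comp_homeomorph (Homeomorph.subLeft x)

/-- Mollification commutes with generalized derivatives. -/
theorem IsWeakDeriv.conv {l : List (Sp d)} {ψ v : Fn d} (h : IsWeakDeriv l ψ v) {K : Smo d}
    (hK : HasCompactSupport K) (x : Sp d) : conv (Dl l K) ψ x = conv K v x := by
  have h1 := (isWeakDeriv_iff.1 h).2.2 (refl x K) (hasCompactSupport_refl x hK)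
  rw [Dl_refl] at h1
  have h2 : ((-1 : ℝ) ^ l.length) * (-1) ^ l.length = 1 := by
    rw [← mul_pow]; simp
  rw [conv_swap, conv_swap]
  have h3 : ∫ y, ψ y * ((-1 : ℝ) ^ l.length • refl x (Dl l K)) y =
      (-1) ^ l.length * ∫ y, Dl l K (x - y) * ψ y := by
    rw [← integral_const_mul]
    congr 1; funext y
    rw [Smo.smul_apply, refl_apply]; ring
  rw [h3] at h1
  have h4 := congrArg (fun r => (-1 : ℝ) ^ l.length * r) h1
  simp only [← mul_assoc, h2, one_mul] at h4
  rw [h4]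
  congr 1; funext y
  rw [refl_apply, mul_comm]

theorem IsWeakDeriv.Dl_mo {l : List (Sp d)} {ψ v : Fn d} (h : IsWeakDeriv l ψ v) {C C' : ℝ}
    (hψ : EB C ψ) (hv : EB C' v) (n : ℕ) : Dl l (mo n ψ) = mo n v := by
  ext x
  rw [FDScheme.Dl_mo hψ, mo_apply hv, h.conv (hasCompactSupport_rho n)]

theorem IsWeakDeriv.unique {l : List (Sp d)} {ψ v v' : Fn d} (h : IsWeakDeriv l ψ v)
    (h' : IsWeakDeriv l ψ v') : v =ᵐ[volume] v' := by
  filter_upwards [ae_tendsto_conv_rho h.2.1, ae_tendsto_conv_rho h'.2.1] with x h1 h2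
  refine tendsto_nhds_unique h1 ?_
  simpa only [← h.conv (hasCompactSupport_rho _), ← h'.conv (hasCompactSupport_rho _)] using h2

theorem Dl_mo_smo (l : List (Sp d)) (φ : Smo d) (n : ℕ) : Dl l (mo n φ) = mo n (Dl l φ) := by
  obtain ⟨C, hC⟩ := Smo.eb φ
  obtain ⟨C', hC'⟩ := Smo.eb (Dl l φ)
  exact (isWeakDeriv_Dl l φ).Dl_mo hC hC' n

/-! ### Existence of generalized derivatives -/

theorem exists_weakDeriv {ψ : Fn d} {B C : ℝ} (hψ : EB B ψ) {l : List (Sp d)}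
    (h : ∀ n x, |Dl l (mo n ψ) x| ≤ C) : ∃ v, EB C v ∧ IsWeakDeriv l ψ v := by
  have hC0 : 0 ≤ C := (abs_nonneg _).trans (h 0 0)
  set r : ℝ := -((d : ℝ) + 1) with hr
  set s : Fn d := fun x => (1 + ‖x‖) ^ r with hs
  have h1x : ∀ x : Sp d, 0 < 1 + ‖x‖ := fun x => by positivity
  have hs0 : ∀ x, 0 < s x := fun x => Real.rpow_pos_of_pos (h1x x) _
  have hs1 : ∀ x, s x ≤ 1 := fun x =>
    Real.rpow_le_one_of_one_le_of_nonpos (by linarith [norm_nonneg x]) (by rw [hr]; linarith [(d.cast_nonneg : (0 : ℝ) ≤ d)])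
  have hsc : Continuous s :=
    Continuous.rpow_const (by fun_prop) fun x => Or.inl (h1x x).ne'
  have hsi : Integrable s (volume : Measure (Sp d)) :=
    integrable_one_add_norm (by simp)
  have hmem : ∀ θ : Fn d, Continuous θ → (∀ x, |θ x| ≤ C * s x) → MemLp θ 2 volume := by
    intro θ hθ hb
    rw [memLp_two_iff_integrable_sq hθ.aestronglyMeasurable]
    refine (hsi.const_mul (C ^ 2)).mono' (hθ.pow 2).aestronglyMeasurable (ae_of_all _ fun x => ?_)
    rw [Real.norm_eq_abs, abs_pow]
    calc |θ x| ^ 2 ≤ (C * s x) ^ 2 := by gcongr; exact hb x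
      _ = C ^ 2 * (s x * s x) := by ring
      _ ≤ C ^ 2 * (s x * 1) := by have := (hs0 x).le; have := hs1 x; gcongr
      _ = _ := by ring
  have hX : ∀ n, MemLp (fun x => Dl l (mo n ψ) x * s x) 2 (volume : Measure (Sp d)) := fun n =>
    hmem _ ((Smo.continuous _).mul hsc) fun x => by
      rw [abs_mul, abs_of_pos (hs0 x)]
      exact mul_le_mul_of_nonneg_right (h n x) (hs0 x).le
  have hY : MemLp (fun x => C * s x) 2 (volume : Measure (Sp d)) :=
    hmem _ (continuous_const.mul hsc) fun x => by
      rw [abs_of_nonneg (mul_nonneg hC0 (hs0 x).le)]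
  set X : ℕ → Lp ℝ 2 (volume : Measure (Sp d)) := fun n => (hX n).toLp _ with hXdef
  set B' := ‖hY.toLp (fun x => C * s x)‖ with hB'
  have hXn : ∀ n, ‖X n‖ ≤ B' := by
    intro n
    refine Lp.norm_le_norm_of_ae_le ?_
    filter_upwards [(hX n).coeFn_toLp, hY.coeFn_toLp] with x hx hy
    rw [hXdef, hx, hy, Real.norm_eq_abs, Real.norm_eq_abs, abs_mul, abs_mul, abs_of_nonneg hC0]
    exact mul_le_mul_of_nonneg_right (h n x) (abs_nonneg _)
  set U : Ultrafilter ℕ := Filter.hyperfilter ℕ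
  have hlim : ∀ f : Lp ℝ 2 (volume : Measure (Sp d)),
      ∃ a, Tendsto (fun n => inner ℝ (X n) f) U (nhds a) ∧ |a| ≤ B' * ‖f‖ := by
    intro f
    have hb : ∀ n, |inner ℝ (X n) f| ≤ B' * ‖f‖ := fun n =>
      (abs_real_inner_le_norm _ _).trans (by gcongr; exact hXn n)
    have hc : IsCompact (Set.Icc (-(B' * ‖f‖)) (B' * ‖f‖)) := isCompact_Icc
    obtain ⟨a, ha, ha'⟩ := hc.ultrafilter_le_nhds (U.map fun n : ℕ => (inner ℝ (X n) f : ℝ)) (by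
      rw [Filter.le_principal_iff]
      exact Filter.mem_map.2 (Filter.Eventually.of_forall fun n => abs_le.1 (hb n)))
    exact ⟨a, ha', abs_le.2 ha⟩
  choose Fl hFl hFlb using hlim
  let L₀ : Lp ℝ 2 (volume : Measure (Sp d)) →ₗ[ℝ] ℝ :=
    { toFun := Fl
      map_add' := fun f g => tendsto_nhds_unique (hFl (f + g)) (by
        simpa only [inner_add_right] using (hFl f).add (hFl g))
      map_smul' := fun a f => tendsto_nhds_unique (hFl (a • f)) (by
        simp only [real_inner_smul_right]
        exact (hFl f).const_mul a) }
  let L := L₀.mkContinuous B' fun f => hFlb f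
  set y := (InnerProductSpace.toDual ℝ (Lp ℝ 2 (volume : Measure (Sp d)))).symm L with hy
  have hyL : ∀ f, inner ℝ y f = Fl f := fun f => InnerProductSpace.toDual_symm_apply
  set v : Fn d := fun x => (s x)⁻¹ * y x with hv
  have hsinv : Continuous fun x => (s x)⁻¹ := hsc.inv₀ fun x => (hs0 x).ne'
  have hvl : LocallyIntegrable v (volume : Measure (Sp d)) := by
    have h1 : LocallyIntegrable y (volume : Measure (Sp d)) :=
      (Lp.memLp y).locallyIntegrable (by norm_num)
    rw [← locallyIntegrableOn_univ] at h1 ⊢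
    exact h1.continuousOn_mul hsinv.continuousOn isOpen_univ.isLocallyClosed
  have hweak : IsWeakDeriv l ψ v := by
    refine isWeakDeriv_iff.2 ⟨hψ.locallyIntegrable, hvl, fun θ hθ => ?_⟩
    have hθs : MemLp (fun x => (s x)⁻¹ * θ x) 2 (volume : Measure (Sp d)) :=
      (hsinv.mul (Smo.continuous θ)).memLp_of_hasCompactSupport hθ.mul_left
    have e1 : ∀ n, inner ℝ (X n) (hθs.toLp _) = ∫ x, Dl l (mo n ψ) x * θ x := by
      intro n
      rw [L2.inner_def]
      refine integral_congr_ae ?_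
      filter_upwards [(hX n).coeFn_toLp, hθs.coeFn_toLp] with x hx hx'
      rw [hXdef, hx, hx']
      have := (hs0 x).ne'
      simp only [RCLike.inner_apply, conj_trivial]
      field_simp
    have e2 : inner ℝ y (hθs.toLp _) = ∫ x, v x * θ x := by
      rw [L2.inner_def]
      refine integral_congr_ae ?_
      filter_upwards [hθs.coeFn_toLp] with x hx'
      rw [hx']
      simp only [RCLike.inner_apply, conj_trivial, hv]
      ring
    have e3 : Tendsto (fun n => ∫ x, mo n ψ x * Dl l θ x) atTop
        (nhds (∫ x, ψ x * Dl l θ x)) := by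
      have hD := integrable_of_hasCompactSupport (hasCompactSupport_Dl hθ l)
      refine tendsto_integral_of_dominated_convergence (fun x => B * |Dl l θ x|)
        (fun n => ((Smo.continuous _).mul (Smo.continuous _)).aestronglyMeasurable)
        (hD.abs.const_mul B) (fun n => ae_of_all _ fun x => ?_) ?_
      · rw [norm_mul, Real.norm_eq_abs, Real.norm_eq_abs, mo_apply hψ]
        refine mul_le_mul_of_nonneg_right ?_ (abs_nonneg _)
        have := abs_conv_le hψ (integrable_rho n) x
        simpa only [abs_of_nonneg (rho_nonneg n _), integral_rho, one_mul] using this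
      · filter_upwards [ae_tendsto_conv_rho hψ.locallyIntegrable] with x hx
        simp only [mo_apply hψ]
        exact hx.mul_const _
    have e4 : ∀ n, ∫ x, mo n ψ x * Dl l θ x = (-1) ^ l.length * ∫ x, Dl l (mo n ψ) x * θ x :=
      fun n => integral_mul_Dl hθ l
    have e5 := (hFl (hθs.toLp _)).const_mul ((-1 : ℝ) ^ l.length)
    simp only [e1, ← e4] at e5
    rw [← e2, hyL]
    exact tendsto_nhds_unique (e3.mono_left Nat.hyperfilter_le_atTop) e5
  refine ⟨v, ⟨hvl.aestronglyMeasurable, ?_⟩, hweak⟩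
  filter_upwards [ae_tendsto_conv_rho hvl] with x hx
  refine le_of_tendsto hx.abs (.of_forall fun n => ?_)
  rw [← hweak.conv (hasCompactSupport_rho n), ← Dl_mo hψ]
  exact h n x

/-! ### Multi-indices -/

theorem perm_flatMap_replicate (L : List (Fin d)) (hL : L.Nodup) (i : Fin d) (hi : i ∈ L)
    (α : Fin d → ℕ) :
    (L.flatMap fun j => List.replicate ((α + Pi.single i 1 : Fin d → ℕ) j) (e (d := d) j)).Perm
      (e i :: L.flatMap fun j => List.replicate (α j) (e j)) := by
  induction L with
  | nil => simp at hi
  | cons j L ih =>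
    obtain ⟨hj, hL⟩ := List.nodup_cons.1 hL
    simp only [List.flatMap_cons]
    by_cases hij : i = j
    · subst hij
      have h1 : L.flatMap (fun j => List.replicate ((α + Pi.single i 1 : Fin d → ℕ) j) (e (d := d) j)) =
          L.flatMap fun j => List.replicate (α j) (e j) := by
        refine List.flatMap_congr fun k hk => ?_
        have : k ≠ i := fun h => hj (h ▸ hk)
        simp [this]
      rw [h1]
      simp [List.replicate_succ]
    · have hi' : i ∈ L := by simpa [hij] using hi
      have h2 : (α + Pi.single i 1 : Fin d → ℕ) j = α j := by simp [Ne.symm hij]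
      rw [h2]
      exact ((ih hL hi').append_left _).trans List.perm_middle

theorem Dl_dirs_add (i : Fin d) (α : Fin d → ℕ) (φ : Smo d) :
    Dl (dirs (α + Pi.single i 1)) φ = Dl (dirs α) (D (e i) φ) := by
  rw [← D_Dl, ← Dl_cons]
  exact Dl_perm (perm_flatMap_replicate _ (List.nodup_finRange d) i (List.mem_finRange i) α) φ

theorem length_dirs {k : ℕ} {α : Fin d → ℕ} (h : α ∈ multi d k) : (dirs α).length = k := by
  rw [multi, mem_piAntidiag] at h
  rw [dirs, List.length_flatMap, ← h.1]
  simp only [List.length_replicate]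
  rw [Fin.sum_univ_def]

/-- The sum of the squares of the derivatives of order `k`, over multi-indices. -/
def Sq (k : ℕ) (φ : Smo d) (x : Sp d) : ℝ := ∑ α ∈ multi d k, Dl (dirs α) φ x ^ 2

theorem sum_Sq (k : ℕ) (φ : Smo d) (x : Sp d) :
    ∑ i, Sq k (D (e i) φ) x = ∑ α ∈ multi d (k + 1), ∑ i, if α i ≠ 0 then
      Dl (dirs α) φ x ^ 2 else 0 := by
  rw [sum_comm]
  refine sum_congr rfl fun i _ => ?_
  rw [← Finset.sum_filter, Sq]
  refine Finset.sum_bij' (fun α _ => α + Pi.single i 1) (fun α _ => α - Pi.single i 1) ?_ ?_ ?_ ?_ ?_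
  · intro α hα
    simp only [multi, mem_piAntidiag, Finset.mem_filter] at hα ⊢
    refine ⟨⟨?_, by simp⟩, by simp⟩
    simp [sum_add_distrib, hα.1]
  · intro α hα
    simp only [multi, mem_piAntidiag, Finset.mem_filter] at hα ⊢
    refine ⟨?_, by simp⟩
    have h1 : α = (α - Pi.single i 1) + Pi.single i 1 := by
      funext j
      by_cases hj : j = i
      · subst hj; simp; omega
      · simp [hj]
    have h2 := hα.1.1
    rw [h1] at h2
    have h3 : ∑ j, (Pi.single i 1 : Fin d → ℕ) j = 1 := by simp
    change ∑ j, ((α - Pi.single i 1 : Fin d → ℕ) j + (Pi.single i 1 : Fin d → ℕ) j) = k + 1 at h2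
    rw [sum_add_distrib, h3] at h2
    exact Nat.succ_injective h2
  · intro α _
    funext j
    simp
  · intro α hα
    have h3 : α i ≠ 0 := (Finset.mem_filter.1 hα).2
    funext j
    by_cases hj : j = i
    · subst hj; simp; omega
    · simp [hj]
  · intro α _
    rw [Dl_dirs_add]

theorem Sq_succ_le (k : ℕ) (φ : Smo d) (x : Sp d) :
    Sq (k + 1) φ x ≤ ∑ i, Sq k (D (e i) φ) x := by
  rw [sum_Sq]
  refine sum_le_sum fun α hα => ?_
  have h1 : ∃ i, α i ≠ 0 := by
    by_contra! h
    rw [multi, mem_piAntidiag] at hα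
    simp [h] at hα
  obtain ⟨i, hi⟩ := h1
  have := single_le_sum (f := fun i => if α i ≠ 0 then Dl (dirs α) φ x ^ 2 else 0)
    (fun i _ => by positivity) (Finset.mem_univ i)
  simpa only [if_pos hi] using this

theorem sum_Sq_le (k : ℕ) (φ : Smo d) (x : Sp d) :
    ∑ i, Sq k (D (e i) φ) x ≤ (k + 1) * Sq (k + 1) φ x := by
  rw [sum_Sq, Sq, mul_sum]
  refine sum_le_sum fun α hα => ?_
  have h1 : (∑ i, α i : ℕ) = k + 1 := (mem_piAntidiag.1 hα).1
  have h2 : ((k : ℝ) + 1) = ∑ i, (α i : ℝ) := by exact_mod_cast h1.symm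
  rw [h2, sum_mul]
  refine sum_le_sum fun i _ => ?_
  split_ifs with h
  · have : (1 : ℝ) ≤ α i := by exact_mod_cast Nat.one_le_iff_ne_zero.2 h
    nlinarith [sq_nonneg (Dl (dirs α) φ x)]
  · positivity

theorem multi_zero : multi d 0 = {0} := by
  ext α
  simp only [multi, mem_piAntidiag, Finset.mem_singleton]
  constructor
  · rintro ⟨h, -⟩
    funext i
    exact (Finset.sum_eq_zero_iff.1 h) i (Finset.mem_univ i)
  · rintro rfl; simp

theorem Sq_zero (φ : Smo d) (x : Sp d) : Sq 0 φ x = φ x ^ 2 := by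
  have : dirs (0 : Fin d → ℕ) = [] := by simp [dirs]
  simp [Sq, multi_zero, this]

theorem Sq_le_H (k : ℕ) (φ : Smo d) (x : Sp d) : Sq k φ x ≤ H k φ x := by
  induction k generalizing φ with
  | zero => rw [Sq_zero, H_zero]
  | succ k ih =>
    rw [H_succ]
    exact (Sq_succ_le k φ x).trans (sum_le_sum fun i _ => ih _)

theorem H_le_Sq (k : ℕ) (φ : Smo d) (x : Sp d) : H k φ x ≤ k.factorial * Sq k φ x := by
  induction k generalizing φ with
  | zero => rw [Sq_zero, H_zero]; simp
  | succ k ih =>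
    rw [H_succ]
    calc _ ≤ ∑ i, (k.factorial : ℝ) * Sq k (D (e i) φ) x := sum_le_sum fun i _ => ih _
      _ = k.factorial * ∑ i, Sq k (D (e i) φ) x := by rw [mul_sum]
      _ ≤ k.factorial * ((k + 1) * Sq (k + 1) φ x) := by gcongr; exact sum_Sq_le k φ x
      _ = _ := by rw [Nat.factorial_succ]; push_cast; ring

theorem H_Dl_le (n : ℕ) (l : List (Sp d)) (φ : Smo d) (x : Sp d) :
    H n (Dl l φ) x ≤ (l.map fun v => ‖v‖ ^ 2).prod * H (n + l.length) φ x := by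
  induction l generalizing n with
  | nil => simp
  | cons v l ih =>
    rw [Dl_cons, List.map_cons, List.prod_cons, List.length_cons, mul_assoc]
    refine (H_D_le n v _ x).trans (mul_le_mul_of_nonneg_left ?_ (by positivity))
    have := ih (n + 1)
    rwa [show n + 1 + l.length = n + (l.length + 1) by ring] at this

/-! ### Bounds for all mollifications -/

/-- The list of directions of a word. -/
def wl : (k : ℕ) → Wd (Finset.univ : Finset (Fin d)) k → List (Sp d)
  | 0, _ => []
  | k + 1, w => wl k w.2 ++ [e w.1]

theorem wop_eq_Dl (k : ℕ) (w : Wd (Finset.univ : Finset (Fin d)) k) (φ : Smo d) :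
    wop (fun i => D (e i)) k w φ = Dl (wl k w) φ := by
  induction k generalizing φ with
  | zero => rfl
  | succ k ih =>
    rw [wl, Dl_append]
    exact ih w.2 _

theorem H_eq_sum_Dl (k : ℕ) (φ : Smo d) (x : Sp d) :
    H k φ x = ∑ w : Wd (Finset.univ : Finset (Fin d)) k, Dl (wl k w) φ x ^ 2 := by
  rw [H_words]
  simp only [wop_eq_Dl]

/-- All mollifications satisfy `H_k ≤ C`. -/
def HB (k : ℕ) (C : ℝ) (ψ : Fn d) : Prop := ∀ n x, H k (mo n ψ) x ≤ C

theorem HB.mono {k : ℕ} {C C' : ℝ} {ψ : Fn d} (h : HB k C ψ) (hC : C ≤ C') : HB k C' ψ :=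
  fun n x => (h n x).trans hC

theorem HB.nonneg {k : ℕ} {C : ℝ} {ψ : Fn d} (h : HB k C ψ) : 0 ≤ C :=
  (H_nonneg _ _ 0).trans (h 0 0)

theorem sum_H_mo_le {ι : Type*} [Fintype ι] {φ : ι → Smo d} {k : ℕ} {C : ℝ}
    (h : ∀ x, ∑ i, H k (φ i) x ≤ C) (n : ℕ) (x : Sp d) : ∑ i, H k (mo n (φ i)) x ≤ C := by
  simp only [H_eq_sum_Dl, Dl_mo_smo] at h ⊢
  rw [← Fintype.sum_prod_type' (f := fun i w => mo n (Dl (wl k w) (φ i)) x ^ 2)]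
  have h1 : ∀ p : ι × Wd (Finset.univ : Finset (Fin d)) k,
      mo n (Dl (wl k p.2) (φ p.1)) x = conv (rho d n) (Dl (wl k p.2) (φ p.1)) x := by
    intro p
    obtain ⟨C, hC⟩ := Smo.eb (Dl (wl k p.2) (φ p.1))
    exact mo_apply hC n x
  simp only [h1]
  refine sum_sq_conv_rho_le (v := fun p : ι × Wd (Finset.univ : Finset (Fin d)) k =>
    Dl (wl k p.2) (φ p.1)) (fun p => Smo.eb _) (ae_of_all _ fun y => ?_) n x
  rw [Fintype.sum_prod_type' (f := fun i w => Dl (wl k w) (φ i) y ^ 2)]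
  exact h y

theorem Smo.hb {φ : Smo d} {k : ℕ} {C : ℝ} (h : ∀ x, H k φ x ≤ C) : HB k C φ := fun n x => by
  simpa using sum_H_mo_le (φ := fun _ : Unit => φ) (by simpa using h) n x

theorem tendsto_Dl_mo {ψ : ℕ → Fn d} {ψ₀ : Fn d} {B : ℝ} (hψ : ∀ j, EB B (ψ j))
    (hψ₀ : EB B ψ₀) (h : ∀ᵐ x, Tendsto (fun j => ψ j x) atTop (nhds (ψ₀ x)))
    (n : ℕ) (l : List (Sp d)) (x : Sp d) :
    Tendsto (fun j => Dl l (mo n (ψ j)) x) atTop (nhds (Dl l (mo n ψ₀) x)) := by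
  simp only [Dl_mo (hψ _), Dl_mo hψ₀, conv]
  have hK := integrable_of_hasCompactSupport (hasCompactSupport_Dl (hasCompactSupport_rho (d := d) n) l)
  have h1 := qmp_sub x
  refine tendsto_integral_of_dominated_convergence (fun y => |Dl l (rho d n) y| * B)
    (fun j => (((hψ j).comp_sub x).integrable_mul hK).aestronglyMeasurable)
    (hK.abs.mul_const B) (fun j => ?_) ?_
  · filter_upwards [((hψ j).comp_sub x).2] with y hy
    rw [norm_mul, Real.norm_eq_abs, Real.norm_eq_abs]
    gcongr
  · filter_upwards [h1.ae h] with y hy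
    exact hy.const_mul _

theorem HB.of_tendsto {ψ : ℕ → Fn d} {ψ₀ : Fn d} {B C : ℝ} {k : ℕ} (hψ : ∀ j, EB B (ψ j))
    (hψ₀ : EB B ψ₀) (h : ∀ᵐ x, Tendsto (fun j => ψ j x) atTop (nhds (ψ₀ x)))
    (hk : ∀ j, HB k C (ψ j)) : HB k C ψ₀ := by
  intro n x
  refine le_of_tendsto (f := fun j => H k (mo n (ψ j)) x) (x := atTop) ?_
    (.of_forall fun j => hk j n x)
  simp only [H_eq_sum_Dl]
  exact tendsto_finsetSum _ fun w _ => (tendsto_Dl_mo hψ hψ₀ h n _ x).pow 2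

theorem abs_Dl_le_of_H {l : List (Sp d)} {φ : Smo d} {C : ℝ} {x : Sp d}
    (h : H l.length φ x ≤ C) :
    |Dl l φ x| ≤ √((l.map fun v => ‖v‖ ^ 2).prod * C) := by
  refine Real.abs_le_sqrt ?_
  have h1 := H_Dl_le 0 l φ x
  rw [H_zero, zero_add] at h1
  have h2 : 0 ≤ (l.map fun v => ‖v‖ ^ 2).prod := List.prod_nonneg (by simp)
  exact h1.trans (mul_le_mul_of_nonneg_left h h2)

/-- Generalized derivatives of functions with bounded mollifications. -/
theorem HB.weakDeriv {ψ : Fn d} {B C : ℝ} {l : List (Sp d)} (hψ : EB B ψ)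
    (h : HB l.length C ψ) :
    EB (√((l.map fun v => ‖v‖ ^ 2).prod * C)) (weakDeriv l ψ) ∧
      IsWeakDeriv l ψ (weakDeriv l ψ) := by
  obtain ⟨v, hv, hw⟩ := exists_weakDeriv hψ fun n x => abs_Dl_le_of_H (h n x)
  have h1 : ∃ v, IsWeakDeriv l ψ v := ⟨v, hw⟩
  have h2 : IsWeakDeriv l ψ (FDScheme.weakDeriv l ψ) := by
    rw [FDScheme.weakDeriv, dif_pos h1]; exact h1.choose_spec
  have h3 := hw.unique h2
  exact ⟨⟨hv.1.congr h3, by filter_upwards [hv.2, h3] with x h1 h2; rwa [← h2]⟩, h2⟩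

/-! ### The classes `𝔅^m` -/

theorem MemB.of_weakDeriv {T : ℝ} {m k : ℕ} {ψ : TFn d} (h : MemB T m ψ) (hk : k ≤ m)
    {α : Fin d → ℕ} (hα : α ∈ multi d k) : ∃ C, ∀ t ∈ Icc 0 T,
      EB C (weakDeriv (dirs α) (ψ t)) ∧ IsWeakDeriv (dirs α) (ψ t) (weakDeriv (dirs α) (ψ t)) := by
  obtain ⟨C, hC⟩ := h.deriv_bounded k hk α hα
  refine ⟨C, fun t ht => ?_⟩
  obtain ⟨v, hw, hv⟩ := hC t ht
  have h1 : ∃ v, IsWeakDeriv (dirs α) (ψ t) v := ⟨v, hw⟩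
  have h2 : IsWeakDeriv (dirs α) (ψ t) (weakDeriv (dirs α) (ψ t)) := by
    rw [weakDeriv, dif_pos h1]; exact h1.choose_spec
  have h3 := hw.unique h2
  exact ⟨⟨hw.2.1.aestronglyMeasurable.congr h3,
    by filter_upwards [hv, h3] with x h1 h2; rwa [← h2]⟩, h2⟩

theorem MemB.eb {T : ℝ} {m : ℕ} {ψ : TFn d} (h : MemB T m ψ) :
    ∃ C, ∀ t ∈ Icc 0 T, EB C (ψ t) := by
  obtain ⟨C, hC⟩ := h.bounded
  exact ⟨C, fun t ht => EB.of_bound (h.continuous t ht).measurable (hC t ht)⟩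

theorem sum_H_mo_le_of_sqD {ι : Type*} [Fintype ι] {T : ℝ} {m k : ℕ} {ψ : ι → TFn d}
    (h : ∀ i, MemB T m (ψ i)) (hk : k ≤ m) {t : ℝ} (ht : t ∈ Icc 0 T) {C : ℝ}
    (hC : ∀ᵐ x, ∑ i, sqD k (ψ i t) x ≤ C) (n : ℕ) (x : Sp d) :
    ∑ i, H k (mo n (ψ i t)) x ≤ k.factorial * C := by
  have hd : ∀ (i : ι) (α : multi d k), ∃ C, EB C (weakDeriv (dirs α.1) (ψ i t)) ∧
      IsWeakDeriv (dirs α.1) (ψ i t) (weakDeriv (dirs α.1) (ψ i t)) := fun i α => by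
    obtain ⟨C, hC⟩ := (h i).of_weakDeriv hk α.2
    exact ⟨C, hC t ht⟩
  have h1 : ∑ i, Sq k (mo n (ψ i t)) x ≤ C := by
    have e1 : ∀ i, Sq k (mo n (ψ i t)) x =
        ∑ α : multi d k, conv (rho d n) (weakDeriv (dirs α.1) (ψ i t)) x ^ 2 := by
      intro i
      rw [Sq, ← sum_coe_sort (multi d k)]
      refine sum_congr rfl fun α _ => ?_
      obtain ⟨C, hC, hw⟩ := hd i α
      obtain ⟨C', hC'⟩ := (h i).eb
      rw [hw.Dl_mo (hC' t ht) hC, mo_apply hC]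
    simp only [e1]
    rw [← Fintype.sum_prod_type' (f := fun i (α : multi d k) =>
      conv (rho d n) (weakDeriv (dirs α.1) (ψ i t)) x ^ 2)]
    refine sum_sq_conv_rho_le (v := fun p : ι × multi d k => weakDeriv (dirs p.2.1) (ψ p.1 t))
      (fun p => by obtain ⟨C, hC, -⟩ := hd p.1 p.2; exact ⟨C, hC⟩) ?_ n x
    filter_upwards [hC] with y hy
    rw [Fintype.sum_prod_type' (f := fun i (α : multi d k) => weakDeriv (dirs α.1) (ψ i t) y ^ 2)]
    refine le_trans (le_of_eq ?_) hy
    refine sum_congr rfl fun i _ => ?_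
    rw [sqD, ← sum_coe_sort (multi d k)]
  calc _ ≤ ∑ i, (k.factorial : ℝ) * Sq k (mo n (ψ i t)) x := sum_le_sum fun i _ => H_le_Sq _ _ _
    _ = k.factorial * ∑ i, Sq k (mo n (ψ i t)) x := by rw [mul_sum]
    _ ≤ _ := by gcongr

theorem sqD_nonneg (k : ℕ) (ψ : Fn d) (x : Sp d) : 0 ≤ sqD k ψ x := by
  unfold sqD; positivity

theorem normB_nonneg (T : ℝ) (m : ℕ) (ψ : TFn d) : 0 ≤ normB T m ψ := Real.sqrt_nonneg _

theorem MemB.sum_sqD_le {T : ℝ} {m : ℕ} {ψ : TFn d} (h : MemB T m ψ) {t : ℝ}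
    (ht : t ∈ Icc 0 T) :
    ∀ᵐ x, ∑ k ∈ Finset.range (m + 1), sqD k (ψ t) x ≤ normB T m ψ ^ 2 := by
  set F : ℝ → ℝ≥0∞ := fun t => essSup (fun x => ENNReal.ofReal
    (∑ k ∈ Finset.range (m + 1), sqD k (ψ t) x)) volume with hF
  have hfin : (⨆ t ∈ Icc (0 : ℝ) T, F t) ≠ (∞ : ℝ≥0∞) := by
    have h1 : ∀ k, ∃ C, k ≤ m → ∀ t ∈ Icc 0 T, ∀ᵐ x, sqD k (ψ t) x ≤ C := by
      intro k
      by_cases hk : k ≤ m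
      · have h2 : ∀ α : multi d k, ∃ C, ∀ t ∈ Icc 0 T, EB C (weakDeriv (dirs α.1) (ψ t)) := by
          intro α
          obtain ⟨C, hC⟩ := h.of_weakDeriv hk α.2
          exact ⟨C, fun t ht => (hC t ht).1⟩
        choose C hC using h2
        refine ⟨∑ α, C α ^ 2, fun _ t ht => ?_⟩
        have h3 : ∀ᵐ x, ∀ α, |weakDeriv (dirs (α : multi d k).1) (ψ t) x| ≤ C α :=
          (ae_all_iff).2 fun α => (hC α t ht).2
        filter_upwards [h3] with x hx
        rw [sqD, ← sum_coe_sort (multi d k)]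
        refine sum_le_sum fun α _ => ?_
        rw [← sq_abs]
        have := hx α
        gcongr
      · exact ⟨0, fun h => absurd h hk⟩
    choose C hC using h1
    refine ne_top_of_le_ne_top (ENNReal.ofReal_ne_top
      (r := ∑ k ∈ Finset.range (m + 1), C k)) (iSup₂_le fun t ht => ?_)
    refine essSup_le_of_ae_le _ ?_
    have h3 : ∀ᵐ x, ∀ k : ℕ, k ≤ m → sqD k (ψ t) x ≤ C k :=
      ae_all_iff.2 fun k => by
        by_cases hk : k ≤ m
        · filter_upwards [hC k hk t ht] with x hx _ using hx
        · exact ae_of_all _ fun x h => absurd h hk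
    filter_upwards [h3] with x hx
    refine ENNReal.ofReal_le_ofReal (sum_le_sum fun k hk => hx k ?_)
    simpa [Nat.lt_succ_iff] using hk
  filter_upwards [ENNReal.ae_le_essSup (μ := (volume : Measure (Sp d))) fun x => ENNReal.ofReal
    (∑ k ∈ Finset.range (m + 1), sqD k (ψ t) x)] with x hx
  have h2 : ENNReal.ofReal (∑ k ∈ Finset.range (m + 1), sqD k (ψ t) x) ≤ ⨆ t ∈ Icc (0 : ℝ) T, F t :=
    hx.trans (le_iSup₂ (f := fun t (_ : t ∈ Icc (0 : ℝ) T) => F t) t ht)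
  have h3 := (ENNReal.ofReal_le_iff_le_toReal hfin).1 h2
  rw [normB, Real.sq_sqrt ENNReal.toReal_nonneg]
  exact h3

theorem MemB.hb {T : ℝ} {m k : ℕ} {ψ : TFn d} (h : MemB T m ψ) (hk : k ≤ m) {t : ℝ}
    (ht : t ∈ Icc 0 T) : HB k (k.factorial * normB T m ψ ^ 2) (ψ t) := by
  intro n x
  have := sum_H_mo_le_of_sqD (ψ := fun _ : Unit => ψ) (fun _ => h) hk ht (C := normB T m ψ ^ 2) (by
    filter_upwards [h.sum_sqD_le ht] with x hx
    simp only [Finset.univ_unique, sum_const, Finset.card_singleton, one_smul]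
    refine le_trans ?_ hx
    exact single_le_sum (f := fun k => sqD k (ψ t) x) (fun k _ => sqD_nonneg _ _ _)
      (Finset.mem_range.2 (by omega))) n x
  simpa using this

theorem normB_le {T : ℝ} {m : ℕ} {ψ : TFn d} {C : ℝ} (hC : 0 ≤ C)
    (h : ∀ t ∈ Icc 0 T, ∀ᵐ x, ∑ k ∈ Finset.range (m + 1), sqD k (ψ t) x ≤ C ^ 2) :
    normB T m ψ ≤ C := by
  rw [normB, Real.sqrt_le_left hC]
  refine ENNReal.toReal_le_of_le_ofReal (sq_nonneg C) (iSup₂_le fun t ht => ?_)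
  refine essSup_le_of_ae_le _ ?_
  filter_upwards [h t ht] with x hx
  exact ENNReal.ofReal_le_ofReal hx

theorem memB_of_hb {T : ℝ} {m : ℕ} {ψ : TFn d} {C : ℕ → ℝ}
    (hm : Measurable fun z : Icc (0 : ℝ) T × Sp d => ψ z.1 z.2)
    (hb : ∃ B : ℝ, ∀ t ∈ Icc (0 : ℝ) T, ∀ x, |ψ t x| ≤ B)
    (hc : ∀ t ∈ Icc (0 : ℝ) T, Continuous (ψ t))
    (h : ∀ k ≤ m, ∀ t ∈ Icc (0 : ℝ) T, HB k (C k) (ψ t)) :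
    MemB T m ψ ∧ normB T m ψ ≤ √(∑ k ∈ Finset.range (m + 1), C k) := by
  obtain ⟨B, hB⟩ := hb
  have hE : ∀ t ∈ Icc 0 T, EB B (ψ t) := fun t ht => EB.of_bound (hc t ht).measurable (hB t ht)
  have hW : ∀ k ≤ m, ∀ α ∈ multi d k, ∀ t ∈ Icc 0 T,
      EB (√(((dirs α).map fun v => ‖v‖ ^ 2).prod * C k)) (weakDeriv (dirs α) (ψ t)) ∧
      IsWeakDeriv (dirs α) (ψ t) (weakDeriv (dirs α) (ψ t)) := by
    intro k hk α hα t ht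
    refine HB.weakDeriv (hE t ht) ?_
    rw [length_dirs hα]
    exact h k hk t ht
  refine ⟨⟨hm, ⟨B, hB⟩, hc, fun k hk α hα => ⟨_, fun t ht =>
    ⟨_, (hW k hk α hα t ht).2, (hW k hk α hα t ht).1.2⟩⟩⟩, normB_le (Real.sqrt_nonneg _) ?_⟩
  intro t ht
  have h0 : ∀ k ≤ m, 0 ≤ C k := fun k hk => (h k hk t ht).nonneg
  have h1 : ∀ᵐ x, ∀ k : ℕ, k ≤ m → sqD k (ψ t) x ≤ C k := by
    refine ae_all_iff.2 fun k => ?_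
    by_cases hk : k ≤ m
    · have h2 : ∀ᵐ x, ∀ α : multi d k, Tendsto
          (fun n => conv (rho d n) (weakDeriv (dirs α.1) (ψ t)) x) atTop
          (nhds (weakDeriv (dirs α.1) (ψ t) x)) :=
        ae_all_iff.2 fun α => ae_tendsto_conv_rho (hW k hk α.1 α.2 t ht).2.2.1
      filter_upwards [h2] with x hx _
      rw [sqD, ← sum_coe_sort (multi d k)]
      refine le_of_tendsto (tendsto_finsetSum _ fun α _ => (hx α).pow 2)
        (.of_forall fun n => ?_)
      refine le_trans ?_ (h k hk t ht n x)
      refine le_trans (le_of_eq ?_) (Sq_le_H k _ x)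
      rw [Sq, ← sum_coe_sort (multi d k)]
      refine sum_congr rfl fun α _ => ?_
      obtain ⟨h3, h4⟩ := hW k hk α.1 α.2 t ht
      rw [h4.Dl_mo (hE t ht) h3, mo_apply h3]
    · exact ae_of_all _ fun x h => absurd h hk
  filter_upwards [h1] with x hx
  rw [Real.sq_sqrt (sum_nonneg fun k hk => h0 k (by simpa [Nat.lt_succ_iff] using hk))]
  exact sum_le_sum fun k hk => hx k (by simpa [Nat.lt_succ_iff] using hk)

/-! ### Lipschitz representatives -/

theorem Smo.abs_sub_le {φ : Smo d} {C : ℝ} (h : ∀ x, H 1 φ x ≤ C) (x y : Sp d) :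
    |φ x - φ y| ≤ √C * ‖x - y‖ := by
  have h1 := dl_sq_le φ h 1 (x - y) y
  rw [dl_apply, one_smul, inv_one, one_mul, add_sub_cancel] at h1
  have hC0 : 0 ≤ C := (H_nonneg 1 φ x).trans (h x)
  have h2 := Real.abs_le_sqrt h1
  rwa [Real.sqrt_mul (sq_nonneg _), Real.sqrt_sq (norm_nonneg _), mul_comm] at h2

/-- The limit of the mollifications. -/
def rp (v : Fn d) (x : Sp d) : ℝ := atTop.limUnder fun n => mo n v x

theorem HB.abs_mo_sub_le {v : Fn d} {B C : ℝ} (hv : EB B v) (h : HB 1 C v) (n k : ℕ)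
    (x : Sp d) : |mo n v x - mo k v x| ≤ √C * eps n + √C * eps k := by
  have h1 : ∀ n j x, |mo n (mo j v) x - mo j v x| ≤ √C * eps n := by
    intro n j x
    obtain ⟨B', hB'⟩ := Smo.eb (mo j v)
    rw [mo_apply hB']
    refine abs_conv_rho_sub_le hB' (ae_of_all _ fun y hy => ?_)
    refine (Smo.abs_sub_le (h j) _ _).trans ?_
    rw [sub_sub_cancel_left, norm_neg]
    gcongr
  have hEB : ∀ j, EB B (mo j v) := fun j =>
    EB.of_bound (Smo.continuous _).measurable fun x => by
      have := abs_conv_le hv (integrable_rho j) x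
      rw [mo_apply hv]
      simpa only [abs_of_nonneg (rho_nonneg j _), integral_rho, one_mul] using this
  have h2 := ae_tendsto_conv_rho hv.locallyIntegrable
  have h3 : ∀ᵐ x, ∀ n, |mo n v x - v x| ≤ √C * eps n := by
    filter_upwards [h2] with x hx n
    have h4 := tendsto_Dl_mo (ψ := fun j => mo j v) hEB hv
      (by simpa only [mo_apply hv] using h2) n [] x
    have h5 : Tendsto (fun j => mo j v x) atTop (nhds (v x)) := by
      simpa only [mo_apply hv] using hx
    exact le_of_tendsto (h4.sub h5).abs (.of_forall fun j => h1 n j x)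
  have h6 : ∀ᵐ x, |mo n v x - mo k v x| ≤ √C * eps n + √C * eps k := by
    filter_upwards [h3] with x hx
    have e : mo n v x - mo k v x = (mo n v x - v x) - (mo k v x - v x) := by ring
    rw [e]
    exact (abs_sub _ _).trans (add_le_add (hx n) (hx k))
  have h7 : Dense {x | |mo n v x - mo k v x| ≤ √C * eps n + √C * eps k} :=
    Measure.dense_of_ae h6
  have h8 : IsClosed {x | |mo n v x - mo k v x| ≤ √C * eps n + √C * eps k} :=
    isClosed_le (((Smo.continuous _).sub (Smo.continuous _)).abs) continuous_const
  have h9 : x ∈ closure {x | |mo n v x - mo k v x| ≤ √C * eps n + √C * eps k} := h7 x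
  rwa [h8.closure_eq] at h9

theorem HB.tendsto_rp {v : Fn d} {B C : ℝ} (hv : EB B v) (h : HB 1 C v) (x : Sp d) :
    Tendsto (fun n => mo n v x) atTop (nhds (rp v x)) := by
  have h1 : CauchySeq fun n => mo n v x := by
    have h2 : Tendsto (fun n => 2 * (√C * eps n)) atTop (nhds 0) := by
      simpa using (tendsto_eps.const_mul (√C)).const_mul 2
    refine cauchySeq_of_le_tendsto_0' _ (fun n k hnk => ?_) h2
    rw [Real.dist_eq]
    refine (h.abs_mo_sub_le hv n k x).trans ?_
    have : eps k ≤ eps n := by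
      unfold eps
      apply one_div_le_one_div_of_le (by positivity)
      have : (n : ℝ) ≤ k := by exact_mod_cast hnk
      linarith
    have := mul_le_mul_of_nonneg_left this (Real.sqrt_nonneg C)
    linarith
  exact h1.tendsto_limUnder

theorem HB.abs_mo_sub_rp_le {v : Fn d} {B C : ℝ} (hv : EB B v) (h : HB 1 C v) (n : ℕ)
    (x : Sp d) : |mo n v x - rp v x| ≤ √C * eps n := by
  have h1 : Tendsto (fun k => √C * eps n + √C * eps k) atTop
      (nhds (√C * eps n + √C * 0)) :=
    (tendsto_eps.const_mul _).const_add _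
  rw [mul_zero, add_zero] at h1
  exact le_of_tendsto_of_tendsto' ((h.tendsto_rp hv x).const_sub _).abs h1
    fun k => h.abs_mo_sub_le hv n k x

theorem rp_of_continuous {v : Fn d} {B : ℝ} (hv : EB B v) (hc : Continuous v) : rp v = v := by
  funext x
  have h1 : Tendsto (fun n => mo n v x) atTop (nhds (v x)) := by
    simpa only [mo_apply hv] using tendsto_conv_rho hv hc.continuousAt
  exact h1.limUnder_eq

theorem HB.abs_rp_sub_le {v : Fn d} {B C : ℝ} (hv : EB B v) (h : HB 1 C v) (x y : Sp d) :
    |rp v x - rp v y| ≤ √C * ‖x - y‖ :=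
  le_of_tendsto ((h.tendsto_rp hv x).sub (h.tendsto_rp hv y)).abs
    (.of_forall fun n => Smo.abs_sub_le (h n) x y)

theorem abs_mo_le {v : Fn d} {B : ℝ} (hv : EB B v) (n : ℕ) (x : Sp d) : |mo n v x| ≤ B := by
  have := abs_conv_le hv (integrable_rho n) x
  rw [mo_apply hv]
  simpa only [abs_of_nonneg (rho_nonneg n _), integral_rho, one_mul] using this

theorem HB.abs_rp_le {v : Fn d} {B C : ℝ} (hv : EB B v) (h : HB 1 C v) (x : Sp d) :
    |rp v x| ≤ B :=
  le_of_tendsto (h.tendsto_rp hv x).abs (.of_forall fun n => abs_mo_le hv n x)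

/-- Bounded Lipschitz functions. -/
def LB (ψ : Fn d) : Prop := (∃ B, ∀ x, |ψ x| ≤ B) ∧ ∃ K, LipschitzWith K ψ

theorem LB.eb {ψ : Fn d} (h : LB ψ) : ∃ B, EB B ψ := by
  obtain ⟨⟨B, hB⟩, K, hK⟩ := h
  exact ⟨B, EB.of_bound hK.continuous.measurable hB⟩

theorem LB.mk' {ψ : Fn d} {B K : ℝ} (h : ∀ x, |ψ x| ≤ B) (hK : 0 ≤ K)
    (h' : ∀ x y, |ψ x - ψ y| ≤ K * ‖x - y‖) : LB ψ :=
  ⟨⟨B, h⟩, ⟨K, hK⟩, LipschitzWith.of_dist_le_mul fun x y => by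
    rw [Real.dist_eq, dist_eq_norm]; exact h' x y⟩

theorem HB.lb_rp {v : Fn d} {B C : ℝ} (hv : EB B v) (h : HB 1 C v) : LB (rp v) :=
  LB.mk' (h.abs_rp_le hv) (Real.sqrt_nonneg _) (h.abs_rp_sub_le hv)

theorem HB.lb {v : Fn d} {B C : ℝ} (hv : EB B v) (h : HB 1 C v) (hc : Continuous v) : LB v := by
  have := h.lb_rp hv
  rwa [rp_of_continuous hv hc] at this

theorem LB.add {φ ψ : Fn d} (h : LB φ) (h' : LB ψ) : LB fun x => φ x + ψ x := by
  obtain ⟨⟨B, hB⟩, K, hK⟩ := h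
  obtain ⟨⟨B', hB'⟩, K', hK'⟩ := h'
  exact ⟨⟨B + B', fun x => (abs_add_le _ _).trans (add_le_add (hB x) (hB' x))⟩, _, hK.add hK'⟩

theorem LB.comp_add {ψ : Fn d} (h : LB ψ) (y : Sp d) : LB fun x => ψ (x + y) := by
  obtain ⟨⟨B, hB⟩, K, hK⟩ := h
  refine ⟨⟨B, fun x => hB _⟩, K, ?_⟩
  have := hK.comp (LipschitzWith.id.add (LipschitzWith.const (α := Sp d) y))
  rw [add_zero, mul_one] at this
  exact this

theorem LB.const_mul {ψ : Fn d} (h : LB ψ) (a : ℝ) : LB fun x => a * ψ x := by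
  obtain ⟨⟨B, hB⟩, K, hK⟩ := h
  refine LB.mk' (B := |a| * B) (K := |a| * K) (fun x => ?_) (by positivity) (fun x y => ?_)
  · rw [abs_mul]; gcongr; exact hB x
  · rw [← mul_sub, abs_mul, mul_assoc]
    gcongr
    have := hK.dist_le_mul x y
    rwa [Real.dist_eq, dist_eq_norm] at this

theorem Smo.lb_of_hasCompactSupport {θ : Smo d} (h : HasCompactSupport θ) :
    ∃ K, LipschitzWith K θ :=
  ContDiff.lipschitzWith_of_hasCompactSupport h (Smo.contDiff θ) (by simp)

theorem LB.isWeakDeriv {ψ : Fn d} (h : LB ψ) (v : Sp d) :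
    (∃ B, EB B fun x => lineDeriv ℝ ψ x v) ∧
      IsWeakDeriv [v] ψ fun x => lineDeriv ℝ ψ x v := by
  obtain ⟨B, hB⟩ := h.eb
  obtain ⟨-, K, hK⟩ := h
  have h1 : EB (K * ‖v‖) fun x => lineDeriv ℝ ψ x v :=
    EB.of_bound (measurable_lineDeriv hK.continuous)
      fun x => norm_lineDeriv_le_of_lipschitz ℝ hK
  refine ⟨⟨_, h1⟩, isWeakDeriv_iff.2 ⟨hB.locallyIntegrable, h1.locallyIntegrable, fun θ hθ => ?_⟩⟩
  obtain ⟨K', hK'⟩ := Smo.lb_of_hasCompactSupport hθ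
  rw [hK.integral_lineDeriv_mul_eq hK' hθ v, List.length_singleton, pow_one, neg_one_mul,
    ← integral_neg]
  congr 1; funext x
  rw [(Smo.differentiable θ x).lineDeriv_eq_fderiv, map_neg, Dl_cons, Dl_nil, D_apply]
  ring

/-- A function with bounded second derivatives is differentiable, with Lipschitz derivatives. -/
theorem HB.lb_lineDeriv {ψ : Fn d} {B C₁ C₂ : ℝ} (hψ : EB B ψ) (hc : Continuous ψ)
    (h1 : HB 1 C₁ ψ) (h2 : HB 2 C₂ ψ) (v : Sp d) : LB fun x => lineDeriv ℝ ψ x v := by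
  obtain ⟨⟨C, hC⟩, hw⟩ := (h1.lb hψ hc).isWeakDeriv v
  have hmo : ∀ n, mo n (fun x => lineDeriv ℝ ψ x v) = D v (mo n ψ) := fun n => (hw.Dl_mo hψ hC n).symm
  have h3 : HB 1 (‖v‖ ^ 2 * C₂) fun x => lineDeriv ℝ ψ x v := by
    intro n x
    rw [hmo]
    exact (H_D_le 1 v _ x).trans (by gcongr; exact h2 n x)
  convert h3.lb_rp hC using 1
  funext x
  refine HasLineDerivAt.lineDeriv ?_
  have h4 := hasDerivAt_of_tendstoUniformly (l := atTop)
    (f := fun n (t : ℝ) => mo n ψ (x + t • v)) (g := fun t : ℝ => ψ (x + t • v))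
    (f' := fun n (t : ℝ) => D v (mo n ψ) (x + t • v))
    (g' := fun t : ℝ => rp (fun x => lineDeriv ℝ ψ x v) (x + t • v)) ?_
    (.of_forall fun n t => ?_) (fun t => ?_) 0
  · simpa [HasLineDerivAt] using h4
  · rw [Metric.tendstoUniformly_iff]
    intro ε hε
    have h5 : Tendsto (fun n => √(‖v‖ ^ 2 * C₂) * eps n) atTop (nhds 0) := by
      have := tendsto_eps.const_mul (√(‖v‖ ^ 2 * C₂))
      rwa [mul_zero] at this
    filter_upwards [h5.eventually (gt_mem_nhds hε)] with n hn t
    rw [dist_comm, Real.dist_eq, ← hmo]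
    exact (h3.abs_mo_sub_rp_le hC n _).trans_lt hn
  · have h2 : HasDerivAt (fun r : ℝ => x + r • v) v t := by
      simpa using ((hasDerivAt_id t).smul_const v).const_add x
    exact (Smo.differentiable (mo n ψ) (x + t • v)).hasFDerivAt.comp_hasDerivAt t h2
  · simpa only [mo_apply hψ] using tendsto_conv_rho hψ hc.continuousAt

/-! ### The operators `δ̄_{h,μ}` on nonsmooth functions -/

theorem conv_comp_add (K ψ : Fn d) (y x : Sp d) :
    conv K (fun z => ψ (z + y)) x = conv K ψ (x + y) := by
  simp only [conv, sub_add_eq_add_sub]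

theorem mo_comp_add {ψ : Fn d} {B : ℝ} (h : EB B ψ) (y : Sp d) (n : ℕ) :
    EB B (fun z => ψ (z + y)) ∧ mo n (fun z => ψ (z + y)) = Tr y (mo n ψ) := by
  have h1 : Measure.QuasiMeasurePreserving (fun z : Sp d => z + y) volume volume :=
    (measurePreserving_add_right volume y).quasiMeasurePreserving
  have h2 : EB B fun z => ψ (z + y) := ⟨h.1.comp_quasiMeasurePreserving h1, h1.ae h.2⟩
  refine ⟨h2, ?_⟩
  ext x
  rw [mo_apply h2, conv_comp_add]
  exact (mo_apply h n (x + y)).symm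

theorem mo_add {φ ψ : Fn d} {B B' : ℝ} (h : EB B φ) (h' : EB B' ψ) (n : ℕ) :
    mo n (fun x => φ x + ψ x) = mo n φ + mo n ψ := by
  ext x
  rw [mo_apply (h.add h'), conv_add (integrable_rho n) h h', Smo.add_apply, mo_apply h, mo_apply h']

theorem mo_const_mul {ψ : Fn d} {B : ℝ} (h : EB B ψ) (a : ℝ) (n : ℕ) :
    mo n (fun x => a * ψ x) = a • mo n ψ := by
  ext x
  rw [mo_apply ((EB.const a).mul h), conv_const_mul, Smo.smul_apply, mo_apply h]

namespace Data

variable (S : Data d)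

theorem dbar_inl_eq (τ₀ h : ℝ) (l : Sp d) (ψ : Fn d) :
    S.dbar τ₀ h (.inl l) ψ = fun x => (S.τ l * h⁻¹) * (ψ (x + h • l) + (-1) * ψ x) := by
  funext x
  simp only [dbar]; ring

theorem dbar_mo {ψ : Fn d} (hψ : LB ψ) (τ₀ h : ℝ) (μ : Sp d ⊕ Fin d) :
    (∃ B, EB B (S.dbar τ₀ h μ ψ)) ∧
      ∀ n, mo n (S.dbar τ₀ h μ ψ) = dB S.τ τ₀ h μ (mo n ψ) := by
  obtain ⟨B, hB⟩ := hψ.eb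
  cases μ with
  | inl l =>
    obtain ⟨h1, -⟩ := mo_comp_add hB (h • l) 0
    have h3 := h1.add ((EB.const (-1)).mul hB)
    rw [dbar_inl_eq]
    refine ⟨⟨_, (EB.const (S.τ l * h⁻¹)).mul h3⟩, fun n => ?_⟩
    rw [mo_const_mul h3, mo_add h1 ((EB.const (-1)).mul hB), mo_const_mul hB,
      (mo_comp_add hB (h • l) n).2]
    ext x
    simp only [dB_inl, Smo.smul_apply, Smo.add_apply, dl_apply]
    change _ * (mo n ψ (x + h • l) + _) = _
    ring
  | inr i =>
    obtain ⟨⟨C, hC⟩, hw⟩ := hψ.isWeakDeriv (e i)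
    have : S.dbar τ₀ h (.inr i) ψ = fun x => τ₀ * lineDeriv ℝ ψ x (e i) := rfl
    rw [this]
    refine ⟨⟨_, (EB.const τ₀).mul hC⟩, fun n => ?_⟩
    rw [mo_const_mul hC, ← hw.Dl_mo hB hC]
    rfl

theorem dbar_lb {ψ : Fn d} {B C₁ C₂ : ℝ} (hψ : EB B ψ) (hc : Continuous ψ)
    (h1 : HB 1 C₁ ψ) (h2 : HB 2 C₂ ψ) (τ₀ h : ℝ) (μ : Sp d ⊕ Fin d) : LB (S.dbar τ₀ h μ ψ) := by
  have hl := h1.lb hψ hc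
  cases μ with
  | inl l =>
    rw [dbar_inl_eq]
    exact ((hl.comp_add _).add (hl.const_mul _)).const_mul _
  | inr i => exact (h1.lb_lineDeriv hψ hc h2 (e i)).const_mul τ₀

theorem dbar_smo (τ₀ h : ℝ) (μ : Sp d ⊕ Fin d) (φ : Smo d) :
    S.dbar τ₀ h μ φ = dB S.τ τ₀ h μ φ := by
  funext x
  cases μ with
  | inl l => simp only [dbar, dB_inl, Smo.smul_apply, dl_apply, mul_assoc]
  | inr i =>
    simp only [dbar, dB_inr, Smo.smul_apply, D_apply]
    rw [(Smo.differentiable φ x).lineDeriv_eq_fderiv]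

end Data

theorem shift_smo (h : ℝ) (μ : Sp d ⊕ Fin d) (φ : Smo d) : shift h μ φ = sh h μ φ := by
  funext x
  cases μ <;> rfl

theorem delta_smo (h : ℝ) (l : Sp d) (φ : Smo d) : delta h l φ = dl h l φ := by
  funext x
  rw [delta, dl_apply, div_eq_inv_mul]

/-! ### The assumptions for mollified coefficients -/

/-- `a` is the average of `F` over a small ball around `x` with the weight given by the
mollification kernel. -/
def IsAvg (n : ℕ) (x : Sp d) (F : Fn d) (a : ℝ) : Prop :=
  (∃ C, EB C F) ∧ conv (rho d n) F x = a

namespace IsAvg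

variable {n : ℕ} {x : Sp d} {F G : Fn d} {a b : ℝ}

theorem of_eb {C : ℝ} (h : EB C F) : IsAvg n x F (mo n F x) := ⟨⟨C, h⟩, (mo_apply h n x).symm⟩

theorem const (a : ℝ) : IsAvg n x (fun _ => a) a :=
  ⟨⟨_, EB.const a⟩, by rw [conv, integral_mul_const, integral_rho, one_mul]⟩

theorem add (hF : IsAvg n x F a) (hG : IsAvg n x G b) : IsAvg n x (fun z => F z + G z) (a + b) := by
  obtain ⟨⟨C, hC⟩, rfl⟩ := hF
  obtain ⟨⟨C', hC'⟩, rfl⟩ := hG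
  exact ⟨⟨_, hC.add hC'⟩, conv_add (integrable_rho n) hC hC' x⟩

theorem const_mul (r : ℝ) (hF : IsAvg n x F a) : IsAvg n x (fun z => r * F z) (r * a) := by
  obtain ⟨⟨C, hC⟩, rfl⟩ := hF
  exact ⟨⟨_, (EB.const r).mul hC⟩, conv_const_mul _ _ _ _⟩

theorem mul_const (r : ℝ) (hF : IsAvg n x F a) : IsAvg n x (fun z => F z * r) (a * r) := by
  simpa only [mul_comm _ r] using hF.const_mul r

theorem sub (hF : IsAvg n x F a) (hG : IsAvg n x G b) : IsAvg n x (fun z => F z - G z) (a - b) := by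
  simpa [sub_eq_add_neg] using hF.add (hG.const_mul (-1))

theorem sum {ι : Type*} (s : Finset ι) {F : ι → Fn d} {a : ι → ℝ}
    (h : ∀ i ∈ s, IsAvg n x (F i) (a i)) : IsAvg n x (fun z => ∑ i ∈ s, F i z) (∑ i ∈ s, a i) := by
  classical
  induction s using Finset.induction_on with
  | empty => simpa using const 0
  | insert i s hi ih =>
    simp only [sum_insert hi]
    exact (h i (by simp)).add (ih fun j hj => h j (by simp [hj]))

theorem nonpos (hF : IsAvg n x F a) (h : ∀ᵐ z, F z ≤ 0) : a ≤ 0 := by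
  obtain ⟨⟨C, hC⟩, rfl⟩ := hF
  have h1 := qmp_sub x
  exact conv_rho_le hC (by filter_upwards [h1.ae h] with y hy _ using hy)

theorem le (hF : IsAvg n x F a) (hG : IsAvg n x G b) (h : ∀ᵐ z, F z ≤ G z) : a ≤ b := by
  have := (hF.sub hG).nonpos (by filter_upwards [h] with z hz; linarith)
  linarith

end IsAvg

namespace MemK

variable {𝒦 : Fn d → Fn d}

theorem bddBorel_smo (φ : Smo d) : BddBorel φ := ⟨(Smo.continuous φ).measurable, Smo.bounded φ⟩

theorem sum (h : MemK 𝒦) {ι : Type*} (s : Finset ι) (φ : ι → Smo d) :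
    𝒦 (fun x => ∑ i ∈ s, φ i x) = fun x => ∑ i ∈ s, 𝒦 (φ i) x := by
  classical
  induction s using Finset.induction_on with
  | empty =>
    have := h.smul 0 (0 : Smo d) (bddBorel_smo 0)
    simpa [Pi.zero_def] using this
  | insert i s hi ih =>
    simp only [sum_insert hi]
    have h1 : (fun x => φ i x + ∑ j ∈ s, φ j x) = (φ i : Fn d) + ((∑ j ∈ s, φ j : Smo d) : Fn d) := by
      funext x
      have : (∑ j ∈ s, φ j : Smo d) x = ∑ j ∈ s, φ j x := map_sum (Smo.ev x) _ _
      rw [Pi.add_apply, this]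
    have h2 : (fun x => ∑ j ∈ s, φ j x) = ((∑ j ∈ s, φ j : Smo d) : Fn d) := by
      funext x
      exact (map_sum (Smo.ev x) _ _).symm
    rw [h1, h.add _ _ (bddBorel_smo _) (bddBorel_smo _), ← h2, ih]
    rfl

theorem le (h : MemK 𝒦) {φ : Smo d} {C : ℝ} (hC : 0 ≤ C) (hφ : ∀ x, φ x ≤ C) (x : Sp d) :
    𝒦 φ x ≤ C := by
  have h1 : BddBorel (1 : Fn d) := bddBorel_smo 1
  have e : (φ : Fn d) + ((C • 1 - φ : Smo d) : Fn d) = C • (1 : Fn d) := by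
    funext y
    simp
  have h2 := h.add φ (C • 1 - φ : Smo d) (bddBorel_smo _) (bddBorel_smo _)
  rw [e, h.smul C 1 h1] at h2
  have h3 := h.nonneg (C • 1 - φ : Smo d) (bddBorel_smo _) (fun y => by simpa using hφ y) x
  have h4 := congrFun h2 x
  simp only [Pi.smul_apply, Pi.add_apply, smul_eq_mul] at h4
  nlinarith [h.one x]

end MemK

/-- Bounded continuous functions with bounded first and second generalized derivatives. -/
def Reg2 (ψ : Fn d) : Prop :=
  (∃ B, EB B ψ) ∧ Continuous ψ ∧ (∃ C, HB 1 C ψ) ∧ ∃ C, HB 2 C ψ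

theorem MemB.reg2 {T : ℝ} {m : ℕ} {ψ : TFn d} (h : MemB T m ψ) (hm : 2 ≤ m) {t : ℝ}
    (ht : t ∈ Icc 0 T) : Reg2 (ψ t) := by
  obtain ⟨C, hC⟩ := h.eb
  exact ⟨⟨C, hC t ht⟩, h.continuous t ht, ⟨_, h.hb (by omega) ht⟩, ⟨_, h.hb hm ht⟩⟩

theorem Reg2.lb {ψ : Fn d} (h : Reg2 ψ) : LB ψ := by
  obtain ⟨⟨B, hB⟩, hc, ⟨C, hC⟩, -⟩ := h
  exact hC.lb hB hc

theorem Reg2.dbar_lb {ψ : Fn d} (h : Reg2 ψ) (S : Data d) (τ₀ r : ℝ) (μ : Sp d ⊕ Fin d) :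
    LB (S.dbar τ₀ r μ ψ) := by
  obtain ⟨⟨B, hB⟩, hc, ⟨C, hC⟩, ⟨C', hC'⟩⟩ := h
  exact S.dbar_lb hB hc hC hC' τ₀ r μ

namespace Data

variable (S : Data d)

/-- The geometric data of the scheme. -/
def geo (τ₀ h : ℝ) : Geo d := ⟨S.Λ₁, S.τ, τ₀, h⟩

/-- The mollified coefficients. -/
def coS (n : ℕ) (t : ℝ) : Coef d :=
  ⟨fun l => mo n (S.q l (clamp S.T t)), fun l => mo n (S.p l (clamp S.T t)),
    mo n (S.c (clamp S.T t))⟩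

/-- A first order difference operator with coefficients frozen at a point. -/
def fB (h : ℝ) (b : Sp d → Fn d) (z : Sp d) (φ : Smo d) : Smo d :=
  ∑ l ∈ S.Λ₁, b l z • dl h l φ

/-- `A_h` with coefficients frozen at a point. -/
def fA (τ₀ h t : ℝ) (z : Sp d) (φ : Smo d) : Smo d :=
  (2 : ℝ) • ∑ μ ∈ S.Λ, dB S.τ τ₀ h μ φ *
    (h⁻¹ • S.fB h (fun l => S.dbar τ₀ h μ (S.q l t)) z (sh h μ φ)
      + S.fB h (fun l => S.dbar τ₀ h μ (S.p l t)) z (sh h μ φ))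

/-- `𝒬_h` with coefficients frozen at a point. -/
def fQ (h t : ℝ) (z : Sp d) (φ : Smo d) : Smo d :=
  ∑ l ∈ S.Λ₁, S.chi h l t z • (dl h l φ * dl h l φ)

/-- The term of the second structural condition containing `Q_{h,μ}`, with coefficients frozen at a
point. -/
def fG (τ₀ h t : ℝ) (z : Sp d) (φ : Smo d) : Smo d :=
  ∑ μ ∈ S.Λ ×ˢ S.Λ, dB S.τ τ₀ h μ.1 (dB S.τ τ₀ h μ.2 φ) *
    (h⁻¹ • S.fB h (fun l => S.dbar2 τ₀ h μ (S.q l t)) z (sh h μ.1 (sh h μ.2 φ)))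

/-- The first structural condition with frozen coefficients. -/
def fJ₁ (m : ℕ) (δ τ₀ K h t : ℝ) (z : Sp d) (φ : Smo d) : Smo d :=
  (m : ℝ) • S.fA τ₀ h t z φ - (1 - δ) • ∑ μ ∈ S.Λ, S.fQ h t z (dB S.τ τ₀ h μ φ)
    - K • S.fQ h t z φ

/-- The second structural condition with frozen coefficients. -/
def fJ₂ (n : ℕ) (δ τ₀ K h t : ℝ) (z : Sp d) (φ : Smo d) : Smo d :=
  (n : ℝ) • ∑ ν ∈ S.Λ, S.fA τ₀ h t z (dB S.τ τ₀ h ν φ)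
    + ((n : ℝ) * ((n : ℝ) - 1)) • S.fG τ₀ h t z φ
    - (1 - δ) • ∑ μ ∈ S.Λ ×ˢ S.Λ, S.fQ h t z (dB S.τ τ₀ h μ.1 (dB S.τ τ₀ h μ.2 φ))
    - K • ∑ μ ∈ S.Λ, S.fQ h t z (dB S.τ τ₀ h μ φ)

variable {S}

theorem sum_apply {ι : Type*} (s : Finset ι) (f : ι → Smo d) (x : Sp d) :
    (∑ i ∈ s, f i : Smo d) x = ∑ i ∈ s, f i x := map_sum (Smo.ev x) _ _

theorem fB_Tr (h : ℝ) (b : Sp d → Fn d) (z y : Sp d) (φ : Smo d) :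
    S.fB h b z (Tr y φ) = Tr y (S.fB h b z φ) := by
  simp only [fB, map_sum, map_smul, dl_Tr]

theorem sh_Tr (h : ℝ) (μ : Sp d ⊕ Fin d) (y : Sp d) (φ : Smo d) :
    sh h μ (Tr y φ) = Tr y (sh h μ φ) := by
  obtain ⟨w, hw⟩ := sh_eq_Tr h μ
  rw [hw, Tr_comm]

theorem fA_Tr (τ₀ h t : ℝ) (z y : Sp d) (φ : Smo d) :
    S.fA τ₀ h t z (Tr y φ) = Tr y (S.fA τ₀ h t z φ) := by
  simp only [fA, map_sum, map_smul, dB_Tr, sh_Tr, fB_Tr, Tr_mul, map_add]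

theorem fQ_Tr (h t : ℝ) (z y : Sp d) (φ : Smo d) :
    S.fQ h t z (Tr y φ) = Tr y (S.fQ h t z φ) := by
  simp only [fQ, map_sum, map_smul, dl_Tr, Tr_mul]

theorem fG_Tr (τ₀ h t : ℝ) (z y : Sp d) (φ : Smo d) :
    S.fG τ₀ h t z (Tr y φ) = Tr y (S.fG τ₀ h t z φ) := by
  simp only [fG, map_sum, map_smul, dB_Tr, sh_Tr, fB_Tr, Tr_mul]

theorem fJ₁_Tr (m : ℕ) (δ τ₀ K h t : ℝ) (z y : Sp d) (φ : Smo d) :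
    S.fJ₁ m δ τ₀ K h t z (Tr y φ) = Tr y (S.fJ₁ m δ τ₀ K h t z φ) := by
  simp only [fJ₁, map_sum, map_smul, map_sub, dB_Tr, fA_Tr, fQ_Tr]

theorem fJ₂_Tr (n : ℕ) (δ τ₀ K h t : ℝ) (z y : Sp d) (φ : Smo d) :
    S.fJ₂ n δ τ₀ K h t z (Tr y φ) = Tr y (S.fJ₂ n δ τ₀ K h t z φ) := by
  simp only [fJ₂, map_sum, map_smul, map_sub, map_add, dB_Tr, fA_Tr, fQ_Tr, fG_Tr]

theorem A_eq (τ₀ h t : ℝ) (φ : Smo d) (x : Sp d) : S.A τ₀ h t φ x = S.fA τ₀ h t x φ x := by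
  simp only [A, L0μ, Q, fA, fB, dbar_smo, shift_smo, delta_smo, Smo.smul_apply, sum_apply,
    Smo.mul_apply, Smo.add_apply]

theorem calQ_eq (h t : ℝ) (φ : Smo d) (x : Sp d) : S.calQ h t φ x = S.fQ h t x φ x := by
  simp only [calQ, fQ, delta_smo, Smo.smul_apply, sum_apply, Smo.mul_apply, sq]

theorem G_eq (τ₀ h t : ℝ) (φ : Smo d) (x : Sp d) :
    ∑ μ ∈ S.Λ ×ˢ S.Λ, S.dbar2 τ₀ h μ φ x * S.Q h (S.dbar2 τ₀ h μ) t (shift2 h μ φ) x =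
      S.fG τ₀ h t x φ x := by
  simp only [fG, fB, sum_apply, Smo.mul_apply, Smo.smul_apply, Q, shift2, shift_smo, delta_smo]
  refine sum_congr rfl fun μ _ => ?_
  rw [dbar2, dbar_smo, dbar_smo]

theorem geo_Λ (τ₀ h : ℝ) : (S.geo τ₀ h).Λ = S.Λ := rfl

theorem W_one (τ₀ h : ℝ) (φ : Smo d) (x : Sp d) :
    (S.geo τ₀ h).W 1 φ x = (∑ μ ∈ S.Λ, dB S.τ τ₀ h μ φ * dB S.τ τ₀ h μ φ : Smo d) x := by
  rw [Geo.W_succ, sum_apply]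
  simp only [Geo.W_zero, Smo.mul_apply, sq]
  rfl

theorem W_two (τ₀ h : ℝ) (φ : Smo d) (x : Sp d) :
    (S.geo τ₀ h).W 2 φ x = (∑ μ ∈ S.Λ ×ˢ S.Λ, dB S.τ τ₀ h μ.1 (dB S.τ τ₀ h μ.2 φ) *
      dB S.τ τ₀ h μ.1 (dB S.τ τ₀ h μ.2 φ) : Smo d) x := by
  rw [sum_apply, sum_product_right]
  rw [Geo.W_succ]
  simp only [W_one, sum_apply, Smo.mul_apply]
  rfl

variable {m : ℕ} {δ c₀ τ₀ K : ℝ} {M : Fin (m + 1) → ℝ}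

/-- The first structural condition at a point, for translations of a function. -/
theorem frozen₁ (hS : S.Hyp m δ c₀ τ₀ K M) {h : ℝ}
    (hh : h ∈ Ioc 0 S.h₀) {t : ℝ} (ht : t ∈ Icc 0 S.T) (φ : Smo d) {C : ℝ}
    (hC : ∀ y, (S.geo τ₀ h).W 1 φ y ≤ C) (z x : Sp d) :
    S.fJ₁ m δ τ₀ K h t z φ x ≤ 2 * (1 - δ) * S.c t z * C := by
  obtain ⟨𝒦, h𝒦, hA⟩ := hS.structural₁ h hh
  have h1 := hA (Tr (x - z) φ) (Tr (x - z) φ).2 t ht z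
  have h2 : (fun y => ∑ μ ∈ S.Λ, S.dbar τ₀ h μ (Tr (x - z) φ) y ^ 2) =
      ((∑ μ ∈ S.Λ, dB S.τ τ₀ h μ (Tr (x - z) φ) * dB S.τ τ₀ h μ (Tr (x - z) φ) : Smo d) :
        Fn d) := by
    funext y
    simp only [dbar_smo, sum_apply, Smo.mul_apply, sq]
  have hC0 : 0 ≤ C := ((S.geo τ₀ h).W_nonneg 1 φ 0).trans (hC 0)
  have h3 := (h𝒦 t ht).le hC0 (φ := ∑ μ ∈ S.Λ, dB S.τ τ₀ h μ (Tr (x - z) φ) *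
    dB S.τ τ₀ h μ (Tr (x - z) φ)) (fun y => by
      rw [← W_one]
      have := hC (y + (x - z))
      rw [W_one, sum_apply] at this ⊢
      simp only [dB_Tr, Smo.mul_apply] at this ⊢
      exact this) z
  rw [h2] at h1
  have hc : 0 ≤ 2 * (1 - δ) * S.c t z :=
    mul_nonneg (by linarith [hS.hδ.2]) (hS.hc₀.le.trans (hS.c_ge t ht z))
  have h4 := mul_le_mul_of_nonneg_left h3 hc
  have h5 : S.fJ₁ m δ τ₀ K h t z (Tr (x - z) φ) z = S.fJ₁ m δ τ₀ K h t z φ x := by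
    rw [fJ₁_Tr]
    change S.fJ₁ m δ τ₀ K h t z φ (z + (x - z)) = _
    rw [add_sub_cancel]
  rw [← h5]
  simp only [A_eq, dbar_smo, calQ_eq] at h1
  simp only [fJ₁, Smo.sub_apply, Smo.smul_apply, sum_apply]
  linarith

theorem frozen₂ (hS : S.Hyp m δ c₀ τ₀ K M) {h : ℝ}
    (hh : h ∈ Ioc 0 S.h₀) {t : ℝ} (ht : t ∈ Icc 0 S.T) {n : ℕ} (hn : n ∈ Finset.Icc 1 m)
    {ι : Type*} [Fintype ι] (φ : ι → Smo d) {C₂ C₁ : ℝ}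
    (hC₂ : ∀ y, ∑ i, (S.geo τ₀ h).W 2 (φ i) y ≤ C₂)
    (hC₁ : ∀ y, ∑ i, (S.geo τ₀ h).W 1 (φ i) y ≤ C₁) :
    ∀ᵐ z, ∀ x, ∑ i, S.fJ₂ n δ τ₀ K h t z (φ i) x ≤ 2 * (1 - δ) * S.c t z * C₂ + K * C₁ := by
  obtain ⟨𝒦, h𝒦, hA⟩ := hS.structural₂ h hh n hn
  obtain ⟨Y, hYc, hYd⟩ := TopologicalSpace.exists_countable_dense (Sp d)
  have h1 : ∀ᵐ z, ∀ y ∈ Y, ∀ i, S.fJ₂ n δ τ₀ K h t z (Tr y (φ i)) z ≤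
      2 * (1 - δ) * S.c t z * 𝒦 t ((∑ μ ∈ S.Λ ×ˢ S.Λ, dB S.τ τ₀ h μ.1 (dB S.τ τ₀ h μ.2 (Tr y (φ i)))
        * dB S.τ τ₀ h μ.1 (dB S.τ τ₀ h μ.2 (Tr y (φ i))) : Smo d) : Fn d) z
      + K * 𝒦 t ((∑ μ ∈ S.Λ, dB S.τ τ₀ h μ (Tr y (φ i)) * dB S.τ τ₀ h μ (Tr y (φ i)) : Smo d) :
        Fn d) z := by
    refine (ae_ball_iff hYc).2 fun y _ => ae_all_iff.2 fun i => ?_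
    filter_upwards [hA (Tr y (φ i)) (Tr y (φ i)).2 t ht] with z hz
    have h2 : (fun w => ∑ μ ∈ S.Λ ×ˢ S.Λ, S.dbar2 τ₀ h μ (Tr y (φ i)) w ^ 2) =
        ((∑ μ ∈ S.Λ ×ˢ S.Λ, dB S.τ τ₀ h μ.1 (dB S.τ τ₀ h μ.2 (Tr y (φ i)))
        * dB S.τ τ₀ h μ.1 (dB S.τ τ₀ h μ.2 (Tr y (φ i))) : Smo d) : Fn d) := by
      funext w
      simp only [dbar2, dbar_smo, sum_apply, Smo.mul_apply, sq]
    have h3 : (fun w => ∑ μ ∈ S.Λ, S.dbar τ₀ h μ (Tr y (φ i)) w ^ 2) =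
        ((∑ μ ∈ S.Λ, dB S.τ τ₀ h μ (Tr y (φ i)) * dB S.τ τ₀ h μ (Tr y (φ i)) : Smo d) :
        Fn d) := by
      funext w
      simp only [dbar_smo, sum_apply, Smo.mul_apply, sq]
    rw [h2, h3, G_eq] at hz
    simp only [dbar2, dbar_smo, A_eq, calQ_eq] at hz
    simp only [fJ₂, Smo.sub_apply, Smo.add_apply, Smo.smul_apply, sum_apply]
    linarith
  filter_upwards [h1] with z hz
  have hclosed : IsClosed {x | ∑ i, S.fJ₂ n δ τ₀ K h t z (φ i) x ≤
      2 * (1 - δ) * S.c t z * C₂ + K * C₁} :=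
    isClosed_le (continuous_finsetSum _ fun i _ => Smo.continuous _) continuous_const
  have hdense : Dense ((fun y => z + y) '' Y) :=
    (Homeomorph.addLeft z).surjective.denseRange.dense_image (Homeomorph.addLeft z).continuous hYd
  have hsub : (fun y => z + y) '' Y ⊆ {x | ∑ i, S.fJ₂ n δ τ₀ K h t z (φ i) x ≤
      2 * (1 - δ) * S.c t z * C₂ + K * C₁} := by
    rintro _ ⟨y, hy, rfl⟩
    have h5 : ∀ i, S.fJ₂ n δ τ₀ K h t z (Tr y (φ i)) z = S.fJ₂ n δ τ₀ K h t z (φ i) (z + y) := by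
      intro i
      rw [fJ₂_Tr]; rfl
    have h6 := sum_le_sum fun i (_ : i ∈ Finset.univ) => hz y hy i
    rw [sum_add_distrib, ← mul_sum, ← mul_sum] at h6
    simp only [h5] at h6
    refine h6.trans ?_
    have hC₂0 : 0 ≤ C₂ :=
      (sum_nonneg fun i _ => (S.geo τ₀ h).W_nonneg 2 (φ i) 0).trans (hC₂ 0)
    have hC₁0 : 0 ≤ C₁ :=
      (sum_nonneg fun i _ => (S.geo τ₀ h).W_nonneg 1 (φ i) 0).trans (hC₁ 0)
    have hc : 0 ≤ 2 * (1 - δ) * S.c t z :=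
      mul_nonneg (by linarith [hS.hδ.2]) (hS.hc₀.le.trans (hS.c_ge t ht z))
    have h𝒦t := h𝒦 t ht
    refine add_le_add (mul_le_mul_of_nonneg_left ?_ hc) (mul_le_mul_of_nonneg_left ?_ hS.hK)
    · rw [← congrFun (h𝒦t.sum Finset.univ fun i => ∑ μ ∈ S.Λ ×ˢ S.Λ,
        dB S.τ τ₀ h μ.1 (dB S.τ τ₀ h μ.2 (Tr y (φ i)))
        * dB S.τ τ₀ h μ.1 (dB S.τ τ₀ h μ.2 (Tr y (φ i)))) z]
      simp only [← sum_apply Finset.univ]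
      refine h𝒦t.le hC₂0 (fun w => ?_) z
      have := hC₂ (w + y)
      simp only [W_two, sum_apply] at this ⊢
      simp only [dB_Tr, Smo.mul_apply] at this ⊢
      exact this
    · rw [← congrFun (h𝒦t.sum Finset.univ fun i => ∑ μ ∈ S.Λ,
        dB S.τ τ₀ h μ (Tr y (φ i)) * dB S.τ τ₀ h μ (Tr y (φ i))) z]
      simp only [← sum_apply Finset.univ]
      refine h𝒦t.le hC₁0 (fun w => ?_) z
      have := hC₁ (w + y)
      simp only [W_one, sum_apply] at this ⊢
      simp only [dB_Tr, Smo.mul_apply] at this ⊢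
      exact this
  intro x
  have := hclosed.closure_subset_iff.2 hsub
  exact this (hdense x)

section Average

variable {n : ℕ} {x : Sp d} {h t : ℝ}

theorem avg_fB {b : Sp d → Fn d} (hb : ∀ l ∈ S.Λ₁, ∃ B, EB B (b l)) (φ : Smo d) :
    IsAvg n x (fun z => S.fB h b z φ x) (∑ l ∈ S.Λ₁, mo n (b l) x * dl h l φ x) := by
  simp only [fB, sum_apply, Smo.smul_apply]
  refine IsAvg.sum _ fun l hl => ?_
  obtain ⟨B, hB⟩ := hb l hl
  exact (IsAvg.of_eb hB).mul_const _

theorem avg_fQ (hq : ∀ l ∈ S.Λ₁, ∃ B, EB B (S.q l t)) (hp : ∀ l ∈ S.Λ₁, ∃ B, EB B (S.p l t))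
    (ht : t ∈ Icc 0 S.T) (φ : Smo d) :
    IsAvg n x (fun z => S.fQ h t z φ x) ((S.geo τ₀ h).Qf (S.coS n t) φ x) := by
  simp only [fQ, sum_apply, Smo.smul_apply, Smo.mul_apply, Geo.Qf, coS, clamp_of_mem ht, geo, sq,
    chi]
  refine IsAvg.sum _ fun l hl => ?_
  obtain ⟨B, hB⟩ := hq l hl
  obtain ⟨B', hB'⟩ := hp l hl
  exact ((IsAvg.of_eb hB).add ((IsAvg.of_eb hB').const_mul h)).mul_const _

theorem avg_fA (hq : ∀ l ∈ S.Λ₁, LB (S.q l t)) (hp : ∀ l ∈ S.Λ₁, LB (S.p l t))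
    (ht : t ∈ Icc 0 S.T) (φ : Smo d) :
    IsAvg n x (fun z => S.fA τ₀ h t z φ x) ((S.geo τ₀ h).Af (S.coS n t) φ x) := by
  have h1 : (S.geo τ₀ h).Af (S.coS n t) φ x = 2 * ∑ μ ∈ S.Λ, dB S.τ τ₀ h μ φ x *
      (h⁻¹ * ∑ l ∈ S.Λ₁, mo n (S.dbar τ₀ h μ (S.q l t)) x * dl h l (sh h μ φ) x
        + ∑ l ∈ S.Λ₁, mo n (S.dbar τ₀ h μ (S.p l t)) x * dl h l (sh h μ φ) x) := by
    simp only [Geo.Af, Geo.Gt, G, Geo.Bq, Geo.Bp, Geo.δF, Geo.δ, coS, clamp_of_mem ht, geo,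
      Smo.smul_apply, sum_apply, Smo.mul_apply, mul_add, sum_add_distrib]
    congr 2 <;> refine sum_congr rfl fun μ _ => ?_
    · congr 2
      exact sum_congr rfl fun l hl => by rw [(S.dbar_mo (hq l hl) τ₀ h μ).2]
    · congr 1
      exact sum_congr rfl fun l hl => by rw [(S.dbar_mo (hp l hl) τ₀ h μ).2]
  rw [h1]
  simp only [fA, Smo.smul_apply, sum_apply, Smo.mul_apply, Smo.add_apply]
  refine (IsAvg.sum _ fun μ _ => (IsAvg.add (IsAvg.const_mul _ ?_) ?_).const_mul _).const_mul 2
  · exact avg_fB (fun l hl => (S.dbar_mo (hq l hl) τ₀ h μ).1) _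
  · exact avg_fB (fun l hl => (S.dbar_mo (hp l hl) τ₀ h μ).1) _

theorem avg_fG (hq : ∀ l ∈ S.Λ₁, LB (S.q l t))
    (hq' : ∀ l ∈ S.Λ₁, ∀ μ, LB (S.dbar τ₀ h μ (S.q l t))) (ht : t ∈ Icc 0 S.T) (φ : Smo d) :
    IsAvg n x (fun z => S.fG τ₀ h t z φ x)
      ((S.geo τ₀ h).Gt (S.geo τ₀ h).δF (S.geo τ₀ h).Bq x 2 (S.coS n t).q φ) := by
  have h1 : (S.geo τ₀ h).Gt (S.geo τ₀ h).δF (S.geo τ₀ h).Bq x 2 (S.coS n t).q φ =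
      ∑ μ ∈ S.Λ ×ˢ S.Λ, dB S.τ τ₀ h μ.1 (dB S.τ τ₀ h μ.2 φ) x *
      (h⁻¹ * ∑ l ∈ S.Λ₁, mo n (S.dbar2 τ₀ h μ (S.q l t)) x *
        dl h l (sh h μ.1 (sh h μ.2 φ)) x) := by
    rw [sum_product_right]
    simp only [Geo.Gt, G, Geo.Bq, Geo.δF, Geo.δ, coS, clamp_of_mem ht, geo,
      Smo.smul_apply, sum_apply, Smo.mul_apply]
    refine sum_congr rfl fun ν _ => sum_congr rfl fun μ _ => ?_
    congr 2
    refine sum_congr rfl fun l hl => ?_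
    rw [dbar2, (S.dbar_mo (hq' l hl ν) τ₀ h μ).2, (S.dbar_mo (hq l hl) τ₀ h ν).2]
  rw [h1]
  simp only [fG, Smo.smul_apply, sum_apply, Smo.mul_apply]
  refine IsAvg.sum _ fun μ _ => (IsAvg.const_mul _ ?_).const_mul _
  exact avg_fB (fun l hl => (S.dbar_mo (hq' l hl μ.2) τ₀ h μ.1).1) _

end Average

/-- The constants bounding the derivatives of the mollified coefficients. -/
def MM (m : ℕ) (M : Fin (m + 1) → ℝ) (k : ℕ) : ℝ :=
  if hk : k < m + 1 then k.factorial * M ⟨k, hk⟩ ^ 2 else 0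

theorem Qn_one (co : Coef d) (h : ℝ) (φ : Smo d) (x : Sp d) :
    (S.geo τ₀ h).Qn co 1 φ x = ∑ μ ∈ S.Λ, (S.geo τ₀ h).Qf co (dB S.τ τ₀ h μ φ) x := rfl

theorem Qn_two (co : Coef d) (h : ℝ) (φ : Smo d) (x : Sp d) :
    (S.geo τ₀ h).Qn co 2 φ x = ∑ μ ∈ S.Λ ×ˢ S.Λ,
      (S.geo τ₀ h).Qf co (dB S.τ τ₀ h μ.1 (dB S.τ τ₀ h μ.2 φ)) x := by
  rw [sum_product_right]; rfl

theorem snap (hS : S.Hyp m δ c₀ τ₀ K M) {h : ℝ} (hh : h ∈ Ioc 0 S.h₀) (n : ℕ) {t : ℝ}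
    (ht : t ∈ Icc 0 S.T) :
    Snap (S.geo τ₀ h) (S.coS n t) m δ K c₀ (S.nrm ^ 2 + τ₀ ^ 2) (S.abs ^ 2) (MM m M) := by
  have hq2 : ∀ l ∈ S.Λ₁, Reg2 (S.q l t) := fun l hl => (hS.smooth.q_mem l hl).reg2 hS.hm ht
  have hp2 : ∀ l ∈ S.Λ₁, Reg2 (S.p l t) := fun l hl => (hS.smooth.p_mem l hl).reg2 hS.hm ht
  have hq : ∀ l ∈ S.Λ₁, LB (S.q l t) := fun l hl => (hq2 l hl).lb
  have hp : ∀ l ∈ S.Λ₁, LB (S.p l t) := fun l hl => (hp2 l hl).lb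
  have hqB := fun l hl => (hq l hl).eb
  have hpB := fun l hl => (hp l hl).eb
  obtain ⟨Cc, hcB⟩ := (hS.smooth.c_mem.reg2 hS.hm ht).1
  have hchi : ∀ l ∈ S.Λ₁, ∀ x, 0 ≤ (S.coS n t).q l x + h * (S.coS n t).p l x := by
    intro l hl x
    obtain ⟨B, hB⟩ := hqB l hl
    obtain ⟨B', hB'⟩ := hpB l hl
    simp only [coS, clamp_of_mem ht]
    exact (IsAvg.const 0).le ((IsAvg.of_eb hB).add ((IsAvg.of_eb hB').const_mul h))
      (ae_of_all _ fun z => hS.chi_nonneg t ht z h hh l hl)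
  have hcx : ∀ x, c₀ ≤ (S.coS n t).c x := by
    intro x
    simp only [coS, clamp_of_mem ht]
    exact (IsAvg.const c₀).le (IsAvg.of_eb hcB) (ae_of_all _ fun z => hS.c_ge t ht z)
  have hcavg : ∀ x, IsAvg n x (S.c t) ((S.coS n t).c x) := by
    intro x
    simp only [coS, clamp_of_mem ht]
    exact IsAvg.of_eb hcB
  refine ⟨hS.hτ₀, hh.1, hchi, ?_, hcx, ?_, ?_, ?_, ?_, ?_⟩
  · intro j
    ext x
    have h1 : IsAvg n x (fun z => ∑ l ∈ S.Λ₁, l j * S.q l t z)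
        (∑ l ∈ S.Λ₁, l j * mo n (S.q l t) x) := IsAvg.sum _ fun l hl => by
      obtain ⟨B, hB⟩ := hqB l hl
      exact (IsAvg.of_eb hB).const_mul _
    have h2 : (fun z => ∑ l ∈ S.Λ₁, l j * S.q l t z) = fun _ => 0 := by
      funext z
      have := congrArg (fun v : Sp d => v j) (hS.centered t ht z)
      simpa [mul_comm] using this
    rw [h2] at h1
    simp only [coS, clamp_of_mem ht, geo, sum_apply, Smo.smul_apply, Smo.zero_apply]
    have h3 := h1.2
    have h4 := (IsAvg.const (n := n) (x := x) 0).2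
    exact h3.symm.trans h4
  · rw [nrm, Real.sq_sqrt (by positivity)]; rfl
  · rw [Data.abs, Real.sq_sqrt (by positivity)]; rfl
  · intro k hk x
    have hk' : k < m + 1 := by omega
    have h1 := sum_H_mo_le_of_sqD (ι := (S.Λ₁ ⊕ S.Λ₁) ⊕ Unit) (T := S.T) (m := m) (k := k)
      (ψ := Sum.elim (Sum.elim (fun l => S.q l) fun l => S.p l) fun _ => S.c)
      (by
        rintro ((l | l) | _)
        · exact hS.smooth.q_mem l l.2
        · exact hS.smooth.p_mem l l.2
        · exact hS.smooth.c_mem) hk ht (C := M ⟨k, hk'⟩ ^ 2) (by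
        filter_upwards [hS.smooth.bound ⟨k, hk'⟩ t ht] with y hy
        rw [sum_add_distrib, ← sum_coe_sort S.Λ₁, ← sum_coe_sort S.Λ₁] at hy
        simpa [Fintype.sum_sum_type] using hy) n x
    rw [MM, dif_pos hk']
    rw [sum_add_distrib, ← sum_coe_sort (S.geo τ₀ h).Λ₁,
      ← sum_coe_sort (S.geo τ₀ h).Λ₁]
    simp only [Fintype.sum_sum_type, Sum.elim_inl, Sum.elim_inr, Finset.univ_unique,
      sum_singleton] at h1
    simp only [coS, clamp_of_mem ht]
    exact h1
  · intro φ C hC x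
    have h1 : IsAvg n x (fun z => S.fJ₁ m δ τ₀ K h t z φ x)
        (m * (S.geo τ₀ h).Af (S.coS n t) φ x - (1 - δ) * (S.geo τ₀ h).Qn (S.coS n t) 1 φ x
          - K * (S.geo τ₀ h).Qf (S.coS n t) φ x) := by
      simp only [fJ₁, Smo.sub_apply, Smo.smul_apply, sum_apply, Qn_one]
      exact (((avg_fA hq hp ht φ).const_mul _).sub
        ((IsAvg.sum _ fun μ _ => avg_fQ hqB hpB ht _).const_mul _)).sub
        ((avg_fQ hqB hpB ht φ).const_mul _)
    have h2 := h1.le (((hcavg x).const_mul (2 * (1 - δ))).mul_const C)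
      (ae_of_all _ fun z => frozen₁ hS hh ht φ hC z x)
    have hC0 : 0 ≤ C := ((S.geo τ₀ h).W_nonneg 1 φ 0).trans (hC 0)
    have h3 : 0 ≤ (1 - δ) * (S.geo τ₀ h).Qn (S.coS n t) 1 φ x :=
      mul_nonneg (by linarith [hS.hδ.2]) ((S.geo τ₀ h).Qn_nonneg _ hchi 1 φ x)
    have h4 : 0 ≤ K * (S.geo τ₀ h).Qf (S.coS n t) φ x :=
      mul_nonneg hS.hK ((S.geo τ₀ h).Qn_nonneg _ hchi 0 φ x)
    have h5 : 0 ≤ 2 * (1 - δ) * (S.coS n t).c x * C :=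
      mul_nonneg (mul_nonneg (by linarith [hS.hδ.2]) (hS.hc₀.le.trans (hcx x))) hC0
    have h6 : (1 : ℝ) ≤ m := by exact_mod_cast hS.hm1
    rcases le_or_gt ((S.geo τ₀ h).Af (S.coS n t) φ x) 0 with h7 | h7
    · linarith
    · nlinarith
  · intro k hk2 hkm ι _ φ C₂ C₁ hC₂ hC₁ x
    have h1 : IsAvg n x (fun z => ∑ i, S.fJ₂ k δ τ₀ K h t z (φ i) x)
        (∑ i, (k * XX (S.geo τ₀ h).Λ (S.geo τ₀ h).δ
            (fun φ => (S.geo τ₀ h).Af (S.coS n t) φ x) (φ i)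
          + k * ((k : ℝ) - 1) * (S.geo τ₀ h).Gt (S.geo τ₀ h).δF (S.geo τ₀ h).Bq x 2
            (S.coS n t).q (φ i)
          - (1 - δ) * (S.geo τ₀ h).Qn (S.coS n t) 2 (φ i) x
          - K * (S.geo τ₀ h).Qn (S.coS n t) 1 (φ i) x)) := by
      refine IsAvg.sum _ fun i _ => ?_
      simp only [fJ₂, Smo.sub_apply, Smo.add_apply, Smo.smul_apply, sum_apply, Qn_one, Qn_two]
      exact ((((IsAvg.sum _ fun μ _ => avg_fA hq hp ht _).const_mul _).add
        ((avg_fG hq (fun l hl μ => (hq2 l hl).dbar_lb S τ₀ h μ) ht _).const_mul _)).sub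
        ((IsAvg.sum _ fun μ _ => avg_fQ hqB hpB ht _).const_mul _)).sub
        ((IsAvg.sum _ fun μ _ => avg_fQ hqB hpB ht _).const_mul _)
    have h2 := h1.le ((((hcavg x).const_mul (2 * (1 - δ))).mul_const C₂).add (IsAvg.const (K * C₁)))
      (by
        filter_upwards [frozen₂ hS hh ht (n := k)
          (Finset.mem_Icc.2 ⟨by omega, hkm⟩) φ hC₂ hC₁] with z hz
        exact hz x)
    simp only [sum_sub_distrib, sum_add_distrib, ← mul_sum] at h2
    linarith

end Data

/-! ### Generalized derivatives as bounded measurable functions -/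

theorem RegT.Dl {ψ : ℝ → Smo d} (h : RegT ψ) (l : List (Sp d)) : RegT fun t => Dl l (ψ t) := by
  induction l with
  | nil => exact h
  | cons v l ih => exact ih.D v

theorem RegT.H_le {ψ : ℝ → Smo d} (h : RegT ψ) (k : ℕ) : ∃ C, ∀ t x, H k (ψ t) x ≤ C := by
  induction k generalizing ψ with
  | zero =>
    obtain ⟨C, hC⟩ := (h.bm.mul h.bm).2
    exact ⟨C, fun t x => by rw [H_zero, sq]; exact (le_abs_self _).trans (hC t x)⟩
  | succ k ih =>
    choose C hC using fun i => ih (h.D (e i))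
    exact ⟨∑ i, C i, fun t x => by rw [H_succ]; exact sum_le_sum fun i _ => hC i t x⟩

/-- The limit of the derivatives of the mollifications. -/
def wd (l : List (Sp d)) (ψ : Fn d) (x : Sp d) : ℝ :=
  Filter.limsup (fun n => Dl l (mo n ψ) x) atTop

theorem abs_limsup_le {a : ℕ → ℝ} {C : ℝ} (h : ∀ n, |a n| ≤ C) :
    |Filter.limsup a atTop| ≤ C := by
  have h1 : Filter.IsBoundedUnder (· ≤ ·) atTop a :=
    Filter.isBoundedUnder_of ⟨C, fun n => (abs_le.1 (h n)).2⟩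
  have h2 : Filter.IsBoundedUnder (· ≥ ·) atTop a :=
    Filter.isBoundedUnder_of ⟨-C, fun n => (abs_le.1 (h n)).1⟩
  refine abs_le.2 ⟨?_, ?_⟩
  · exact Filter.le_limsup_of_frequently_le
      (Filter.Frequently.of_forall fun n => (abs_le.1 (h n)).1) h1
  · exact Filter.limsup_le_of_le h2.isCobounded_flip
      (.of_forall fun n => (abs_le.1 (h n)).2)

section Wd

variable {l : List (Sp d)} {ψ : Fn d} {B C : ℝ}

theorem HB.abs_wd_le (h : HB l.length C ψ) (x : Sp d) :
    |wd l ψ x| ≤ √((l.map fun v => ‖v‖ ^ 2).prod * C) :=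
  abs_limsup_le fun n => abs_Dl_le_of_H (h n x)

theorem HB.ae_tendsto_Dl (hψ : EB B ψ) (h : HB l.length C ψ) :
    ∀ᵐ x, Tendsto (fun n => Dl l (mo n ψ) x) atTop (nhds (wd l ψ x)) := by
  obtain ⟨h1, h2⟩ := h.weakDeriv hψ
  filter_upwards [ae_tendsto_conv_rho h2.2.1] with x hx
  have h3 : Tendsto (fun n => Dl l (mo n ψ) x) atTop (nhds (FDScheme.weakDeriv l ψ x)) := by
    simpa only [h2.Dl_mo hψ h1, mo_apply h1] using hx
  rwa [wd, h3.limsup_eq]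

theorem HB.wd_ae_eq (hψ : EB B ψ) (h : HB l.length C ψ) : wd l ψ =ᵐ[volume] FDScheme.weakDeriv l ψ := by
  obtain ⟨h1, h2⟩ := h.weakDeriv hψ
  filter_upwards [ae_tendsto_conv_rho h2.2.1, h.ae_tendsto_Dl hψ] with x hx hx'
  refine tendsto_nhds_unique hx' ?_
  simpa only [h2.Dl_mo hψ h1, mo_apply h1] using hx

theorem HB.eb_wd (hψ : EB B ψ) (h : HB l.length C ψ) :
    EB (√((l.map fun v => ‖v‖ ^ 2).prod * C)) (wd l ψ) :=
  ⟨(h.weakDeriv hψ).1.1.congr (h.wd_ae_eq hψ).symm, ae_of_all _ h.abs_wd_le⟩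

theorem HB.mo_wd (hψ : EB B ψ) (h : HB l.length C ψ) (n : ℕ) :
    mo n (wd l ψ) = Dl l (mo n ψ) := by
  rw [mo_congr (h.eb_wd hψ) (h.wd_ae_eq hψ), (h.weakDeriv hψ).2.Dl_mo hψ (h.weakDeriv hψ).1]

theorem BM.wd {u : TFn d} (hu : BM u) (h : ∀ t, HB l.length C (u t)) :
    BM fun t => wd l (u t) :=
  ⟨Measurable.limsup fun n => ((regT_mo hu n).Dl l).bm.1, _, fun t x => (h t).abs_wd_le x⟩

end Wd

/-- Sums of products with Lipschitz coefficients almost commute with mollification. -/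
theorem mo_pair_sub_le {ι : Type*} [Fintype ι] {a v : ι → Fn d} {A V : ℝ} (hA : 0 ≤ A)
    (ha : ∀ i x y, |a i x - a i y| ≤ A * ‖x - y‖) (hab : ∀ i, ∃ B, EB B (a i))
    (hv : ∀ i, EB V (v i)) (n : ℕ) (x : Sp d) :
    |mo n (fun y => ∑ i, a i y * v i y) x - ∑ i, a i x * mo n (v i) x| ≤
      Fintype.card ι * (A * V) * eps n := by
  choose B hB using hab
  have h1 : ∀ i, EB (B i * V) fun y => a i y * v i y := fun i => (hB i).mul (hv i)
  have e1 : IsAvg n x (fun y => ∑ i, a i y * v i y) (∑ i, mo n (fun y => a i y * v i y) x) :=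
    IsAvg.sum _ fun i _ => IsAvg.of_eb (h1 i)
  obtain ⟨C, hC⟩ := e1.1
  rw [mo_apply hC, e1.2, ← sum_sub_distrib]
  refine (abs_sum_le_sum_abs _ _).trans ?_
  have h2 : ∀ i, |mo n (fun y => a i y * v i y) x - a i x * mo n (v i) x| ≤ A * V * eps n := by
    intro i
    have e2 : IsAvg n x (fun y => a i y * v i y - a i x * v i y)
        (mo n (fun y => a i y * v i y) x - a i x * mo n (v i) x) :=
      (IsAvg.of_eb (h1 i)).sub ((IsAvg.of_eb (hv i)).const_mul _)
    obtain ⟨C', hC'⟩ := e2.1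
    rw [← e2.2, ← sub_zero (conv _ _ x)]
    have h3 := qmp_sub x
    refine abs_conv_rho_sub_le hC' ?_
    filter_upwards [h3.ae (hv i).2] with y hy hyn
    rw [sub_zero, ← sub_mul, abs_mul]
    have h4 := ha i (x - y) x
    rw [sub_sub_cancel_left, norm_neg] at h4
    calc _ ≤ (A * ‖y‖) * V := by gcongr
      _ ≤ (A * eps n) * V := by
          have := (abs_nonneg _).trans hy
          gcongr
      _ = _ := by ring
  refine (sum_le_sum fun i _ => h2 i).trans (le_of_eq ?_)
  simp [mul_assoc]

theorem MemB.bm {T : ℝ} {m : ℕ} {ψ : TFn d} (h : MemB T m ψ) (hT : 0 ≤ T) :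
    BM fun t => ψ (clamp T t) := by
  obtain ⟨C, hC⟩ := h.bounded
  refine ⟨?_, C, fun t x => hC _ (clamp_mem hT t) x⟩
  have h1 : Measurable fun z : ℝ × Sp d => ((⟨clamp T z.1, clamp_mem hT z.1⟩ : Icc (0 : ℝ) T), z.2) :=
    (((measurable_clamp T).comp measurable_fst).subtype_mk).prodMk measurable_snd
  exact h.measurable.comp h1

namespace Data

variable (S : Data d)

/-- The index set of the terms of the operators. -/
abbrev Ix : Type := (S.Λ₁ ⊕ S.Λ₁) ⊕ Unit

/-- The coefficients `q`, `p`, `-c`, stopped at the ends of `[0,T]`. -/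
def cf (t : ℝ) : S.Ix → Fn d
  | .inl (.inl l) => S.q l (clamp S.T t)
  | .inl (.inr l) => S.p l (clamp S.T t)
  | .inr _ => fun x => -S.c (clamp S.T t) x

/-- The numerical factors of the terms of `𝓛^{(i)}`. -/
def jf (i : ℕ) : S.Ix → ℝ
  | .inl (.inl _) => 1 / (((i : ℝ) + 1) * ((i : ℝ) + 2))
  | .inl (.inr _) => 1 / ((i : ℝ) + 1)
  | .inr _ => if i = 0 then 1 else 0

/-- The directions of differentiation in the terms of `𝓛^{(i)}`. -/
def jl (i : ℕ) : S.Ix → List (Sp d)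
  | .inl (.inl l) => List.replicate (i + 2) l
  | .inl (.inr l) => List.replicate (i + 1) l
  | .inr _ => []

/-- `𝓛^{(i)}` for smooth functions, where `𝓛^{(0)} = 𝓛`. -/
def Ls (i : ℕ) (t : ℝ) (φ : Smo d) (x : Sp d) : ℝ :=
  ∑ ι, S.cf t ι x * (S.jf i ι * Dl (S.jl i ι) φ x)

/-- A measurable representative of `𝓛^{(i)} u`, where `𝓛^{(0)} = 𝓛`. -/
def Lw (i : ℕ) (t : ℝ) (u : Fn d) (x : Sp d) : ℝ :=
  ∑ ι, S.cf t ι x * (S.jf i ι * wd (S.jl i ι) u x)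

theorem length_jl (i : ℕ) (ι : S.Ix) : (S.jl i ι).length ≤ i + 2 := by
  rcases ι with (l | l) | _ <;> simp [jl]

theorem abs_jf_le (i : ℕ) (ι : S.Ix) : |S.jf i ι| ≤ 1 := by
  rcases ι with (l | l) | _
  · simp only [jf]
    rw [abs_of_nonneg (by positivity)]
    refine div_le_one_of_le₀ ?_ (by positivity)
    have : (0 : ℝ) ≤ i := by positivity
    nlinarith
  · simp only [jf]
    rw [abs_of_nonneg (by positivity)]
    refine div_le_one_of_le₀ ?_ (by positivity)
    have : (0 : ℝ) ≤ i := by positivity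
    linarith
  · simp only [jf]; split_ifs <;> simp

/-- The coefficients of the finite difference operator. -/
def fc (h : ℝ) (l : Sp d) (t : ℝ) (x : Sp d) : ℝ :=
  S.q l (clamp S.T t) x / h ^ 2 + S.p l (clamp S.T t) x / h

theorem Lh_eq {h : ℝ} (hh : h ≠ 0) {t : ℝ} (ht : t ∈ Icc 0 S.T) (v : Fn d) (x : Sp d) :
    S.Lh h t v x = fdo S.Λ₁ h (S.fc h) (fun t => S.c (clamp S.T t)) t v x := by
  rw [Lh, L0h, fdo, clamp_of_mem ht, mul_sum, ← sum_add_distrib]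
  congr 1
  refine sum_congr rfl fun l _ => ?_
  rw [fc, clamp_of_mem ht, delta]
  field_simp

variable {S} {m : ℕ} {δ c₀ τ₀ K : ℝ} {M : Fin (m + 1) → ℝ}

theorem memB_cf (hS : S.Hyp m δ c₀ τ₀ K M) (ι : S.Ix) :
    ∃ ψ, MemB S.T m ψ ∧ ((∀ t, S.cf t ι = ψ (clamp S.T t)) ∨
      ∀ t x, S.cf t ι x = -ψ (clamp S.T t) x) := by
  rcases ι with (l | l) | _
  · exact ⟨_, hS.smooth.q_mem l l.2, .inl fun t => rfl⟩
  · exact ⟨_, hS.smooth.p_mem l l.2, .inl fun t => rfl⟩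
  · exact ⟨_, hS.smooth.c_mem, .inr fun t x => rfl⟩

theorem bm_cf (hS : S.Hyp m δ c₀ τ₀ K M) (ι : S.Ix) : BM fun t => S.cf t ι := by
  obtain ⟨ψ, hψ, h | h⟩ := memB_cf hS ι
  · simpa only [h] using hψ.bm S.T_pos.le
  · have := (hψ.bm S.T_pos.le).neg
    simpa only [← h] using this

theorem bm_fc (hS : S.Hyp m δ c₀ τ₀ K M) (h : ℝ) : ∀ l ∈ S.Λ₁, BM (S.fc h l) := by
  intro l hl
  have h1 := (((hS.smooth.q_mem l hl).bm S.T_pos.le).mul (BM.const (h ^ 2)⁻¹)).add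
    (((hS.smooth.p_mem l hl).bm S.T_pos.le).mul (BM.const h⁻¹))
  simp only [← div_eq_mul_inv] at h1
  exact h1

theorem bm_c (hS : S.Hyp m δ c₀ τ₀ K M) : BM fun t => S.c (clamp S.T t) :=
  hS.smooth.c_mem.bm S.T_pos.le

theorem fc_nonneg (hS : S.Hyp m δ c₀ τ₀ K M) {h : ℝ} (hh : h ∈ Ioc 0 S.h₀) :
    ∀ l ∈ S.Λ₁, ∀ t x, 0 ≤ S.fc h l t x := by
  intro l hl t x
  have h1 := hS.chi_nonneg _ (clamp_mem S.T_pos.le t) x h hh l hl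
  have h2 : S.fc h l t x = S.chi h l (clamp S.T t) x / h ^ 2 := by
    rw [fc, chi]; have := hh.1.ne'; field_simp
  rw [h2]
  exact div_nonneg h1 (by positivity)

theorem c_ge_clamp (hS : S.Hyp m δ c₀ τ₀ K M) (t : ℝ) (x : Sp d) :
    c₀ ≤ S.c (clamp S.T t) x := hS.c_ge _ (clamp_mem S.T_pos.le t) x

theorem abs_sub_le_of_memB {T : ℝ} {ψ : TFn d} (h : MemB T m ψ) (hm : 1 ≤ m)
    {t : ℝ} (ht : t ∈ Icc 0 T) (x y : Sp d) : |ψ t x - ψ t y| ≤ normB T m ψ * ‖x - y‖ := by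
  obtain ⟨B, hB⟩ := h.eb
  have h1 := (h.hb hm ht).abs_rp_sub_le (hB t ht) x y
  rw [rp_of_continuous (hB t ht) (h.continuous t ht)] at h1
  rwa [Nat.factorial_one, Nat.cast_one, one_mul, Real.sqrt_sq (normB_nonneg _ _ _)] at h1

theorem cf_lip (hS : S.Hyp m δ c₀ τ₀ K M) :
    ∃ A, 0 ≤ A ∧ ∀ ι t x y, |S.cf t ι x - S.cf t ι y| ≤ A * ‖x - y‖ := by
  have h1 : ∀ ι : S.Ix, ∃ A, 0 ≤ A ∧ ∀ t x y, |S.cf t ι x - S.cf t ι y| ≤ A * ‖x - y‖ := by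
    intro ι
    obtain ⟨ψ, hψ, h⟩ := memB_cf hS ι
    refine ⟨normB S.T m ψ, normB_nonneg _ _ _, fun t x y => ?_⟩
    have h2 := abs_sub_le_of_memB hψ hS.hm1 (clamp_mem S.T_pos.le t)
    rcases h with h | h
    · rw [h]; exact h2 x y
    · rw [h, h, neg_sub_neg, abs_sub_comm]; exact h2 x y
  choose A hA0 hA using h1
  refine ⟨∑ ι, A ι, sum_nonneg fun ι _ => hA0 ι, fun ι t x y => (hA ι t x y).trans ?_⟩
  gcongr
  exact single_le_sum (fun ι _ => hA0 ι) (Finset.mem_univ ι)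

theorem cf_sq_le (hS : S.Hyp m δ c₀ τ₀ K M) (ι : S.Ix) (t : ℝ) (x : Sp d) : S.cf t ι x ^ 2 ≤ MM m M 0 := by
  have hT := clamp_mem S.T_pos.le t
  have h1 : ∀ n, ∑ l ∈ S.Λ₁, ((S.coS n t).q l x ^ 2 + (S.coS n t).p l x ^ 2)
      + (S.coS n t).c x ^ 2 ≤ MM m M 0 := by
    intro n
    have := (snap hS (h := S.h₀) ⟨S.h₀_pos, le_rfl⟩ n hT).coef 0 (by omega) x
    simpa only [H_zero, coS, clamp_of_mem hT, geo] using this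
  have key : ∀ ψ : TFn d, MemB S.T m ψ →
      (∀ n, mo n (ψ (clamp S.T t)) x ^ 2 ≤ MM m M 0) → ψ (clamp S.T t) x ^ 2 ≤ MM m M 0 := by
    intro ψ hψ h
    obtain ⟨B, hB⟩ := hψ.eb
    have h2 := tendsto_conv_rho (hB _ hT) (x := x) (hψ.continuous _ hT).continuousAt
    simp only [mo_apply (hB _ hT)] at h
    exact le_of_tendsto (h2.pow 2) (.of_forall h)
  have h2 : ∀ n, ∀ l ∈ S.Λ₁, (S.coS n t).q l x ^ 2 + (S.coS n t).p l x ^ 2 ≤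
      ∑ l ∈ S.Λ₁, ((S.coS n t).q l x ^ 2 + (S.coS n t).p l x ^ 2) := fun n l hl =>
    single_le_sum (f := fun l => (S.coS n t).q l x ^ 2 + (S.coS n t).p l x ^ 2)
      (fun l _ => by positivity) hl
  rcases ι with (l | l) | _
  · refine key _ (hS.smooth.q_mem l l.2) fun n => ?_
    have h3 : (S.coS n t).q l x ^ 2 ≤ MM m M 0 := by
      nlinarith [h1 n, h2 n l l.2, sq_nonneg ((S.coS n t).p l x), sq_nonneg ((S.coS n t).c x)]
    exact h3
  · refine key _ (hS.smooth.p_mem l l.2) fun n => ?_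
    have h3 : (S.coS n t).p l x ^ 2 ≤ MM m M 0 := by
      nlinarith [h1 n, h2 n l l.2, sq_nonneg ((S.coS n t).q l x), sq_nonneg ((S.coS n t).c x)]
    exact h3
  · simp only [cf, neg_sq]
    refine key _ hS.smooth.c_mem fun n => ?_
    have h3 : (S.coS n t).c x ^ 2 ≤ MM m M 0 := by
      have : 0 ≤ ∑ l ∈ S.Λ₁, ((S.coS n t).q l x ^ 2 + (S.coS n t).p l x ^ 2) :=
        sum_nonneg fun l _ => by positivity
      linarith [h1 n]
    exact h3

end Data

theorem abs_iterate_D_le {r : ℕ} {φ : Smo d} {C : ℝ} {y : Sp d} (h : H r φ y ≤ C) (l : Sp d) :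
    |(D l)^[r] φ y| ≤ ‖l‖ ^ r * √C := by
  have h1 := H_iterate_D_le 0 r l φ y
  rw [H_zero, zero_add] at h1
  have h2 : ((D l)^[r] φ y) ^ 2 ≤ (‖l‖ ^ r) ^ 2 * C := by
    rw [← pow_mul, mul_comm r 2, pow_mul]
    exact h1.trans (by gcongr)
  have h3 := Real.abs_le_sqrt h2
  rwa [Real.sqrt_mul (by positivity), Real.sqrt_sq (by positivity)] at h3

/-- Taylor expansions of difference quotients. -/
theorem taylor_first (h : ℝ) (k : ℕ) (φ : Smo d) (l x : Sp d) : ∃ y,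
    φ (x + h • l) - φ x = h * (∑ i ∈ Finset.range (k + 1),
      h ^ i / (i + 1).factorial * (D l)^[i + 1] φ x + h ^ (k + 1) * ((D l)^[k + 2] φ y
        / (k + 2).factorial)) := by
  obtain ⟨y, hy⟩ := taylor_lagrange φ x (h • l) (k + 1)
  refine ⟨y, ?_⟩
  rw [hy, sum_range_succ', mul_add, mul_sum]
  simp only [iterate_D_smul, Smo.smul_apply, Nat.factorial_zero, Nat.cast_one, div_one,
    Function.iterate_zero, id, pow_zero, one_mul]
  rw [add_assoc, add_comm (φ x), ← add_assoc, add_sub_cancel_right]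
  congr 1
  · exact sum_congr rfl fun i _ => by rw [pow_succ]; ring
  · rw [pow_succ _ (k + 1)]; ring

theorem taylor_second (h : ℝ) (k : ℕ) (φ : Smo d) (l x : Sp d) : ∃ y,
    φ (x + h • l) - φ x = h * D l φ x + h ^ 2 * (∑ i ∈ Finset.range (k + 1),
      h ^ i / (i + 2).factorial * (D l)^[i + 2] φ x + h ^ (k + 1) * ((D l)^[k + 3] φ y
        / (k + 3).factorial)) := by
  obtain ⟨y, hy⟩ := taylor_first h (k + 1) φ l x
  refine ⟨y, ?_⟩
  rw [hy, sum_range_succ', mul_add, mul_add, mul_add, mul_sum, mul_sum]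
  have e1 : h * (h ^ 0 / ((0 + 1).factorial : ℝ) * (D l)^[0 + 1] φ x) = h * D l φ x := by simp
  rw [e1, add_comm _ (h * D l φ x), add_assoc]
  congr 2
  · exact sum_congr rfl fun i _ => by rw [pow_succ]; ring
  · rw [pow_succ _ (k + 1)]; ring

variable {S : Data d} {m : ℕ} {δ c₀ τ₀ K : ℝ} {M : Fin (m + 1) → ℝ}

namespace Data

theorem Ls_eq (i : ℕ) (t : ℝ) (φ : Smo d) (x : Sp d) : S.Ls i t φ x =
    ∑ l ∈ S.Λ₁, S.q l (clamp S.T t) x * (1 / (((i : ℝ) + 1) * ((i : ℝ) + 2)) * (D l)^[i + 2] φ x)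
    + ∑ l ∈ S.Λ₁, S.p l (clamp S.T t) x * (1 / ((i : ℝ) + 1) * (D l)^[i + 1] φ x)
    - if i = 0 then S.c (clamp S.T t) x * φ x else 0 := by
  rw [Ls, Fintype.sum_sum_type, Fintype.sum_sum_type, sub_eq_add_neg]
  congr 1
  · rw [← sum_coe_sort S.Λ₁, ← sum_coe_sort S.Λ₁]
    simp only [cf, jf, jl, Dl_replicate]
  · simp only [cf, jf, jl, Finset.univ_unique, sum_singleton]
    split_ifs
    · simp [Dl]
    · simp

theorem norm_le_abs {l : Sp d} (hl : l ∈ S.Λ₁) : ‖l‖ ≤ S.abs := by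
  refine Real.le_sqrt_of_sq_le ?_
  exact single_le_sum (f := fun l => ‖l‖ ^ 2) (fun l _ => by positivity) hl

theorem sum_norm_pow_le (r : ℕ) : ∑ l ∈ S.Λ₁, ‖l‖ ^ (r + 2) ≤ S.abs ^ (r + 2) := by
  have h1 : S.abs ^ 2 = ∑ l ∈ S.Λ₁, ‖l‖ ^ 2 := Real.sq_sqrt (by positivity)
  rw [pow_add S.abs, h1, mul_sum]
  refine sum_le_sum fun l hl => ?_
  rw [pow_add]
  have := norm_le_abs hl
  gcongr

theorem abs_coef_le (hS : S.Hyp m δ c₀ τ₀ K M) (ι : S.Ix) (t : ℝ) (x : Sp d) :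
    |S.cf t ι x| ≤ √(MM m M 0) :=
  Real.abs_le_sqrt (cf_sq_le hS ι t x)

/-- Expansion of the finite difference operator in powers of the mesh size. -/
theorem abs_fdo_sub_le (hS : S.Hyp m δ c₀ τ₀ K M) {h C : ℝ} (hh : 0 < h) (k : ℕ) (φ : Smo d)
    (h2 : ∀ y, H (k + 2) φ y ≤ C) (h3 : ∀ y, H (k + 3) φ y ≤ C) (t : ℝ) (x : Sp d) :
    |fdo S.Λ₁ h (S.fc h) (fun t => S.c (clamp S.T t)) t φ x
      - ∑ i ∈ Finset.range (k + 1), h ^ i / i.factorial * S.Ls i t φ x| ≤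
    h ^ (k + 1) * (√(MM m M 0) * (S.abs ^ (k + 3) + S.abs ^ (k + 2)) * √C) := by
  choose y hy using fun l => taylor_second h k φ l x
  choose z hz using fun l => taylor_first h k φ l x
  set q : Fn d := fun l => S.q l (clamp S.T t) x with hq
  set p : Fn d := fun l => S.p l (clamp S.T t) x with hp
  have hcent : ∑ l ∈ S.Λ₁, q l * D l φ x = 0 := by
    have h4 := hS.centered _ (clamp_mem S.T_pos.le t) x
    have : ∑ l ∈ S.Λ₁, q l * D l φ x = D (∑ l ∈ S.Λ₁, q l • l) φ x := by
      simp only [D_apply, map_sum, map_smul, smul_eq_mul]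
    rw [this, h4]; simp [D_apply]
  have e1 : fdo S.Λ₁ h (S.fc h) (fun t => S.c (clamp S.T t)) t φ x =
      ∑ l ∈ S.Λ₁, q l * (∑ i ∈ Finset.range (k + 1),
        h ^ i / (i + 2).factorial * (D l)^[i + 2] φ x + h ^ (k + 1) * ((D l)^[k + 3] φ (y l)
          / (k + 3).factorial))
      + ∑ l ∈ S.Λ₁, p l * (∑ i ∈ Finset.range (k + 1),
        h ^ i / (i + 1).factorial * (D l)^[i + 1] φ x + h ^ (k + 1) * ((D l)^[k + 2] φ (z l)
          / (k + 2).factorial)) - S.c (clamp S.T t) x * φ x := by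
    rw [fdo]
    congr 1
    have : ∀ l ∈ S.Λ₁, S.fc h l t x * (φ (x + h • l) - φ x) = h⁻¹ * (q l * D l φ x)
        + (q l * (∑ i ∈ Finset.range (k + 1),
        h ^ i / (i + 2).factorial * (D l)^[i + 2] φ x + h ^ (k + 1) * ((D l)^[k + 3] φ (y l)
          / (k + 3).factorial)) + p l * (∑ i ∈ Finset.range (k + 1),
        h ^ i / (i + 1).factorial * (D l)^[i + 1] φ x + h ^ (k + 1) * ((D l)^[k + 2] φ (z l)
          / (k + 2).factorial))) := by
      intro l _
      have h5 : S.fc h l t x * (φ (x + h • l) - φ x) = (q l / h ^ 2) * (φ (x + h • l) - φ x)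
          + (p l / h) * (φ (x + h • l) - φ x) := by rw [fc, hq, hp]; ring
      rw [h5]
      nth_rewrite 1 [hy l]
      rw [hz l]
      field_simp
      ring
    rw [sum_congr rfl this, sum_add_distrib, ← mul_sum, hcent, mul_zero,
      zero_add, sum_add_distrib]
  have e2 : ∑ i ∈ Finset.range (k + 1), h ^ i / i.factorial * S.Ls i t φ x =
      ∑ l ∈ S.Λ₁, q l * (∑ i ∈ Finset.range (k + 1),
        h ^ i / (i + 2).factorial * (D l)^[i + 2] φ x)
      + ∑ l ∈ S.Λ₁, p l * (∑ i ∈ Finset.range (k + 1),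
        h ^ i / (i + 1).factorial * (D l)^[i + 1] φ x) - S.c (clamp S.T t) x * φ x := by
    simp only [Ls_eq, mul_add, mul_sub, sum_add_distrib, sum_sub_distrib,
      mul_sum]
    congr 1
    · congr 1
      · rw [sum_comm]
        refine sum_congr rfl fun l _ => sum_congr rfl fun i _ => ?_
        rw [Nat.factorial_succ, Nat.factorial_succ]
        push_cast
        field_simp
        ring
      · rw [sum_comm]
        refine sum_congr rfl fun l _ => sum_congr rfl fun i _ => ?_
        rw [Nat.factorial_succ]
        push_cast
        field_simp
        exact mul_comm _ _
    · rw [sum_range_succ']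
      simp
  have e3 : fdo S.Λ₁ h (S.fc h) (fun t => S.c (clamp S.T t)) t φ x
      - ∑ i ∈ Finset.range (k + 1), h ^ i / i.factorial * S.Ls i t φ x =
      h ^ (k + 1) * (∑ l ∈ S.Λ₁, q l * ((D l)^[k + 3] φ (y l) / (k + 3).factorial)
        + ∑ l ∈ S.Λ₁, p l * ((D l)^[k + 2] φ (z l) / (k + 2).factorial)) := by
    rw [e1, e2]
    simp only [mul_add, sum_add_distrib, mul_sum]
    have : ∀ (a : ℝ) (b : Fn d) (c : Fn d), ∑ l ∈ S.Λ₁, b l * (h ^ (k + 1) * c l) =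
      ∑ l ∈ S.Λ₁, h ^ (k + 1) * (b l * c l) := fun a b c =>
        sum_congr rfl fun l _ => by ring
    rw [this 0, this 0]
    ring
  rw [e3, abs_mul, abs_of_pos (by positivity)]
  have hone : ∀ r : ℕ, (1 : ℝ) ≤ r.factorial := fun r => by exact_mod_cast r.factorial_pos
  have key : ∀ (b : Fn d) (r : ℕ) (w : Sp d → Sp d), (∀ l ∈ S.Λ₁, |b l| ≤ √(MM m M 0)) →
      (∀ y, H (r + 2) φ y ≤ C) → |∑ l ∈ S.Λ₁, b l * ((D l)^[r + 2] φ (w l) / (r + 2).factorial)| ≤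
      √(MM m M 0) * S.abs ^ (r + 2) * √C := by
    intro b r w hb hC
    calc _ ≤ ∑ l ∈ S.Λ₁, √(MM m M 0) * (‖l‖ ^ (r + 2) * √C) := by
          refine (abs_sum_le_sum_abs _ _).trans (sum_le_sum fun l hl => ?_)
          rw [abs_mul, abs_div, Nat.abs_cast]
          refine mul_le_mul (hb l hl) ?_ (by positivity) (Real.sqrt_nonneg _)
          exact (div_le_self (abs_nonneg _) (hone _)).trans (abs_iterate_D_le (hC _) l)
      _ = √(MM m M 0) * (∑ l ∈ S.Λ₁, ‖l‖ ^ (r + 2)) * √C := by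
          rw [mul_sum, sum_mul]
          exact sum_congr rfl fun l _ => by ring
      _ ≤ _ := by gcongr; exact sum_norm_pow_le r
  gcongr
  refine (abs_add_le _ _).trans ?_
  have k1 := key q (k + 1) y (fun l hl =>
    abs_coef_le hS (.inl (.inl ⟨l, hl⟩)) t x) h3
  have k2 := key p k z (fun l hl =>
    abs_coef_le hS (.inl (.inr ⟨l, hl⟩)) t x) h2
  calc _ ≤ _ := add_le_add k1 k2
    _ = _ := by ring

/-- The maximum principle for the degenerate parabolic operator. -/
theorem max_principle (hS : S.Hyp m δ c₀ τ₀ K M) {w : ℝ → Smo d} {G : TFn d} {w₀ : Fn d} {b ε : ℝ}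
    (hw : RegT w) (hG : BM G)
    (he : ∀ t ∈ Icc 0 S.T, ∀ x, w t x = w₀ x + ∫ s in 0..t, G s x)
    (h0 : ∀ x, |w₀ x| ≤ b) (hε : 0 ≤ ε) (hle : ∀ t ∈ Icc 0 S.T, ∀ x, |G t x - S.Ls 0 t (w t) x| ≤ ε) :
    ∀ t ∈ Icc 0 S.T, ∀ x, |w t x| ≤ b + ε / c₀ := by
  obtain ⟨C, hC⟩ := hw.H_le 2
  obtain ⟨C', hC'⟩ := hw.H_le 3
  set N := √(MM m M 0) * (S.abs ^ (0 + 3) + S.abs ^ (0 + 2)) * √(max C C') with hN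
  have habs : 0 ≤ S.abs := Real.sqrt_nonneg _
  have hN0 : 0 ≤ N := by positivity
  have key : ∀ h ∈ Ioc 0 S.h₀, ∀ t ∈ Icc 0 S.T, ∀ x, |w t x| ≤ b + (ε + h * N) / c₀ := by
    intro h hh
    have hh0 := hh.1
    refine fd_stable (h := h) S.T_pos.le hS.hc₀ (bm_fc hS h) (bm_c hS) (fc_nonneg hS hh) (c_ge_clamp hS)
      (fun x => hG.intervalIntegrable x _ _) he ?_ h0 (by positivity) fun t ht x => ?_
    · obtain ⟨B, hB⟩ := hw.bm.2
      exact ⟨B, fun t _ x => hB t x⟩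
    · have h1 := abs_fdo_sub_le hS hh.1 0 (w t) (C := max C C')
        (fun y => (hC t y).trans (le_max_left _ _)) (fun y => (hC' t y).trans (le_max_right _ _)) t x
      simp only [zero_add, Finset.range_one, sum_singleton, pow_zero, Nat.factorial_zero,
        Nat.cast_one, div_one, one_mul, pow_one] at h1
      have h2 := hle t ht x
      rw [abs_le] at h1 h2 ⊢
      simp only [zero_add] at hN
      rw [← hN] at h1
      constructor <;> linarith [h1.1, h1.2, h2.1, h2.2]
  intro t ht x
  have hlim : Tendsto (fun h : ℝ => b + (ε + h * N) / c₀) (nhdsWithin 0 (Ioi 0))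
      (nhds (b + (ε + 0 * N) / c₀)) := by
    refine Tendsto.mono_left (Continuous.tendsto ?_ 0) nhdsWithin_le_nhds
    fun_prop
  rw [zero_mul, add_zero] at hlim
  refine ge_of_tendsto hlim ?_
  filter_upwards [Ioc_mem_nhdsGT S.h₀_pos] with h hh
  exact key h hh t ht x

/-! ### The operators `𝓛^{(i)}` on functions with bounded generalized derivatives -/

/-- A bound for the terms of `𝓛^{(i)} u`. -/
def jV (S : Data d) (i : ℕ) (C : ℝ) : ℝ :=
  ∑ ι, √(((S.jl i ι).map fun v => ‖v‖ ^ 2).prod * C)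

theorem le_jV (i : ℕ) (C : ℝ) (ι : S.Ix) :
    √(((S.jl i ι).map fun v => ‖v‖ ^ 2).prod * C) ≤ S.jV i C :=
  single_le_sum (f := fun ι => √(((S.jl i ι).map fun v => ‖v‖ ^ 2).prod * C))
    (fun _ _ => Real.sqrt_nonneg _) (Finset.mem_univ ι)

theorem jV_nonneg (i : ℕ) (C : ℝ) : 0 ≤ S.jV i C := sum_nonneg fun _ _ => Real.sqrt_nonneg _

section Lw

variable {i : ℕ} {u : Fn d} {B C : ℝ}

theorem eb_term (hu : EB B u) (h : ∀ k ≤ i + 2, HB k C u) (ι : S.Ix) :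
    EB (S.jV i C) fun x => S.jf i ι * wd (S.jl i ι) u x := by
  have h1 := (h _ (S.length_jl i ι)).eb_wd hu
  refine ⟨((EB.const _).mul h1).1, ?_⟩
  filter_upwards [h1.2] with x hx
  rw [abs_mul]
  calc _ ≤ 1 * S.jV i C := by
        have := S.abs_jf_le i ι
        have := hx.trans (le_jV i C ι)
        gcongr
    _ = _ := one_mul _

theorem eb_cf (hS : S.Hyp m δ c₀ τ₀ K M) (t : ℝ) (ι : S.Ix) : ∃ B, EB B (S.cf t ι) := by
  obtain ⟨C, hC⟩ := (bm_cf hS ι).eb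
  exact ⟨C, hC t⟩

theorem mo_Lw_sub_le (hS : S.Hyp m δ c₀ τ₀ K M) (i : ℕ) (C : ℝ) :
    ∃ N, 0 ≤ N ∧ ∀ (u : Fn d) (B : ℝ), EB B u → (∀ k ≤ i + 2, HB k C u) → ∀ t n x,
      |mo n (S.Lw i t u) x - S.Ls i t (mo n u) x| ≤ N * eps n := by
  obtain ⟨A, hA0, hA⟩ := cf_lip hS
  refine ⟨Fintype.card S.Ix * (A * S.jV i C), by have := S.jV_nonneg i C; positivity, ?_⟩
  intro u B hu h t n x
  have h1 := mo_pair_sub_le hA0 (fun ι => hA ι t) (eb_cf hS t) (eb_term hu h) n x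
  have h2 : ∀ ι : S.Ix, mo n (fun x => S.jf i ι * wd (S.jl i ι) u x) x =
      S.jf i ι * Dl (S.jl i ι) (mo n u) x := by
    intro ι
    have h3 := h _ (S.length_jl i ι)
    rw [mo_const_mul (h3.eb_wd hu), h3.mo_wd hu]; rfl
  simp only [h2] at h1
  exact h1

theorem eb_Lw (hS : S.Hyp m δ c₀ τ₀ K M) (hu : EB B u) (h : ∀ k ≤ i + 2, HB k C u) (t : ℝ) :
    ∃ B', EB B' (S.Lw i t u) := by
  choose A hA using eb_cf hS t
  have : IsAvg 0 0 (S.Lw i t u) _ := IsAvg.sum Finset.univ fun ι _ =>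
    IsAvg.of_eb ((hA ι).mul (eb_term hu h ι))
  exact this.1

theorem ae_tendsto_Ls (hu : EB B u) (h : ∀ k ≤ i + 2, HB k C u) (t : ℝ) :
    ∀ᵐ x, Tendsto (fun n => S.Ls i t (mo n u) x) atTop (nhds (S.Lw i t u x)) := by
  have h1 : ∀ᵐ x, ∀ ι : S.Ix, Tendsto (fun n => Dl (S.jl i ι) (mo n u) x) atTop
      (nhds (wd (S.jl i ι) u x)) :=
    ae_all_iff.2 fun ι => (h _ (S.length_jl i ι)).ae_tendsto_Dl hu
  filter_upwards [h1] with x hx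
  exact tendsto_finsetSum _ fun ι _ => ((hx ι).const_mul _).const_mul _

theorem bm_Lw (hS : S.Hyp m δ c₀ τ₀ K M) {u : TFn d} (hu : BM u)
    (h : ∀ t, ∀ k ≤ i + 2, HB k C (u t)) : BM fun t => S.Lw i t (u t) :=
  BM.sum _ fun ι _ => (bm_cf hS ι).mul ((BM.const _).mul (hu.wd fun t => h t _ (S.length_jl i ι)))

theorem bm_Ls (hS : S.Hyp m δ c₀ τ₀ K M) {φ : ℝ → Smo d} (hφ : RegT φ) (i : ℕ) :
    BM fun t => S.Ls i t (φ t) :=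
  BM.sum _ fun ι _ => (bm_cf hS ι).mul ((BM.const _).mul (hφ.Dl _).bm)

theorem abs_Ls_mo_le (hS : S.Hyp m δ c₀ τ₀ K M) (i : ℕ) (C : ℝ) :
    ∃ N, ∀ u : Fn d, (∀ k ≤ i + 2, HB k C u) → ∀ t n x, |S.Ls i t (mo n u) x| ≤ N := by
  choose A hA using fun ι => (bm_cf hS ι).2
  refine ⟨∑ ι, A ι * S.jV i C, fun u h t n x => (abs_sum_le_sum_abs _ _).trans
    (sum_le_sum fun ι _ => ?_)⟩
  rw [abs_mul, abs_mul]
  have h1 := abs_Dl_le_of_H (h _ (S.length_jl i ι) n x)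
  calc _ ≤ A ι * (1 * S.jV i C) := by
        have h2 := S.abs_jf_le i ι
        have h3 := hA ι t x
        have h4 := h1.trans (le_jV i C ι)
        have h5 := (abs_nonneg _).trans h3
        gcongr
    _ = _ := by rw [one_mul]

end Lw

theorem Ls_sub (i : ℕ) (t : ℝ) (φ ψ : Smo d) (x : Sp d) :
    S.Ls i t (φ - ψ) x = S.Ls i t φ x - S.Ls i t ψ x := by
  simp only [Ls, map_sub, Smo.sub_apply, ← sum_sub_distrib, mul_sub]

theorem Lw_zero_ae {t : ℝ} (ht : t ∈ Icc 0 S.T) {u : Fn d} {B C : ℝ} (hu : EB B u)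
    (h : ∀ k ≤ 2, HB k C u) : S.Lw 0 t u =ᵐ[volume] S.L t u := by
  have h1 : ∀ i : Fin d, ∀ᵐ x, Tendsto (fun n => Dl [e i] (mo n u) x) atTop
      (nhds (weakDeriv [e i] u x)) := fun i => by
    have h2 : HB [e i].length C u := h 1 (by norm_num)
    filter_upwards [h2.ae_tendsto_Dl hu, h2.wd_ae_eq hu] with x hx hx'
    rwa [← hx']
  have h2 : ∀ i j : Fin d, ∀ᵐ x, Tendsto (fun n => Dl [e i, e j] (mo n u) x) atTop
      (nhds (weakDeriv [e i, e j] u x)) := fun i j => by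
    have h2 : HB [e i, e j].length C u := h 2 le_rfl
    filter_upwards [h2.ae_tendsto_Dl hu, h2.wd_ae_eq hu] with x hx hx'
    rwa [← hx']
  filter_upwards [ae_tendsto_Ls (i := 0) hu h t, ae_all_iff.2 h1,
    ae_all_iff.2 fun i => ae_all_iff.2 (h2 i), ae_tendsto_conv_rho hu.locallyIntegrable]
    with x hx hx1 hx2 hx0
  refine tendsto_nhds_unique hx ?_
  simp only [← mo_apply hu] at hx0
  have h3 := ((tendsto_finsetSum S.Λ₁ fun l _ => tendsto_finsetSum Finset.univ fun i _ =>
    tendsto_finsetSum Finset.univ fun j _ => (hx2 i j).const_mul (S.q l t x * l i * l j)).const_mul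
      (1 / 2)).add (tendsto_finsetSum S.Λ₁ fun l _ => tendsto_finsetSum Finset.univ fun i _ =>
      (hx1 i).const_mul (S.p l t x * l i)) |>.sub (hx0.const_mul (S.c t x))
  refine h3.congr fun n => ?_
  rw [Ls_eq, clamp_of_mem ht]
  congr 1
  have e1 : ∀ (l : Sp d) (φ : Smo d), D l φ x = ∑ i, l i * D (e i) φ x := by
    intro l φ
    rw [D_eq_sum, Smo.sum_apply]; rfl
  congr 1
  · rw [mul_sum]
    refine sum_congr rfl fun l _ => ?_
    have e2 : (D l)^[0 + 2] (mo n u) x = ∑ i, ∑ j, l i * (l j * D (e i) (D (e j) (mo n u)) x) := by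
      rw [Function.iterate_succ_apply', Function.iterate_one, e1]
      refine sum_congr rfl fun i _ => ?_
      rw [D_comm, e1, mul_sum]
      exact sum_congr rfl fun j _ => by rw [D_comm]
    rw [e2]
    simp only [mul_sum]
    refine sum_congr rfl fun i _ => sum_congr rfl fun j _ => ?_
    rw [show Dl [e i, e j] (mo n u) x = D (e i) (D (e j) (mo n u)) x from rfl]
    push_cast
    ring
  · refine sum_congr rfl fun l _ => ?_
    rw [zero_add, Function.iterate_one, e1]
    simp only [mul_sum]
    refine sum_congr rfl fun i _ => ?_
    rw [show Dl [e i] (mo n u) x = D (e i) (mo n u) x from rfl]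
    push_cast
    ring

theorem Lw_ae {t : ℝ} (ht : t ∈ Icc 0 S.T) {i : ℕ} (hi : i ≠ 0) {u : Fn d} {B C : ℝ}
    (hu : EB B u) (h : ∀ k ≤ i + 2, HB k C u) : S.Lw i t u =ᵐ[volume] S.Li i t u := by
  have h1 : ∀ᵐ x, ∀ ι : S.Ix, wd (S.jl i ι) u x = weakDeriv (S.jl i ι) u x :=
    ae_all_iff.2 fun ι => (h _ (S.length_jl i ι)).wd_ae_eq hu
  filter_upwards [h1] with x hx
  rw [Lw, Li, Fintype.sum_sum_type, Fintype.sum_sum_type, mul_sum, mul_sum,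
    ← sum_coe_sort S.Λ₁, ← sum_coe_sort S.Λ₁]
  simp only [hx]
  simp only [cf, jf, jl, clamp_of_mem ht, if_neg hi, zero_mul, mul_zero, Finset.sum_const_zero,
    add_zero]
  congr 1 <;> exact sum_congr rfl fun l _ => by ring

end Data

/-! ### Equations in the sense of generalized functions -/

theorem WeakEq.congr {T : ℝ} {g : Fn d} {R R' u : TFn d} (h : WeakEq T g R u)
    (hR : ∀ t ∈ Icc 0 T, R t =ᵐ[volume] R' t) : WeakEq T g R' u := by
  intro t ht φ hφ
  rw [h t ht φ hφ]
  congr 1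
  refine intervalIntegral.integral_congr fun s hs => ?_
  rw [uIcc_of_le ht.1] at hs
  refine integral_congr_ae ?_
  filter_upwards [hR s ⟨hs.1, hs.2.trans ht.2⟩] with x hx
  rw [hx]

/-- Mollifications of solutions. -/
theorem WeakEq.mo {T : ℝ} {g : Fn d} {R u : TFn d} {B B' B'' : ℝ} (h : WeakEq T g R u)
    (hg : EB B g) (hR : ∀ t, EB B' (R t)) (hu : ∀ t ∈ Icc 0 T, EB B'' (u t)) (n : ℕ) :
    ∀ t ∈ Icc 0 T, ∀ x, mo n (u t) x = mo n g x + ∫ s in 0..t, mo n (R s) x := by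
  intro t ht x
  have h1 := h t ht _ (isTest_of (hasCompactSupport_refl x (hasCompactSupport_rho n)))
  simp only [refl_apply] at h1
  simp only [mo_apply hg, mo_apply (hu t ht), mo_apply (hR _), conv_swap]
  exact h1

theorem integral_swap {θ : Fn d} (hθ : Integrable θ volume) {R : TFn d} (hR : BM R) {t : ℝ}
    (ht : 0 ≤ t) : ∫ x, θ x * ∫ s in 0..t, R s x = ∫ s in 0..t, ∫ x, θ x * R s x := by
  obtain ⟨C, hC⟩ := hR.2
  have h1 : Integrable (uncurry fun (x : Sp d) (s : ℝ) => θ x * R s x)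
      (volume.prod (volume.restrict (Ioc 0 t))) := by
    have h2 : Integrable (fun z : Sp d × ℝ => θ z.1) (volume.prod (volume.restrict (Ioc 0 t))) :=
      hθ.comp_fst _
    refine (h2.bdd_mul (c := C) (f := fun z : Sp d × ℝ => R z.2 z.1)
      (hR.1.comp measurable_swap).aestronglyMeasurable (ae_of_all _ fun z => hC _ _)).congr ?_
    exact ae_of_all _ fun z => mul_comm _ _
  simp only [intervalIntegral.integral_of_le ht, ← integral_const_mul]
  exact integral_integral_swap h1

/-- Limits of approximate solutions are solutions. -/
theorem weakEq_of_tendsto {T B : ℝ} {g : Fn d} {R u : TFn d}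
    {gn : ℕ → Fn d} {Rn un : ℕ → TFn d} {ε : ℕ → ℝ}
    (hgn : ∀ n, EB B (gn n)) (hRn : ∀ n, BM (Rn n)) (hRB : ∀ n t x, |Rn n t x| ≤ B)
    (hun : ∀ n, ∀ t ∈ Icc 0 T, EB B (un n t))
    (hg : ∀ᵐ x, Tendsto (fun n => gn n x) atTop (nhds (g x)))
    (hu : ∀ t ∈ Icc 0 T, ∀ᵐ x, Tendsto (fun n => un n t x) atTop (nhds (u t x)))
    (hR : ∀ t ∈ Icc 0 T, ∀ᵐ x, Tendsto (fun n => Rn n t x) atTop (nhds (R t x)))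
    (hε : Tendsto ε atTop (nhds 0))
    (h : ∀ n, ∀ t ∈ Icc 0 T, ∀ x, |un n t x - gn n x - ∫ s in 0..t, Rn n s x| ≤ ε n) :
    WeakEq T g R u := by
  intro t ht φ hφ
  obtain ⟨θ, hθc, rfl⟩ := hφ.lift
  have hθ : Integrable θ (volume : Measure (Sp d)) := integrable_of_hasCompactSupport hθc
  have key : ∀ (f : ℕ → Fn d) (f₀ : Fn d), (∀ n, EB B (f n)) →
      (∀ᵐ x, Tendsto (fun n => f n x) atTop (nhds (f₀ x))) →
      Tendsto (fun n => ∫ x, θ x * f n x) atTop (nhds (∫ x, θ x * f₀ x)) := by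
    intro f f₀ hf hlim
    refine tendsto_integral_of_dominated_convergence (fun x => |θ x| * B)
      (fun n => ((hf n).integrable_mul hθ).aestronglyMeasurable) (hθ.abs.mul_const B) (fun n => ?_) ?_
    · filter_upwards [(hf n).2] with x hx
      rw [norm_mul, Real.norm_eq_abs, Real.norm_eq_abs]
      gcongr
    · filter_upwards [hlim] with x hx
      exact hx.const_mul _
  have k1 := key _ _ (fun n => hun n t ht) (hu t ht)
  have k2 := key _ _ hgn hg
  have hRE : ∀ n s, EB B (Rn n s) := fun n s => EB.of_bound ((hRn n).measurable_space s) (hRB n s)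
  have k3 : Tendsto (fun n => ∫ s in 0..t, ∫ x, θ x * Rn n s x) atTop
      (nhds (∫ s in 0..t, ∫ x, θ x * R s x)) := by
    refine intervalIntegral.tendsto_integral_filter_of_dominated_convergence
      (fun _ => ∫ x, |θ x| * B) (.of_forall fun n => ?_)
      (.of_forall fun n => ae_of_all _ fun s _ => ?_) (by simp)
      (ae_of_all _ fun s hs => ?_)
    · have h1 : Measurable fun z : ℝ × Sp d => θ z.2 * Rn n z.1 z.2 :=
        ((Smo.continuous θ).measurable.comp measurable_snd).mul (hRn n).1
      exact h1.stronglyMeasurable.integral_prod_right.aestronglyMeasurable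
    · refine norm_integral_le_of_norm_le (hθ.abs.mul_const B) ?_
      filter_upwards [(hRE n s).2] with x hx
      rw [norm_mul, Real.norm_eq_abs, Real.norm_eq_abs]
      gcongr
    · rw [uIoc_of_le ht.1] at hs
      exact key _ _ (fun n => hRE n s) (hR s ⟨hs.1.le, hs.2.trans ht.2⟩)
  have k4 : Tendsto (fun n => (∫ x, θ x * un n t x) - (∫ x, θ x * gn n x)
      - ∫ s in 0..t, ∫ x, θ x * Rn n s x) atTop (nhds 0) := by
    refine squeeze_zero_norm (a := fun n => (∫ x, |θ x|) * ε n) (fun n => ?_)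
      (by simpa using hε.const_mul (∫ x, |θ x|))
    rw [← integral_swap hθ (hRn n) ht.1]
    have hI : Integrable (fun x => θ x * ∫ s in 0..t, Rn n s x) (volume : Measure (Sp d)) := by
      have h1 := (hRn n).primitive (ht.1.trans ht.2)
      obtain ⟨C, hC⟩ := h1.eb
      have h2 := (hC t).integrable_mul hθ
      have h3 : max 0 (min T t) = t := clamp_of_mem ht
      simpa only [h3] using h2
    have hI2 : Integrable (fun x => θ x * un n t x - θ x * gn n x) (volume : Measure (Sp d)) :=
      ((hun n t ht).integrable_mul hθ).sub ((hgn n).integrable_mul hθ)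
    rw [← integral_sub ((hun n t ht).integrable_mul hθ) ((hgn n).integrable_mul hθ),
      ← integral_sub hI2 hI,
      ← integral_mul_const]
    refine norm_integral_le_of_norm_le (hθ.abs.mul_const _) (ae_of_all _ fun x => ?_)
    have h1 := h n t ht x
    rw [show θ x * un n t x - θ x * gn n x - θ x * ∫ s in 0..t, Rn n s x =
      θ x * (un n t x - gn n x - ∫ s in 0..t, Rn n s x) by ring, norm_mul, Real.norm_eq_abs,
      Real.norm_eq_abs]
    gcongr
  have := tendsto_nhds_unique k4 ((k1.sub k2).sub k3)
  linarith

/-! ### Mollification of approximate equations -/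

theorem H_mo_le (n k : ℕ) (B : ℝ) :
    ∃ C, ∀ u : Fn d, EB B u → ∀ x, H k (mo n u) x ≤ C := by
  refine ⟨∑ w : Wd (Finset.univ : Finset (Fin d)) k, ((∫ y, |Dl (wl k w) (rho d n) y|) * B) ^ 2,
    fun u hu x => ?_⟩
  rw [H_eq_sum_Dl]
  refine sum_le_sum fun w _ => ?_
  rw [Dl_mo hu, ← sq_abs]
  have := abs_conv_le hu (integrable_of_hasCompactSupport
    (hasCompactSupport_Dl (hasCompactSupport_rho (d := d) n) (wl k w))) x
  gcongr

theorem mo_integral {T : ℝ} {g : Fn d} {R u : TFn d} {B B' : ℝ} (hg : EB B g) (hR : BM R)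
    (hu : ∀ t, EB B' (u t))
    (h : ∀ t ∈ Icc 0 T, ∀ x, u t x = g x + ∫ s in 0..t, R s x) (n : ℕ) :
    ∀ t ∈ Icc 0 T, ∀ x, mo n (u t) x = mo n g x + ∫ s in 0..t, mo n (R s) x := by
  intro t ht x
  obtain ⟨C, hC⟩ := hR.eb
  have hθ : Integrable (refl x (rho d n)) (volume : Measure (Sp d)) :=
    integrable_of_hasCompactSupport (hasCompactSupport_refl x (hasCompactSupport_rho n))
  simp only [mo_apply hg, mo_apply (hu t), mo_apply (hC _), conv_swap, h t ht]
  have h1 := integral_swap hθ hR ht.1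
  simp only [refl_apply] at h1
  rw [← h1]
  simp only [mul_add]
  refine integral_add ?_ ?_
  · exact (hg.integrable_mul hθ)
  · obtain ⟨C', hC'⟩ := (hR.primitive (ht.1.trans ht.2)).eb
    have h2 := (hC' t).integrable_mul hθ
    have h3 : max 0 (min T t) = t := clamp_of_mem ht
    simp only [h3] at h2
    exact h2

theorem abs_mo_sub_mo_le {F G : Fn d} {B B' a : ℝ} (hF : EB B F) (hG : EB B' G)
    (h : ∀ᵐ x, |F x - G x| ≤ a) (n : ℕ) (x : Sp d) : |mo n F x - mo n G x| ≤ a := by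
  have h1 : IsAvg n x (fun z => F z - G z) (mo n F x - mo n G x) :=
    (IsAvg.of_eb hF).sub (IsAvg.of_eb hG)
  rw [abs_le, neg_le]
  constructor
  · have h2 := (h1.const_mul (-1)).le (IsAvg.const a)
      (by filter_upwards [h] with z hz; linarith [(abs_le.1 hz).1])
    linarith
  · exact h1.le (IsAvg.const a) (by filter_upwards [h] with z hz using (abs_le.1 hz).2)

theorem Smo.abs_mo_sub_le {φ : Smo d} {C : ℝ} (h : ∀ x, H 1 φ x ≤ C) (n : ℕ) (x : Sp d) :
    |mo n φ x - φ x| ≤ √C * eps n := by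
  obtain ⟨B, hB⟩ := Smo.eb φ
  have := (Smo.hb h).abs_mo_sub_rp_le hB n x
  rwa [rp_of_continuous hB (Smo.continuous φ)] at this

/-- Mollification on bounded smooth functions. -/
def moL (n : ℕ) : Smo d →ₗ[ℝ] Smo d where
  toFun φ := mo n φ
  map_add' φ ψ := by
    obtain ⟨B, hB⟩ := Smo.eb φ
    obtain ⟨B', hB'⟩ := Smo.eb ψ
    exact mo_add hB hB' n
  map_smul' a φ := by
    obtain ⟨B, hB⟩ := Smo.eb φ
    exact mo_const_mul hB a n

theorem moL_apply (n : ℕ) (φ : Smo d) : moL n φ = mo n φ := rfl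

theorem moL_Tr (n : ℕ) (y : Sp d) (φ : Smo d) : moL n (Tr y φ) = Tr y (moL n φ) := by
  obtain ⟨B, hB⟩ := Smo.eb φ
  exact (mo_comp_add hB y n).2

theorem moL_D (n : ℕ) (v : Sp d) (φ : Smo d) : moL n (D v φ) = D v (moL n φ) :=
  (Dl_mo_smo [v] φ n).symm

namespace Data

variable (S : Data d)

/-- Difference operators corresponding to the terms of `𝓛`. -/
def jd (h : ℝ) : S.Ix → Smo d →ₗ[ℝ] Smo d
  | .inl (.inl l) => (h ^ 2)⁻¹ • (Tr (h • (l : Sp d)) - LinearMap.id - h • D (l : Sp d))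
  | .inl (.inr l) => dl h l
  | .inr _ => LinearMap.id

theorem mo_jd (h : ℝ) (ι : S.Ix) (n : ℕ) (φ : Smo d) : mo n (S.jd h ι φ) = S.jd h ι (mo n φ) := by
  simp only [← moL_apply]
  rcases ι with (l | l) | _
  · simp only [jd, LinearMap.smul_apply, LinearMap.sub_apply, LinearMap.id_apply, map_smul, map_sub,
      moL_Tr, moL_D]
  · simp only [jd, dl, LinearMap.smul_apply, LinearMap.sub_apply, LinearMap.id_apply, map_smul,
      map_sub, moL_Tr]
  · rfl

/-- A bound for difference quotients. -/
def jB : ℝ := S.abs ^ 2 + S.abs + 1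

variable {S}

theorem abs_jd_le {h D : ℝ} (hh : 0 < h) {φ : Smo d} (hφ : ∀ k ≤ 2, ∀ x, H k φ x ≤ D) (ι : S.Ix)
    (x : Sp d) : |S.jd h ι φ x| ≤ S.jB * √D := by
  have ha : 0 ≤ S.abs := Real.sqrt_nonneg _
  have hs : 0 ≤ √D := Real.sqrt_nonneg _
  rcases ι with (l | l) | _
  · obtain ⟨y, hy⟩ := taylor_lagrange φ x (h • (l : Sp d)) 1
    have h1 : S.jd h (.inl (.inl l)) φ x = (FDScheme.D (l : Sp d))^[2] φ y / 2 := by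
      simp only [jd, LinearMap.smul_apply, LinearMap.sub_apply, LinearMap.id_apply, Smo.smul_apply,
        Smo.sub_apply, Tr_apply]
      rw [hy]
      simp only [sum_range_succ, Finset.sum_range_zero, iterate_D_smul, Smo.smul_apply]
      simp
      field_simp
      ring
    rw [h1, abs_div, abs_two]
    have h2 := abs_iterate_D_le (hφ 2 le_rfl y) (l : Sp d)
    have h3 := norm_le_abs l.2
    calc _ ≤ |(FDScheme.D (l : Sp d))^[2] φ y| := div_le_self (abs_nonneg _) (by norm_num)
      _ ≤ S.abs ^ 2 * √D := h2.trans (by gcongr)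
      _ ≤ _ := by rw [jB]; gcongr; linarith
  · have h1 := dl_sq_le φ (hφ 1 (by norm_num)) h l x
    have h2 := Real.abs_le_sqrt h1
    rw [Real.sqrt_mul (sq_nonneg _), Real.sqrt_sq (norm_nonneg _)] at h2
    have h3 := norm_le_abs l.2
    calc _ ≤ S.abs * √D := h2.trans (by gcongr)
      _ ≤ _ := by rw [jB]; gcongr; nlinarith
  · have h1 := Real.abs_le_sqrt (hφ 0 (by norm_num) x)
    calc _ ≤ 1 * √D := by rw [one_mul]; exact h1
      _ ≤ _ := by rw [jB]; gcongr; nlinarith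

theorem sum_jd {h : ℝ} (hh : h ≠ 0) (b : S.Ix → ℝ) (hb : ∑ l : S.Λ₁, b (.inl (.inl l)) • (l : Sp d) = 0)
    (φ : Smo d) (x : Sp d) : ∑ ι, b ι * S.jd h ι φ x = ∑ l : S.Λ₁,
      (b (.inl (.inl l)) / h ^ 2 + b (.inl (.inr l)) / h) * (φ (x + h • (l : Sp d)) - φ x)
      + b (.inr ()) * φ x := by
  have h1 : ∑ l : S.Λ₁, b (.inl (.inl l)) * D (l : Sp d) φ x = 0 := by
    have : ∑ l : S.Λ₁, b (.inl (.inl l)) * D (l : Sp d) φ x =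
        D (∑ l : S.Λ₁, b (.inl (.inl l)) • (l : Sp d)) φ x := by
      simp only [D_apply, map_sum, map_smul, smul_eq_mul]
    rw [this, hb]; simp [D_apply]
  rw [Fintype.sum_sum_type, Fintype.sum_sum_type, ← sum_add_distrib]
  congr 1
  · simp only [jd, LinearMap.smul_apply, LinearMap.sub_apply, LinearMap.id_apply, Smo.smul_apply,
        Smo.sub_apply, Tr_apply, dl_apply]
    rw [← sub_eq_zero, ← sum_sub_distrib, ← mul_zero (-h⁻¹), ← h1, mul_sum]
    refine sum_congr rfl fun l _ => ?_
    field_simp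
    ring
  · simp [jd]

variable {m : ℕ} {δ c₀ τ₀ K : ℝ} {M : Fin (m + 1) → ℝ}

theorem fdo_eq_sum_jd (hS : S.Hyp m δ c₀ τ₀ K M) {h : ℝ} (hh : h ≠ 0) (t : ℝ) (φ : Smo d)
    (x : Sp d) : fdo S.Λ₁ h (S.fc h) (fun t => S.c (clamp S.T t)) t φ x =
      ∑ ι, S.cf t ι x * S.jd h ι φ x := by
  rw [sum_jd hh]
  · rw [fdo, ← sum_coe_sort S.Λ₁, sub_eq_add_neg, ← neg_mul]; rfl
  · have := hS.centered _ (clamp_mem S.T_pos.le t) x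
    rw [← sum_coe_sort S.Λ₁] at this
    exact this

variable (S) in
/-- The mollified coefficients of the finite difference operator. -/
def fcS (j : ℕ) (h : ℝ) (l : Sp d) (t : ℝ) (x : Sp d) : ℝ :=
  (S.coS j t).q l x / h ^ 2 + (S.coS j t).p l x / h

theorem Lop_eq_fdo {h : ℝ} (hh : h ≠ 0) (j : ℕ) (t : ℝ) (φ : Smo d) (x : Sp d) :
    (S.geo τ₀ h).Lop (S.coS j t) φ x =
      fdo S.Λ₁ h (S.fcS j h) (fun t => (S.coS j t).c) t φ x := by
  rw [Geo.Lop_eq _ (show (S.geo τ₀ h).h ≠ 0 from hh), fdo, Geo.L0]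
  congr 1
  refine sum_congr rfl fun l _ => ?_
  rw [fcS]
  simp only [geo]
  field_simp

theorem Lop_eq_sum_jd (hS : S.Hyp m δ c₀ τ₀ K M) {h : ℝ} (hh : h ∈ Ioc 0 S.h₀) (j : ℕ) {t : ℝ} (ht : t ∈ Icc 0 S.T)
    (φ : Smo d) (x : Sp d) : (S.geo τ₀ h).Lop (S.coS j t) φ x =
      ∑ ι, mo j (S.cf t ι) x * S.jd h ι φ x := by
  have hsn := snap hS hh j ht
  rw [sum_jd hh.1.ne', Lop_eq_fdo hh.1.ne', fdo, ← sum_coe_sort S.Λ₁, sub_eq_add_neg, ← neg_mul]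
  · congr 2
    obtain ⟨B, hB⟩ := hS.smooth.c_mem.eb
    have h1 : mo j (fun x => -1 * S.c (clamp S.T t) x) = (-1 : ℝ) • mo j (S.c (clamp S.T t)) :=
      mo_const_mul (hB _ (clamp_mem S.T_pos.le t)) _ _
    simp only [neg_mul, one_mul] at h1
    simp only [cf, h1]
    simp [coS]
  · have h2 := hsn.cent_word 0 () x
    rw [← sum_coe_sort] at h2
    exact h2

/-- Mollification almost commutes with the mollified finite difference operators. -/
theorem mo_Lop_sub_le (hS : S.Hyp m δ c₀ τ₀ K M) (D : ℝ) : ∃ N, 0 ≤ N ∧ ∃ Nn : ℕ → ℝ, ∀ n j : ℕ, ∀ h ∈ Ioc 0 S.h₀,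
    ∀ t ∈ Icc 0 S.T, ∀ φ : Smo d, (∀ k ≤ 2, ∀ x, H k φ x ≤ D) → ∀ x,
      |mo n ((S.geo τ₀ h).Lop (S.coS j t) φ) x - S.Ls 0 t (mo n φ) x| ≤
        N * eps n + N * eps j + Nn n * h := by
  obtain ⟨A, hA0, hA⟩ := cf_lip hS
  choose C hC using fun n => H_mo_le (d := d) n 3 (√D)
  set V := S.jB * √D with hV
  set N := Fintype.card S.Ix * (A * V) with hN
  have hV0 : 0 ≤ V := by
    have ha : 0 ≤ S.abs := Real.sqrt_nonneg _
    rw [hV, jB]; positivity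
  have hN0 : 0 ≤ N := by positivity
  refine ⟨N, hN0, fun n => √(MM m M 0) * (S.abs ^ 3 + S.abs ^ 2)
    * √(max D (C n)), fun n j h hh t ht φ hφ x => ?_⟩
  have hjd : ∀ ι, EB V (S.jd h ι φ) := fun ι =>
    EB.of_bound (Smo.continuous _).measurable (abs_jd_le hh.1 hφ ι)
  choose Bc hBc using eb_cf hS t
  have h1 : |mo n ((S.geo τ₀ h).Lop (S.coS j t) φ) x
      - mo n (fun y => ∑ ι, S.cf t ι y * S.jd h ι φ y) x| ≤ N * eps j := by
    obtain ⟨B, hB⟩ := Smo.eb ((S.geo τ₀ h).Lop (S.coS j t) φ)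
    have h2 : IsAvg n x (fun y => ∑ ι, S.cf t ι y * S.jd h ι φ y) _ :=
      IsAvg.sum _ fun ι _ => IsAvg.of_eb ((hBc ι).mul (hjd ι))
    obtain ⟨B', hB'⟩ := h2.1
    refine abs_mo_sub_mo_le hB hB' (ae_of_all _ fun y => ?_) n x
    rw [Lop_eq_sum_jd hS hh j ht, ← sum_sub_distrib]
    refine (abs_sum_le_sum_abs _ _).trans ?_
    have h3 : ∀ ι, |mo j (S.cf t ι) y * S.jd h ι φ y - S.cf t ι y * S.jd h ι φ y| ≤
        (A * eps j) * V := by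
      intro ι
      rw [← sub_mul, abs_mul]
      have h4 : |mo j (S.cf t ι) y - S.cf t ι y| ≤ A * eps j := by
        rw [mo_apply (hBc ι)]
        refine abs_conv_rho_sub_le (hBc ι) (ae_of_all _ fun z hz => ?_)
        refine (hA ι t _ _).trans ?_
        rw [sub_sub_cancel_left, norm_neg]
        gcongr
      exact mul_le_mul h4 (abs_jd_le hh.1 hφ ι y) (abs_nonneg _)
        (mul_nonneg hA0 (eps_pos j).le)
    refine (sum_le_sum fun ι _ => h3 ι).trans (le_of_eq ?_)
    rw [hN, sum_const, Finset.card_univ, nsmul_eq_mul]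
    ring
  have h2 := mo_pair_sub_le hA0 (fun ι => hA ι t) (eb_cf hS t) hjd n x
  simp only [mo_jd] at h2
  rw [← fdo_eq_sum_jd hS hh.1.ne'] at h2
  have hφE : EB (√D) φ := EB.of_bound (Smo.continuous φ).measurable fun y =>
    Real.abs_le_sqrt (hφ 0 (by norm_num) y)
  have h3 := abs_fdo_sub_le hS hh.1 0 (mo n φ) (C := max D (C n))
    (fun y => (Smo.hb (hφ 2 le_rfl) n y).trans (le_max_left _ _))
    (fun y => (hC n φ hφE y).trans (le_max_right _ _)) t x
  simp only [zero_add, Finset.range_one, sum_singleton, pow_zero, Nat.factorial_zero,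
    Nat.cast_one, div_one, one_mul, pow_one] at h3
  rw [← hN] at h2
  rw [abs_le] at h1 h2 h3 ⊢
  constructor <;> linarith [h1.1, h1.2, h2.1, h2.2, h3.1, h3.2]

/-! ### Smooth solutions of finite difference equations with mollified data -/

theorem regT_q (hS : S.Hyp m δ c₀ τ₀ K M) (j : ℕ) : ∀ l ∈ S.Λ₁, RegT fun t => (S.coS j t).q l :=
  fun l hl => regT_mo ((hS.smooth.q_mem l hl).bm S.T_pos.le) j

theorem regT_p (hS : S.Hyp m δ c₀ τ₀ K M) (j : ℕ) : ∀ l ∈ S.Λ₁, RegT fun t => (S.coS j t).p l :=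
  fun l hl => regT_mo ((hS.smooth.p_mem l hl).bm S.T_pos.le) j

theorem regT_c (hS : S.Hyp m δ c₀ τ₀ K M) (j : ℕ) : RegT fun t => (S.coS j t).c :=
  regT_mo (hS.smooth.c_mem.bm S.T_pos.le) j

theorem coS_clamp (j : ℕ) (t : ℝ) : S.coS j t = S.coS j (clamp S.T t) := by
  simp only [coS, clamp_of_mem (clamp_mem S.T_pos.le t)]

theorem regT_fcS (hS : S.Hyp m δ c₀ τ₀ K M) (j : ℕ) (h : ℝ) :
    ∀ l ∈ S.Λ₁, ∀ n, SmT n (S.fcS j h l) := by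
  intro l hl n
  have h1 := (((regT_q hS j l hl).smul (h ^ 2)⁻¹).add ((regT_p hS j l hl).smul h⁻¹)) n
  have h2 : S.fcS j h l = fun t x => ((h ^ 2)⁻¹ • (S.coS j t).q l + h⁻¹ • (S.coS j t).p l : Smo d) x := by
    funext t x
    simp only [fcS, Smo.add_apply, Smo.smul_apply]
    ring
  rw [h2]
  exact h1

theorem exists_fd_smooth (hS : S.Hyp m δ c₀ τ₀ K M) {h : ℝ} (hh : h ∈ Ioc 0 S.h₀) (j : ℕ) {f : TFn d}
    {g : Fn d} (hf : BM f) (hg : BM fun _ => g) : ∃ U : ℝ → Smo d,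
      IntT S.T U (fun t => (S.geo τ₀ h).Lop (S.coS j t) (U t) + mo j (f t)) ∧ U 0 = mo j g ∧
      ∀ t, U t = U (clamp S.T t) := by
  have hT := S.T_pos.le
  have haS := regT_fcS hS j h
  have hcS := regT_c hS j
  have hfS := regT_mo hf j
  have hgS := regT_mo hg j
  obtain ⟨u, hu, hu'⟩ := exists_fd_solution (h := h) hT (fun l hl => (haS l hl 0).lip.1) hcS.bm hfS.bm
    hgS.bm
  have hsol : FDSol S.Λ₁ h S.T (S.fcS j h) (fun t => (S.coS j t).c) (fun t => mo j (f t)) (mo j g) u :=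
    ⟨hu, hu'⟩
  have hsn := fun t => snap hS hh j (clamp_mem hT t)
  have h0 : ∀ l ∈ S.Λ₁, ∀ t x, 0 ≤ S.fcS j h l t x := by
    intro l hl t x
    have h1 := (hsn t).chi l hl x
    rw [← coS_clamp] at h1
    have h2 : S.fcS j h l t x = ((S.coS j t).q l x + h * (S.coS j t).p l x) / h ^ 2 := by
      have := hh.1.ne'
      rw [fcS]; field_simp
    rw [h2]
    exact div_nonneg h1 (by positivity)
  have h1 : ∀ t x, c₀ ≤ (S.coS j t).c x := by
    intro t x
    have h1 := (hsn t).c_ge x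
    rwa [← coS_clamp] at h1
  obtain ⟨U, hU, hUu⟩ := RegT.lift fun n => hsol.smooth hT hS.hc₀ h0 h1 n (fun l hl => haS l hl n)
    (hcS n) (hfS n) (hgS n)
  have hUu' : ∀ t, (U t : Fn d) = u t := fun t => funext (hUu t)
  refine ⟨U, ⟨hU, ?_, ?_⟩, ?_, fun t => ?_⟩
  · have hs : ∀ b : Sp d → ℝ → Smo d, (∀ l ∈ S.Λ₁, RegT (b l)) →
        RegT fun t => ∑ l ∈ S.Λ₁, b l t * dl h l (U t) :=
      fun b hb => RegT.sum _ fun l hl => (hb l hl).mul (hU.dl h l)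
    exact ((((hs _ (regT_q hS j)).smul h⁻¹).add (hs _ (regT_p hS j))).add (hcS.mul hU).neg).add hfS
  · intro t ht x
    have h2 := hsol.2 t x
    have h3 := hsol.2 0 x
    rw [clamp_of_mem ht] at h2
    rw [clamp_of_mem ⟨le_rfl, hT⟩, intervalIntegral.integral_same, add_zero] at h3
    simp only [hUu, Smo.add_apply, Lop_eq_fdo hh.1.ne']
    rw [h2, h3]
    simp only [hUu']
  · ext x
    have h3 := hsol.2 0 x
    rwa [clamp_of_mem ⟨le_rfl, hT⟩, intervalIntegral.integral_same, add_zero, ← hUu] at h3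
  · ext x
    rw [hUu, hUu, hsol.clamp_eq hT]

end Data

/-- The uniform estimate for finite difference equations with mollified data. -/
theorem fd_bound (m : ℕ) {δ c₀ τ₀ K : ℝ} (hδ : δ ∈ Ioc (0 : ℝ) 1) (hc₀ : 0 < c₀)
    (hτ₀ : 0 < τ₀) (hK : 0 ≤ K) (M : Fin (m + 1) → ℝ) (absΛ nrmΛ : ℝ) :
    ∃ C, 0 ≤ C ∧ ∀ (d : ℕ) (S : Data d), S.abs = absΛ → S.nrm = nrmΛ →
      S.Hyp m δ c₀ τ₀ K M → ∀ n ≤ m, ∀ h ∈ Ioc 0 S.h₀, ∀ (j : ℕ) (f : TFn d)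
      (g : Fn d) (F : ℝ), BM f → (BM fun _ => g) → 0 ≤ F →
      (∀ t ∈ Icc 0 S.T, ∀ k ≤ n, HB k F (f t)) → (∀ k ≤ n, HB k F g) → ∃ U : ℝ → Smo d,
        IntT S.T U (fun t => (S.geo τ₀ h).Lop (S.coS j t) (U t) + mo j (f t)) ∧ U 0 = mo j g ∧
        ∀ t, ∀ k ≤ n, ∀ x, H k (U t) x ≤ C * F := by
  set A := nrmΛ ^ 2 + τ₀ ^ 2 with hA
  have hap := fun n : Fin (m + 1) => apriori m (A := A) (L := absΛ ^ 2) (τ₀ := τ₀) (Data.MM m M) hδ.1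
    hδ.2 hK hc₀ n (Nat.lt_succ_iff.1 n.2)
  choose C hC0 hC using hap
  set Am := ∑ k ∈ Finset.range (m + 1), A ^ k with hAm
  set Tm := ∑ k ∈ Finset.range (m + 1), (τ₀ ^ 2)⁻¹ ^ k with hTm
  have hA0 : 0 ≤ A := by positivity
  have hAm0 : 0 ≤ Am := by positivity
  have hTm0 : 0 ≤ Tm := by positivity
  have hCs0 : 0 ≤ ∑ n, C n := sum_nonneg fun n _ => hC0 n
  refine ⟨Tm * ((∑ n, C n) * Am), by positivity, ?_⟩
  rintro d S rfl rfl hS n hn h hh j f g F hf hg hF hfF hgF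
  obtain ⟨U, hU, hU0, hUc⟩ := Data.exists_fd_smooth hS hh j hf hg
  have hsn := fun t (ht : t ∈ Icc 0 S.T) => Data.snap hS hh j ht
  obtain ⟨κ, hκ⟩ : ∃ κ, ∀ t x, ∑ l ∈ S.Λ₁, ((S.coS j t).q l x + h * (S.coS j t).p l x) / h ^ 2
      + 2 * (S.coS j t).c x ≤ κ := by
    obtain ⟨κ, hκ⟩ := BM.exists_bound_coef (Λ₁ := S.Λ₁)
      (a := fun l t x => (S.coS j t).q l x * (h ^ 2)⁻¹ + (S.coS j t).p l x * h⁻¹)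
      (c := fun t x => 2 * (S.coS j t).c x)
      (fun l hl => ((Data.regT_q hS j l hl).bm.mul (BM.const _)).add
        ((Data.regT_p hS j l hl).bm.mul (BM.const _)))
      ((BM.const 2).mul (Data.regT_c hS j).bm)
    refine ⟨κ, fun t x => le_trans (le_of_eq ?_) (hκ t x)⟩
    congr 1
    refine sum_congr rfl fun l _ => ?_
    have := hh.1.ne'
    field_simp
  have hWle : ∀ (φ : Smo d) (k : ℕ), k ≤ n → (∀ x, H k φ x ≤ F) → ∀ x,
      (S.geo τ₀ h).W k φ x ≤ Am * F := by
    intro φ k hk hφ x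
    have h1 := (S.geo τ₀ h).sum_W_le (hsn 0 ⟨le_rfl, S.T_pos.le⟩).nrm k (fun _ : Unit => φ) (C := F)
      (fun y => by simpa using hφ y) x
    simp only [Finset.univ_unique, sum_const, Finset.card_singleton, one_smul] at h1
    refine h1.trans ?_
    gcongr
    exact single_le_sum (f := fun k => A ^ k) (fun k _ => pow_nonneg hA0 k)
      (Finset.mem_range.2 (by omega))
  obtain ⟨V, G, -, -, -, -, -, -, hW⟩ := hC ⟨n, by omega⟩ d (S.geo τ₀ h) (S.coS j) S.T κ (Am * F) U
    (fun t => mo j (f t)) rfl S.T_pos.le hsn (fun t _ x => hκ t x) (regT_mo hf j) hU (mul_nonneg hAm0 hF)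
    (fun k hk t ht x => hWle _ k hk (hfF t ht k hk j) x)
    (fun k hk x => by rw [hU0]; exact hWle _ k hk (hgF k hk j) x)
  refine ⟨U, hU, hU0, fun t k hk x => ?_⟩
  rw [hUc]
  have ht := clamp_mem S.T_pos.le t
  refine ((S.geo τ₀ h).H_le_W hτ₀ k _ x).trans ?_
  have h1 := hW k hk _ ht x
  have h2 : (τ₀ ^ 2)⁻¹ ^ k ≤ Tm :=
    single_le_sum (f := fun k => (τ₀ ^ 2)⁻¹ ^ k)
      (fun k _ => pow_nonneg (inv_nonneg.2 (sq_nonneg τ₀)) k)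
      (Finset.mem_range.2 (by omega))
  have h3 : C ⟨n, by omega⟩ ≤ ∑ n, C n :=
    single_le_sum (f := C) (fun n _ => hC0 n) (Finset.mem_univ _)
  calc _ ≤ Tm * (C ⟨n, by omega⟩ * (Am * F)) := by
        have := (S.geo τ₀ h).W_nonneg k (U (clamp S.T t)) x
        exact mul_le_mul h2 h1 this hTm0
    _ ≤ Tm * ((∑ n, C n) * (Am * F)) :=
        mul_le_mul_of_nonneg_left (mul_le_mul_of_nonneg_right h3 (mul_nonneg hAm0 hF)) hTm0
    _ = _ := by ring

theorem cauchySeq_of_eps {a : ℝ} {β : ℕ → ℝ} {x : ℕ → ℝ}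
    (h : ∀ n i j, |x i - x j| ≤ a * eps n + β n * (eps i + eps j)) : CauchySeq x := by
  rw [Metric.cauchySeq_iff']
  intro ε hε
  have h1 : Tendsto (fun n => a * eps n) atTop (nhds 0) := by
    simpa using tendsto_eps.const_mul a
  obtain ⟨n, hn⟩ := (h1.eventually (gt_mem_nhds (half_pos hε))).exists
  have h2 : Tendsto (fun i => |β n| * (eps i + eps i)) atTop (nhds 0) := by
    simpa using (tendsto_eps.add tendsto_eps).const_mul |β n|
  obtain ⟨J, hJ⟩ := (h2.eventually (gt_mem_nhds (half_pos hε))).exists_forall_of_atTop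
  refine ⟨J, fun i hi => ?_⟩
  have h3 : eps i ≤ eps J := by
    unfold eps
    have : (J : ℝ) ≤ i := by exact_mod_cast hi
    gcongr
  rw [Real.dist_eq]
  calc _ ≤ a * eps n + β n * (eps i + eps J) := h n i J
    _ ≤ a * eps n + |β n| * (eps J + eps J) := by
        have := eps_pos i
        have := eps_pos J
        gcongr
        exact le_abs_self _
    _ < ε := by linarith [hJ J le_rfl]

theorem tendsto_mo_mo {v : Fn d} {B : ℝ} (hv : EB B v) (n : ℕ) (x : Sp d) :
    Tendsto (fun j => mo n (mo j v) x) atTop (nhds (mo n v x)) := by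
  refine tendsto_Dl_mo (ψ := fun j => mo j v) (B := B) (fun j =>
    EB.of_bound (Smo.continuous _).measurable (abs_mo_le hv j)) hv ?_ n [] x
  filter_upwards [ae_tendsto_conv_rho hv.locallyIntegrable] with y hy
  simpa only [mo_apply hv] using hy

theorem mo_add_smo {φ ψ : Smo d} (n : ℕ) (x : Sp d) :
    mo n (φ + ψ : Smo d) x = mo n φ x + mo n ψ x := by
  rw [← moL_apply, map_add]; rfl

theorem HB.abs_mo_zero_le {v : Fn d} {C : ℝ} (h : HB 0 C v) (n : ℕ) (x : Sp d) :
    |mo n v x| ≤ √C := Real.abs_le_sqrt (h n x)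

theorem eps_le_one (n : ℕ) : eps n ≤ 1 := by
  unfold eps
  rw [div_le_one (by positivity)]
  have : (0 : ℝ) ≤ n := by positivity
  linarith

namespace Data

/-- Solutions of `∂u/∂t = 𝓛 u + f`, `u(0,·) = g`, with bounds for the derivatives of order up to
`n`. -/
structure Sol (S : Data d) (n : ℕ) (C : ℝ) (g : Fn d) (f u : TFn d) : Prop where
  bm : BM u
  continuous : Continuous (uncurry u)
  hb : ∀ t, ∀ k ≤ n, HB k C (u t)
  eq : WeakEq S.T g (fun s x => S.Lw 0 s (u s) x + f s x) u

variable {S : Data d} {m : ℕ} {δ c₀ τ₀ K : ℝ} {M : Fin (m + 1) → ℝ}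

theorem Sol.continuous_space {n : ℕ} {C : ℝ} {g : Fn d} {f u : TFn d}
    (h : S.Sol n C g f u) (t : ℝ) : Continuous (u t) :=
  h.continuous.comp (by fun_prop : Continuous fun x : Sp d => (t, x))

/-- Uniqueness of solutions. -/
theorem Sol.unique (hS : S.Hyp m δ c₀ τ₀ K M) {n n' : ℕ} (hn : 2 ≤ n) (hn' : 2 ≤ n') {C C' B : ℝ} {g : Fn d}
    {f u v : TFn d} (hg : EB B g) (hf : BM f) (hu : S.Sol n C g f u) (hv : S.Sol n' C' g f v) :
    ∀ t ∈ Icc 0 S.T, ∀ x, u t x = v t x := by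
  have hu2 : ∀ t, ∀ k ≤ 0 + 2, HB k C (u t) := fun t k hk => hu.hb t k (by omega)
  have hv2 : ∀ t, ∀ k ≤ 0 + 2, HB k C' (v t) := fun t k hk => hv.hb t k (by omega)
  obtain ⟨Bf, hBf⟩ := hf.eb
  obtain ⟨Bu, hBu⟩ := hu.bm.eb
  obtain ⟨Bv, hBv⟩ := hv.bm.eb
  have hLu := bm_Lw hS hu.bm hu2
  have hLv := bm_Lw hS hv.bm hv2
  obtain ⟨Lu, hLuB⟩ := hLu.eb
  obtain ⟨Lv, hLvB⟩ := hLv.eb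
  obtain ⟨N, hN0, hN⟩ := mo_Lw_sub_le (S := S) hS 0 C
  obtain ⟨N', hN0', hN'⟩ := mo_Lw_sub_le (S := S) hS 0 C'
  have eu := hu.eq.mo hg (fun t => (hLuB t).add (hBf t)) (fun t _ => hBu t)
  have ev := hv.eq.mo hg (fun t => (hLvB t).add (hBf t)) (fun t _ => hBv t)
  have key : ∀ k : ℕ, ∀ t ∈ Icc 0 S.T, ∀ x,
      |mo k (u t) x - mo k (v t) x| ≤ 0 + ((N + N') * eps k) / c₀ := by
    intro k
    have hRu := regT_mo (hLu.add hf) k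
    have hRv := regT_mo (hLv.add hf) k
    refine max_principle hS (w := fun t => mo k (u t) - mo k (v t))
      (G := fun t x => mo k (fun x => S.Lw 0 t (u t) x + f t x) x
        - mo k (fun x => S.Lw 0 t (v t) x + f t x) x) (w₀ := fun _ => 0)
      ((regT_mo hu.bm k).sub (regT_mo hv.bm k)) (hRu.bm.sub hRv.bm) (fun t ht x => ?_)
      (fun x => by simp) (by have := eps_pos k; positivity) fun t ht x => ?_
    · rw [Smo.sub_apply, eu k t ht x, ev k t ht x, intervalIntegral.integral_sub
        (hRu.bm.intervalIntegrable _ _ _) (hRv.bm.intervalIntegrable _ _ _)]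
      ring
    · rw [mo_add (hLuB t) (hBf t), mo_add (hLvB t) (hBf t), Ls_sub]
      have h1 := hN (u t) Bu (hBu t) (hu2 t) t k x
      have h2 := hN' (v t) Bv (hBv t) (hv2 t) t k x
      simp only [Smo.add_apply]
      rw [abs_le] at h1 h2 ⊢
      constructor <;> linarith [h1.1, h1.2, h2.1, h2.2]
  intro t ht x
  have h1 : Tendsto (fun k => |mo k (u t) x - mo k (v t) x|) atTop
      (nhds |u t x - v t x|) := by
    simp only [mo_apply (hBu t), mo_apply (hBv t)]
    exact ((tendsto_conv_rho (hBu t) (hu.continuous_space t).continuousAt).sub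
      (tendsto_conv_rho (hBv t) (hv.continuous_space t).continuousAt)).abs
  have h2 : Tendsto (fun k => 0 + ((N + N') * eps k) / c₀) atTop (nhds 0) := by
    simpa using ((tendsto_eps.const_mul (N + N')).div_const c₀).const_add 0
  have h3 := le_of_tendsto_of_tendsto h1 h2 (.of_forall fun k => key k t ht x)
  exact sub_eq_zero.1 (abs_eq_zero.1 (le_antisymm h3 (abs_nonneg _)))

theorem h₀_eps_mem (S : Data d) (j : ℕ) : S.h₀ * eps j ∈ Ioc 0 S.h₀ :=
  ⟨mul_pos S.h₀_pos (eps_pos j), mul_le_of_le_one_right S.h₀_pos.le (eps_le_one j)⟩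

/-- The distance between the approximate solutions. -/
theorem approx_cauchy (hS : S.Hyp m δ c₀ τ₀ K M) {D F N : ℝ} {Nn : ℕ → ℝ} {f : TFn d} {g : Fn d} {B : ℝ}
    (hf : BM f) (hg : EB B g) (hfF : ∀ t ∈ Icc 0 S.T, HB 1 F (f t)) (hgF : HB 1 F g)
    (hN0 : 0 ≤ N) (hN : ∀ n j : ℕ, ∀ h ∈ Ioc 0 S.h₀,
      ∀ t ∈ Icc 0 S.T, ∀ φ : Smo d, (∀ k ≤ 2, ∀ x, H k φ x ≤ D) → ∀ x,
        |mo n ((S.geo τ₀ h).Lop (S.coS j t) φ) x - S.Ls 0 t (mo n φ) x| ≤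
          N * eps n + N * eps j + Nn n * h)
    {U : ℕ → ℝ → Smo d}
    (hU : ∀ j, IntT S.T (U j) fun t =>
      (S.geo τ₀ (S.h₀ * eps j)).Lop (S.coS j t) (U j t) + mo j (f t))
    (hU0 : ∀ j, U j 0 = mo j g) (hUD : ∀ j t, ∀ k ≤ 2, ∀ x, H k (U j t) x ≤ D) :
    ∃ (a : ℝ) (β : ℕ → ℝ), ∀ t ∈ Icc 0 S.T, ∀ x, ∀ n i j,
      |U i t x - U j t x| ≤ a * eps n + β n * (eps i + eps j) := by
  have hh := S.h₀_eps_mem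
  refine ⟨2 * √D + 2 * N / c₀, fun n => √F
    + (N + |Nn n| * S.h₀ + √F) / c₀, fun t ht x n i j => ?_⟩
  obtain ⟨Bf, hBf⟩ := hf.eb
  have hb : ∀ (v : Fn d) (B : ℝ), EB B v → HB 1 F v → ∀ y,
      |mo n (mo i v) y - mo n (mo j v) y| ≤ √F * (eps i + eps j) := by
    intro v B hv hF y
    obtain ⟨B1, hB1⟩ := Smo.eb (mo i v)
    obtain ⟨B2, hB2⟩ := Smo.eb (mo j v)
    refine abs_mo_sub_mo_le hB1 hB2 (ae_of_all _ fun z => ?_) n y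
    rw [mul_add]
    exact hF.abs_mo_sub_le hv i j z
  have hUE : ∀ j, ∃ B, ∀ t, EB B (U j t) := fun j => (hU j).1.bm.eb
  have eU : ∀ j, ∀ t ∈ Icc 0 S.T, ∀ x, mo n (U j t) x = mo n (U j 0) x + ∫ s in 0..t,
      mo n ((S.geo τ₀ (S.h₀ * eps j)).Lop (S.coS j s) (U j s) + mo j (f s) : Smo d) x := by
    intro j
    obtain ⟨B, hB⟩ := hUE j
    exact mo_integral (hB 0) (hU j).2.1.bm hB (hU j).2.2 n
  have hR := fun j => regT_mo (hU j).2.1.bm n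
  have he0 := eps_pos n
  have hei := eps_pos i
  have hej := eps_pos j
  have hNn : ∀ j, Nn n * (S.h₀ * eps j) ≤ |Nn n| * (S.h₀ * eps j) := fun j => by
    have := (hh j).1.le
    gcongr
    exact le_abs_self _
  have hs0 : 0 ≤ √F := Real.sqrt_nonneg _
  have hε : 0 ≤ 2 * N * eps n + (N + |Nn n| * S.h₀ + √F) * (eps i + eps j) := by
    have := S.h₀_pos
    positivity
  have key := max_principle hS (w := fun t => mo n (U i t) - mo n (U j t))
    (w₀ := fun x => mo n (U i 0) x - mo n (U j 0) x) (b := √F * (eps i + eps j))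
    ((regT_mo (hU i).1.bm n).sub (regT_mo (hU j).1.bm n)) ((hR i).bm.sub (hR j).bm)
    (fun t ht x => by
      rw [Smo.sub_apply, eU i t ht x, eU j t ht x, intervalIntegral.integral_sub
        ((hR i).bm.intervalIntegrable _ _ _) ((hR j).bm.intervalIntegrable _ _ _)]
      ring)
    (fun x => by rw [hU0, hU0]; exact hb g B hg hgF x) hε
    (fun t ht x => by
      rw [mo_add_smo, mo_add_smo, Ls_sub]
      have h1 := hN n i _ (hh i) t ht (U i t) (hUD i t) x
      have h2 := hN n j _ (hh j) t ht (U j t) (hUD j t) x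
      have h3 := hb (f t) Bf (hBf t) (hfF t ht) x
      have h4 := hNn i
      have h5 := hNn j
      rw [abs_le] at h1 h2 h3 ⊢
      constructor <;> nlinarith [h1.1, h1.2, h2.1, h2.2, h3.1, h3.2]) t ht x
  rw [Smo.sub_apply] at key
  have h1 := Smo.abs_mo_sub_le (hUD i t 1 (by norm_num)) n x
  have h2 := Smo.abs_mo_sub_le (hUD j t 1 (by norm_num)) n x
  have e1 : (2 * √D + 2 * N / c₀) * eps n + (√F
      + (N + |Nn n| * S.h₀ + √F) / c₀) * (eps i + eps j) = 2 * (√D * eps n)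
      + (√F * (eps i + eps j) + (2 * N * eps n
        + (N + |Nn n| * S.h₀ + √F) * (eps i + eps j)) / c₀) := by
    field_simp
    ring
  rw [e1]
  rw [abs_le] at h1 h2 key ⊢
  constructor <;> linarith [h1.1, h1.2, h2.1, h2.2, key.1, key.2]

/-- The limit of the approximate solutions satisfies the equation. -/
theorem weakEq_of_approx (hS : S.Hyp m δ c₀ τ₀ K M) {D N : ℝ} {Nn : ℕ → ℝ}
    {f u : TFn d} {g : Fn d} {B : ℝ} (hf : BM f) (hg : EB B g)
    (hN : ∀ n j : ℕ, ∀ h ∈ Ioc 0 S.h₀,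
      ∀ t ∈ Icc 0 S.T, ∀ φ : Smo d, (∀ k ≤ 2, ∀ x, H k φ x ≤ D) → ∀ x,
        |mo n ((S.geo τ₀ h).Lop (S.coS j t) φ) x - S.Ls 0 t (mo n φ) x| ≤
          N * eps n + N * eps j + Nn n * h)
    {U : ℕ → ℝ → Smo d}
    (hU : ∀ j, IntT S.T (U j) fun t =>
      (S.geo τ₀ (S.h₀ * eps j)).Lop (S.coS j t) (U j t) + mo j (f t))
    (hU0 : ∀ j, U j 0 = mo j g) (hUD : ∀ j t, ∀ k ≤ 2, ∀ x, H k (U j t) x ≤ D) (hu : BM u)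
    (huD : ∀ t, ∀ k ≤ 2, HB k D (u t))
    (hlim : ∀ t ∈ Icc 0 S.T, ∀ x, Tendsto (fun j => U j t x) atTop (nhds (u t x))) :
    WeakEq S.T g (fun s x => S.Lw 0 s (u s) x + f s x) u := by
  have hh := S.h₀_eps_mem
  obtain ⟨Bf, hBf⟩ := hf.eb
  obtain ⟨Bu, hBu⟩ := hu.eb
  obtain ⟨BL, hBL⟩ := abs_Ls_mo_le hS 0 D
  have hUE : ∀ j t, EB (√D) (U j t) := fun j t =>
    EB.of_bound (Smo.continuous _).measurable fun x => Real.abs_le_sqrt (hUD j t 0 (by norm_num) x)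
  have hUHB : ∀ j t, ∀ k ≤ 0 + 2, HB k D (U j t) := fun j t k hk => Smo.hb (hUD j t k hk)
  have hT := S.T_pos.le
  have mono : ∀ {a b : ℝ} {ψ : Fn d}, a ≤ b → EB a ψ → EB b ψ := fun hab h =>
    ⟨h.1, by filter_upwards [h.2] with x hx using hx.trans hab⟩
  have hBf0 : ∀ n t x, |mo n (f t) x| ≤ Bf := fun n t x => abs_mo_le (hBf t) n x
  have hmo : ∀ {B : ℝ} {ψ : Fn d}, EB B ψ → ∀ n, EB B (mo n ψ) := fun h n =>
    EB.of_bound (Smo.continuous _).measurable (abs_mo_le h n)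
  refine weakEq_of_tendsto (B := max B (max Bu (BL + Bf))) (gn := fun n => mo n g)
    (un := fun n t => mo n (u t)) (Rn := fun n s x => S.Ls 0 s (mo n (u s)) x + mo n (f s) x)
    (ε := fun n => S.T * (N * eps n)) (fun n => mono (le_max_left _ _) (hmo hg n))
    (fun n => (bm_Ls hS (regT_mo hu n) 0).add (regT_mo hf n).bm) (fun n t x => ?_)
    (fun n t _ => mono ((le_max_left _ _).trans (le_max_right _ _)) (hmo (hBu t) n)) ?_
    (fun t _ => ?_) (fun t _ => ?_) ?_ (fun n t ht x => ?_)
  · refine (abs_add_le _ _).trans (le_trans ?_ ((le_max_right _ _).trans (le_max_right _ _)))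
    exact add_le_add (hBL _ (huD t) t n x) (hBf0 n t x)
  · filter_upwards [ae_tendsto_conv_rho hg.locallyIntegrable] with y hy
    simpa only [mo_apply hg] using hy
  · filter_upwards [ae_tendsto_conv_rho (hBu t).locallyIntegrable] with y hy
    simpa only [mo_apply (hBu t)] using hy
  · filter_upwards [ae_tendsto_conv_rho (hBf t).locallyIntegrable, ae_tendsto_Ls (hBu t) (huD t) t]
      with y hy hy'
    simp only [← mo_apply (hBf t)] at hy
    exact hy'.add hy
  · simpa using (tendsto_eps.const_mul N).const_mul S.T
  · have hRj := fun j => regT_mo (hU j).2.1.bm n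
    have hQj : ∀ j, BM fun s x => S.Ls 0 s (mo n (U j s)) x + mo n (mo j (f s)) x := fun j =>
      (bm_Ls hS (regT_mo (hU j).1.bm n) 0).add (regT_mo (regT_mo hf j).bm n).bm
    have h1 : ∀ j, |mo n (U j t) x - mo n (mo j g) x - ∫ s in 0..t,
        (S.Ls 0 s (mo n (U j s)) x + mo n (mo j (f s)) x)| ≤
        S.T * (N * eps n + N * eps j + |Nn n| * (S.h₀ * eps j)) := by
      intro j
      have h2 := mo_integral (hUE j 0) (hU j).2.1.bm (hUE j) (hU j).2.2 n t ht x
      rw [h2, hU0, add_sub_cancel_left, ← intervalIntegral.integral_sub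
        ((hRj j).bm.intervalIntegrable _ _ _) ((hQj j).intervalIntegrable _ _ _)]
      have h0 : 0 ≤ N * eps n + N * eps j + |Nn n| * (S.h₀ * eps j) := by
        refine (abs_nonneg _).trans ((hN n j _ (hh j) 0 ⟨le_rfl, hT⟩ (U j 0) (hUD j 0) x).trans ?_)
        gcongr
        · exact (hh j).1.le
        · exact le_abs_self _
      have h3 := intervalIntegral.norm_integral_le_of_norm_le_const (a := (0 : ℝ)) (b := t)
        (f := fun s => mo n ((S.geo τ₀ (S.h₀ * eps j)).Lop (S.coS j s) (U j s) + mo j (f s) : Smo d) x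
          - (S.Ls 0 s (mo n (U j s)) x + mo n (mo j (f s)) x))
        (C := N * eps n + N * eps j + |Nn n| * (S.h₀ * eps j)) (fun s hs => by
          rw [uIoc_of_le ht.1] at hs
          have h4 := hN n j _ (hh j) s ⟨hs.1.le, hs.2.trans ht.2⟩ (U j s) (hUD j s) x
          rw [mo_add_smo, add_sub_add_right_eq_sub, Real.norm_eq_abs]
          refine h4.trans ?_
          gcongr
          · exact (hh j).1.le
          · exact le_abs_self _)
      rw [Real.norm_eq_abs, sub_zero, abs_of_nonneg ht.1] at h3
      refine h3.trans ?_
      rw [mul_comm]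
      exact mul_le_mul_of_nonneg_right ht.2 h0
    have hUt : ∀ s ∈ Icc 0 S.T, ∀ l x, Tendsto (fun j => Dl l (mo n (U j s)) x) atTop
        (nhds (Dl l (mo n (u s)) x)) := fun s hs l x =>
      tendsto_Dl_mo (fun j => mono (le_max_left _ Bu) (hUE j s))
        (mono (le_max_right _ _) (hBu s)) (ae_of_all _ fun y => hlim s hs y) n l x
    have h2 : Tendsto (fun j => ∫ s in 0..t,
        (S.Ls 0 s (mo n (U j s)) x + mo n (mo j (f s)) x)) atTop
        (nhds (∫ s in 0..t, (S.Ls 0 s (mo n (u s)) x + mo n (f s) x))) := by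
      refine intervalIntegral.tendsto_integral_filter_of_dominated_convergence (fun _ => BL + Bf)
        (.of_forall fun j => ((hQj j).measurable_time x).aestronglyMeasurable)
        (.of_forall fun j => ae_of_all _ fun s _ => ?_) (by simp)
        (ae_of_all _ fun s hs => ?_)
      · refine (abs_add_le _ _).trans (add_le_add (hBL _ (hUHB j s) s n x) ?_)
        exact abs_mo_le (hmo (hBf s) j) n x
      · rw [uIoc_of_le ht.1] at hs
        refine Tendsto.add ?_ (tendsto_mo_mo (hBf s) n x)
        exact tendsto_finsetSum _ fun ι _ =>
          ((hUt s ⟨hs.1.le, hs.2.trans ht.2⟩ _ x).const_mul _).const_mul _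
    have h3 := (((hUt t ht [] x).sub (tendsto_mo_mo hg n x)).sub h2).abs
    have h4 : Tendsto (fun j => S.T * (N * eps n + N * eps j + |Nn n| * (S.h₀ * eps j)))
        atTop (nhds (S.T * (N * eps n + N * 0 + |Nn n| * (S.h₀ * 0)))) :=
      (((tendsto_eps.const_mul N).const_add _).add
        ((tendsto_eps.const_mul S.h₀).const_mul |Nn n|)).const_mul S.T
    simp only [mul_zero, add_zero] at h4
    exact le_of_tendsto_of_tendsto h3 h4 (.of_forall h1)

end Data

theorem clamp_sub_le (T t s : ℝ) : |clamp T t - clamp T s| ≤ |t - s| := by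
  have h1 := abs_max_sub_max_le_max 0 (min T t) 0 (min T s)
  have h2 := abs_min_sub_min_le_max T t T s
  rw [sub_self, abs_zero, max_eq_right (abs_nonneg (_ : ℝ))] at h1 h2
  exact h1.trans h2

/-- Solvability of the degenerate parabolic equation, with estimates of the derivatives. -/
theorem exists_sol (m : ℕ) {δ c₀ τ₀ K : ℝ} (hδ : δ ∈ Ioc (0 : ℝ) 1) (hc₀ : 0 < c₀)
    (hτ₀ : 0 < τ₀) (hK : 0 ≤ K) (M : Fin (m + 1) → ℝ) (absΛ nrmΛ : ℝ) :
    ∃ C, 0 ≤ C ∧ ∀ (d : ℕ) (S : Data d), S.abs = absΛ → S.nrm = nrmΛ →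
      S.Hyp m δ c₀ τ₀ K M → ∀ n ≤ m, 2 ≤ n → ∀ (f : TFn d)
      (g : Fn d) (F : ℝ), BM f → (BM fun _ => g) → 0 ≤ F →
      (∀ t ∈ Icc 0 S.T, ∀ k ≤ n, HB k F (f t)) → (∀ k ≤ n, HB k F g) →
      ∃ u, S.Sol n (C * F) g f u := by
  obtain ⟨C, hC0, hC⟩ := fd_bound m hδ hc₀ hτ₀ hK M absΛ nrmΛ
  refine ⟨C, hC0, ?_⟩
  intro d S habs hnrm hS n hn hn2 f g F hf hg hF hfF hgF
  have hT := S.T_pos.le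
  have hh := S.h₀_eps_mem
  choose U hU hU0 hUD using fun j =>
    hC d S habs hnrm hS n hn _ (hh j) j f g F hf hg hF hfF hgF
  set D := C * F with hD
  have hUD2 : ∀ j t, ∀ k ≤ 2, ∀ x, H k (U j t) x ≤ D := fun j t k hk => hUD j t k (hk.trans hn2)
  obtain ⟨N, hN0, Nn, hN⟩ := Data.mo_Lop_sub_le hS D
  obtain ⟨Bg, hBg⟩ := hg.eb
  obtain ⟨a, β, hab⟩ := Data.approx_cauchy hS hf (hBg 0)
    (fun t ht => hfF t ht 1 (by omega)) (hgF 1 (by omega)) hN0 hN hU hU0 hUD2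
  have hcau := fun t x => cauchySeq_of_eps (hab _ (clamp_mem hT t) x)
  choose u hu using fun t x => cauchySeq_tendsto_of_complete (hcau t x)
  have hUs : ∀ j t x, |U j t x| ≤ √D := fun j t x =>
    Real.abs_le_sqrt (hUD2 j t 0 (by norm_num) x)
  have hub : ∀ t x, |u t x| ≤ √D := fun t x =>
    le_of_tendsto (hu t x).abs (.of_forall fun j => hUs j _ x)
  have hbm : BM u := by
    refine ⟨?_, _, hub⟩
    refine measurable_of_tendsto_metrizable (f := fun j (z : ℝ × Sp d) => U j (clamp S.T z.1) z.2)
      (fun j => ?_) (tendsto_pi_nhds.2 fun z => hu z.1 z.2)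
    exact (hU j).1.bm.1.comp (((measurable_clamp S.T).comp measurable_fst).prodMk measurable_snd)
  have hUE : ∀ j t, EB (√D) (U j t) := fun j t =>
    EB.of_bound (Smo.continuous _).measurable (hUs j t)
  have huE : ∀ t, EB (√D) (u t) := fun t => EB.of_bound (hbm.measurable_space t) (hub t)
  have hhb : ∀ t, ∀ k ≤ n, HB k D (u t) := fun t k hk =>
    HB.of_tendsto (fun j => hUE j (clamp S.T t)) (huE t) (ae_of_all _ (hu t))
      fun j => Smo.hb (hUD j _ k hk)
  obtain ⟨R, hR0, hR⟩ : ∃ R, 0 ≤ R ∧ ∀ j, ∀ t ∈ Icc 0 S.T, ∀ x,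
      |((S.geo τ₀ (S.h₀ * eps j)).Lop (S.coS j t) (U j t) + mo j (f t) : Smo d) x| ≤ R := by
    refine ⟨∑ _ι : S.Ix, √(Data.MM m M 0) * (S.jB * √D) + √F, ?_,
      fun j t ht x => ?_⟩
    · have : 0 ≤ S.jB := by
        have : 0 ≤ S.abs := Real.sqrt_nonneg _
        rw [Data.jB]; positivity
      positivity
    · rw [Smo.add_apply, Data.Lop_eq_sum_jd hS (hh j) j ht]
      refine (abs_add_le _ _).trans (add_le_add ?_ ((hfF t ht 0 (by omega)).abs_mo_zero_le j x))
      refine (abs_sum_le_sum_abs _ _).trans (sum_le_sum fun ι _ => ?_)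
      rw [abs_mul]
      refine mul_le_mul ?_ (Data.abs_jd_le (hh j).1 (hUD2 j t) ι x) (abs_nonneg _)
        (Real.sqrt_nonneg _)
      exact abs_mo_le (EB.of_bound ((Data.bm_cf hS ι).measurable_space t)
        (Data.abs_coef_le hS ι t)) j x
  have hlip : ∀ t s x y, |u t x - u s y| ≤ R * |t - s| + √D * ‖x - y‖ := by
    intro t s x y
    refine le_of_tendsto ((hu t x).sub (hu s y)).abs (.of_forall fun j => ?_)
    have h1 := Smo.abs_sub_le (hUD2 j (clamp S.T t) 1 (by norm_num)) x y
    have h2 : |U j (clamp S.T t) y - U j (clamp S.T s) y| ≤ R * |t - s| := by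
      rw [(hU j).2.2 _ (clamp_mem hT t), (hU j).2.2 _ (clamp_mem hT s), add_sub_add_left_eq_sub,
        intervalIntegral.integral_interval_sub_left
          ((hU j).2.1.bm.intervalIntegrable _ _ _) ((hU j).2.1.bm.intervalIntegrable _ _ _)]
      refine (intervalIntegral.norm_integral_le_of_norm_le_const (C := R) (f := fun s =>
        ((S.geo τ₀ (S.h₀ * eps j)).Lop (S.coS j s) (U j s) + mo j (f s) : Smo d) y)
        fun r hr => ?_).trans ?_
      · refine hR j r ?_ y
        have h3 := uIoc_subset_uIcc hr
        exact ordConnected_Icc.uIcc_subset (clamp_mem hT s) (clamp_mem hT t) h3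
      · exact mul_le_mul_of_nonneg_left (clamp_sub_le _ _ _) hR0
    have h3 := abs_add_le (U j (clamp S.T t) x - U j (clamp S.T t) y)
      (U j (clamp S.T t) y - U j (clamp S.T s) y)
    rw [sub_add_sub_cancel] at h3
    linarith
  have hcont : Continuous (uncurry u) := by
    refine continuous_iff_continuousAt.2 fun z => ?_
    rw [ContinuousAt, tendsto_iff_dist_tendsto_zero]
    refine squeeze_zero (fun _ => dist_nonneg)
      (fun w => (hlip w.1 z.1 w.2 z.2 : dist (uncurry u w) (uncurry u z) ≤ _)) ?_
    have h1 : Continuous fun w : ℝ × Sp d => R * |w.1 - z.1| + √D * ‖w.2 - z.2‖ := by fun_prop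
    simpa using h1.tendsto z
  refine ⟨u, hbm, hcont, hhb, Data.weakEq_of_approx hS hf (hBg 0) hN hU hU0 hUD2 hbm
    (fun t k hk => hhb t k (hk.trans hn2)) fun t ht x => ?_⟩
  have := hu t x
  rwa [clamp_of_mem ht] at this

theorem H_add_le (n : ℕ) (φ ψ : Smo d) (x : Sp d) : H n (φ + ψ) x ≤ 2 * (H n φ x + H n ψ x) := by
  have h1 := H_sum_smul_le n (fun _ : Fin 2 => (1 : ℝ)) ![φ, ψ] x
  simpa [Fin.sum_univ_two, one_add_one_eq_two] using h1

theorem H_smul (n : ℕ) (a : ℝ) (φ : Smo d) (x : Sp d) : H n (a • φ) x = a ^ 2 * H n φ x := by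
  induction n generalizing φ with
  | zero => simp only [H_zero, Smo.smul_apply]; ring
  | succ n ih => simp only [H_succ, map_smul, ih, mul_sum]

/-- Derivatives of sums of products. -/
theorem H_sum_mul_le {ι : Type*} [Fintype ι] (n : ℕ) (a φ : ι → Smo d) (x : Sp d) :
    H n (∑ i, a i * φ i) x ≤ 4 ^ n * (∑ k ∈ Finset.range (n + 1), ∑ i, H k (a i) x) *
      ∑ k ∈ Finset.range (n + 1), ∑ i, H k (φ i) x := by
  induction n generalizing a φ with
  | zero =>
    simp only [H_zero, Smo.sum_apply, Smo.mul_apply, zero_add, Finset.range_one,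
      sum_singleton, pow_zero, one_mul]
    exact sum_mul_sq_le_sq_mul_sq _ _ _
  | succ n ih =>
    set X := fun (b : ι → Smo d) (k : ℕ) => ∑ i, H k (b i) x with hX
    have hX0 : ∀ b k, 0 ≤ X b k := fun b k => sum_nonneg fun i _ => H_nonneg _ _ _
    have hXs : ∀ b k, ∑ j, X (fun i => D (e j) (b i)) k = X b (k + 1) := by
      intro b k
      simp only [hX, H_succ]
      exact sum_comm
    set Y := fun b : ι → Smo d => ∑ k ∈ Finset.range (n + 1), X b k with hY
    have hY0 : ∀ b, 0 ≤ Y b := fun b => sum_nonneg fun k _ => hX0 b k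
    have hYs : ∀ b, ∑ j, Y (fun i => D (e j) (b i)) ≤ ∑ k ∈ Finset.range (n + 1 + 1), X b k := by
      intro b
      simp only [hY]
      rw [sum_comm]
      simp only [hXs]
      rw [sum_range_succ' _ (n + 1)]
      exact le_add_of_nonneg_right (hX0 b 0)
    have hYl : ∀ b, Y b ≤ ∑ k ∈ Finset.range (n + 1 + 1), X b k := fun b => by
      rw [sum_range_succ _ (n + 1)]
      exact le_add_of_nonneg_right (hX0 b _)
    have h1 : ∀ j, H n (D (e j) (∑ i, a i * φ i)) x ≤
        2 * (4 ^ n * Y a * Y (fun i => D (e j) (φ i)) + 4 ^ n * Y (fun i => D (e j) (a i)) * Y φ) := by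
      intro j
      have h2 : D (e j) (∑ i, a i * φ i) = ∑ i, a i * D (e j) (φ i) + ∑ i, D (e j) (a i) * φ i := by
        rw [map_sum, ← sum_add_distrib]
        exact sum_congr rfl fun i _ => D_mul _ _ _
      rw [h2]
      refine (H_add_le n _ _ x).trans ?_
      have h3 := ih a fun i => D (e j) (φ i)
      have h4 := ih (fun i => D (e j) (a i)) φ
      simp only [hX, hY] at *
      linarith
    rw [H_succ]
    refine (sum_le_sum fun j _ => h1 j).trans ?_
    rw [← mul_sum, sum_add_distrib, ← mul_sum, ← sum_mul, ← mul_sum]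
    set P := ∑ k ∈ Finset.range (n + 1 + 1), X a k
    set R := ∑ k ∈ Finset.range (n + 1 + 1), X φ k
    have hR0 : 0 ≤ R := (hY0 φ).trans (hYl φ)
    have hP0 : 0 ≤ P := (hY0 a).trans (hYl a)
    have h5 : 4 ^ n * Y a * ∑ j, Y (fun i => D (e j) (φ i)) ≤ 4 ^ n * P * R := by
      refine mul_le_mul (mul_le_mul_of_nonneg_left (hYl a) (by positivity)) (hYs φ)
        (sum_nonneg fun j _ => hY0 _) (by positivity)
    have h6 : 4 ^ n * (∑ j, Y (fun i => D (e j) (a i))) * Y φ ≤ 4 ^ n * P * R := by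
      refine mul_le_mul (mul_le_mul_of_nonneg_left (hYs a) (by positivity)) (hYl φ) (hY0 φ)
        (by positivity)
    calc _ ≤ 2 * (4 ^ n * P * R + 4 ^ n * P * R) := by linarith
      _ = _ := by ring

/-- Linear combinations of functions with bounded derivatives. -/
theorem HB.sum {ι : Type*} [Fintype ι] {k : ℕ} {C : ι → ℝ} {w : ι → ℝ} {v : ι → Fn d}
    (hv : ∀ i, ∃ B, EB B (v i)) (h : ∀ i, HB k (C i) (v i)) :
    HB k ((∑ i, w i ^ 2) * ∑ i, C i) fun x => ∑ i, w i * v i x := by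
  intro n x
  choose B hB using hv
  have h1 : mo n (fun x => ∑ i, w i * v i x) = ∑ i, w i • mo n (v i) := by
    ext y
    have h2 : IsAvg n y (fun x => ∑ i, w i * v i x) (∑ i, w i * mo n (v i) y) :=
      IsAvg.sum _ fun i _ => (IsAvg.of_eb (hB i)).const_mul _
    obtain ⟨C', hC'⟩ := h2.1
    rw [mo_apply hC', h2.2, Smo.sum_apply]
    rfl
  rw [h1]
  refine (H_sum_smul_le k w _ x).trans ?_
  gcongr with i
  exact h i n x

namespace Data

theorem MM_nonneg (k : ℕ) : 0 ≤ MM m M k := by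
  unfold MM
  split_ifs <;> positivity

theorem sum_H_cf_le (hS : S.Hyp m δ c₀ τ₀ K M) {k : ℕ} (hk : k ≤ m) (t : ℝ) (n : ℕ) (x : Sp d) :
    ∑ ι, H k (mo n (S.cf t ι)) x ≤ MM m M k := by
  have hT := clamp_mem S.T_pos.le t
  have h1 := (snap hS (h := S.h₀) ⟨S.h₀_pos, le_rfl⟩ n hT).coef k hk x
  rw [← coS_clamp] at h1
  refine le_trans (le_of_eq ?_) h1
  rw [Fintype.sum_sum_type, Fintype.sum_sum_type, sum_add_distrib,
    ← sum_coe_sort (S.geo τ₀ S.h₀).Λ₁, ← sum_coe_sort (S.geo τ₀ S.h₀).Λ₁]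
  congr 1
  obtain ⟨B, hB⟩ := (bm_c hS).eb
  have h2 : mo n (fun x => -1 * S.c (clamp S.T t) x) = (-1 : ℝ) • mo n (S.c (clamp S.T t)) :=
    mo_const_mul (hB t) _ _
  simp only [neg_mul, one_mul] at h2
  simp only [cf, Finset.univ_unique, sum_singleton, h2, H_smul]
  simp [coS]

/-- The order of `𝓛^{(i)}` is at most `o`. -/
def OrdLe (S : Data d) (i o : ℕ) : Prop := o = i + 2 ∨ (o = i + 1 ∧ Odd i ∧ S.Symm)

/-- The constant in the estimate of `𝓛^{(i)} u`. -/
def cL (m : ℕ) (M : Fin (m + 1) → ℝ) (a : ℝ) : ℝ :=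
  4 ^ m * (∑ k ∈ Finset.range (m + 1), MM m M k) * ((m + 1) * (2 * (1 + a) ^ (2 * (m + 2))))

theorem iterate_D_neg (r : ℕ) (l : Sp d) (φ : Smo d) : (D (-l))^[r] φ = (-1 : ℝ) ^ r • (D l)^[r] φ := by
  rw [← iterate_D_smul, neg_one_smul]

theorem sum_odd_eq_zero (hs : ∀ l ∈ S.Λ₁, -l ∈ S.Λ₁) {b : Fn d}
    (hb : ∀ l ∈ S.Λ₁, b (-l) = -b l) : ∑ l ∈ S.Λ₁, b l = 0 := by
  have h1 : ∑ l ∈ S.Λ₁, b l = ∑ l ∈ S.Λ₁, b (-l) :=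
    Finset.sum_bij' (fun l _ => -l) (fun l _ => -l) hs hs (fun l _ => neg_neg l)
      (fun l _ => neg_neg l) (fun l _ => by rw [neg_neg])
  rw [sum_congr rfl hb, sum_neg_distrib] at h1
  linarith

theorem sum_q_odd (hs : S.Symm) {i : ℕ} (hi : Odd i) (t : ℝ) (φ : Smo d) (x : Sp d) (a : ℝ) :
    ∑ l ∈ S.Λ₁, S.q l (clamp S.T t) x * (a * (D l)^[i + 2] φ x) = 0 := by
  refine sum_odd_eq_zero hs.1 fun l hl => ?_
  rw [← hs.2 l hl _ (clamp_mem S.T_pos.le t), iterate_D_neg, Smo.smul_apply,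
    (Odd.add_even hi even_two).neg_one_pow]
  ring

theorem sum_p_odd (hs : S.Symm) (hp : S.Antisymm) {i : ℕ} (hi : Odd i) (t : ℝ) (φ : Smo d) (x : Sp d)
    (a : ℝ) : ∑ l ∈ S.Λ₁, S.p l (clamp S.T t) x * (a * (D l)^[i + 1] φ x) = 0 := by
  refine sum_odd_eq_zero hs.1 fun l hl => ?_
  rw [hp l hl _ (clamp_mem S.T_pos.le t), iterate_D_neg, Smo.smul_apply, (Odd.add_one hi).neg_one_pow]
  ring

theorem sum_H_iterate_le {r k : ℕ} {E a : ℝ} (ha : S.abs ≤ a) (ha1 : 1 ≤ a) (hr : 1 ≤ r) {R : ℕ}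
    (hR : r ≤ R) {φ : Smo d} {w : ℝ} (hw : |w| ≤ 1) (x : Sp d) (h : H (k + r) φ x ≤ E) :
    ∑ l : S.Λ₁, H k (w • (D (l : Sp d))^[r] φ) x ≤ a ^ (2 * R) * E := by
  have hE : 0 ≤ E := (H_nonneg _ _ _).trans h
  have h1 : w ^ 2 ≤ 1 := by rw [← sq_abs]; exact pow_le_one₀ (abs_nonneg _) hw
  have habs : 0 ≤ S.abs := Real.sqrt_nonneg _
  calc _ ≤ ∑ l : S.Λ₁, ‖(l : Sp d)‖ ^ (2 * (r - 1) + 2) * E := by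
        refine sum_le_sum fun l _ => ?_
        rw [H_smul, show 2 * (r - 1) + 2 = 2 * r by omega, pow_mul]
        have h2 := H_iterate_D_le k r (l : Sp d) φ x
        have h3 := H_nonneg k ((D (l : Sp d))^[r] φ) x
        calc _ ≤ 1 * H k ((D (l : Sp d))^[r] φ) x := by gcongr
          _ ≤ _ := by rw [one_mul]; exact h2.trans (by gcongr)
    _ = (∑ l ∈ S.Λ₁, ‖l‖ ^ (2 * (r - 1) + 2)) * E := by
        rw [← sum_mul, sum_coe_sort S.Λ₁ fun l => ‖l‖ ^ (2 * (r - 1) + 2)]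
    _ ≤ S.abs ^ (2 * (r - 1) + 2) * E := by
        gcongr
        exact sum_norm_pow_le _
    _ ≤ a ^ (2 * (r - 1) + 2) * E := by gcongr
    _ ≤ _ := mul_le_mul_of_nonneg_right (pow_le_pow_right₀ ha1 (by omega)) hE

/-- The operators `𝓛^{(i)}`, `i ≥ 1`, lower the smoothness by their order. -/
theorem hb_Lw (hS : S.Hyp m δ c₀ τ₀ K M) {i o n : ℕ} (hi : 1 ≤ i) (him : i ≤ m) (ho : S.OrdLe i o) (hn : n ≤ m)
    (hn1 : 1 ≤ n) {u : Fn d} {B E : ℝ} (hu : EB B u) (h : ∀ k ≤ n + o, HB k E u) (t : ℝ) :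
    ∀ k ≤ n, HB k (cL m M S.abs * E) (S.Lw i t u) := by
  have ha0 : 0 ≤ S.abs := Real.sqrt_nonneg _
  have hE0 : 0 ≤ E := (h 0 (by omega)).nonneg
  have hio : i + 1 ≤ o ∧ i + 2 ≤ n + o := by rcases ho with rfl | ⟨rfl, -, -⟩ <;> omega
  have hu2 : ∀ k ≤ i + 2, HB k E u := fun k hk => h k (by omega)
  obtain ⟨b, hb1, hbo, hbL⟩ : ∃ b : ℝ, |b| ≤ 1 ∧ (b = 0 ∨ o = i + 2) ∧ ∀ (φ : Smo d) x,
      ∑ l ∈ S.Λ₁, S.q l (clamp S.T t) x *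
        (1 / (((i : ℝ) + 1) * ((i : ℝ) + 2)) * (D l)^[i + 2] φ x) =
      b * ∑ l ∈ S.Λ₁, S.q l (clamp S.T t) x *
        (1 / (((i : ℝ) + 1) * ((i : ℝ) + 2)) * (D l)^[i + 2] φ x) := by
    rcases ho with rfl | ⟨rfl, hi, hs⟩
    · exact ⟨1, by simp, .inr rfl, fun φ x => (one_mul _).symm⟩
    · exact ⟨0, by simp, .inl rfl, fun φ x => by rw [sum_q_odd hs hi, mul_zero]⟩
  obtain ⟨β, hβ, hβo, hβL⟩ : ∃ β : S.Ix → ℝ, (∀ ι, |β ι| ≤ 1) ∧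
      (∀ l, β (.inl (.inl l)) = 0 ∨ o = i + 2) ∧
      ∀ (φ : Smo d) x, S.Ls i t φ x = ∑ ι, S.cf t ι x * (β ι * S.jf i ι * Dl (S.jl i ι) φ x) := by
    refine ⟨fun ι => match ι with | .inl (.inl _) => b | _ => 1, ?_, fun l => hbo, fun φ x => ?_⟩
    · rintro ((l | l) | _) <;> simp [hb1]
    · rw [Ls_eq, hbL, Fintype.sum_sum_type, Fintype.sum_sum_type, if_neg (by omega), sub_zero,
        ← sum_coe_sort S.Λ₁, ← sum_coe_sort S.Λ₁, mul_sum]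
      simp only [cf, jf, jl, Dl_replicate, if_neg (show i ≠ 0 by omega), one_mul, zero_mul,
        mul_zero, Finset.sum_const_zero, add_zero]
      congr 1
      exact sum_congr rfl fun l _ => by ring
  set ψ : ℕ → Smo d := fun n => ∑ ι, mo n (S.cf t ι) * ((β ι * S.jf i ι) • Dl (S.jl i ι) (mo n u))
    with hψ
  have hlim : ∀ᵐ x, Tendsto (fun n => ψ n x) atTop (nhds (S.Lw i t u x)) := by
    have h1 : ∀ᵐ x, ∀ ι, Tendsto (fun n => mo n (S.cf t ι) x) atTop
        (nhds (S.cf t ι x)) := ae_all_iff.2 fun ι => by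
      obtain ⟨B', hB'⟩ := eb_cf hS t ι
      filter_upwards [ae_tendsto_conv_rho hB'.locallyIntegrable] with y hy
      simpa only [mo_apply hB'] using hy
    have h2 : ∀ᵐ x, ∀ ι, Tendsto (fun n => Dl (S.jl i ι) (mo n u) x) atTop
        (nhds (wd (S.jl i ι) u x)) :=
      ae_all_iff.2 fun ι => (hu2 _ (S.length_jl i ι)).ae_tendsto_Dl hu
    filter_upwards [h1, h2, ae_tendsto_Ls hu hu2 t] with x hx1 hx2 hx3
    have h3 : ∑ ι, S.cf t ι x * (β ι * S.jf i ι * wd (S.jl i ι) u x) = S.Lw i t u x := by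
      refine tendsto_nhds_unique (f := fun n => S.Ls i t (mo n u) x) ?_ hx3
      simp only [hβL]
      exact tendsto_finsetSum _ fun ι _ => ((hx2 ι).const_mul _).const_mul _
    rw [← h3]
    simp only [hψ, Smo.sum_apply, Smo.mul_apply, Smo.smul_apply]
    exact tendsto_finsetSum _ fun ι _ => (hx1 ι).mul ((hx2 ι).const_mul _)
  have hH : ∀ k ≤ n, ∀ j x, H k (ψ j) x ≤ cL m M S.abs * E := by
    intro k hk j x
    refine (H_sum_mul_le k _ _ x).trans ?_
    have h1 : ∑ k ∈ Finset.range (k + 1), ∑ ι, H k (mo j (S.cf t ι)) x ≤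
        ∑ k ∈ Finset.range (m + 1), MM m M k := by
      refine (sum_le_sum fun r hr => sum_H_cf_le hS (by
        have := Finset.mem_range.1 hr; omega) t j x).trans ?_
      exact Finset.sum_le_sum_of_subset_of_nonneg (Finset.range_subset_range.2 (by omega))
        fun r _ _ => MM_nonneg r
    have hjf : ∀ ι, |β ι * S.jf i ι| ≤ 1 := fun ι => by
      rw [abs_mul]
      exact mul_le_one₀ (hβ ι) (abs_nonneg _) (S.abs_jf_le i ι)
    have h2 : ∀ r ≤ k, ∑ ι, H r ((β ι * S.jf i ι) • Dl (S.jl i ι) (mo j u)) x ≤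
        2 * (1 + S.abs) ^ (2 * (m + 2)) * E := by
      intro r hr
      have e1 : ∑ l : S.Λ₁, H r ((β (.inl (.inl l)) * S.jf i (.inl (.inl l)))
          • Dl (S.jl i (.inl (.inl l))) (mo j u)) x ≤ (1 + S.abs) ^ (2 * (m + 2)) * E := by
        by_cases hb : ∀ l, β (.inl (.inl l)) = 0
        · simp only [hb, zero_mul, H_smul]
          rw [sum_eq_zero fun l _ => by ring]
          positivity
        · obtain ⟨l, hl⟩ := not_forall.1 hb
          have ho2 := (hβo l).resolve_left hl
          have h4 := h (r + (i + 2)) (by omega) j x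
          have h6 : ∀ l' : S.Λ₁, H r ((β (.inl (.inl l')) * S.jf i (.inl (.inl l')))
              • Dl (S.jl i (.inl (.inl l'))) (mo j u)) x ≤
              H r ((1 : ℝ) • (D (l' : Sp d))^[i + 2] (mo j u)) x := by
            intro l'
            rw [H_smul, H_smul, jl, Dl_replicate]
            have := H_nonneg r ((D (l' : Sp d))^[i + 2] (mo j u)) x
            refine mul_le_mul_of_nonneg_right ?_ this
            rw [sq_le_sq, abs_one]
            exact hjf _
          refine (sum_le_sum fun l' _ => h6 l').trans ?_
          exact sum_H_iterate_le (by linarith) (by linarith) (by omega) (by omega) (by simp) x h4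
      have e2 : ∑ l : S.Λ₁, H r ((β (.inl (.inr l)) * S.jf i (.inl (.inr l)))
          • Dl (S.jl i (.inl (.inr l))) (mo j u)) x ≤ (1 + S.abs) ^ (2 * (m + 2)) * E := by
        have h4 := h (r + (i + 1)) (by omega) j x
        have h6 : ∀ l' : S.Λ₁, H r ((β (.inl (.inr l')) * S.jf i (.inl (.inr l')))
            • Dl (S.jl i (.inl (.inr l'))) (mo j u)) x ≤
            H r ((1 : ℝ) • (D (l' : Sp d))^[i + 1] (mo j u)) x := by
          intro l'
          rw [H_smul, H_smul, jl, Dl_replicate]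
          have := H_nonneg r ((D (l' : Sp d))^[i + 1] (mo j u)) x
          refine mul_le_mul_of_nonneg_right ?_ this
          rw [sq_le_sq, abs_one]
          exact hjf _
        refine (sum_le_sum fun l' _ => h6 l').trans ?_
        exact sum_H_iterate_le (by linarith) (by linarith) (by omega) (by omega) (by simp) x h4
      rw [Fintype.sum_sum_type, Fintype.sum_sum_type]
      have e3 : ∑ ι : Unit, H r ((β (.inr ι) * S.jf i (.inr ι)) • Dl (S.jl i (.inr ι)) (mo j u)) x = 0 := by
        simp only [jf, if_neg (show i ≠ 0 by omega), mul_zero, H_smul]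
        simp
      rw [e3]
      linarith
    have h3 : ∑ r ∈ Finset.range (k + 1), ∑ ι, H r ((β ι * S.jf i ι) • Dl (S.jl i ι) (mo j u)) x ≤
        (m + 1) * (2 * (1 + S.abs) ^ (2 * (m + 2))) * E := by
      refine (sum_le_sum fun r hr => h2 r (by have := Finset.mem_range.1 hr; omega)).trans ?_
      rw [sum_const, Finset.card_range, nsmul_eq_mul, mul_assoc]
      have h4 : ((k + 1 : ℕ) : ℝ) ≤ (m : ℝ) + 1 := by exact_mod_cast (by omega : k + 1 ≤ m + 1)
      calc _ ≤ ((m : ℝ) + 1) * (2 * ((1 + S.abs) ^ (2 * (m + 2)) * E)) := by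
            gcongr
        _ = _ := by ring
    rw [cL, mul_assoc (4 ^ m * _)]
    refine mul_le_mul (mul_le_mul (pow_le_pow_right₀ (by norm_num) (hk.trans hn)) h1
      (sum_nonneg fun r _ => sum_nonneg fun ι _ => H_nonneg _ _ _) (by positivity)) h3
      (sum_nonneg fun r _ => sum_nonneg fun ι _ => H_nonneg _ _ _) ?_
    have := sum_nonneg fun k (_ : k ∈ Finset.range (m + 1)) => MM_nonneg (M := M) k
    positivity
  obtain ⟨B', hB'⟩ := eb_Lw hS hu hu2 t
  intro k hk
  have hb0 : ∀ j, EB (√(cL m M S.abs * E)) (ψ j) := fun j =>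
    EB.of_bound (Smo.continuous _).measurable fun x => Real.abs_le_sqrt (hH 0 (by omega) j x)
  have mono : ∀ {a b : ℝ} {v : Fn d}, a ≤ b → EB a v → EB b v := fun hab h =>
    ⟨h.1, by filter_upwards [h.2] with x hx using hx.trans hab⟩
  exact HB.of_tendsto (fun j => mono (le_max_left _ B') (hb0 j)) (mono (le_max_right _ _) hB') hlim
    fun j => Smo.hb (hH k hk j)

end Data

theorem HB.zero {k : ℕ} {C : ℝ} (hC : 0 ≤ C) : HB k C (0 : Fn d) :=
  Smo.hb (φ := 0) fun x => by
    have h := H_smul k 0 (0 : Smo d) x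
    rw [zero_smul] at h
    rw [h]
    simpa using hC

namespace Data

theorem Sol.mono {n : ℕ} {C C' : ℝ} {g : Fn d} {f u : TFn d} (h : S.Sol n C g f u)
    (hC : C ≤ C') : S.Sol n C' g f u :=
  ⟨h.bm, h.continuous, fun t k hk => (h.hb t k hk).mono hC, h.eq⟩

/-- The initial values of the system. -/
def ini (g : Fn d) (j : ℕ) : Fn d := if j = 0 then g else 0

variable (S) in
/-- The free terms of the system. -/
def src (f : TFn d) (u : ℕ → TFn d) (j : ℕ) (s : ℝ) (x : Sp d) : ℝ :=
  (if j = 0 then f s x else 0) +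
    ∑ i ∈ Finset.Icc 1 j, (j.choose i : ℝ) * S.Lw i s (u (j - i) s) x

variable (S) in
/-- `u 0, …, u k` solve the system, and `u j` has `m - r j` bounded derivatives. -/
def SysSol (m r k : ℕ) (E : ℝ) (g : Fn d) (f : TFn d) (u : ℕ → TFn d) : Prop :=
  ∀ j ≤ k, S.Sol (m - r * j) E (ini g j) (S.src f u j) (u j)

variable (S) in
/-- The admissible losses of smoothness. -/
def Rate (r : ℕ) : Prop := r = 3 ∨ (r = 2 ∧ S.Symm)

theorem src_congr (f : TFn d) {u v : ℕ → TFn d} {j : ℕ} (h : ∀ i < j, u i = v i) :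
    S.src f u j = S.src f v j := by
  funext s x
  rw [src, src]
  congr 1
  refine sum_congr rfl fun i hi => ?_
  have := Finset.mem_Icc.1 hi
  rw [h (j - i) (by omega)]

theorem Rate.exists_ord {r : ℕ} (hr : S.Rate r) {i : ℕ} (hi : 1 ≤ i) : ∃ o ≤ r * i, S.OrdLe i o := by
  rcases hr with rfl | ⟨rfl, hs⟩
  · exact ⟨i + 2, by omega, .inl rfl⟩
  · rcases Nat.even_or_odd i with he | ho
    · obtain ⟨a, ha⟩ := he
      exact ⟨i + 2, by omega, .inl rfl⟩
    · exact ⟨i + 1, by omega, .inr ⟨rfl, ho, hs⟩⟩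

theorem rate_le {r j k m : ℕ} (hj : j ≤ k) (hrk : r * k + 2 ≤ m) : r * j + 2 ≤ m :=
  (Nat.add_le_add_right (Nat.mul_le_mul_left r hj) 2).trans hrk

theorem Rate.two_le {r : ℕ} (hr : S.Rate r) : 2 ≤ r := by rcases hr with rfl | ⟨rfl, -⟩ <;> norm_num

/-- The smoothness of the functions entering the system. -/
theorem SysSol.hb_sub {r k : ℕ} {E : ℝ} {g : Fn d} {f : TFn d} {u : ℕ → TFn d}
    (hu : S.SysSol m r k E g f u) {j i : ℕ} (hj : j ≤ k + 1) (hi : i ∈ Finset.Icc 1 j)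
    (hjm : r * j + 2 ≤ m) (t : ℝ) : ∀ a ≤ m - r * j + r * i, HB a E (u (j - i) t) := by
  intro a ha
  obtain ⟨hi1, hij⟩ := Finset.mem_Icc.1 hi
  refine (hu (j - i) (by omega)).hb t a (ha.trans ?_)
  have h1 : r * (j - i) + r * i = r * j := by rw [← mul_add, Nat.sub_add_cancel hij]
  omega

theorem SysSol.hb_sub' {r k : ℕ} {E : ℝ} {g : Fn d} {f : TFn d} {u : ℕ → TFn d}
    (hr : S.Rate r) (hu : S.SysSol m r k E g f u) {j i : ℕ} (hj : j ≤ k + 1) (hi : i ∈ Finset.Icc 1 j)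
    (hjm : r * j + 2 ≤ m) (t : ℝ) : ∀ a ≤ i + 2, HB a E (u (j - i) t) := by
  intro a ha
  have h2 := Nat.mul_le_mul_right i hr.two_le
  exact hu.hb_sub hj hi hjm t a (by omega)

theorem SysSol.bm_src (hS : S.Hyp m δ c₀ τ₀ K M) {r k : ℕ} {E : ℝ} {g : Fn d}
    {f : TFn d} {u : ℕ → TFn d} (hr : S.Rate r) (hf : BM f)
    (hu : S.SysSol m r k E g f u) {j : ℕ} (hj : j ≤ k + 1) (hjm : r * j + 2 ≤ m) :
    BM (S.src f u j) := by
  refine BM.add (φ := fun s x => if j = 0 then f s x else 0) ?_ (BM.sum _ fun i hi => ?_)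
  · split_ifs
    · exact hf
    · exact BM.const 0
  · have := Finset.mem_Icc.1 hi
    exact (BM.const _).mul (bm_Lw hS (hu (j - i) (by omega)).bm (hu.hb_sub' hr hj hi hjm))

theorem bm_ini {g : Fn d} (hg : BM fun _ => g) (j : ℕ) : BM fun _ => ini g j := by
  unfold ini
  split_ifs
  · exact hg
  · exact BM.const 0

end Data

/-- Solvability of the system, with estimates of the derivatives. -/
theorem exists_sysSol (m : ℕ) {δ c₀ τ₀ K : ℝ} (hδ : δ ∈ Ioc (0 : ℝ) 1) (hc₀ : 0 < c₀)
    (hτ₀ : 0 < τ₀) (hK : 0 ≤ K) (M : Fin (m + 1) → ℝ) (absΛ nrmΛ : ℝ) (k : ℕ) :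
    ∃ E, 0 ≤ E ∧ ∀ (d : ℕ) (S : Data d), S.abs = absΛ → S.nrm = nrmΛ →
      S.Hyp m δ c₀ τ₀ K M → ∀ r, S.Rate r → r * k + 2 ≤ m → ∀ (f : TFn d)
      (g : Fn d) (F : ℝ), BM f → (BM fun _ => g) → 0 ≤ F →
      (∀ t ∈ Icc 0 S.T, ∀ a ≤ m, HB a F (f t)) → (∀ a ≤ m, HB a F g) →
      ∃ u, S.SysSol m r k (E * F) g f u := by
  obtain ⟨C, hC0, hC⟩ := exists_sol m hδ hc₀ hτ₀ hK M absΛ nrmΛ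
  induction k with
  | zero =>
    refine ⟨C, hC0, fun d S ha hn hS r hr hk f g F hf hg hF hfF hgF => ?_⟩
    obtain ⟨u, hu⟩ := hC d S ha hn hS m le_rfl hS.hm f g F hf hg hF hfF hgF
    refine ⟨fun _ => u, fun j hj => ?_⟩
    obtain rfl : j = 0 := by omega
    have e : S.src f (fun _ => u) 0 = f := by funext s x; simp [Data.src]
    rw [e]
    exact hu
  | succ k ih =>
    obtain ⟨E, hE0, hE⟩ := ih
    set W : ℝ := (∑ i : Finset.Icc 1 (k + 1), ((k + 1).choose i : ℝ) ^ 2) *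
      ∑ _i : Finset.Icc 1 (k + 1), Data.cL m M |absΛ| with hW
    refine ⟨E + C * (|W| * E), by positivity, fun d S ha hn hS r hr hk f g F hf hg hF hfF hgF => ?_⟩
    have hrk : r * k + 2 ≤ m := Data.rate_le (by omega) hk
    obtain ⟨u, hu⟩ := hE d S ha hn hS r hr hrk f g F hf hg hF hfF hgF
    have hbm := hu.bm_src hS hr hf le_rfl hk
    have ha' : |absΛ| = S.abs := by rw [← ha]; exact abs_of_nonneg (Real.sqrt_nonneg _)
    have hsrc : ∀ t ∈ Icc 0 S.T, ∀ a ≤ m - r * (k + 1),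
        HB a (|W| * (E * F)) (S.src f u (k + 1) t) := by
      intro t ht a hak
      have e : S.src f u (k + 1) t = fun x => ∑ i : Finset.Icc 1 (k + 1),
          ((k + 1).choose i : ℝ) * S.Lw i t (u (k + 1 - i) t) x := by
        funext x
        rw [Data.src, if_neg (by omega), zero_add, ← sum_coe_sort]
      rw [e]
      refine (HB.sum (C := fun _ => Data.cL m M |absΛ| * (E * F)) (fun i => ?_) fun i => ?_).mono ?_
      · obtain ⟨B, hB⟩ := (hu (k + 1 - i) (by have := (Finset.mem_Icc.1 i.2).1; omega)).bm.eb
        exact Data.eb_Lw hS (hB t) (hu.hb_sub' hr le_rfl i.2 hk t) t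
      · have hi := Finset.mem_Icc.1 i.2
        obtain ⟨B, hB⟩ := (hu (k + 1 - i) (by omega)).bm.eb
        obtain ⟨o, ho, hio⟩ := hr.exists_ord hi.1
        have h2 := Nat.mul_le_mul_left r hi.2
        have h3 := Nat.mul_le_mul_right (i : ℕ) hr.two_le
        rw [ha']
        exact Data.hb_Lw hS hi.1 (by omega) hio (Nat.sub_le _ _) (by omega)
          (hB t) (fun a ha => hu.hb_sub le_rfl i.2 hk t a (by omega)) t a hak
      · rw [← sum_mul, ← mul_assoc, ← hW]
        exact mul_le_mul_of_nonneg_right (le_abs_self W) (by positivity)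
    obtain ⟨v, hv⟩ := hC d S ha hn hS (m - r * (k + 1)) (Nat.sub_le _ _) (by omega) _ 0 _ hbm
      (BM.const 0) (by positivity) hsrc fun a _ => HB.zero (by positivity)
    refine ⟨Function.update u (k + 1) v, fun j hj => ?_⟩
    rw [Data.src_congr (v := u) f fun i hi => Function.update_of_ne (by omega) _ _]
    rcases Nat.lt_or_ge j (k + 1) with h | h
    · rw [Function.update_of_ne (by omega)]
      refine (hu j (by omega)).mono ?_
      have : 0 ≤ C * (|W| * E) * F := by positivity
      linarith
    · obtain rfl : j = k + 1 := by omega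
      rw [Function.update_self, Data.ini, if_neg (by omega)]
      refine hv.mono ?_
      have : 0 ≤ E * F := by positivity
      linarith

theorem mo_zero (n : ℕ) : mo n (0 : Fn d) = 0 := by
  have e : (0 : Fn d) = fun _ => 0 * 0 := by funext; simp
  rw [e, mo_const_mul (EB.const (d := d) 0) 0 n, zero_smul]

namespace Data

variable (S) in
/-- The free term, extended in time. -/
def fcl (t : ℝ) : Fn d := S.f (clamp S.T t)

theorem Sol.memB {n n' : ℕ} {E : ℝ} {g : Fn d} {f u : TFn d} (h : S.Sol n E g f u)
    (hn : n' ≤ n) : MemB S.T n' u ∧ normB S.T n' u ≤ √((n' + 1) * E) := by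
  have h1 := memB_of_hb (T := S.T) (m := n') (ψ := u) (C := fun _ => E)
    (h.bm.1.comp ((measurable_subtype_coe.comp measurable_fst).prodMk measurable_snd))
    (h.bm.2.imp fun C hC t _ => hC t) (fun t _ => h.continuous_space t)
    fun k hk t _ => h.hb t k (hk.trans hn)
  simpa [sum_const, nsmul_eq_mul] using h1

theorem exists_sol_of_memB {n : ℕ} {g : Fn d} {f R w : TFn d}
    (hc : ContinuousOn (uncurry w) (Icc 0 S.T ×ˢ univ)) (hw : MemB S.T n w)
    (heq : WeakEq S.T g R w)
    (hR : ∀ t ∈ Icc 0 S.T, R t =ᵐ[volume] fun x => S.Lw 0 t (w t) x + f t x) :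
    ∃ C, S.Sol n C g f fun t => w (clamp S.T t) := by
  have hT := S.T_pos.le
  refine ⟨(n.factorial : ℝ) * normB S.T n w ^ 2, hw.bm hT, ?_, fun t k hk => ?_, ?_⟩
  · have h1 : Continuous fun z : ℝ × Sp d => (clamp S.T z.1, z.2) := by
      unfold clamp
      fun_prop
    exact hc.comp_continuous h1 fun z => ⟨clamp_mem hT z.1, mem_univ _⟩
  · refine (hw.hb hk (clamp_mem hT t)).mono (mul_le_mul_of_nonneg_right ?_ (sq_nonneg _))
    exact_mod_cast Nat.factorial_le hk
  · have h1 : WeakEq S.T g R fun t => w (clamp S.T t) := by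
      intro t ht φ hφ
      simp only [clamp_of_mem ht]
      exact heq t ht φ hφ
    refine h1.congr fun t ht => ?_
    simp only [clamp_of_mem ht]
    exact hR t ht

theorem Sol.isSolution {n : ℕ} {E : ℝ} {u : TFn d} (hn : 2 ≤ n) (h : S.Sol n E S.g S.fcl u) :
    S.IsSolution u := by
  refine ⟨h.continuous.continuousOn, (h.memB hn).1, h.eq.congr fun t ht => ?_⟩
  obtain ⟨B, hB⟩ := h.bm.eb
  filter_upwards [Lw_zero_ae ht (hB t) fun k hk => h.hb t k (hk.trans hn)] with x hx
  rw [hx, fcl, clamp_of_mem ht]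

theorem IsSolution.exists_sol {v : TFn d} (h : S.IsSolution v) :
    ∃ C, S.Sol 2 C S.g S.fcl fun t => v (clamp S.T t) := by
  refine exists_sol_of_memB h.continuousOn h.memB h.eq fun t ht => ?_
  obtain ⟨B, hB⟩ := h.memB.eb
  filter_upwards [Lw_zero_ae ht (hB t ht) fun k hk => (h.memB.hb hk ht).mono
    (mul_le_mul_of_nonneg_right (Nat.cast_le.2 (Nat.factorial_le hk)) (sq_nonneg _))] with x hx
  rw [hx, fcl, clamp_of_mem ht]

variable {r k : ℕ} {E : ℝ} {g : Fn d} {f : TFn d} {u : ℕ → TFn d}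

theorem SysSol.src_ae (hr : S.Rate r) (hrk : r * k + 2 ≤ m) (hu : S.SysSol m r k E g f u) {j : ℕ}
    (hj : j ≤ k) (hj1 : 1 ≤ j) {t : ℝ} (ht : t ∈ Icc 0 S.T) :
    ∀ᵐ x, S.src f u j t x = ∑ i ∈ Finset.Icc 1 j, (j.choose i : ℝ) * S.Li i t (u (j - i) t) x := by
  have hjm := rate_le hj hrk
  have h1 : ∀ᵐ x, ∀ i : Finset.Icc 1 j, S.Lw i t (u (j - i) t) x = S.Li i t (u (j - i) t) x := by
    refine ae_all_iff.2 fun i => ?_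
    have hi := Finset.mem_Icc.1 i.2
    obtain ⟨B, hB⟩ := (hu (j - i) (by omega)).bm.eb
    exact Lw_ae ht (by omega) (hB t) (hu.hb_sub' hr (by omega) i.2 hjm t)
  filter_upwards [h1] with x hx
  rw [src, if_neg (by omega), zero_add]
  exact sum_congr rfl fun i hi => by rw [hx ⟨i, hi⟩]

theorem SysSol.isSystemSolution (hr : S.Rate r) (hrk : r * k + 2 ≤ m)
    (hu : S.SysSol m r k E S.g S.fcl u) : S.IsSystemSolution k u := by
  have hsm : ∀ j ≤ k, k - j + 2 ≤ m - r * j := by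
    intro j hj
    have h1 : r * (k - j) + r * j = r * k := by rw [← mul_add, Nat.sub_add_cancel hj]
    have h2 := Nat.mul_le_mul_right (k - j) hr.two_le
    omega
  have h0 := hu 0 (Nat.zero_le k)
  have e0 : S.src S.fcl u 0 = S.fcl := by funext s x; simp [src]
  rw [e0, ini, if_pos rfl] at h0
  refine ⟨h0.isSolution ((hsm 0 (Nat.zero_le k)).trans' (by omega)),
    fun j hj => (hu j (Finset.mem_Icc.1 hj).2).continuous.continuousOn,
    fun j hj => ((hu j (Finset.mem_Icc.1 hj).2).memB (hsm j (Finset.mem_Icc.1 hj).2)).1,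
    fun j hj => ?_⟩
  obtain ⟨hj1, hjk⟩ := Finset.mem_Icc.1 hj
  have h1 := (hu j hjk).eq
  rw [ini, if_neg (by omega)] at h1
  refine h1.congr fun t ht => ?_
  obtain ⟨B, hB⟩ := (hu j hjk).bm.eb
  have h2 := hsm j hjk
  filter_upwards [Lw_zero_ae ht (hB t) fun a ha => (hu j hjk).hb t a (by omega),
    hu.src_ae hr hrk hjk hj1 ht] with x hx hx'
  rw [hx, hx']

theorem SysSol.unique (hS : S.Hyp m δ c₀ τ₀ K M) (hr : S.Rate r) (hrk : r * k + 2 ≤ m)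
    (hu : S.SysSol m r k E S.g S.fcl u) {v : ℕ → TFn d} (hv : S.IsSystemSolution k v) :
    ∀ j ≤ k, S.EqH (v j) (u j) := by
  have hf : BM S.fcl := hS.smooth.f_mem.bm S.T_pos.le
  have hg : BM fun _ => S.g := hS.smooth.g_mem.bm S.T_pos.le
  intro j
  induction j using Nat.strong_induction_on with
  | _ j ih =>
  intro hj t ht x
  have hjm := rate_le hj hrk
  obtain ⟨B, hB⟩ := (bm_ini hg j).eb
  suffices h : ∃ C, S.Sol 2 C (ini S.g j) (S.src S.fcl u j) fun t => v j (clamp S.T t) by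
    obtain ⟨C, hC⟩ := h
    have h1 := Sol.unique hS le_rfl (show 2 ≤ m - r * j by omega) (hB 0)
      (hu.bm_src hS hr hf (by omega) hjm) hC (hu j hj) t ht x
    rwa [clamp_of_mem ht] at h1
  rcases Nat.eq_zero_or_pos j with rfl | hj1
  · have e0 : S.src S.fcl u 0 = S.fcl := by funext s x; simp [src]
    rw [e0, ini, if_pos rfl]
    exact hv.zero.exists_sol
  · have hjI : j ∈ Finset.Icc 1 k := Finset.mem_Icc.2 ⟨hj1, hj⟩
    have hmem := hv.memB j hjI
    have hmem2 : MemB S.T 2 (v j) := ⟨hmem.measurable, hmem.bounded, hmem.continuous,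
      fun a ha => hmem.deriv_bounded a (by omega)⟩
    refine exists_sol_of_memB (R := fun s x => S.L s (v j s) x +
      ∑ i ∈ Finset.Icc 1 j, (j.choose i : ℝ) * S.Li i s (v (j - i) s) x) (hv.continuousOn j hjI)
      hmem2 ?_ fun t ht => ?_
    · rw [ini, if_neg (by omega)]
      exact hv.eq j hjI
    · obtain ⟨B, hB⟩ := hmem2.eb
      filter_upwards [Lw_zero_ae ht (hB t ht) fun k hk => (hmem2.hb hk ht).mono
        (mul_le_mul_of_nonneg_right (Nat.cast_le.2 (Nat.factorial_le hk)) (sq_nonneg _)),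
        hu.src_ae hr hrk hj hj1 ht] with x hx hx'
      rw [hx, hx']
      congr 1
      refine sum_congr rfl fun i hi => ?_
      have hi := Finset.mem_Icc.1 hi
      have e : v (j - i) t = u (j - i) t := funext fun x => ih (j - i) (by omega) (by omega) t ht x
      rw [e]

theorem Ls_odd (hs : S.Symm) (hp : S.Antisymm) {i : ℕ} (hi : Odd i) (t : ℝ) (φ : Smo d) (x : Sp d) :
    S.Ls i t φ x = 0 := by
  rw [Ls_eq, sum_q_odd hs hi, sum_p_odd hs hp hi, if_neg (by rintro rfl; simp at hi)]
  simp

theorem Lw_eq_zero_ae {i : ℕ} {B C : ℝ} {v : Fn d} {t : ℝ} (hv : EB B v)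
    (h : ∀ k ≤ i + 2, HB k C v) (h0 : ∀ n x, S.Ls i t (mo n v) x = 0) : ∀ᵐ x, S.Lw i t v x = 0 := by
  filter_upwards [ae_tendsto_Ls (S := S) hv h t] with x hx
  simp only [h0] at hx
  exact tendsto_nhds_unique hx tendsto_const_nhds

theorem Ls_mo_zero (i : ℕ) (t : ℝ) (n : ℕ) (x : Sp d) : S.Ls i t (mo n (0 : Fn d)) x = 0 := by
  have h := S.Ls_sub i t (0 : Smo d) 0 x
  rwa [sub_self, sub_self, ← mo_zero n] at h

/-- Under the symmetry conditions the odd terms of the expansion vanish. -/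
theorem SysSol.odd_eq_zero (hS : S.Hyp m δ c₀ τ₀ K M) (hr : S.Rate r) (hrk : r * k + 2 ≤ m)
    (hu : S.SysSol m r k E g f u) (hs : S.Symm) (hp : S.Antisymm) :
    ∀ j ≤ k, Odd j → S.EqH (u j) 0 := by
  intro j
  induction j using Nat.strong_induction_on with
  | _ j ih =>
  intro hj hodd t ht x
  have hj0 : j ≠ 0 := by rintro rfl; simp at hodd
  have hjm := rate_le hj hrk
  have hsol := hu j hj
  have hsol' : S.Sol (m - r * j) E 0 (fun _ _ => 0) (u j) := by
    have h0 := hsol.eq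
    rw [ini, if_neg hj0] at h0
    refine ⟨hsol.bm, hsol.continuous, hsol.hb, h0.congr fun t ht => ?_⟩
    have h1 : ∀ᵐ x, ∀ i : Finset.Icc 1 j, S.Lw i t (u (j - i) t) x = 0 := by
      refine ae_all_iff.2 fun i => ?_
      have hi := Finset.mem_Icc.1 i.2
      obtain ⟨B, hB⟩ := (hu (j - i) (by omega)).bm.eb
      refine Lw_eq_zero_ae (hB t) (hu.hb_sub' hr (by omega) i.2 hjm t) fun n x => ?_
      rcases Nat.even_or_odd i with he | ho
      · have e : u (j - i) t = 0 := funext fun x =>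
          ih (j - i) (by omega) (by omega) (Nat.Odd.sub_even hi.2 hodd he) t ht x
        rw [e]
        exact Ls_mo_zero _ _ _ _
      · exact Ls_odd hs hp ho _ _ _
    filter_upwards [h1] with x hx
    rw [src, if_neg hj0, zero_add]
    congr 1
    exact sum_eq_zero fun i hi => by rw [hx ⟨i, hi⟩, mul_zero]
  obtain ⟨C, hC0, hC⟩ := exists_sol m hS.hδ hS.hc₀ hS.hτ₀ hS.hK M S.abs S.nrm
  obtain ⟨w, hw⟩ := hC d S rfl rfl hS m le_rfl hS.hm (fun _ _ => 0) 0 0 (BM.const 0) (BM.const 0) le_rfl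
    (fun t _ k _ => HB.zero le_rfl) fun k _ => HB.zero le_rfl
  rw [Sol.unique hS (show 2 ≤ m - r * j by omega) hS.hm (EB.const 0) (BM.const 0)
    hsol' hw t ht x]
  obtain ⟨B, hB⟩ := hw.bm.eb
  have h1 := tendsto_conv_rho (hB t) (hw.continuous_space t).continuousAt (x := x)
  simp only [← mo_apply (hB t)] at h1
  have h2 : ∀ n, mo n (w t) x = 0 := fun n => by
    have := (hw.hb t 0 (Nat.zero_le m)).abs_mo_zero_le n x
    rw [mul_zero, Real.sqrt_zero] at this
    exact abs_eq_zero.1 (le_antisymm this (abs_nonneg _))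
  simp only [h2] at h1
  exact tendsto_nhds_unique h1 tendsto_const_nhds

theorem size_nonneg (n : ℕ) : 0 ≤ S.size n := add_nonneg (normB_nonneg _ _ _) (normB_nonneg _ _ _)

variable (S m) in
/-- The bound of the data. -/
def bd : ℝ := (m.factorial : ℝ) * S.size m ^ 2

theorem bd_nonneg : 0 ≤ S.bd m := by unfold bd; positivity

theorem hb_bd (hS : S.Hyp m δ c₀ τ₀ K M) {a : ℕ} (ha : a ≤ m) :
    (∀ t, HB a (S.bd m) (S.fcl t)) ∧ HB a (S.bd m) S.g := by
  have hT := S.T_pos.le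
  have h1 : ∀ y : ℝ, 0 ≤ y → y ≤ S.size m → (a.factorial : ℝ) * y ^ 2 ≤ S.bd m := fun y hy h =>
    mul_le_mul (Nat.cast_le.2 (Nat.factorial_le ha)) (pow_le_pow_left₀ hy h 2) (sq_nonneg _)
      (Nat.cast_nonneg _)
  have h2 := normB_nonneg S.T m S.f
  have h3 := normB_nonneg S.T m fun _ => S.g
  refine ⟨fun t => (hS.smooth.f_mem.hb ha (clamp_mem hT t)).mono (h1 _ h2 ?_),
    (hS.smooth.g_mem.hb ha (left_mem_Icc.2 hT)).mono (h1 _ h3 ?_)⟩ <;> rw [size] <;> linarith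

theorem Sol.normB_le {n n' : ℕ} {g : Fn d} {f u : TFn d} (hE : 0 ≤ E)
    (h : S.Sol n (E * S.bd m) g f u) (hn : n' ≤ n) (hm : n' ≤ m) :
    normB S.T n' u ≤ √((m + 1) * E * m.factorial) * S.size m := by
  refine (h.memB hn).2.trans ?_
  rw [← Real.sqrt_sq (size_nonneg (S := S) m), ← Real.sqrt_mul (by positivity)]
  refine Real.sqrt_le_sqrt ?_
  have h1 : (n' : ℝ) + 1 ≤ m + 1 := by exact_mod_cast Nat.succ_le_succ hm
  rw [bd]
  calc _ ≤ ((m : ℝ) + 1) * (E * (m.factorial * S.size m ^ 2)) :=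
        mul_le_mul_of_nonneg_right h1 (by positivity)
    _ = _ := by ring

end Data

theorem IsAvg.mo_eq {n : ℕ} {x : Sp d} {F : Fn d} {a : ℝ} (h : IsAvg n x F a) : mo n F x = a := by
  obtain ⟨⟨C, hC⟩, e⟩ := h
  rw [mo_apply hC, e]

theorem MemB.lipT {T : ℝ} {m : ℕ} {ψ : TFn d} (h : MemB T m ψ) (hm : 1 ≤ m) (hT : 0 ≤ T) :
    LipT fun t => ψ (clamp T t) := by
  refine ⟨h.bm hT, normB T m ψ, fun t x y => ?_⟩
  have := Data.abs_sub_le_of_memB h hm (clamp_mem hT t) (x + y) x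
  rwa [add_sub_cancel_left] at this

/-- Mollification almost commutes with a finite difference operator. -/
theorem exists_mo_fdo_sub_le {Λ₁ : Finset (Sp d)} {h : ℝ} {a : Sp d → TFn d}
    {c v : TFn d} (ha : ∀ l ∈ Λ₁, LipT (a l)) (hc : LipT c) (hv : BM v) :
    ∃ N, 0 ≤ N ∧ ∀ t n x, |mo n (fdo Λ₁ h a c t (v t)) x - fdo Λ₁ h a c t (mo n (v t)) x| ≤ N * eps n := by
  obtain ⟨V, hV⟩ := hv.eb
  have hV0 : 0 ≤ |V| + |V| := by positivity
  let A : Λ₁ ⊕ Unit → TFn d := Sum.elim (fun l => a l) fun _ => c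
  let w : ℝ → Λ₁ ⊕ Unit → Fn d := fun t => Sum.elim
    (fun l x => v t (x + h • (l : Sp d)) - v t x) fun _ x => -1 * v t x
  have hA : ∀ ι, LipT (A ι) := by
    rintro (l | _)
    · exact ha l l.2
    · exact hc
  have hw : ∀ t ι, EB (|V| + |V|) (w t ι) := by
    have mono : ∀ {C : ℝ} {φ : Fn d}, EB C φ → C ≤ |V| + |V| → EB (|V| + |V|) φ :=
      fun hφ hC => ⟨hφ.1, by filter_upwards [hφ.2] with x hx using hx.trans hC⟩
    have hVV := le_abs_self V
    rintro t (l | _)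
    · have h1 := ((mo_comp_add (hV t) (h • (l : Sp d)) 0).1.add (hV t).neg)
      simp only [← sub_eq_add_neg] at h1
      exact mono h1 (by linarith)
    · have h1 := (hV t).neg
      have e : w t (.inr ()) = fun x => -v t x := by
        funext x
        exact neg_one_mul _
      rw [show w t (Sum.inr _) = w t (.inr ()) from rfl, e]
      exact mono h1 (by linarith [abs_nonneg V])
  have hmo : ∀ t n ι x, mo n (w t ι) x = match ι with
      | .inl l => mo n (v t) (x + h • (l : Sp d)) - mo n (v t) x
      | .inr _ => -1 * mo n (v t) x := by
    rintro t n (l | _) x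
    · have h2 := mo_comp_add (hV t) (h • (l : Sp d)) n
      have h1 := ((IsAvg.of_eb h2.1 (n := n) (x := x)).sub (IsAvg.of_eb (hV t))).mo_eq
      rw [h2.2] at h1
      exact h1
    · exact ((IsAvg.of_eb (hV t) (n := n) (x := x)).const_mul (-1)).mo_eq
  choose L hL0 hL using fun ι => (hA ι).2.imp fun C hC => (⟨abs_nonneg C, fun t x y =>
    (hC t x y).trans (mul_le_mul_of_nonneg_right (le_abs_self C) (norm_nonneg y))⟩ :
      0 ≤ |C| ∧ ∀ t x y, |A ι t (x + y) - A ι t x| ≤ |C| * ‖y‖)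
  have hL' : 0 ≤ ∑ ι, |L ι| := sum_nonneg fun ι _ => abs_nonneg _
  refine ⟨(Fintype.card (Λ₁ ⊕ Unit) : ℝ) * ((∑ ι, |L ι|) * (|V| + |V|)), by positivity,
    fun t n x => ?_⟩
  have key := mo_pair_sub_le (a := fun ι => A ι t) (v := w t) hL' (fun ι x y => ?_)
    (fun ι => (hA ι).1.eb.imp fun B hB => hB t) (hw t) n x
  · have e1 : (fun y => ∑ ι, A ι t y * w t ι y) = fdo Λ₁ h a c t (v t) := by
      funext y
      rw [Fintype.sum_sum_type, fdo, ← sum_coe_sort Λ₁]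
      simp [A, w, sub_eq_add_neg]
    have e2 : ∑ ι, A ι t x * mo n (w t ι) x = fdo Λ₁ h a c t (mo n (v t)) x := by
      simp only [hmo]
      rw [Fintype.sum_sum_type, fdo, ← sum_coe_sort Λ₁]
      simp [A, sub_eq_add_neg]
    rw [e1, e2] at key
    exact key
  · have h1 := hL ι t y (x - y)
    rw [add_sub_cancel] at h1
    exact h1.trans (mul_le_mul_of_nonneg_right
      (single_le_sum (f := fun ι => |L ι|) (fun ι _ => abs_nonneg _) (Finset.mem_univ ι))
      (norm_nonneg _))

theorem fdo_sub_sum {Λ₁ : Finset (Sp d)} {h : ℝ} {a : Sp d → TFn d} {c : TFn d} (t : ℝ)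
    {ι : Type*} (s : Finset ι) (w : ι → ℝ) (v : Fn d) (φ : ι → Fn d) (x : Sp d) :
    fdo Λ₁ h a c t (fun x => v x - ∑ j ∈ s, w j * φ j x) x =
      fdo Λ₁ h a c t v x - ∑ j ∈ s, w j * fdo Λ₁ h a c t (φ j) x := by
  simp only [fdo, mul_sub, sum_sub_distrib, mul_sum]
  rw [sum_comm (s := s), sum_comm (s := s)]
  have e : ∀ (f : Sp d → ι → ℝ), ∑ l ∈ Λ₁, ∑ j ∈ s, a l t x * (w j * f l j) =
      ∑ l ∈ Λ₁, ∑ j ∈ s, w j * (a l t x * f l j) := fun f =>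
    sum_congr rfl fun l _ => sum_congr rfl fun j _ => by ring
  rw [e, e, sum_congr rfl fun j _ => show c t x * (w j * φ j x) = w j * (c t x * φ j x) by ring]
  ring

/-- The expansion of a product of two exponential generating sums. -/
theorem sum_choose_regroup (k : ℕ) (h : ℝ) (X : ℕ → ℕ → ℝ) :
    ∑ j ∈ Finset.range (k + 1), h ^ j / (j.factorial : ℝ) *
      ∑ i ∈ Finset.range (j + 1), (j.choose i : ℝ) * X i (j - i) =
    ∑ j ∈ Finset.range (k + 1), h ^ j / (j.factorial : ℝ) *
      ∑ i ∈ Finset.range (k - j + 1), h ^ i / (i.factorial : ℝ) * X i j := by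
  have h1 := Finset.sum_range_diag_flip (k + 1) fun j i =>
    h ^ j / (j.factorial : ℝ) * (h ^ i / (i.factorial : ℝ) * X i j)
  simp only [mul_sum]
  have h2 : ∀ j ∈ Finset.range (k + 1), ∑ i ∈ Finset.range (k + 1 - j),
      h ^ j / (j.factorial : ℝ) * (h ^ i / (i.factorial : ℝ) * X i j) =
      ∑ i ∈ Finset.range (k - j + 1), h ^ j / (j.factorial : ℝ) * (h ^ i / (i.factorial : ℝ) * X i j) := by
    intro j hj
    have := Finset.mem_range.1 hj
    rw [show k + 1 - j = k - j + 1 by omega]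
  rw [← sum_congr rfl h2, ← h1]
  refine sum_congr rfl fun j _ => ?_
  rw [← Finset.sum_flip]
  refine sum_congr rfl fun i hi => ?_
  have hij : i ≤ j := Finset.mem_range_succ_iff.1 hi
  rw [Nat.choose_symm hij, Nat.sub_sub_self hij, Nat.cast_choose ℝ hij]
  have h3 : h ^ j = h ^ i * h ^ (j - i) := by rw [← pow_add, Nat.add_sub_cancel' hij]
  have h4 := Nat.factorial_ne_zero j
  have h5 : (j.factorial : ℝ) ≠ 0 := by exact_mod_cast h4
  rw [h3]
  field_simp

namespace Data

theorem lipT_fc (hS : S.Hyp m δ c₀ τ₀ K M) (h : ℝ) :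
    ∀ l ∈ S.Λ₁, LipT (S.fc h l) := by
  intro l hl
  have hT := S.T_pos.le
  have := ((LipT.const (1 / h ^ 2)).mul ((hS.smooth.q_mem l hl).lipT hS.hm1 hT)).add
    ((LipT.const (1 / h)).mul ((hS.smooth.p_mem l hl).lipT hS.hm1 hT))
  convert this using 3 with t x
  rw [fc]
  ring

theorem exists_fdSol (hS : S.Hyp m δ c₀ τ₀ K M) (h : ℝ) :
    ∃ v, FDSol S.Λ₁ h S.T (S.fc h) (fun t => S.c (clamp S.T t)) S.fcl S.g v :=
  exists_fd_solution S.T_pos.le (bm_fc hS h) (bm_c hS) (hS.smooth.f_mem.bm S.T_pos.le)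
    (hS.smooth.g_mem.bm S.T_pos.le)

theorem fdSol_unique (hS : S.Hyp m δ c₀ τ₀ K M) {h : ℝ} (hh : h ∈ Ioc 0 S.h₀)
    {v w : TFn d} (hv : FDSol S.Λ₁ h S.T (S.fc h) (fun t => S.c (clamp S.T t)) S.fcl S.g v)
    (hw : FDSol S.Λ₁ h S.T (S.fc h) (fun t => S.c (clamp S.T t)) S.fcl S.g w) : v = w :=
  FDSol.unique S.T_pos.le hS.hc₀ (bm_fc hS h) (bm_c hS) (hS.smooth.f_mem.bm S.T_pos.le)
    (fc_nonneg hS hh) (c_ge_clamp hS) hv hw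

theorem integral_Lh_eq {h : ℝ} (hh : h ≠ 0) {t : ℝ} (ht : t ∈ Icc 0 S.T) {v w : TFn d}
    (hvw : S.EqH v w) (x : Sp d) :
    ∫ s in 0..t, (S.Lh h s (v s) x + S.f s x) =
      ∫ s in 0..t, (fdo S.Λ₁ h (S.fc h) (fun t => S.c (clamp S.T t)) s (w s) x + S.fcl s x) := by
  refine intervalIntegral.integral_congr fun s hs => ?_
  rw [uIcc_of_le ht.1] at hs
  have hs' : s ∈ Icc 0 S.T := ⟨hs.1, hs.2.trans ht.2⟩
  have e : v s = w s := funext fun x => hvw s hs' x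
  simp only [Lh_eq S hh hs', e, fcl, clamp_of_mem hs']

theorem isFDSolution_of_fdSol {h : ℝ} (hh : h ≠ 0) {v : TFn d}
    (hv : FDSol S.Λ₁ h S.T (S.fc h) (fun t => S.c (clamp S.T t)) S.fcl S.g v) : S.IsFDSolution h v := by
  refine ⟨hv.1.1.comp ((measurable_subtype_coe.comp measurable_fst).prodMk measurable_snd),
    hv.1.2.imp fun C hC t _ => hC t, fun t ht x => ?_⟩
  rw [integral_Lh_eq hh ht (fun _ _ _ => rfl), hv.2 t x, clamp_of_mem ht]

theorem IsFDSolution.fdSol {h : ℝ} (hh : h ≠ 0) {v : TFn d} (hv : S.IsFDSolution h v) :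
    FDSol S.Λ₁ h S.T (S.fc h) (fun t => S.c (clamp S.T t)) S.fcl S.g fun t => v (clamp S.T t) := by
  have hT := S.T_pos.le
  refine ⟨⟨?_, hv.bounded.imp fun C hC t => hC _ (clamp_mem hT t)⟩, fun t x => ?_⟩
  · have h1 : Measurable fun z : ℝ × Sp d => ((⟨clamp S.T z.1, clamp_mem hT z.1⟩ : Icc 0 S.T), z.2) :=
      (((measurable_clamp S.T).comp measurable_fst).subtype_mk).prodMk measurable_snd
    exact hv.measurable.comp h1
  · exact (hv.eq _ (clamp_mem hT t) x).trans (congrArg (S.g x + ·)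
      (integral_Lh_eq hh (clamp_mem hT t) (fun s hs x => by rw [clamp_of_mem hs]) x))

variable {r k : ℕ} {E : ℝ} {g : Fn d} {f : TFn d} {u : ℕ → TFn d}

/-- Mollification almost commutes with the operators of the system. -/
theorem SysSol.exists_mo_rhs_sub_le (hS : S.Hyp m δ c₀ τ₀ K M)
    (hr : S.Rate r) (hrk : r * k + 2 ≤ m) (hf : BM f) (hu : S.SysSol m r k E g f u) {j : ℕ} (hj : j ≤ k) :
    ∃ N, 0 ≤ N ∧ ∀ t n x, |mo n (fun x => S.Lw 0 t (u j t) x + S.src f u j t x) x -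
      ((if j = 0 then mo n (f t) x else 0) +
        ∑ i ∈ Finset.range (j + 1), (j.choose i : ℝ) * S.Ls i t (mo n (u (j - i) t)) x)| ≤ N * eps n := by
  have hjm := rate_le hj hrk
  have hb : ∀ i ≤ j, ∀ t, ∀ a ≤ i + 2, HB a E (u (j - i) t) := by
    intro i hi t a ha
    rcases Nat.eq_zero_or_pos i with rfl | h
    · exact (hu j hj).hb t a (by omega)
    · exact hu.hb_sub' hr (by omega) (Finset.mem_Icc.2 ⟨h, hi⟩) hjm t a ha
  choose N hN0 hN using fun i => mo_Lw_sub_le hS i E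
  obtain ⟨Bf, hBf⟩ := hf.eb
  refine ⟨∑ i ∈ Finset.range (j + 1), (j.choose i : ℝ) * N i,
    sum_nonneg fun i _ => mul_nonneg (Nat.cast_nonneg _) (hN0 i), fun t n x => ?_⟩
  have e : (fun x => S.Lw 0 t (u j t) x + S.src f u j t x) = fun x => (if j = 0 then f t x else 0) +
      ∑ i ∈ Finset.range (j + 1), (j.choose i : ℝ) * S.Lw i t (u (j - i) t) x := by
    funext x
    rw [Finset.range_eq_Ico, Finset.sum_eq_sum_Ico_succ_bot (Nat.succ_pos j), src,
      show Finset.Ico (0 + 1) (j + 1) = Finset.Icc 1 j by ext; rfl]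
    rw [Nat.choose_zero_right, Nat.cast_one, one_mul, Nat.sub_zero]
    ring
  have h1 : IsAvg n x (fun x => if j = 0 then f t x else 0) (if j = 0 then mo n (f t) x else 0) := by
    split_ifs
    · exact IsAvg.of_eb (hBf t)
    · exact IsAvg.const 0
  have hEB : ∀ i ≤ j, ∃ B, ∀ t, EB B (u (j - i) t) := fun i hi => (hu (j - i) (by omega)).bm.eb
  have h2 : IsAvg n x (fun x => ∑ i ∈ Finset.range (j + 1), (j.choose i : ℝ) * S.Lw i t (u (j - i) t) x)
      (∑ i ∈ Finset.range (j + 1), (j.choose i : ℝ) * mo n (S.Lw i t (u (j - i) t)) x) := by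
    refine IsAvg.sum _ fun i hi => IsAvg.const_mul _ ?_
    have hi := Finset.mem_range_succ_iff.1 hi
    obtain ⟨B, hB⟩ := hEB i hi
    obtain ⟨B', hB'⟩ := eb_Lw hS (hB t) (hb i hi t) t
    exact IsAvg.of_eb hB'
  rw [e, (h1.add h2).mo_eq, add_sub_add_left_eq_sub, ← sum_sub_distrib, sum_mul]
  refine (abs_sum_le_sum_abs _ _).trans (sum_le_sum fun i hi => ?_)
  have hi := Finset.mem_range_succ_iff.1 hi
  obtain ⟨B, hB⟩ := hEB i hi
  rw [← mul_sub, abs_mul, Nat.abs_cast, mul_assoc]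
  exact mul_le_mul_of_nonneg_left (hN i (u (j - i) t) B (hB t) (hb i hi t) t n x) (Nat.cast_nonneg _)

/-- The constant in the remainder of the expansion. -/
def cE (m : ℕ) (M : Fin (m + 1) → ℝ) (a c₀ : ℝ) (k : ℕ) : ℝ :=
  (∑ j ∈ Finset.range (k + 1), 1 / (j.factorial : ℝ) *
    (√(MM m M 0) * (a ^ (k - j + 3) + a ^ (k - j + 2)))) / c₀

theorem cE_nonneg {a : ℝ} (ha : 0 ≤ a) (hc₀ : 0 < c₀) : 0 ≤ cE m M a c₀ k := by
  unfold cE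
  positivity

/-- The expansion of the finite difference solution. -/
theorem SysSol.expansion (hS : S.Hyp m δ c₀ τ₀ K M) (hr : S.Rate r) (hrk : r * k + 2 ≤ m)
    (hu : S.SysSol m r k E S.g S.fcl u)
    (hsm : ∀ j ≤ k, ∀ t ∈ Icc 0 S.T, ∀ a ≤ k - j + 3, HB a E (u j t)) {h : ℝ} (hh : h ∈ Ioc 0 S.h₀)
    {v : TFn d}
    (hv : FDSol S.Λ₁ h S.T (S.fc h) (fun t => S.c (clamp S.T t)) S.fcl S.g v) :
    ∀ t ∈ Icc 0 S.T, ∀ x,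
      |v t x - ∑ j ∈ Finset.range (k + 1), h ^ j / (j.factorial : ℝ) * u j t x| ≤
        h ^ (k + 1) * (cE m M S.abs c₀ k * √E) := by
  have hT := S.T_pos.le
  have hm1 : 1 ≤ m := by omega
  have hh0 := hh.1
  have hf : BM S.fcl := hS.smooth.f_mem.bm hT
  have hg : BM fun _ => S.g := hS.smooth.g_mem.bm hT
  have hvl : LipT v := FDSol.lip hT hS.hc₀ (lipT_fc hS h) (hS.smooth.c_mem.lipT hm1 hT)
    (hS.smooth.f_mem.lipT hm1 hT) (hS.smooth.g_mem.lipT hm1 hT) (fc_nonneg hS hh) (c_ge_clamp hS) hv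
  set a := S.fc h with ha
  set c : TFn d := fun t => S.c (clamp S.T t) with hc
  have haB : ∀ l ∈ S.Λ₁, BM (a l) := bm_fc hS h
  have hcB : BM c := bm_c hS
  obtain ⟨N₀, hN₀, hN⟩ := exists_mo_fdo_sub_le (h := h) (lipT_fc hS h)
    (hS.smooth.c_mem.lipT hm1 hT) hv.1
  have hN' : ∀ j, ∃ N, 0 ≤ N ∧ (j ≤ k → ∀ t n x,
      |mo n (fun x => S.Lw 0 t (u j t) x + S.src S.fcl u j t x) x -
      ((if j = 0 then mo n (S.fcl t) x else 0) +
        ∑ i ∈ Finset.range (j + 1), (j.choose i : ℝ) * S.Ls i t (mo n (u (j - i) t)) x)| ≤ N * eps n) := by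
    intro j
    by_cases hj : j ≤ k
    · obtain ⟨N, h0, h1⟩ := hu.exists_mo_rhs_sub_le hS hr hrk hf hj
      exact ⟨N, h0, fun _ => h1⟩
    · exact ⟨0, le_rfl, fun h => absurd h hj⟩
  choose N hN0 hNj using hN'
  set w : ℕ → ℝ := fun j => h ^ j / (j.factorial : ℝ) with hw
  have hw0 : ∀ j, 0 ≤ w j := fun j => div_nonneg (pow_nonneg hh0.le _) (Nat.cast_nonneg _)
  have hjm : ∀ j ≤ k, r * j + 2 ≤ m := fun j hj => rate_le hj hrk
  obtain ⟨Bg, hBg⟩ := hg.eb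
  obtain ⟨Bf, hBf⟩ := hf.eb
  obtain ⟨Bv, hBv⟩ := hv.1.eb
  have hfdB := BM.fdo (h := h) haB hcB hv.1
  have hGB : BM fun s x => fdo S.Λ₁ h a c s (v s) x + S.fcl s x := hfdB.add hf
  have hRB : ∀ j ≤ k, BM fun s x => S.Lw 0 s (u j s) x + S.src S.fcl u j s x := fun j hj =>
    (bm_Lw hS (hu j hj).bm fun t a ha => (hu j hj).hb t a (by have := hjm j hj; omega)).add
      (hu.bm_src hS hr hf (by omega) (hjm j hj))
  have ev := mo_integral (hBg 0) hGB hBv fun t ht x => by rw [hv.2 t x, clamp_of_mem ht]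
  have eu : ∀ j ≤ k, ∀ n, ∀ t ∈ Icc 0 S.T, ∀ x, mo n (u j t) x = mo n (ini S.g j) x +
      ∫ s in 0..t, mo n (fun x => S.Lw 0 s (u j s) x + S.src S.fcl u j s x) x := by
    intro j hj n
    obtain ⟨B, hB⟩ := (bm_ini hg j).eb
    obtain ⟨B', hB'⟩ := (hRB j hj).eb
    obtain ⟨B'', hB''⟩ := (hu j hj).bm.eb
    exact (hu j hj).eq.mo (hB 0) hB' (fun t _ => hB'' t) n
  set b : ℕ → ℝ := fun j => √(MM m M 0) * (S.abs ^ (k - j + 3) + S.abs ^ (k - j + 2)) *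
    √E with hb
  have habs : 0 ≤ S.abs := Real.sqrt_nonneg _
  have hb0 : ∀ j, 0 ≤ b j := fun j => by
    have := Real.sqrt_nonneg (MM m M 0)
    have := Real.sqrt_nonneg E
    simp only [hb]
    positivity
  set P : ℝ := ∑ j ∈ Finset.range (k + 1), w j * (h ^ (k - j + 1) * b j) with hP
  have hP0 : 0 ≤ P := sum_nonneg fun j _ => mul_nonneg (hw0 j)
    (mul_nonneg (pow_nonneg hh0.le _) (hb0 j))
  set Q : ℝ := N₀ + ∑ j ∈ Finset.range (k + 1), w j * N j with hQ
  have hQ0 : 0 ≤ Q := add_nonneg hN₀ (sum_nonneg fun j _ => mul_nonneg (hw0 j) (hN0 j))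
  have key : ∀ n, ∀ t ∈ Icc 0 S.T, ∀ x,
      |mo n (v t) x - ∑ j ∈ Finset.range (k + 1), w j * mo n (u j t) x| ≤
        0 + (Q * eps n + P) / c₀ := by
    intro n
    have hmv := (regT_mo hv.1 n).bm
    have hmG := (regT_mo hGB n).bm
    have hmu : ∀ j ≤ k, BM fun t => mo n (u j t) := fun j hj => (regT_mo (hu j hj).bm n).bm
    have hmR : ∀ j ≤ k, BM fun t => mo n (fun x => S.Lw 0 t (u j t) x + S.src S.fcl u j t x) :=
      fun j hj => (regT_mo (hRB j hj) n).bm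
    have hle : ∀ {j}, j ∈ Finset.range (k + 1) → j ≤ k := fun hj =>
      Finset.mem_range_succ_iff.1 hj
    have hvB := hmv.sub (BM.sum (Finset.range (k + 1)) fun j hj => (BM.const (w j)).mul (hmu j (hle hj)))
    have hGB' := hmG.sub
      (BM.sum (Finset.range (k + 1)) fun j hj => (BM.const (w j)).mul (hmR j (hle hj)))
    refine fd_stable (h := h) hT hS.hc₀ haB hcB (fc_nonneg hS hh) (c_ge_clamp hS)
      (v := fun t x => mo n (v t) x - ∑ j ∈ Finset.range (k + 1), w j * mo n (u j t) x) (v₀ := 0)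
      (fun x => hGB'.intervalIntegrable x _ _) (fun t ht x => ?_)
      (hvB.2.imp fun C hC t _ => hC t) (fun x => by simp)
      (add_nonneg (mul_nonneg hQ0 (eps_pos n).le) hP0) fun t ht x => ?_
    · rw [intervalIntegral.integral_sub (hmG.intervalIntegrable x _ _)
        ((BM.sum (Finset.range (k + 1)) fun j hj =>
          (BM.const (w j)).mul (hmR j (hle hj))).intervalIntegrable x _ _),
        intervalIntegral.integral_finsetSum fun j hj =>
          ((BM.const (w j)).mul (hmR j (hle hj))).intervalIntegrable x _ _]
      simp only [intervalIntegral.integral_const_mul]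
      rw [ev n t ht x, sum_congr rfl fun j hj => by rw [eu j (hle hj) n t ht x]]
      simp only [mul_add, sum_add_distrib]
      have h1 : ∑ j ∈ Finset.range (k + 1), w j * mo n (ini S.g j) x = mo n S.g x := by
        rw [sum_eq_single 0]
        · simp [hw, ini]
        · intro j _ hj
          rw [ini, if_neg hj, mo_zero]
          simp
        · simp
      rw [h1]
      simp only [Pi.zero_apply]
      ring
    · have h1 := hN t n x
      have h2 : mo n (fun x => fdo S.Λ₁ h a c t (v t) x + S.fcl t x) x =
          mo n (fdo S.Λ₁ h a c t (v t)) x + mo n (S.fcl t) x := by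
        obtain ⟨B, hB⟩ := hfdB.eb
        exact ((IsAvg.of_eb (hB t)).add (IsAvg.of_eb (hBf t))).mo_eq
      have h3 := fdo_sub_sum (Λ₁ := S.Λ₁) (h := h) (a := a) (c := c) t (Finset.range (k + 1)) w
        (mo n (v t)) (fun j => mo n (u j t)) x
      have h4 : ∑ j ∈ Finset.range (k + 1), w j * ((if j = 0 then mo n (S.fcl t) x else 0) +
          ∑ i ∈ Finset.range (j + 1), (j.choose i : ℝ) * S.Ls i t (mo n (u (j - i) t)) x) =
          mo n (S.fcl t) x + ∑ j ∈ Finset.range (k + 1), w j *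
            ∑ i ∈ Finset.range (k - j + 1), h ^ i / (i.factorial : ℝ) * S.Ls i t (mo n (u j t)) x := by
        rw [← sum_choose_regroup k h fun i j => S.Ls i t (mo n (u j t)) x]
        simp only [mul_add, sum_add_distrib]
        congr 1
        rw [sum_eq_single 0]
        · simp [hw]
        · intro j _ hj
          rw [if_neg hj, mul_zero]
        · simp
      have h5 : |∑ j ∈ Finset.range (k + 1), w j *
          (mo n (fun x => S.Lw 0 t (u j t) x + S.src S.fcl u j t x) x -
          ((if j = 0 then mo n (S.fcl t) x else 0) +
          ∑ i ∈ Finset.range (j + 1), (j.choose i : ℝ) * S.Ls i t (mo n (u (j - i) t)) x))| ≤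
          (∑ j ∈ Finset.range (k + 1), w j * N j) * eps n := by
        rw [sum_mul]
        refine (abs_sum_le_sum_abs _ _).trans (sum_le_sum fun j hj => ?_)
        rw [abs_mul, abs_of_nonneg (hw0 j), mul_assoc]
        exact mul_le_mul_of_nonneg_left (hNj j (hle hj) t n x) (hw0 j)
      have h6 : |∑ j ∈ Finset.range (k + 1), w j * (fdo S.Λ₁ h a c t (mo n (u j t)) x -
          ∑ i ∈ Finset.range (k - j + 1), h ^ i / (i.factorial : ℝ) * S.Ls i t (mo n (u j t)) x)| ≤ P := by
        refine (abs_sum_le_sum_abs _ _).trans (sum_le_sum fun j hj => ?_)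
        rw [abs_mul, abs_of_nonneg (hw0 j)]
        exact mul_le_mul_of_nonneg_left (abs_fdo_sub_le hS hh0 (k - j) _
          (hsm j (hle hj) t ht _ (by omega) n) (hsm j (hle hj) t ht _ le_rfl n) t x) (hw0 j)
      simp only [mul_sub, sum_sub_distrib] at h5 h6
      rw [h4] at h5
      simp only [h2, h3]
      rw [show (Q * eps n + P) = N₀ * eps n + (∑ j ∈ Finset.range (k + 1), w j * N j) * eps n + P by
        rw [hQ]; ring]
      rw [abs_le] at h1 h5 h6 ⊢
      constructor <;> linarith [h1.1, h1.2, h5.1, h5.2, h6.1, h6.2]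
  intro t ht x
  have h1 : Tendsto (fun n => |mo n (v t) x - ∑ j ∈ Finset.range (k + 1), w j * mo n (u j t) x|)
      atTop (nhds |v t x - ∑ j ∈ Finset.range (k + 1), w j * u j t x|) := by
    refine (Tendsto.sub ?_ (tendsto_finsetSum _ fun j hj => Tendsto.const_mul _ ?_)).abs
    · simp only [mo_apply (hBv t)]
      exact tendsto_conv_rho (hBv t) (hvl.continuous t).continuousAt
    · have hj := Finset.mem_range_succ_iff.1 hj
      obtain ⟨B, hB⟩ := (hu j hj).bm.eb
      simp only [mo_apply (hB t)]
      exact tendsto_conv_rho (hB t) ((hu j hj).continuous_space t).continuousAt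
  have h2 : Tendsto (fun n => 0 + (Q * eps n + P) / c₀) atTop (nhds (P / c₀)) := by
    simpa using (((tendsto_eps.const_mul Q).add_const P).div_const c₀).const_add 0
  refine (le_of_tendsto_of_tendsto h1 h2 (.of_forall fun n => key n t ht x)).trans
    (le_of_eq ?_)
  rw [cE, hP, div_mul_eq_mul_div, ← mul_div_assoc, sum_mul, mul_sum]
  congr 1
  refine sum_congr rfl fun j hj => ?_
  have hj := Finset.mem_range_succ_iff.1 hj
  have e : h ^ (k + 1) = h ^ j * h ^ (k - j + 1) := by rw [← pow_add]; congr 1; omega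
  simp only [hw, hb]
  rw [e]
  ring

end Data

/-! ### Extrapolation -/

theorem sum_coef_mul {r : ℝ} (h0 : 0 < r) (h1 : r < 1) (n : ℕ) (j : Fin (n + 1)) :
    ∑ i, coef r n i * r ^ ((i : ℕ) * (j : ℕ)) = if j = 0 then 1 else 0 := by
  have e : vand r n = Matrix.vandermonde fun i : Fin (n + 1) => r ^ (i : ℕ) := by
    ext i j
    simp [vand, Matrix.vandermonde_apply, pow_mul]
  have hdet : IsUnit (vand r n).det := by
    rw [e, isUnit_iff_ne_zero, Matrix.det_vandermonde_ne_zero_iff]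
    exact fun i j hij => Fin.ext (pow_right_injective₀ h0 h1.ne hij)
  have h2 : Matrix.vecMul (coef r n) (vand r n) = Pi.single 0 1 := by
    rw [coef, Matrix.vecMul_vecMul, Matrix.nonsing_inv_mul _ hdet, Matrix.vecMul_one]
  have h3 := congrFun h2 j
  rw [Pi.single_apply] at h3
  rw [← h3]
  rfl

/-- Linear combinations which cancel the lower order terms of an expansion. -/
theorem abs_sum_mul_sub_le {n k : ℕ} {b U : Fin (n + 1) → ℝ} {y : ℕ → ℝ} {h B : ℝ} (hh : 0 ≤ h)
    (hB : 0 ≤ B) (hU : ∀ i : Fin (n + 1), |U i - ∑ j ∈ Finset.range (k + 1),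
      ((1 / 2) ^ (i : ℕ) * h) ^ j / (j.factorial : ℝ) * y j| ≤ ((1 / 2) ^ (i : ℕ) * h) ^ (k + 1) * B)
    (hb0 : ∑ i, b i = 1)
    (hb : ∀ j ∈ Finset.Icc 1 k, y j = 0 ∨ ∑ i, b i * (1 / 2) ^ ((i : ℕ) * j) = 0) :
    |∑ i, b i * U i - y 0| ≤ h ^ (k + 1) * ((∑ i, |b i|) * B) := by
  have e : ∑ i, b i * ∑ j ∈ Finset.range (k + 1),
      ((1 / 2) ^ (i : ℕ) * h) ^ j / (j.factorial : ℝ) * y j = y 0 := by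
    simp only [mul_sum]
    rw [sum_comm, sum_range_succ', sum_eq_zero, zero_add]
    · simp [← sum_mul, hb0]
    · intro j hj
      have hj := Finset.mem_range.1 hj
      rcases hb (j + 1) (Finset.mem_Icc.2 ⟨by omega, by omega⟩) with h | h'
      · simp [h]
      · calc _ = (∑ i : Fin (n + 1), b i * (1 / 2) ^ ((i : ℕ) * (j + 1))) *
              (h ^ (j + 1) / ((j + 1).factorial : ℝ) * y (j + 1)) := by
              rw [sum_mul]
              refine sum_congr rfl fun i _ => ?_
              rw [mul_pow, ← pow_mul]
              ring
          _ = 0 := by rw [h', zero_mul]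
  rw [← e, ← sum_sub_distrib, sum_mul, mul_sum]
  refine (abs_sum_le_sum_abs _ _).trans (sum_le_sum fun i _ => ?_)
  rw [← mul_sub, abs_mul]
  have h1 : ((1 / 2 : ℝ) ^ (i : ℕ) * h) ^ (k + 1) ≤ h ^ (k + 1) :=
    pow_le_pow_left₀ (by positivity)
      (mul_le_of_le_one_left hh (pow_le_one₀ (by norm_num) (by norm_num))) _
  calc _ ≤ |b i| * (h ^ (k + 1) * B) := mul_le_mul_of_nonneg_left
        ((hU i).trans (mul_le_mul_of_nonneg_right h1 hB)) (abs_nonneg _)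
    _ = _ := by ring

theorem half_pow_mul_mem {h h₀ : ℝ} (hh : h ∈ Ioc 0 h₀) (i : ℕ) : (1 / 2) ^ i * h ∈ Ioc 0 h₀ :=
  ⟨mul_pos (by positivity) hh.1, (mul_le_of_le_one_left hh.1.le
    (pow_le_one₀ (by norm_num) (by norm_num))).trans hh.2⟩

section extrapolation

variable {k : ℕ} {h₀ B : ℝ} {y : ℕ → TFn d} {U : ℝ → TFn d} {t : ℝ} {x : Sp d}

theorem abs_ubar_sub_le (hB : 0 ≤ B) (hU : ∀ h ∈ Ioc 0 h₀, |U h t x - ∑ j ∈ Finset.range (k + 1),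
      h ^ j / (j.factorial : ℝ) * y j t x| ≤ h ^ (k + 1) * B) {h : ℝ} (hh : h ∈ Ioc 0 h₀) :
    |ubar k U h t x - y 0 t x| ≤ h ^ (k + 1) * ((∑ i, |coef (1 / 2) k i|) * B) := by
  refine abs_sum_mul_sub_le (y := fun j => y j t x) hh.1.le hB (fun i => hU _ (half_pow_mul_mem hh i))
    ?_ fun j hj => .inr ?_
  · have := sum_coef_mul (r := 1 / 2) (by norm_num) (by norm_num) k 0
    simpa using this
  · have hj := Finset.mem_Icc.1 hj
    have := sum_coef_mul (r := 1 / 2) (by norm_num) (by norm_num) k ⟨j, by omega⟩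
    rwa [if_neg (by simp [Fin.ext_iff]; omega)] at this

theorem abs_sub_utilde_le (hk : Odd k) (hy : ∀ j ∈ Finset.Icc 1 k, Odd j → y j t x = 0) (hB : 0 ≤ B)
    (hU : ∀ h ∈ Ioc 0 h₀, |U h t x - ∑ j ∈ Finset.range (k + 1),
      h ^ j / (j.factorial : ℝ) * y j t x| ≤ h ^ (k + 1) * B) {h : ℝ} (hh : h ∈ Ioc 0 h₀) :
    |y 0 t x - utilde k U h t x| ≤
      h ^ (k + 1) * ((∑ i, |coef (1 / 4) ((k - 1) / 2) i|) * B) := by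
  rw [abs_sub_comm]
  refine abs_sum_mul_sub_le (y := fun j => y j t x) hh.1.le hB (fun i => hU _ (half_pow_mul_mem hh i))
    ?_ fun j hj => ?_
  · have := sum_coef_mul (r := 1 / 4) (by norm_num) (by norm_num) ((k - 1) / 2) 0
    simpa using this
  · rcases Nat.even_or_odd j with ⟨a, ha⟩ | ho
    · have hj := Finset.mem_Icc.1 hj
      obtain ⟨b, hb⟩ := hk
      have := sum_coef_mul (r := 1 / 4) (by norm_num) (by norm_num) ((k - 1) / 2) ⟨a, by omega⟩
      rw [if_neg (by simp [Fin.ext_iff]; omega)] at this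
      refine .inr (Eq.trans (sum_congr rfl fun i _ => ?_) this)
      have e : (1 / 2 : ℝ) ^ ((i : ℕ) * j) = (1 / 4) ^ ((i : ℕ) * a) := by
        rw [show (1 / 4 : ℝ) = (1 / 2) ^ 2 by norm_num, ← pow_mul]
        congr 1
        rw [ha]
        ring
      exact congrArg (coef (1 / 4) ((k - 1) / 2) i * ·) e
    · exact .inl (hy j hj ho)

end extrapolation

namespace Data

variable {k : ℕ} {E : ℝ}

/-- The expansion for arbitrary solutions, in each of the three cases. -/
theorem abs_sub_sum_le (hS : S.Hyp m δ c₀ τ₀ K M) (hE0 : 0 ≤ E)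
    (hE : ∀ r, S.Rate r → r * k + 2 ≤ m → ∃ u, S.SysSol m r k (E * S.bd m) S.g S.fcl u)
    {u : ℕ → TFn d} {uh : ℝ → TFn d} (hu : S.IsSystemSolution k u)
    (huh : ∀ h ∈ Ioc 0 S.h₀, S.IsFDSolution h (uh h))
    (hcase : 3 * k + 3 ≤ m ∨ (2 * k + 3 ≤ m ∧ S.Symm) ∨ S.CaseIII m k) :
    ∀ h ∈ Ioc 0 S.h₀, ∀ t ∈ Icc 0 S.T, ∀ x,
      |uh h t x - ∑ j ∈ Finset.range (k + 1), h ^ j / (j.factorial : ℝ) * u j t x| ≤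
        h ^ (k + 1) * (cE m M S.abs c₀ k * √(E * m.factorial) * S.size m) := by
  intro h hh t ht x
  obtain ⟨r, hr, hrk, v, hv, hsm⟩ : ∃ r, S.Rate r ∧ r * k + 2 ≤ m ∧ ∃ v,
      S.SysSol m r k (E * S.bd m) S.g S.fcl v ∧
      ∀ j ≤ k, ∀ t ∈ Icc 0 S.T, ∀ a ≤ k - j + 3, HB a (E * S.bd m) (v j t) := by
    rcases hcase with h | ⟨h, hs⟩ | ⟨hodd, h, hs, hp⟩
    · obtain ⟨v, hv⟩ := hE 3 (.inl rfl) (by omega)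
      exact ⟨3, .inl rfl, by omega, v, hv, fun j hj t _ a ha => (hv j hj).hb t a (by omega)⟩
    · obtain ⟨v, hv⟩ := hE 2 (.inr ⟨rfl, hs⟩) (by omega)
      exact ⟨2, .inr ⟨rfl, hs⟩, by omega, v, hv, fun j hj t _ a ha => (hv j hj).hb t a (by omega)⟩
    · have hr : S.Rate 2 := .inr ⟨rfl, hs⟩
      obtain ⟨v, hv⟩ := hE 2 hr h
      refine ⟨2, hr, h, v, hv, fun j hj t ht a ha => ?_⟩
      rcases hj.lt_or_eq with hlt | rfl
      · exact (hv j hj).hb t a (by omega)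
      · have e : v j t = 0 := funext fun x =>
          hv.odd_eq_zero hS hr h hs hp j le_rfl hodd t ht x
        rw [e]
        exact HB.zero (mul_nonneg hE0 bd_nonneg)
  have h1 := hv.expansion hS hr hrk hsm hh ((huh h hh).fdSol hh.1.ne') t ht x
  rw [clamp_of_mem ht] at h1
  have huv := hv.unique hS hr hrk hu
  have e1 : ∑ j ∈ Finset.range (k + 1), h ^ j / (j.factorial : ℝ) * u j t x =
      ∑ j ∈ Finset.range (k + 1), h ^ j / (j.factorial : ℝ) * v j t x :=
    sum_congr rfl fun j hj => by
      rw [huv j (Finset.mem_range_succ_iff.1 hj) t ht x]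
  have e2 : √(E * S.bd m) = √(E * m.factorial) * S.size m := by
    rw [bd, ← mul_assoc, Real.sqrt_mul (by positivity), Real.sqrt_sq (size_nonneg m)]
  rw [e1]
  rw [e2, ← mul_assoc (cE m M S.abs c₀ k)] at h1
  exact h1

theorem systemClaim (hS : S.Hyp m δ c₀ τ₀ K M) (hE0 : 0 ≤ E) {r : ℕ} (hr : S.Rate r) (hrk : r * k + 2 ≤ m)
    {u : ℕ → TFn d} (hu : S.SysSol m r k (E * S.bd m) S.g S.fcl u) {N : ℝ}
    (hN : √((m + 1) * E * m.factorial) ≤ N) : S.SystemClaim m k r N := by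
  refine ⟨u, hu.isSystemSolution hr hrk, fun v hv j hj =>
    hu.unique hS hr hrk hv j (Finset.mem_Icc.1 hj).2, fun j hj => ?_⟩
  have hj := hu j (Finset.mem_Icc.1 hj).2
  exact ⟨(hj.memB le_rfl).1, (hj.normB_le hE0 le_rfl (Nat.sub_le _ _)).trans
    (mul_le_mul_of_nonneg_right hN (size_nonneg m))⟩

theorem parabolicClaim (hS : S.Hyp m δ c₀ τ₀ K M) (hE0 : 0 ≤ E) {u : ℕ → TFn d}
    (hu : S.SysSol m 3 0 (E * S.bd m) S.g S.fcl u) {N : ℝ}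
    (hN : √((m + 1) * E * m.factorial) ≤ N) : S.ParabolicClaim m N := by
  have h0 := hu 0 le_rfl
  refine ⟨u 0, (hu.isSystemSolution (.inl rfl) hS.hm).zero, fun v hv =>
    hu.unique hS (.inl rfl) hS.hm (v := fun _ => v)
      ⟨hv, by simp, by simp, by simp⟩ 0 le_rfl, (h0.memB (by simp)).1,
    (h0.normB_le hE0 (by simp) le_rfl).trans (mul_le_mul_of_nonneg_right hN (size_nonneg m))⟩

end Data

end FDScheme

end

theorem theorem08p11p3p1 (m : ℕ) (hm : 2 ≤ m) (δ c₀ τ₀ K : ℝ) (hδ : δ ∈ Set.Ioc (0 : ℝ) 1)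
    (hc₀ : 0 < c₀) (hτ₀ : 0 < τ₀) (hK : 1 ≤ K) (M : Fin (m + 1) → ℝ) (absΛ nrmΛ : ℝ) :
    ∃ N : ℝ, ∀ (d : ℕ) (S : FDScheme.Data d), S.abs = absΛ → S.nrm = nrmΛ →
      S.Assumptions m δ c₀ τ₀ K M →
      -- the degenerate parabolic equation
      S.ParabolicClaim m N ∧
      -- the system for the coefficients of the expansion
      (∀ k : ℕ, 1 ≤ k → 3 * k + 2 ≤ m → S.SystemClaim m k 3 N) ∧
      (∀ k : ℕ, 1 ≤ k → 2 * k + 2 ≤ m → S.Symm → S.SystemClaim m k 2 N ∧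
        (S.Antisymm → ∀ u, S.IsSystemSolution k u →
          ∀ j ∈ Finset.Icc 1 k, Odd j → S.EqH (u j) 0)) ∧
      -- unique bounded solvability of the finite difference equation
      (∀ h ∈ Set.Ioc 0 S.h₀, ∃ v, S.IsFDSolution h v ∧
        ∀ w, S.IsFDSolution h w → S.EqH w v) ∧
      -- the expansion and the accelerated schemes
      (3 ≤ m → ∀ (k : ℕ) (u : ℕ → ℝ → FDScheme.Sp d → ℝ) (uh : ℝ → ℝ → FDScheme.Sp d → ℝ),
        S.IsSystemSolution k u → (∀ h ∈ Set.Ioc 0 S.h₀, S.IsFDSolution h (uh h)) →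
        (3 * k + 3 ≤ m ∨ (2 * k + 3 ≤ m ∧ S.Symm) ∨ S.CaseIII m k →
          S.ExpansionClaim m k N u uh ∧
          ∀ h ∈ Set.Ioc 0 S.h₀, ∀ t ∈ Set.Icc 0 S.T, ∀ x,
            |FDScheme.ubar k uh h t x - u 0 t x| ≤ N * S.size m * h ^ (k + 1)) ∧
        (S.CaseIII m k →
          (∀ j ∈ Finset.Icc 1 k, Odd j → S.EqH (u j) 0) ∧
          ∀ h ∈ Set.Ioc 0 S.h₀, ∀ t ∈ Set.Icc 0 S.T, ∀ x,
            |u 0 t x - FDScheme.utilde k uh h t x| ≤ N * S.size m * h ^ (k + 1))) := by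
  have hK0 : 0 ≤ K := zero_le_one.trans hK
  choose E hE0 hE using fun k => FDScheme.exists_sysSol m hδ hc₀ hτ₀ hK0 M absΛ nrmΛ k
  let A : ℕ → ℝ := fun k => √((m + 1) * E k * m.factorial)
  let B : ℕ → ℝ := fun k => FDScheme.Data.cE m M |absΛ| c₀ k * √(E k * m.factorial)
  let C : ℕ → ℝ := fun k => ∑ i, |FDScheme.coef (1 / 2) k i|
  let C' : ℕ → ℝ := fun k => ∑ i, |FDScheme.coef (1 / 4) ((k - 1) / 2) i|
  have hA : ∀ k, 0 ≤ A k := fun k => Real.sqrt_nonneg _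
  have hB : ∀ k, 0 ≤ B k := fun k =>
    mul_nonneg (FDScheme.Data.cE_nonneg (abs_nonneg _) hc₀) (Real.sqrt_nonneg _)
  have hC : ∀ k, 0 ≤ C k := fun k => sum_nonneg fun i _ => abs_nonneg _
  have hC' : ∀ k, 0 ≤ C' k := fun k => sum_nonneg fun i _ => abs_nonneg _
  let D : ℕ → ℝ := fun k => A k + (B k + (C k * B k + C' k * B k))
  have hD : ∀ k ≤ m, D k ≤ ∑ k ∈ Finset.range (m + 1), D k := fun k hk =>
    single_le_sum (f := D) (fun k _ => add_nonneg (hA k) (add_nonneg (hB k)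
      (add_nonneg (mul_nonneg (hC k) (hB k)) (mul_nonneg (hC' k) (hB k)))))
      (Finset.mem_range.2 (Nat.lt_succ_of_le hk))
  set N := ∑ k ∈ Finset.range (m + 1), D k
  have hle : ∀ k ≤ m, A k ≤ N ∧ B k ≤ N ∧ C k * B k ≤ N ∧ C' k * B k ≤ N := fun k hk => by
    have h1 := hD k hk
    have h2 := mul_nonneg (hC k) (hB k)
    have h3 := mul_nonneg (hC' k) (hB k)
    have h4 := hA k
    have h5 := hB k
    simp only [D] at h1
    refine ⟨?_, ?_, ?_, ?_⟩ <;> linarith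
  refine ⟨N, fun d S habs hnrm hA => ?_⟩
  have hS : S.Hyp m δ c₀ τ₀ K M := ⟨hA, hm, hδ, hc₀, hτ₀, hK0⟩
  have hT := S.T_pos.le
  have hsys : ∀ k r, S.Rate r → r * k + 2 ≤ m →
      ∃ u, S.SysSol m r k (E k * S.bd m) S.g S.fcl u := fun k r hr hrk =>
    hE k d S habs hnrm hS r hr hrk S.fcl S.g (S.bd m) (hS.smooth.f_mem.bm hT)
      (hS.smooth.g_mem.bm hT) FDScheme.Data.bd_nonneg
      (fun t _ a ha => (FDScheme.Data.hb_bd hS ha).1 t) fun a ha => (FDScheme.Data.hb_bd hS ha).2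
  have hvan : ∀ k, 2 * k + 2 ≤ m → S.Symm → S.Antisymm → ∀ u, S.IsSystemSolution k u →
      ∀ j ∈ Finset.Icc 1 k, Odd j → S.EqH (u j) 0 := by
    intro k hk hs hp u hu j hj hodd t ht x
    obtain ⟨v, hv⟩ := hsys k 2 (.inr ⟨rfl, hs⟩) hk
    have hj := (Finset.mem_Icc.1 hj).2
    rw [hv.unique hS (.inr ⟨rfl, hs⟩) hk hu j hj t ht x]
    exact hv.odd_eq_zero hS (.inr ⟨rfl, hs⟩) hk hs hp j hj hodd t ht x
  refine ⟨?_, fun k _ hk => ?_, fun k _ hk hs => ⟨?_, hvan k hk hs⟩, fun h hh => ?_,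
    fun hm3 k u uh hu huh => ?_⟩
  · obtain ⟨u, hu⟩ := hsys 0 3 (.inl rfl) hm
    exact FDScheme.Data.parabolicClaim hS (hE0 0) hu (hle 0 (by omega)).1
  · obtain ⟨u, hu⟩ := hsys k 3 (.inl rfl) hk
    exact FDScheme.Data.systemClaim hS (hE0 k) (.inl rfl) hk hu
      (hle k (by omega)).1
  · obtain ⟨u, hu⟩ := hsys k 2 (.inr ⟨rfl, hs⟩) hk
    exact FDScheme.Data.systemClaim hS (hE0 k) (.inr ⟨rfl, hs⟩) hk hu
      (hle k (by omega)).1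
  · obtain ⟨v, hv⟩ := FDScheme.Data.exists_fdSol hS h
    refine ⟨v, FDScheme.Data.isFDSolution_of_fdSol hh.1.ne' hv, fun w hw t ht x => ?_⟩
    rw [← FDScheme.Data.fdSol_unique hS hh (hw.fdSol hh.1.ne') hv]
    simp only [FDScheme.clamp_of_mem ht]
  · have hsz := FDScheme.Data.size_nonneg (S := S) m
    have hcase : 3 * k + 3 ≤ m ∨ (2 * k + 3 ≤ m ∧ S.Symm) ∨ S.CaseIII m k →
        k ≤ m ∧ ∀ h ∈ Set.Ioc 0 S.h₀, ∀ t ∈ Set.Icc 0 S.T, ∀ x,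
        |uh h t x - ∑ j ∈ Finset.range (k + 1), h ^ j / (j.factorial : ℝ) * u j t x| ≤
          h ^ (k + 1) * (B k * S.size m) := by
      intro hc
      refine ⟨?_, ?_⟩
      · rcases hc with h | ⟨h, -⟩ | ⟨-, h, -⟩ <;> omega
      · have h1 := FDScheme.Data.abs_sub_sum_le hS (hE0 k) (hsys k) hu huh hc
        rwa [show S.abs = |absΛ| by rw [← habs]; exact (abs_of_nonneg (Real.sqrt_nonneg _)).symm] at h1
    have hfin : ∀ {y c h : ℝ}, 0 < h → c * B k ≤ N → y ≤ h ^ (k + 1) * (c * (B k * S.size m)) →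
        y ≤ N * S.size m * h ^ (k + 1) := by
      intro y c h hh hc hy
      refine hy.trans ?_
      rw [← mul_assoc c, mul_comm]
      exact mul_le_mul_of_nonneg_right (mul_le_mul_of_nonneg_right hc hsz) (pow_nonneg hh.le _)
    refine ⟨fun hc => ⟨?_, fun h hh t ht x => ?_⟩, fun hc => ?_⟩
    · obtain ⟨hkm, hexp⟩ := hcase hc
      refine ⟨fun h t x => (uh h t x - ∑ j ∈ Finset.range (k + 1),
        h ^ j / (j.factorial : ℝ) * u j t x) / h ^ (k + 1), fun h hh t ht x => ⟨?_, ?_⟩⟩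
      · have hp : h ^ (k + 1) ≠ 0 := pow_ne_zero _ hh.1.ne'
        have e : ∑ j ∈ Finset.range (k + 1), h ^ j / (j.factorial : ℝ) * u j t x = u 0 t x +
            ∑ j ∈ Finset.Icc 1 k, h ^ j / (j.factorial : ℝ) * u j t x := by
          rw [Finset.range_eq_Ico, Finset.sum_eq_sum_Ico_succ_bot (Nat.succ_pos k),
            show Finset.Ico (0 + 1) (k + 1) = Finset.Icc 1 k by ext; rfl]
          simp
        rw [mul_div_cancel₀ _ hp, e]
        ring
      · rw [abs_div, abs_of_pos (pow_pos hh.1 _), div_le_iff₀ (pow_pos hh.1 _)]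
        refine hfin (c := 1) hh.1 (by rw [one_mul]; exact (hle k hkm).2.1) ?_
        rw [one_mul]
        exact hexp h hh t ht x
    · obtain ⟨hkm, hexp⟩ := hcase hc
      exact hfin hh.1 (hle k hkm).2.2.1 (FDScheme.abs_ubar_sub_le (mul_nonneg (hB k) hsz)
        (fun h hh => hexp h hh t ht x) hh)
    · obtain ⟨hkm, hexp⟩ := hcase (.inr (.inr hc))
      obtain ⟨hodd, hk, hs, hp⟩ := hc
      have hz := hvan k hk hs hp u hu
      exact ⟨hz, fun h hh t ht x => hfin hh.1 (hle k hkm).2.2.2 (FDScheme.abs_sub_utilde_le hodd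
        (fun j hj ho => hz j hj ho t ht x) (mul_nonneg (hB k) hsz)
        (fun h hh => hexp h hh t ht x) hh)⟩
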